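/- Let $\sigma,\delta\in\{1,-1\}$ and let $q:\mathbb R^2\to\mathbb R$ be a classical solution of the nonlocal mKdV equation $$q_t(x,t)-6\sigma\,q(-x,-t)\,q(x,t)\,q_x(x,t)+q_{xxx}(x,t)=0$$ such that, for every $t$, $q(x,t)\to q_\pm$ as $x\to\pm\infty$, where $q_+=\delta q_-$, $|q_\pm|=q_0>0$, and $(1+|x|)(q(x,t)-q_\pm)\in L^1(\mathbb R^\pm)$ in $x$. For $z\in\mathbb C\setminus\{0\}$ put $$k=\tfrac12\Big(z+\delta\sigma\tfrac{q_0^2}{z}\Big),\quad \lambda=\tfrac12\Big(z-\delta\sigma\tfrac{q_0^2}{z}\Big),\quad \theta(x,t;z)=\lambda\,[x+(4k^2+2\sigma\delta q_0^2)t],\quad E_\pm(z)=\begin{pmatrix}1&\frac{iq_\pm}{z}\\-\delta\sigma\frac{iq_\pm}{z}&1\end{pmatrix}.$$ If $\delta\sigma=1$, let $D_\pm=\{\pm\operatorname{Im}z>0\}$ and $\Sigma=\mathbb R\setminus\{0\}$; if $\delta\sigma=-1$, let $D_\pm=\{\pm(|z|-q_0)\operatorname{Im}z>0\}$ and $\Sigma=(\mathbb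 R\setminus\{0\})\cup\{|z|=q_0\}$. Orient $\Sigma$ so that $D_+$ lies on its left. The branch points are the two solutions of $z^2=\delta\sigma q_0^2$, and $\Sigma^0$ is $\Sigma$ without them. Fix $t$. The Jost solutions $\Phi_\pm(x,t;z)$ solve $\Phi_x=\begin{pmatrix}ik&q(x,t)\\ \sigma q(-x,-t)&-ik\end{pmatrix}\Phi$ with $\Phi_\pm e^{-i\theta\sigma_3}\to E_\pm$ as $x\to\pm\infty$, where $\sigma_3=\operatorname{diag}(1,-1)$; the columns $\Phi_{+1},\Phi_{-2}$ are defined by this for $z\in D_+\cup\Sigma^0$, and $\Phi_{-1},\Phi_{+2}$ for $z\in D_-\cup\Sigma^0$. The scattering matrix $S=(s_{ij})$ is given by $\Phi_+=\Phi_-S$ on $\Sigma^0$, and $s_{11}$, $s_{22}$ are extended to $D_+$, $D_-$ by $$s_{11}=\frac{\det(\Phi_{+1},\Phi_{-2})}{1-\delta\sigma q_0^2/z^2},\qquad s_{22}=\frac{\det(\Phi_{-1},\Phi_{+2})}{1-\delta\sigma q_0^2/z^2}.$$ Assume that there are no spectral singularities: $s_{11}$ and $s_{22}$ have no zeros on $\Sigma^0$,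 and near each branch point $|s_{11}|$ on $D_+\cup\Sigma^0$ and $|s_{22}|$ on $D_-\cup\Sigma^0$ are bounded below by a positive constant. Assume that the zeros of $s_{11}$ in $D_+\cap\{\operatorname{Re}z>0\}$ are exactly the distinct points $z_1,\dots,z_{N_1}$, that those in $D_+\cap\{\operatorname{Re}z=0\}$ are exactly the distinct points $iw_1,\dots,iw_{N_2}$ (with $w_m\in\mathbb R$), and that all of them are simple. Let $\eta_1,\dots,\eta_{2N_1+N_2}$ be the points $z_1,\dots,z_{N_1}$, $-z_1^*,\dots,-z_{N_1}^*$, $iw_1,\dots,iw_{N_2}$ in this order, and let $\widehat\eta_n=\delta\sigma q_0^2/\eta_n$. In what follows, $\log[1+s_{12}s_{21}]$ denotes any function $\ell$ on $\Sigma$ with $e^{\ell}=1+s_{12}s_{21}$ on $\Sigma^0$ that is continuous on $\Sigma$ away from $\pm q_0$ and the branch points, tends to $0$ as $\zeta\to\infty$ and as $\zeta\to0$ along $\Sigma$, and, if $\delta\sigma=-1$, has an imaginary part that is equal to a constant $c$ on the open upper semicircle of $|\zeta|=q_0$ and to $-c$ on the open lower one ($\pm iq_0$ excluded). Then such a branch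 exists, and for every such branch the following hold, with $$s(z)=\frac1{2\pi i}\int_\Sigma\frac{\log[1+s_{12}(\zeta)s_{21}(\zeta)]}{\zeta-z}\,d\zeta ,$$ where the integral converges absolutely for every $z\in D_+\cup D_-\cup\{0\}$. 1. (Trace formulae) $$s_{11}(z)=e^{s(z)}\prod_{n=1}^{2N_1+N_2}\frac{z-\eta_n}{z-\widehat\eta_n}\ \ (z\in D_+),\qquad s_{22}(z)=e^{-s(z)}\prod_{n=1}^{2N_1+N_2}\frac{z-\widehat\eta_n}{z-\eta_n}\ \ (z\in D_-).$$ 2. (Theta condition) $$\left(\prod_{n=1}^{N_1}\frac{|z_n|^4}{q_0^4}\ \prod_{m=1}^{N_2}(-\delta\sigma)\frac{w_m^2}{q_0^2}\right)\exp\left(\frac1{2\pi i}\int_\Sigma\frac{\log[1+s_{12}(\zeta)s_{21}(\zeta)]}{\zeta}\,d\zeta\right)=\delta .$$ 3. (Derivatives) For every $j=1,\dots,2N_1+N_2$, $$s_{11}'(\eta_j)=\frac{\prod_{m\ne j}(\eta_j-\eta_m)}{\prod_{m}(\eta_j-\widehat\eta_m)}\,e^{s(\eta_j)},\qquad s_{22}'(\widehat\eta_j)=\frac{\prod_{m\ne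 j}(\widehat\eta_j-\widehat\eta_m)}{\prod_{m}(\widehat\eta_j-\eta_m)}\,e^{-s(\widehat\eta_j)} .$$ -/

import Mathlib

open Filter Topology MeasureTheory

namespace NonlocalMKdV

noncomputable section

/-- `q` is a classical real solution of the nonlocal (reverse-space-time) mKdV equation
`q_t(x,t) - 6 σ q(-x,-t) q(x,t) q_x(x,t) + q_xxx(x,t) = 0`. -/
structure IsSolution (σ : ℝ) (q : ℝ → ℝ → ℝ) : Prop where
  contDiff_space : ∀ t, ContDiff ℝ 3 (fun x => q x t)
  differentiable_time : ∀ x, Differentiable ℝ (fun t => q x t)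
  equation : ∀ x t,
    deriv (fun τ => q x τ) t
      - 6 * σ * q (-x) (-t) * q x t * deriv (fun y => q y t) x
      + iteratedDeriv 3 (fun y => q y t) x = 0

/-- Non-zero boundary conditions: `q(x,t) → q_±` as `x → ±∞`, where `q_- = qm`,
`q_+ = δ q_-` and `|q_±| = q₀ > 0`, together with
`(1 + |x|) (q(x,t) - q_±) ∈ L¹(ℝ^±)`. -/
structure HasNZBC (δ q₀ qm : ℝ) (q : ℝ → ℝ → ℝ) : Prop where
  pos : 0 < q₀
  abs_eq : |qm| = q₀
  tendsto_atTop : ∀ t, Tendsto (fun x => q x t) atTop (𝓝 (δ * qm))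
  tendsto_atBot : ∀ t, Tendsto (fun x => q x t) atBot (𝓝 qm)
  decay_right : ∀ t, IntegrableOn (fun x => (1 + |x|) * (q x t - δ * qm)) (Set.Ioi 0)
  decay_left : ∀ t, IntegrableOn (fun x => (1 + |x|) * (q x t - qm)) (Set.Iio 0)

/-! ### The uniformization plane -/

/-- `k(z) = (z + δσ q₀² / z) / 2`. -/
def kz (σ δ q₀ : ℝ) (z : ℂ) : ℂ := (z + (δ * σ * q₀ ^ 2 : ℝ) / z) / 2

/-- `λ(z) = (z - δσ q₀² / z) / 2`. -/
def lam (σ δ q₀ : ℝ) (z : ℂ) : ℂ := (z - (δ * σ * q₀ ^ 2 : ℝ) / z) / 2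

/-- `θ(x,t;z) = λ(z) [x + (4 k(z)² + 2 σδ q₀²) t]`. -/
def theta (σ δ q₀ x t : ℝ) (z : ℂ) : ℂ :=
  lam σ δ q₀ z * (x + (4 * kz σ δ q₀ z ^ 2 + (2 * σ * δ * q₀ ^ 2 : ℝ)) * t)

/-- `D_+`: the upper half-plane if `δσ = 1`, and `{(|z| - q₀) Im z > 0}` if `δσ = -1`. -/
def Dplus (σ δ q₀ : ℝ) : Set ℂ :=
  {z | (δ * σ = 1 ∧ 0 < z.im) ∨ (δ * σ = -1 ∧ 0 < (‖z‖ - q₀) * z.im)}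

/-- `D_-`: the lower half-plane if `δσ = 1`, and `{(|z| - q₀) Im z < 0}` if `δσ = -1`. -/
def Dminus (σ δ q₀ : ℝ) : Set ℂ :=
  {z | (δ * σ = 1 ∧ z.im < 0) ∨ (δ * σ = -1 ∧ (‖z‖ - q₀) * z.im < 0)}

/-- The continuous spectrum `Σ`: `ℝ ∖ {0}` if `δσ = 1`,
and `(ℝ ∖ {0}) ∪ {|z| = q₀}` if `δσ = -1`. -/
def Sig (σ δ q₀ : ℝ) : Set ℂ :=
  {z | (z.im = 0 ∧ z ≠ 0) ∨ (δ * σ = -1 ∧ ‖z‖ = q₀)}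

/-- The branch points, `±q₀` if `δσ = 1` and `±i q₀` if `δσ = -1`. -/
def branchPoints (σ δ q₀ : ℝ) : Set ℂ := {z | z ^ 2 = (δ * σ * q₀ ^ 2 : ℝ)}

/-- `Σ⁰`: the continuous spectrum without the branch points. -/
def Sig0 (σ δ q₀ : ℝ) : Set ℂ := Sig σ δ q₀ \ branchPoints σ δ q₀

/-! ### Jost solutions and scattering coefficients -/

/-- The coefficient matrix `X = i k σ₃ + Q` of the `x`-part of the Lax pair. -/
def laxX (σ δ q₀ : ℝ) (q : ℝ → ℝ → ℝ) (x t : ℝ) (z : ℂ) : Matrix (Fin 2) (Fin 2) ℂ :=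
  !![Complex.I * kz σ δ q₀ z, (q x t : ℂ);
     ((σ * q (-x) (-t) : ℝ) : ℂ), -(Complex.I * kz σ δ q₀ z)]

/-- `E_±(z)`, where `b` stands for `q_±` (recall `k + λ = z`). -/
def bgE (σ δ b : ℝ) (z : ℂ) : Matrix (Fin 2) (Fin 2) ℂ :=
  !![1, Complex.I * b / z;
     -((δ * σ : ℝ) * (Complex.I * b / z)), 1]

/-- The diagonal of `σ₃`. -/
def pauli3 : Fin 2 → ℂ := ![1, -1]

/-- `φ` is the `j`-th column of the Jost solution normalised at the end `l` of the line
(`l = atTop`, `b = q_+` or `l = atBot`, `b = q_-`): it solves `φ_x = X φ`, and the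
`j`-th column `φ e^{∓iθ}` of the modified Jost solution tends to the `j`-th column of `E_±`. -/
def IsJostColumn (σ δ q₀ : ℝ) (q : ℝ → ℝ → ℝ) (t : ℝ) (z : ℂ) (l : Filter ℝ) (b : ℝ)
    (j : Fin 2) (φ : ℝ → Fin 2 → ℂ) : Prop :=
  (∀ x i, HasDerivAt (fun y => φ y i) ((laxX σ δ q₀ q x t z).mulVec (φ x) i) x) ∧
  Tendsto (fun x => Complex.exp (-(pauli3 j * Complex.I * theta σ δ q₀ x t z)) • φ x) l
    (𝓝 (fun i => bgE σ δ b z i j))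

/-- The column selected by `IsJostColumn`. It exists and is unique for `z ∈ Σ⁰`, for the columns
`Φ_{+1}`, `Φ_{-2}` also when `z ∈ D_+`, and for `Φ_{-1}`, `Φ_{+2}` also when `z ∈ D_-`; there the
extension by this condition is the analytic continuation off `Σ`. -/
def jostColumn (σ δ q₀ : ℝ) (q : ℝ → ℝ → ℝ) (t : ℝ) (z : ℂ) (l : Filter ℝ) (b : ℝ)
    (j : Fin 2) : ℝ → Fin 2 → ℂ :=
  Classical.epsilon (IsJostColumn σ δ q₀ q t z l b j)

/-- The `j`-th column of `Φ_+(x,t;z)`; the index `0` is the first column. -/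
def jostPlus (σ δ q₀ qm : ℝ) (q : ℝ → ℝ → ℝ) (t : ℝ) (z : ℂ) (j : Fin 2) : ℝ → Fin 2 → ℂ :=
  jostColumn σ δ q₀ q t z atTop (δ * qm) j

/-- The `j`-th column of `Φ_-(x,t;z)`. -/
def jostMinus (σ δ q₀ qm : ℝ) (q : ℝ → ℝ → ℝ) (t : ℝ) (z : ℂ) (j : Fin 2) : ℝ → Fin 2 → ℂ :=
  jostColumn σ δ q₀ q t z atBot qm j

/-- Wronskian determinant of two columns. -/
def wr (φ ψ : Fin 2 → ℂ) : ℂ := φ 0 * ψ 1 - φ 1 * ψ 0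

/-- `det Φ_± = 1 - δσ q₀² / z²`. -/
def detE (σ δ q₀ : ℝ) (z : ℂ) : ℂ := 1 - (δ * σ * q₀ ^ 2 : ℝ) / z ^ 2

/-- `s₁₁`, the entry of the matrix `S` in `Φ_+ = Φ_- S`, in its Wronskian form. The Wronskian of two
solutions does not depend on `x` (`X` is trace-free), so it is taken at `x = 0`. -/
def s11 (σ δ q₀ qm : ℝ) (q : ℝ → ℝ → ℝ) (t : ℝ) (z : ℂ) : ℂ :=
  wr (jostPlus σ δ q₀ qm q t z 0 0) (jostMinus σ δ q₀ qm q t z 1 0) / detE σ δ q₀ z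

def s12 (σ δ q₀ qm : ℝ) (q : ℝ → ℝ → ℝ) (t : ℝ) (z : ℂ) : ℂ :=
  wr (jostPlus σ δ q₀ qm q t z 1 0) (jostMinus σ δ q₀ qm q t z 1 0) / detE σ δ q₀ z

def s21 (σ δ q₀ qm : ℝ) (q : ℝ → ℝ → ℝ) (t : ℝ) (z : ℂ) : ℂ :=
  wr (jostMinus σ δ q₀ qm q t z 0 0) (jostPlus σ δ q₀ qm q t z 0 0) / detE σ δ q₀ z

def s22 (σ δ q₀ qm : ℝ) (q : ℝ → ℝ → ℝ) (t : ℝ) (z : ℂ) : ℂ :=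
  wr (jostMinus σ δ q₀ qm q t z 0 0) (jostPlus σ δ q₀ qm q t z 1 0) / detE σ δ q₀ z

/-- The Wronskian expressions above are the entries of the matrix `S` with `Φ_+ = Φ_- S`
(stated column by column), whenever `det Φ_- = 1 - δσ q₀² / z² ≠ 0`. -/
theorem entries_eq {σ δ q₀ qm : ℝ} {q : ℝ → ℝ → ℝ} {t : ℝ} {z : ℂ}
    (S : Matrix (Fin 2) (Fin 2) ℂ)
    (hS : ∀ j, jostPlus σ δ q₀ qm q t z j 0 =
      S 0 j • jostMinus σ δ q₀ qm q t z 0 0 + S 1 j • jostMinus σ δ q₀ qm q t z 1 0)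
    (hdet : wr (jostMinus σ δ q₀ qm q t z 0 0) (jostMinus σ δ q₀ qm q t z 1 0) = detE σ δ q₀ z)
    (h0 : detE σ δ q₀ z ≠ 0) :
    S 0 0 = s11 σ δ q₀ qm q t z ∧ S 0 1 = s12 σ δ q₀ qm q t z ∧
    S 1 0 = s21 σ δ q₀ qm q t z ∧ S 1 1 = s22 σ δ q₀ qm q t z := by
  unfold s11 s12 s21 s22
  rw [hS 0, hS 1]
  refine ⟨?_, ?_, ?_, ?_⟩ <;> rw [eq_div_iff h0, ← hdet] <;>
    simp only [wr, Pi.add_apply, Pi.smul_apply, smul_eq_mul] <;> ring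

/-- No spectral singularities: `s₁₁` and `s₂₂` do not vanish on `Σ`. At the branch points, where
they may have poles, this means that they stay away from `0` near those points. -/
structure NoSpectralSingularities (σ δ q₀ qm : ℝ) (q : ℝ → ℝ → ℝ) (t : ℝ) : Prop where
  s11_ne : ∀ ζ ∈ Sig0 σ δ q₀, s11 σ δ q₀ qm q t ζ ≠ 0
  s22_ne : ∀ ζ ∈ Sig0 σ δ q₀, s22 σ δ q₀ qm q t ζ ≠ 0
  s11_branch : ∀ b ∈ branchPoints σ δ q₀, ∃ c > 0,
    ∀ᶠ z in 𝓝[Dplus σ δ q₀ ∪ Sig0 σ δ q₀] b, c ≤ ‖s11 σ δ q₀ qm q t z‖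
  s22_branch : ∀ b ∈ branchPoints σ δ q₀, ∃ c > 0,
    ∀ᶠ z in 𝓝[Dminus σ δ q₀ ∪ Sig0 σ δ q₀] b, c ≤ ‖s22 σ δ q₀ qm q t z‖

/-- The zeros of `s₁₁` in `D_+ ∩ {Re z > 0}` are exactly the distinct points `z_1, …, z_{N₁}`,
those in `D_+ ∩ {Re z = 0}` are exactly the distinct points `i w_1, …, i w_{N₂}`,
and all of them are simple. -/
structure IsSimpleDiscreteSpectrum (σ δ q₀ qm : ℝ) (q : ℝ → ℝ → ℝ) (t : ℝ) {N₁ N₂ : ℕ}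
    (zs : Fin N₁ → ℂ) (ws : Fin N₂ → ℝ) : Prop where
  zs_injective : Function.Injective zs
  ws_injective : Function.Injective ws
  zs_range : Set.range zs =
    {ζ | ζ ∈ Dplus σ δ q₀ ∧ 0 < ζ.re ∧ s11 σ δ q₀ qm q t ζ = 0}
  ws_range : (Set.range fun m => Complex.I * (ws m : ℂ)) =
    {ζ | ζ ∈ Dplus σ δ q₀ ∧ ζ.re = 0 ∧ s11 σ δ q₀ qm q t ζ = 0}
  zs_simple : ∀ n, deriv (s11 σ δ q₀ qm q t) (zs n) ≠ 0
  ws_simple : ∀ m, deriv (s11 σ δ q₀ qm q t) (Complex.I * (ws m : ℂ)) ≠ 0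

/-- The `2N₁ + N₂` points `η_n`: first `z_n`, then `-z_n^*`, then `i w_n`. -/
def eta {N₁ N₂ : ℕ} (zs : Fin N₁ → ℂ) (ws : Fin N₂ → ℝ) : Fin N₁ ⊕ Fin N₁ ⊕ Fin N₂ → ℂ :=
  Sum.elim zs (Sum.elim (fun n => -(starRingEnd ℂ) (zs n)) (fun m => Complex.I * (ws m : ℂ)))

/-- `η̂_n = δσ q₀² / η_n`. -/
def etaHat (σ δ q₀ : ℝ) {N₁ N₂ : ℕ} (zs : Fin N₁ → ℂ) (ws : Fin N₂ → ℝ)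
    (n : Fin N₁ ⊕ Fin N₁ ⊕ Fin N₂) : ℂ :=
  (δ * σ * q₀ ^ 2 : ℝ) / eta zs ws n

/-! ### Integration along the oriented contour `Σ` -/

/-- `q₀ e^{iφ}`. -/
def circlePt (q₀ φ : ℝ) : ℂ := q₀ * Complex.exp (Complex.I * φ)

open Classical in
/-- `∫_Σ f(ζ) dζ`, where `Σ` is oriented with `D_+` on its left. If `δσ = 1` this is the real line
from left to right. If `δσ = -1`, the half-lines `|x| > q₀` run from left to right, the segment
`(-q₀, q₀)` from right to left, and both semicircles from `-q₀` to `q₀`. -/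
def contourIntegral (σ δ q₀ : ℝ) (f : ℂ → ℂ) : ℂ :=
  if δ * σ = 1 then ∫ x : ℝ, f x
  else (∫ x in {x : ℝ | q₀ < |x|}, f x) - (∫ x in Set.Ioo (-q₀) q₀, f x)
    - (∫ φ in Set.Ioo 0 Real.pi, f (circlePt q₀ φ) * (Complex.I * circlePt q₀ φ))
    + (∫ φ in Set.Ioo (-Real.pi) 0, f (circlePt q₀ φ) * (Complex.I * circlePt q₀ φ))

/-- `f` is absolutely integrable along `Σ`. -/
def ContourIntegrable (σ δ q₀ : ℝ) (f : ℂ → ℂ) : Prop :=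
  Integrable (fun x : ℝ => f x) ∧
  (δ * σ = -1 → IntegrableOn (fun φ : ℝ => f (circlePt q₀ φ)) (Set.Ioo (-Real.pi) Real.pi))

/-- `ℓ` is a branch of `log [1 + s₁₂ s₂₁]` along `Σ`: it is continuous on `Σ` away from the points
`±q₀` and the branch points, it tends to `0` as `ζ → ∞` and as `ζ → 0` along `Σ`, and, if
`δσ = -1`, its imaginary part is constant on the open upper and on the open lower
semicircle (without `±i q₀`), with opposite constants. -/
structure IsLogBranch (σ δ q₀ qm : ℝ) (q : ℝ → ℝ → ℝ) (t : ℝ) (ℓ : ℂ → ℂ) : Prop where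
  exp_eq : ∀ ζ ∈ Sig0 σ δ q₀,
    Complex.exp (ℓ ζ) = 1 + s12 σ δ q₀ qm q t ζ * s21 σ δ q₀ qm q t ζ
  continuousOn : ContinuousOn ℓ (Sig0 σ δ q₀ \ {(q₀ : ℂ), -(q₀ : ℂ)})
  tendsto_infty : Tendsto ℓ (cocompact ℂ ⊓ 𝓟 (Sig σ δ q₀)) (𝓝 0)
  tendsto_zero : Tendsto ℓ (𝓝[Sig σ δ q₀] 0) (𝓝 0)
  circle : δ * σ = -1 → ∃ c : ℝ, ∀ ζ ∈ Sig0 σ δ q₀, ‖ζ‖ = q₀ →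
    (0 < ζ.im → (ℓ ζ).im = c) ∧ (ζ.im < 0 → (ℓ ζ).im = -c)

/-- `s(z) = (1 / 2πi) ∫_Σ ℓ(ζ) / (ζ - z) dζ`. -/
def cauchyS (σ δ q₀ : ℝ) (ℓ : ℂ → ℂ) (z : ℂ) : ℂ :=
  1 / (2 * Real.pi * Complex.I) * contourIntegral σ δ q₀ (fun ζ => ℓ ζ / (ζ - z))

end

end NonlocalMKdV

/-!
Fix `t`. The Lax system has the real potentials `q(x, t)` and `σ q(-x, -t)`, whose differences to
their limits have a finite first moment. The normalised Jost solution at `+∞` solves a Volterra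
equation (`RightPotential.jostM_eq`) whose kernel is bounded for `Im λ ≥ 0`, away from `λ = 0`; its
Picard series is continuous there and holomorphic for `Im λ > 0`. The other three Jost columns are
obtained from it by `x ↦ -x` and by exchanging the components, so that the uniqueness of Jost
solutions (`IsRightJost.unique`) identifies them with the given ones
(`RightPotential.apply_jostColumn`).

For `κ = δσq₀²` the domain `D₊` is `{Im λ > 0}` in all cases. `scatteringPair` collects what the
argument uses of `(F, G) = (s₁₁, s₂₂)`: regularity; the symmetries `s₁₁(κ / z) = δ s₂₂(z)` and
`s₁₁(-z*) = s₁₁(z)*`; `F, G → 1` at infinity, by a Riemann–Lebesgue argument uniform in the closed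
half-plane; the bound `|λ F| ≤ C` at the branch points; and the integrability of
`F G - 1 = s₁₂ s₂₁` against `dζ / ζ` at infinity. For the last point, the off-diagonal entries are
dominated by Fourier integrals of bounded integrable functions, which are square integrable
(`lintegral_fint_sq_le`).

The zeros `η` of `F` come in pairs `η, -η*`. `ScatteringPair.zeroFreePair` divides them out by
`∏ (z - η) / (z - η̂)`, which has the value `B = ∏ η² / κ`, the product of the theta condition, at
`z = 0`, and leaves a pair without zeros, with the constant `β = δ / B` in place of `δ`. Since `F G`
is unchanged on `Σ⁰`, it remains to show for such pairs (`ZeroFreePair.solvesJumpProblem`) that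
branches of `log (F G)` exist, and that every one satisfies `F = e^s` on `D₊`, `G = e^{-s}` on `D₋`
and `e^{s(0)} = β`. The last equation is the theta condition; the derivatives follow by splitting
off one factor at a zero.

In the coordinate `z = q₀ e^w` the upper half-plane is the strip `0 < Im w < π`, and its part
outside the circle is a half-strip. There `F` has a logarithm `H` that vanishes at the right end,
and the symmetry `z ↦ κ / z` turns it into a logarithm of `G`. The jump of these logarithms across
`Σ` is a branch of `log (F G)`, and by connectedness the only one (`IsBranch.eq_of_line`), except
that for `δσ = -1` the branch on the arcs depends on a choice `m` of `log β`, which the constant `c`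
determines and which does not affect `e^s`. Cauchy's formula for `H` times the kernel, on rectangles
that exhaust the strip, computes `s`.

The difficulty is that near a branch point on the boundary `H` is only known to satisfy
`|Re H| ≤ C + |log d|`, with `d` the distance along the edge, with no control of `Im H`. The remedy is that `∮ H² = 0`: its real part
bounds `∫ (Im H)²` on lines close to the edge by `∫ (Re H)²` and by the other edges
(`integral_normSq_le`). A uniform `L²` bound implies the convergence of the integrals up to the edge
(`edge_limit`, `rectInt_of_horizontal_singularity`), so that no singular behaviour has to be
excluded by hand.
-/

namespace NonlocalMKdV

open Complex Set
open scoped Real ComplexConjugate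

noncomputable section

section

/-! ### Volterra equations on half-lines -/

/-- Picard iterates of the Volterra equation `u x = e + ∫_x^∞ M x y u(y) dy`. -/
def volterraIter (M : ℝ → ℝ → Matrix (Fin 2) (Fin 2) ℂ) (e : Fin 2 → ℂ) :
    ℕ → ℝ → Fin 2 → ℂ
  | 0, _ => e
  | n + 1, x => ∫ y in Ioi x, (M x y).mulVec (volterraIter M e n y)

/-- The solution of the Volterra equation, as the sum of its Picard iterates. -/
def volterraSol (M : ℝ → ℝ → Matrix (Fin 2) (Fin 2) ℂ) (e : Fin 2 → ℂ)
    (x : ℝ) : Fin 2 → ℂ :=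
  ∑' n, volterraIter M e n x

/-- The tail `∫_x^∞ B`. -/
def tailInt (B : ℝ → ℝ) (x : ℝ) : ℝ := ∫ y in Ioi x, B y

lemma integral_Ioi_eq_sub {E : Type*} [NormedAddCommGroup E] [NormedSpace ℝ E] {G : ℝ → E}
    (hi : ∀ x, IntegrableOn G (Ioi x)) (x : ℝ) :
    ∫ y in Ioi x, G y = (∫ y in Ioi 0, G y) - ∫ y in (0 : ℝ)..x, G y := by
  rw [← intervalIntegral.integral_Ioi_sub_Ioi' (hi 0) (hi x), sub_sub_cancel]

lemma hasDerivAt_integral_Ioi {E : Type*} [NormedAddCommGroup E] [NormedSpace ℝ E]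
    [CompleteSpace E] {G : ℝ → E} (hG : Continuous G) (hi : ∀ x, IntegrableOn G (Ioi x)) (x : ℝ) :
    HasDerivAt (fun x => ∫ y in Ioi x, G y) (-G x) x := by
  rw [funext (integral_Ioi_eq_sub hi)]
  exact (intervalIntegral.integral_hasDerivAt_right (hG.intervalIntegrable _ _)
    (hG.stronglyMeasurableAtFilter _ _) hG.continuousAt).const_sub _

/-- A continuous non-negative function that is integrable at `+∞`; it is used to dominate
Volterra kernels. -/
structure TailMajorant (B : ℝ → ℝ) : Prop where
  cont : Continuous B
  nonneg : ∀ x, 0 ≤ B x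
  integrable : ∀ x, IntegrableOn B (Ioi x)

namespace TailMajorant

variable {B : ℝ → ℝ}

lemma tailInt_nonneg (hB : TailMajorant B) (x : ℝ) : 0 ≤ tailInt B x :=
  integral_nonneg hB.nonneg

lemma hasDerivAt_tailInt (hB : TailMajorant B) (x : ℝ) : HasDerivAt (tailInt B) (-B x) x :=
  hasDerivAt_integral_Ioi hB.cont hB.integrable x

lemma antitone_tailInt (hB : TailMajorant B) : Antitone (tailInt B) :=
  antitone_of_hasDerivAt_nonpos hB.hasDerivAt_tailInt fun x => neg_nonpos.2 (hB.nonneg x)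

lemma tendsto_tailInt (hB : TailMajorant B) : Tendsto (tailInt B) atTop (𝓝 0) := by
  rw [show tailInt B = _ from funext (integral_Ioi_eq_sub hB.integrable)]
  simpa using (intervalIntegral_tendsto_integral_Ioi 0 (hB.integrable 0) tendsto_id).const_sub
    (∫ y in Ioi 0, B y)

lemma tendsto_exp_tailInt (hB : TailMajorant B) :
    Tendsto (fun x => -(1 / 2) * Real.exp (2 * tailInt B x)) atTop (𝓝 (-(1 / 2))) := by
  have := ((Real.continuous_exp.tendsto _).comp (hB.tendsto_tailInt.const_mul 2)).const_mul
    (-(1 / 2) : ℝ)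
  simpa using this

lemma hasDerivAt_exp_tailInt (hB : TailMajorant B) (x : ℝ) :
    HasDerivAt (fun x => -(1 / 2) * Real.exp (2 * tailInt B x))
      (B x * Real.exp (2 * tailInt B x)) x := by
  have := (((hB.hasDerivAt_tailInt x).const_mul 2).exp).const_mul (-(1 / 2) : ℝ)
  refine this.congr_deriv ?_
  ring

lemma integrableOn_weight (hB : TailMajorant B) (x : ℝ) :
    IntegrableOn (fun y => B y * Real.exp (2 * tailInt B y)) (Ioi x) :=
  integrableOn_Ioi_deriv_of_nonneg' (fun y _ => hB.hasDerivAt_exp_tailInt y)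
    (fun y _ => mul_nonneg (hB.nonneg y) (Real.exp_nonneg _)) hB.tendsto_exp_tailInt

/-- The weight `exp (2 ∫_x^∞ B)` turns the Volterra operator into a contraction of
ratio `1 / 2`. -/
lemma integral_weight_le (hB : TailMajorant B) (x : ℝ) :
    ∫ y in Ioi x, B y * Real.exp (2 * tailInt B y) ≤
      (1 / 2) * Real.exp (2 * tailInt B x) := by
  rw [integral_Ioi_of_hasDerivAt_of_nonneg' (fun y _ => hB.hasDerivAt_exp_tailInt y)
    (fun y _ => mul_nonneg (hB.nonneg y) (Real.exp_nonneg _)) hB.tendsto_exp_tailInt]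
  linarith

end TailMajorant

/-- `M` is dominated by `B` on `{a ≤ x ≤ y}`. -/
def KernelBound (a : ℝ) (B : ℝ → ℝ) (M : ℝ → ℝ → Matrix (Fin 2) (Fin 2) ℂ) : Prop :=
  ∀ x y, a ≤ x → x ≤ y → ∀ v : Fin 2 → ℂ, ‖(M x y).mulVec v‖ ≤ B y * ‖v‖

section fixed

variable {a : ℝ} {B : ℝ → ℝ} {M : ℝ → ℝ → Matrix (Fin 2) (Fin 2) ℂ} {e : Fin 2 → ℂ}

lemma norm_volterra_integrand_le (hB : TailMajorant B) (hM : KernelBound a B M)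
    {u : ℝ → Fin 2 → ℂ} {C : ℝ} (hu : ∀ x, a ≤ x → ‖u x‖ ≤ C * Real.exp (2 * tailInt B x))
    {x y : ℝ} (hx : a ≤ x) (hy : x ≤ y) :
    ‖(M x y).mulVec (u y)‖ ≤ C * (B y * Real.exp (2 * tailInt B y)) := by
  refine (hM x y hx hy _).trans ?_
  exact (mul_le_mul_of_nonneg_left (hu y (hx.trans hy)) (hB.nonneg y)).trans_eq (by ring)

lemma norm_volterraIter_le (hB : TailMajorant B) (hM : KernelBound a B M) (n : ℕ) :
    ∀ x, a ≤ x → ‖volterraIter M e n x‖ ≤ ‖e‖ * (1 / 2) ^ n * Real.exp (2 * tailInt B x) := by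
  induction n with
  | zero =>
    intro x _
    have : 1 ≤ Real.exp (2 * tailInt B x) := Real.one_le_exp (by
      have := hB.tailInt_nonneg x; positivity)
    simpa [volterraIter] using le_mul_of_one_le_right (norm_nonneg e) this
  | succ n ih =>
    intro x hx
    rw [volterraIter]
    have h := norm_integral_le_of_norm_le (μ := volume.restrict (Ioi x))
      (f := fun y => (M x y).mulVec (volterraIter M e n y))
      ((hB.integrableOn_weight x).const_mul (‖e‖ * (1 / 2) ^ n))
      ((ae_restrict_mem measurableSet_Ioi).mono fun y hy =>
        norm_volterra_integrand_le hB hM ih hx (le_of_lt hy))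
    refine h.trans ?_
    rw [integral_const_mul]
    refine (mul_le_mul_of_nonneg_left (hB.integral_weight_le x) (by positivity)).trans_eq ?_
    ring

/-- Geometric majorant of the Picard iterates. -/
lemma summable_volterraIter_majorant (C : ℝ) :
    Summable fun n : ℕ => ‖e‖ * (1 / 2 : ℝ) ^ n * C :=
  (summable_geometric_two.mul_left _).mul_right _

lemma summable_volterraIter (hB : TailMajorant B) (hM : KernelBound a B M) {x : ℝ} (hx : a ≤ x) :
    Summable fun n => volterraIter M e n x :=
  Summable.of_norm_bounded (summable_volterraIter_majorant _)
    fun n => norm_volterraIter_le hB hM n x hx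

lemma norm_volterraSol_le (hB : TailMajorant B) (hM : KernelBound a B M) {x : ℝ} (hx : a ≤ x) :
    ‖volterraSol M e x‖ ≤ 2 * ‖e‖ * Real.exp (2 * tailInt B x) := by
  have h := tsum_of_norm_bounded
    (((hasSum_geometric_two).mul_left ‖e‖).mul_right (Real.exp (2 * tailInt B x)))
    fun n => norm_volterraIter_le (e := e) hB hM n x hx
  rwa [mul_comm 2 ‖e‖]

/-- The right-hand side of the Volterra equation depends continuously on `x`. -/
lemma continuous_volterra_integral (hB : TailMajorant B) (hM : ∀ a, KernelBound a B M)
    (hMc : Continuous fun p : ℝ × ℝ => M p.1 p.2) {u : ℝ → Fin 2 → ℂ} (hu : Continuous u) {C : ℝ}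
    (hub : ∀ x, ‖u x‖ ≤ C * Real.exp (2 * tailInt B x)) :
    Continuous fun x => ∫ y in Ioi x, (M x y).mulVec (u y) := by
  have hC : 0 ≤ C := nonneg_of_mul_nonneg_left ((norm_nonneg _).trans (hub 0)) (Real.exp_pos _)
  have hcont : ∀ x, Continuous fun y => (M x y).mulVec (u y) := fun x =>
    (hMc.comp (Continuous.prodMk_right x)).matrix_mulVec hu
  rw [continuous_iff_continuousAt]
  intro x0
  simp_rw [← integral_indicator measurableSet_Ioi]
  refine continuousAt_of_dominated (bound := (Ioi (x0 - 1)).indicator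
    fun y => C * (B y * Real.exp (2 * tailInt B y))) ?_ ?_ ?_ ?_
  · exact Eventually.of_forall fun x =>
      (hcont x).aestronglyMeasurable.indicator measurableSet_Ioi
  · filter_upwards [Ioi_mem_nhds (show x0 - 1 < x0 by linarith)] with x hx
    refine Eventually.of_forall fun y => ?_
    by_cases hy : y ∈ Ioi x
    · rw [indicator_of_mem hy, indicator_of_mem (show y ∈ Ioi (x0 - 1) from lt_trans (mem_Ioi.1 hx) hy)]
      exact norm_volterra_integrand_le hB (hM x) (fun x _ => hub x) le_rfl (le_of_lt hy)
    · rw [indicator_of_notMem hy, norm_zero]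
      exact indicator_nonneg (fun y _ => mul_nonneg hC
        (mul_nonneg (hB.nonneg y) (Real.exp_nonneg _))) y
  · exact (integrable_indicator_iff measurableSet_Ioi).2 ((hB.integrableOn_weight _).const_mul C)
  · filter_upwards [Measure.ae_ne volume x0] with y hy
    rcases lt_or_gt_of_ne hy with h | h
    · refine ContinuousAt.congr (f := fun _ => (0 : Fin 2 → ℂ)) continuousAt_const ?_
      filter_upwards [Ioi_mem_nhds h] with x hx
      exact (indicator_of_notMem (not_lt.2 (le_of_lt hx)) _).symm
    · refine ContinuousAt.congr (f := fun x => (M x y).mulVec (u y))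
        ((hMc.comp (.prodMk_left y)).matrix_mulVec continuous_const).continuousAt ?_
      filter_upwards [Iio_mem_nhds h] with x hx
      rw [indicator_of_mem (show y ∈ Ioi x from hx)]

lemma continuous_volterraIter (hB : TailMajorant B) (hM : ∀ a, KernelBound a B M)
    (hMc : Continuous fun p : ℝ × ℝ => M p.1 p.2) (n : ℕ) :
    Continuous (volterraIter M e n) := by
  induction n with
  | zero => exact continuous_const
  | succ n ih =>
    exact continuous_volterra_integral hB hM hMc ih fun x =>
      norm_volterraIter_le hB (hM x) n x le_rfl

lemma continuous_volterraSol (hB : TailMajorant B) (hM : ∀ a, KernelBound a B M)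
    (hMc : Continuous fun p : ℝ × ℝ => M p.1 p.2) :
    Continuous (volterraSol M e) := by
  rw [continuous_iff_continuousAt]
  intro x0
  have h : ContinuousOn (volterraSol M e) (Ioi (x0 - 1)) := by
    refine continuousOn_tsum (fun n => (continuous_volterraIter hB hM hMc n).continuousOn)
      (summable_volterraIter_majorant (e := e) (Real.exp (2 * tailInt B (x0 - 1)))) ?_
    intro n x hx
    refine (norm_volterraIter_le hB (hM x) n x le_rfl).trans ?_
    have := hB.antitone_tailInt (le_of_lt hx)
    gcongr
  exact h.continuousAt (Ioi_mem_nhds (by linarith))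

lemma integrableOn_volterra (hB : TailMajorant B) (hM : KernelBound a B M)
    (hMc : Continuous fun p : ℝ × ℝ => M p.1 p.2) {u : ℝ → Fin 2 → ℂ} (hu : Continuous u) {C : ℝ}
    (hub : ∀ x, a ≤ x → ‖u x‖ ≤ C * Real.exp (2 * tailInt B x)) {x : ℝ} (hx : a ≤ x) :
    IntegrableOn (fun y => (M x y).mulVec (u y)) (Ioi x) := by
  refine Integrable.mono' ((hB.integrableOn_weight x).const_mul C) ?_
    ((ae_restrict_mem measurableSet_Ioi).mono fun y hy =>
      norm_volterra_integrand_le hB hM hub hx (le_of_lt hy))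
  exact ((hMc.comp (Continuous.prodMk_right x)).matrix_mulVec hu).aestronglyMeasurable

/-- The sum of the Picard iterates solves the Volterra equation. -/
lemma volterraSol_eq (hB : TailMajorant B) (hM : ∀ a, KernelBound a B M)
    (hMc : Continuous fun p : ℝ × ℝ => M p.1 p.2) (x : ℝ) :
    volterraSol M e x = e + ∫ y in Ioi x, (M x y).mulVec (volterraSol M e y) := by
  have hs := summable_volterraIter (e := e) hB (hM x) (le_refl x)
  rw [volterraSol, hs.tsum_eq_zero_add]
  congr 1
  have hint : ∀ n, Integrable (fun y => (M x y).mulVec (volterraIter M e n y))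
      (volume.restrict (Ioi x)) := fun n =>
    integrableOn_volterra hB (hM x) hMc (continuous_volterraIter hB hM hMc n)
      (norm_volterraIter_le hB (hM x) n) le_rfl
  have hsum : Summable fun n => ∫ y in Ioi x, ‖(M x y).mulVec (volterraIter M e n y)‖ := by
    refine Summable.of_nonneg_of_le (fun n => integral_nonneg fun y => norm_nonneg _) (fun n => ?_)
      (summable_volterraIter_majorant (e := e)
        (∫ y in Ioi x, B y * Real.exp (2 * tailInt B y)))
    rw [← integral_const_mul]
    refine setIntegral_mono_on (hint n).norm ((hB.integrableOn_weight x).const_mul _)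
      measurableSet_Ioi fun y hy => ?_
    exact norm_volterra_integrand_le hB (hM x) (norm_volterraIter_le hB (hM x) n) le_rfl
      (le_of_lt hy)
  have h := hasSum_integral_of_summable_integral_norm hint hsum
  have h2 : ∫ y in Ioi x, ∑' n, (M x y).mulVec (volterraIter M e n y) =
      ∫ y in Ioi x, (M x y).mulVec (volterraSol M e y) := by
    refine setIntegral_congr_fun measurableSet_Ioi fun y hy => ?_
    have hsy := summable_volterraIter (e := e) hB (hM y) (le_refl y)
    have := hsy.map_tsum (Matrix.mulVecLin (M x y))
      (LinearMap.continuous_of_finiteDimensional _)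
    simpa [volterraSol] using this.symm
  rw [← h2]
  exact h.tsum_eq

lemma norm_volterraSol_sub_le (hB : TailMajorant B) (hM : ∀ a, KernelBound a B M)
    (hMc : Continuous fun p : ℝ × ℝ => M p.1 p.2) (x : ℝ) :
    ‖volterraSol M e x - e‖ ≤
      2 * ‖e‖ * ∫ y in Ioi x, B y * Real.exp (2 * tailInt B y) := by
  rw [volterraSol_eq hB hM hMc x, add_sub_cancel_left, ← integral_const_mul]
  refine norm_integral_le_of_norm_le ((hB.integrableOn_weight x).const_mul (2 * ‖e‖)) ?_
  exact (ae_restrict_mem measurableSet_Ioi).mono fun y hy =>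
    norm_volterra_integrand_le hB (hM x) (fun x _ => norm_volterraSol_le hB (hM x) le_rfl) le_rfl
      (le_of_lt hy)

lemma tendsto_volterraSol (hB : TailMajorant B) (hM : ∀ a, KernelBound a B M)
    (hMc : Continuous fun p : ℝ × ℝ => M p.1 p.2) :
    Tendsto (volterraSol M e) atTop (𝓝 e) := by
  rw [tendsto_iff_norm_sub_tendsto_zero]
  refine squeeze_zero (fun _ => norm_nonneg _) (norm_volterraSol_sub_le hB hM hMc) ?_
  have h0 : ∀ x, ∫ y in Ioi x, B y * Real.exp (2 * tailInt B y) =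
      -(1 / 2) - -(1 / 2) * Real.exp (2 * tailInt B x) := fun x =>
    integral_Ioi_of_hasDerivAt_of_nonneg' (fun y _ => hB.hasDerivAt_exp_tailInt y)
    (fun y _ => mul_nonneg (hB.nonneg y) (Real.exp_nonneg _)) hB.tendsto_exp_tailInt
  simp_rw [h0]
  have := (hB.tendsto_exp_tailInt.const_sub (-(1 / 2))).const_mul (2 * ‖e‖)
  simpa using this

end fixed

/-! ### Dependence of Volterra solutions on a parameter -/

/-- An integral of holomorphic functions with an integrable majorant is holomorphic. -/
lemma differentiableOn_integral_of_dominated {E : Type*} [NormedAddCommGroup E]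
    [NormedSpace ℂ E] [CompleteSpace E] {α : Type*} [MeasurableSpace α]
    {μ : Measure α} {U : Set ℂ} (hU : IsOpen U) {F : ℂ → α → E} {b : α → ℝ}
    (hF : ∀ᵐ y ∂μ, DifferentiableOn ℂ (fun z => F z y) U)
    (hm : ∀ z ∈ U, AEStronglyMeasurable (F z) μ)
    (hb : ∀ᵐ y ∂μ, ∀ z ∈ U, ‖F z y‖ ≤ b y) (hbi : Integrable b μ) :
    DifferentiableOn ℂ (fun z => ∫ y, F z y ∂μ) U := by
  intro z0 hz₀
  obtain ⟨r, hr, hrU⟩ := Metric.isOpen_iff.1 hU z0 hz₀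
  refine DifferentiableAt.differentiableWithinAt ?_
  have hr4 : (0 : ℝ) < r / 4 := by positivity
  have hsub : ∀ z ∈ Metric.ball z0 (r / 4), Metric.closedBall z (r / 4) ⊆ U := fun z hz =>
    (Metric.closedBall_subset_ball' (by linarith [Metric.mem_ball.1 hz])).trans hrU
  have hd : ∀ᵐ y ∂μ, ∀ z ∈ U, HasDerivAt (fun z => F z y) (deriv (fun z => F z y) z) z :=
    hF.mono fun y hy z hz => (hy.differentiableAt (hU.mem_nhds hz)).hasDerivAt
  refine (hasDerivAt_integral_of_dominated_loc_of_deriv_le (𝕜 := ℂ) (F := F)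
    (F' := fun z y => deriv (fun z => F z y) z) (bound := fun y => b y / (r / 4))
    (Metric.ball_mem_nhds z0 hr4) ?_ ?_ ?_ ?_ ?_ ?_).2.differentiableAt
  · filter_upwards [hU.mem_nhds hz₀] with z hz using hm z hz
  · exact hbi.mono' (hm z0 hz₀) (hb.mono fun y hy => hy z0 hz₀)
  · -- the derivative is an a.e. limit of difference quotients, hence measurable
    classical
    refine aestronglyMeasurable_of_tendsto_ae (𝓝[≠] (0 : ℂ))
      (f := fun s y => if z0 + s ∈ U then s⁻¹ • (F (z0 + s) y - F z0 y) else 0) (fun s => ?_) ?_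
    · by_cases h : z0 + s ∈ U
      · simp only [if_pos h]
        exact ((hm _ h).sub (hm _ hz₀)).const_smul s⁻¹
      · simpa only [if_neg h] using aestronglyMeasurable_const
    · have hU' : ∀ᶠ s in 𝓝[≠] (0 : ℂ), z0 + s ∈ U := nhdsWithin_le_nhds
        ((continuous_const_add z0).continuousAt.preimage_mem_nhds (hU.mem_nhds (by simpa)))
      filter_upwards [hd] with y hy
      refine (hy z0 hz₀).tendsto_slope_zero.congr' ?_
      filter_upwards [hU'] with s h using (if_pos h).symm
  · filter_upwards [hF, hb] with y hy hby z hz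
    refine norm_deriv_le_of_forall_mem_sphere_norm_le hr4 ?_ ?_
    · exact (hy.mono (hsub z hz)).diffContOnCl_ball (subset_refl _)
    · exact fun w hw => hby w (hsub z hz (Metric.sphere_subset_closedBall hw))
  · exact hbi.div_const _
  · filter_upwards [hd] with y hy z hz
    exact hy z (hsub z hz (Metric.mem_closedBall_self hr4.le))

section parameter

variable {Z : Set ℂ} {a : ℝ} {B : ℝ → ℝ} {M : ℂ → ℝ → ℝ → Matrix (Fin 2) (Fin 2) ℂ}
  {e : ℂ → Fin 2 → ℂ} {C : ℝ}

lemma norm_volterraIter_le_of_param (hB : TailMajorant B) (hM : ∀ z ∈ Z, KernelBound a B (M z))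
    (heb : ∀ z ∈ Z, ‖e z‖ ≤ C) (n : ℕ) {z : ℂ} (hz : z ∈ Z) {x : ℝ} (hx : a ≤ x) :
    ‖volterraIter (M z) (e z) n x‖ ≤ C * (1 / 2) ^ n * Real.exp (2 * tailInt B x) := by
  refine (norm_volterraIter_le hB (hM z hz) n x hx).trans ?_
  have := heb z hz
  gcongr

lemma continuousOn_volterraIter_param (hB : TailMajorant B)
    (hM : ∀ z ∈ Z, KernelBound a B (M z)) (he : ContinuousOn e Z) (heb : ∀ z ∈ Z, ‖e z‖ ≤ C)
    (hMx : ∀ z ∈ Z, Continuous fun p : ℝ × ℝ => M z p.1 p.2)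
    (hMz : ∀ x y, ContinuousOn (fun z => M z x y) Z)
    (hu : ∀ z ∈ Z, ∀ n, Continuous (volterraIter (M z) (e z) n)) (n : ℕ) :
    ∀ x, a ≤ x → ContinuousOn (fun z => volterraIter (M z) (e z) n x) Z := by
  induction n with
  | zero => exact fun x _ => he
  | succ n ih =>
    intro x hx
    simp only [volterraIter]
    refine continuousOn_of_dominated
      (bound := fun y => C * (1 / 2) ^ n * (B y * Real.exp (2 * tailInt B y))) ?_ ?_ ?_ ?_
    · exact fun z hz => (((hMx z hz).comp (Continuous.prodMk_right x)).matrix_mulVec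
        (hu z hz n)).aestronglyMeasurable
    · exact fun z hz => (ae_restrict_mem measurableSet_Ioi).mono fun y hy =>
        norm_volterra_integrand_le hB (hM z hz)
          (fun x hx => norm_volterraIter_le_of_param hB hM heb n hz hx) hx (le_of_lt hy)
    · exact (hB.integrableOn_weight x).const_mul _
    · refine (ae_restrict_mem measurableSet_Ioi).mono fun y hy => ?_
      have h1 := hMz x y
      have h2 := ih y (hx.trans (le_of_lt hy))
      rw [continuousOn_iff_continuous_domRestrict] at h1 h2 ⊢
      exact h1.matrix_mulVec h2

lemma continuousOn_volterraSol_param (hB : TailMajorant B)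
    (hM : ∀ z ∈ Z, KernelBound a B (M z)) (he : ContinuousOn e Z) (heb : ∀ z ∈ Z, ‖e z‖ ≤ C)
    (hMx : ∀ z ∈ Z, Continuous fun p : ℝ × ℝ => M z p.1 p.2)
    (hMz : ∀ x y, ContinuousOn (fun z => M z x y) Z)
    (hu : ∀ z ∈ Z, ∀ n, Continuous (volterraIter (M z) (e z) n)) {x : ℝ} (hx : a ≤ x) :
    ContinuousOn (fun z => volterraSol (M z) (e z) x) Z := by
  refine continuousOn_tsum
    (fun n => continuousOn_volterraIter_param hB hM he heb hMx hMz hu n x hx)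
    (((summable_geometric_two).mul_left C).mul_right (Real.exp (2 * tailInt B x))) ?_
  exact fun n z hz => norm_volterraIter_le_of_param hB hM heb n hz hx

lemma differentiableOn_mulVec {U : Set ℂ} {A : ℂ → Matrix (Fin 2) (Fin 2) ℂ}
    {v : ℂ → Fin 2 → ℂ} (hA : ∀ i j, DifferentiableOn ℂ (fun z => A z i j) U)
    (hv : DifferentiableOn ℂ v U) : DifferentiableOn ℂ (fun z => (A z).mulVec (v z)) U := by
  rw [differentiableOn_pi] at hv ⊢
  intro i
  simp only [Matrix.mulVec, dotProduct, Fin.sum_univ_two]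
  exact ((hA i 0).mul (hv 0)).add ((hA i 1).mul (hv 1))

lemma differentiableOn_volterraIter_param (hZ : IsOpen Z) (hB : TailMajorant B)
    (hM : ∀ z ∈ Z, KernelBound a B (M z)) (he : DifferentiableOn ℂ e Z)
    (heb : ∀ z ∈ Z, ‖e z‖ ≤ C)
    (hMx : ∀ z ∈ Z, Continuous fun p : ℝ × ℝ => M z p.1 p.2)
    (hMz : ∀ x y i j, DifferentiableOn ℂ (fun z => M z x y i j) Z)
    (hu : ∀ z ∈ Z, ∀ n, Continuous (volterraIter (M z) (e z) n)) (n : ℕ) :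
    ∀ x, a ≤ x → DifferentiableOn ℂ (fun z => volterraIter (M z) (e z) n x) Z := by
  induction n with
  | zero => exact fun x _ => he
  | succ n ih =>
    intro x hx
    simp only [volterraIter]
    refine differentiableOn_integral_of_dominated hZ
      (b := fun y => C * (1 / 2) ^ n * (B y * Real.exp (2 * tailInt B y))) ?_ ?_ ?_ ?_
    · refine (ae_restrict_mem measurableSet_Ioi).mono fun y hy => ?_
      exact differentiableOn_mulVec (hMz x y) (ih y (hx.trans (le_of_lt hy)))
    · exact fun z hz => (((hMx z hz).comp (Continuous.prodMk_right x)).matrix_mulVec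
        (hu z hz n)).aestronglyMeasurable
    · exact (ae_restrict_mem measurableSet_Ioi).mono fun y hy z hz =>
        norm_volterra_integrand_le hB (hM z hz)
          (fun x hx => norm_volterraIter_le_of_param hB hM heb n hz hx) hx (le_of_lt hy)
    · exact (hB.integrableOn_weight x).const_mul _

lemma differentiableOn_volterraSol_param (hZ : IsOpen Z) (hB : TailMajorant B)
    (hM : ∀ z ∈ Z, KernelBound a B (M z)) (he : DifferentiableOn ℂ e Z)
    (heb : ∀ z ∈ Z, ‖e z‖ ≤ C)
    (hMx : ∀ z ∈ Z, Continuous fun p : ℝ × ℝ => M z p.1 p.2)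
    (hMz : ∀ x y i j, DifferentiableOn ℂ (fun z => M z x y i j) Z)
    (hu : ∀ z ∈ Z, ∀ n, Continuous (volterraIter (M z) (e z) n)) {x : ℝ} (hx : a ≤ x) :
    DifferentiableOn ℂ (fun z => volterraSol (M z) (e z) x) Z := by
  refine differentiableOn_tsum_of_summable_norm
    (((summable_geometric_two).mul_left C).mul_right (Real.exp (2 * tailInt B x)))
    (fun n => differentiableOn_volterraIter_param hZ hB hM he heb hMx hMz hu n x hx) hZ ?_
  exact fun n z hz => norm_volterraIter_le_of_param hB hM heb n hz hx

end parameter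

end

section

/-! ### The normalised Jost solution at `+∞` -/

/-- The coefficients `p`, `r` of the system `φ' = [[ik, p], [r, -ik]] φ`, with limits `a`, `b` at
`+∞` that are attained with an integrable first moment, and `a b = κ`. -/
structure RightPotential (κ : ℝ) (p r : ℝ → ℝ) (a b : ℝ) : Prop where
  contDiff_p : ContDiff ℝ 1 p
  contDiff_r : ContDiff ℝ 1 r
  mul_eq : a * b = κ
  integrable_p : IntegrableOn (fun x => (1 + |x|) * (p x - a)) (Ioi 0)
  integrable_r : IntegrableOn (fun x => (1 + |x|) * (r x - b)) (Ioi 0)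
  tendsto_p : Tendsto p atTop (𝓝 a)
  tendsto_r : Tendsto r atTop (𝓝 b)

/-- `k(z)` in terms of `κ = δσ q₀²`. -/
def unifK (κ : ℝ) (z : ℂ) : ℂ := (z + κ / z) / 2

/-- `λ(z)` in terms of `κ = δσ q₀²`. -/
def Λ (κ : ℝ) (z : ℂ) : ℂ := (z - κ / z) / 2

/-- The points at which the right Jost solution decaying like `e^{iλx}` is considered. -/
def Ω (κ : ℝ) : Set ℂ := {z | z ≠ 0 ∧ Λ κ z ≠ 0 ∧ 0 ≤ (Λ κ z).im}

/-- The first moment weight `(1 + |x|) (|p - a| + |r - b|)`. -/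
def potWeight (p r : ℝ → ℝ) (a b : ℝ) (x : ℝ) : ℝ :=
  (1 + |x|) * (|p x - a| + |r x - b|)

/-- `(e^{2iλs} - 1) / (2iλ)`. -/
def expQuot (l : ℂ) (s : ℝ) : ℂ := (exp (2 * I * l * s) - 1) / (2 * I * l)

/-- The kernel of the Volterra equation for `e^{-iλx} φ`. It is `- e^{(x-y)N} Δ(y)`, where `N` is
the limit at `+∞` of the coefficient matrix of the system for `e^{-iλx} φ` and `Δ` is the
difference to that limit; `N² = -2iλ N` makes the exponential explicit. -/
def jostKernel (κ : ℝ) (p r : ℝ → ℝ) (a b : ℝ) (z : ℂ) (x y : ℝ) :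
    Matrix (Fin 2) (Fin 2) ℂ :=
  !![expQuot (Λ κ z) (y - x) * a * (r y - b : ℝ),
     -((p y - a : ℝ) : ℂ) + expQuot (Λ κ z) (y - x) * (p y - a : ℝ) * (I * κ / z);
     -((r y - b : ℝ) : ℂ) - I * z * expQuot (Λ κ z) (y - x) * (r y - b : ℝ),
     expQuot (Λ κ z) (y - x) * b * (p y - a : ℝ)]

/-- The limit of `e^{-iλx} φ` at `+∞`. -/
def jostLimit (b : ℝ) (z : ℂ) : Fin 2 → ℂ := ![1, -(I * b / z)]

/-- The normalised right Jost solution `e^{-iλx} φ`. -/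
def jostM (κ : ℝ) (p r : ℝ → ℝ) (a b : ℝ) (z : ℂ) : ℝ → Fin 2 → ℂ :=
  volterraSol (jostKernel κ p r a b z) (jostLimit b z)

/-- The size of the coefficient matrix `N` of the background. -/
def bgSize (κ a b : ℝ) (z : ℂ) : ℝ := |a| + |b| + |κ| / ‖z‖ + ‖z‖

lemma bgSize_nonneg (κ a b : ℝ) (z : ℂ) : 0 ≤ bgSize κ a b z := by
  unfold bgSize; positivity

variable {κ a b : ℝ} {p r : ℝ → ℝ} {z : ℂ}

lemma RightPotential.tailMajorant (h : RightPotential κ p r a b) {C : ℝ} (hC : 0 ≤ C) :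
    TailMajorant fun y => C * potWeight p r a b y := by
  have hc : Continuous fun y => C * potWeight p r a b y := by
    have := h.contDiff_p.continuous
    have := h.contDiff_r.continuous
    unfold potWeight
    fun_prop
  refine ⟨hc, fun x => by unfold potWeight; positivity, fun x => ?_⟩
  have h0 : IntegrableOn (fun y => C * potWeight p r a b y) (Ioi 0) := by
    refine ((h.integrable_p.norm.add h.integrable_r.norm).const_mul C).congr
      (.of_forall fun y => ?_)
    simp only [Pi.add_apply, norm_mul, Real.norm_eq_abs, potWeight,
      abs_of_nonneg (by positivity : 0 ≤ 1 + |y|), mul_add]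
  rcases le_total 0 x with hx | hx
  · exact h0.mono_set (Ioi_subset_Ioi hx)
  · rw [← Ioc_union_Ioi_eq_Ioi hx]
    exact hc.integrableOn_Ioc.union h0

/-- The majorant of the Volterra kernel for a fixed spectral parameter. -/
lemma RightPotential.majorant (h : RightPotential κ p r a b) (z : ℂ) :
    TailMajorant fun y => (1 + bgSize κ a b z / ‖Λ κ z‖) * potWeight p r a b y :=
  h.tailMajorant (by have := bgSize_nonneg κ a b z; positivity)

lemma norm_exp_le_one {l : ℂ} (hl : 0 ≤ l.im) {s : ℝ} (hs : 0 ≤ s) :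
    ‖exp (2 * I * l * s)‖ ≤ 1 := by
  rw [norm_exp, Real.exp_le_one_iff, show (2 * I * l * s).re = -(2 * (l.im * s)) by simp; ring]
  linarith [mul_nonneg hl hs]

lemma norm_expQuot_le_inv {l : ℂ} (hl : 0 ≤ l.im) {s : ℝ} (hs : 0 ≤ s) :
    ‖expQuot l s‖ ≤ 1 / ‖l‖ := by
  rw [expQuot, norm_div]
  have h1 := (norm_sub_le _ _).trans (add_le_add_left (norm_exp_le_one hl hs) ‖(1 : ℂ)‖)
  rw [norm_one] at h1
  rw [show ‖2 * I * l‖ = 2 * ‖l‖ by simp, ← div_div]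
  gcongr
  linarith

/-- This bound, uniform as `λ → 0`, is where the first moment of the potential is needed. -/
lemma norm_expQuot_le {l : ℂ} (hl : 0 ≤ l.im) (hl0 : l ≠ 0) {s : ℝ} (hs : 0 ≤ s) :
    ‖expQuot l s‖ ≤ s := by
  have hd : ∀ t ∈ Icc (0 : ℝ) s, HasDerivWithinAt
      (fun t : ℝ => exp (2 * I * l * t) / (2 * I * l))
      (exp (2 * I * l * t)) (Icc 0 s) t := by
    intro t _
    have h1 : HasDerivAt (fun t : ℝ => 2 * I * l * (t : ℂ)) (2 * I * l) t := by
      simpa using (ofRealCLM.hasDerivAt (x := t)).const_mul (2 * I * l)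
    have h2 := (h1.cexp).div_const (2 * I * l)
    have h3 : 2 * I * l ≠ 0 := by simp [hl0]
    rw [mul_div_assoc, div_self h3, mul_one] at h2
    exact h2.hasDerivWithinAt
  have := norm_image_sub_le_of_norm_deriv_le_segment' hd (C := 1)
    (fun t ht => norm_exp_le_one hl ht.1) s ⟨hs, le_rfl⟩
  rw [expQuot, sub_div]
  simpa using this

lemma norm_mulVec_le_of_rows {A : Matrix (Fin 2) (Fin 2) ℂ} {K : ℝ}
    (hA : ∀ i, ‖A i 0‖ + ‖A i 1‖ ≤ K) (v : Fin 2 → ℂ) : ‖A.mulVec v‖ ≤ K * ‖v‖ := by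
  have hK := (by positivity : 0 ≤ ‖A 0 0‖ + ‖A 0 1‖).trans (hA 0)
  refine (pi_norm_le_iff_of_nonneg (by positivity)).2 fun i => ?_
  rw [Matrix.mulVec, dotProduct, Fin.sum_univ_two]
  calc _ ≤ ‖A i 0‖ * ‖v‖ + ‖A i 1‖ * ‖v‖ := (norm_add_le _ _).trans (by
        rw [norm_mul, norm_mul]; gcongr <;> exact norm_le_pi_norm v _)
    _ ≤ _ := by rw [← add_mul]; gcongr; exact hA i

lemma norm_jostKernel_mulVec_le {x y : ℝ} (v : Fin 2 → ℂ) :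
    ‖(jostKernel κ p r a b z x y).mulVec v‖ ≤
      (1 + ‖expQuot (Λ κ z) (y - x)‖ * bgSize κ a b z) *
        (|p y - a| + |r y - b|) * ‖v‖ := by
  refine norm_mulVec_le_of_rows (fun i => ?_) v
  simp only [jostKernel]
  generalize expQuot (Λ κ z) (y - x) = c
  have hS : bgSize κ a b z = |a| + |b| + |κ| / ‖z‖ + ‖z‖ := rfl
  have h0 := abs_nonneg a
  have h1 := abs_nonneg b
  have h2 : 0 ≤ |κ| / ‖z‖ := by positivity
  have h3 := norm_nonneg z
  have hf : ‖((p y - a : ℝ) : ℂ)‖ = |p y - a| := norm_real _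
  have hg : ‖((r y - b : ℝ) : ℂ)‖ = |r y - b| := norm_real _
  generalize ((p y - a : ℝ) : ℂ) = f at *
  generalize ((r y - b : ℝ) : ℂ) = g at *
  rw [← hf, ← hg]
  generalize bgSize κ a b z = S at *
  fin_cases i
  · calc _ ≤ ‖c‖ * |a| * ‖g‖ + (‖f‖ + ‖c‖ * ‖f‖ * (|κ| / ‖z‖)) :=
          add_le_add (by simp) ((norm_add_le _ _).trans (by simp))
      _ ≤ ‖c‖ * S * ‖g‖ + (‖f‖ + ‖c‖ * ‖f‖ * S) := by gcongr <;> linarith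
      _ ≤ _ := by linarith [norm_nonneg g]
  · calc _ ≤ (‖g‖ + ‖z‖ * ‖c‖ * ‖g‖) + ‖c‖ * |b| * ‖f‖ :=
          add_le_add ((norm_sub_le _ _).trans (by simp)) (by simp)
      _ ≤ (‖g‖ + S * ‖c‖ * ‖g‖) + ‖c‖ * S * ‖f‖ := by gcongr <;> linarith
      _ ≤ _ := by linarith [norm_nonneg f]

lemma kernelBound_of_lam (hz : z ∈ Ω κ) {C : ℝ}
    (hC : 1 + bgSize κ a b z / ‖Λ κ z‖ ≤ C) (x0 : ℝ) :
    KernelBound x0 (fun y => C * potWeight p r a b y) (jostKernel κ p r a b z) := by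
  intro x y _ hxy v
  refine (norm_jostKernel_mulVec_le v).trans ?_
  have h1 := norm_expQuot_le_inv hz.2.2 (sub_nonneg.2 hxy)
  have h2 : 1 + ‖expQuot (Λ κ z) (y - x)‖ * bgSize κ a b z ≤ C := by
    refine le_trans ?_ hC
    rw [div_eq_mul_one_div, mul_comm (bgSize κ a b z)]
    have := bgSize_nonneg κ a b z
    gcongr
  have hC0 : 0 ≤ C := le_trans (by have := bgSize_nonneg κ a b z; positivity) hC
  have h3 : |p y - a| + |r y - b| ≤ potWeight p r a b y := by
    unfold potWeight
    refine le_mul_of_one_le_left (by positivity) ?_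
    linarith [abs_nonneg y]
  dsimp only
  gcongr

lemma kernelBound_of_bgSize (hz : z ∈ Ω κ) {C : ℝ} (hC : 1 + bgSize κ a b z ≤ C) :
    KernelBound 0 (fun y => C * potWeight p r a b y) (jostKernel κ p r a b z) := by
  intro x y hx hxy v
  refine (norm_jostKernel_mulVec_le v).trans ?_
  have hs := bgSize_nonneg κ a b z
  have h1 := norm_expQuot_le hz.2.2 hz.2.1 (sub_nonneg.2 hxy)
  have h2 : 1 + ‖expQuot (Λ κ z) (y - x)‖ * bgSize κ a b z ≤ C * (1 + |y|) := by
    have h3 : ‖expQuot (Λ κ z) (y - x)‖ ≤ |y| := by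
      rw [abs_of_nonneg (hx.trans hxy)]; linarith
    calc _ ≤ 1 + |y| * bgSize κ a b z := by gcongr
      _ ≤ (1 + bgSize κ a b z) * (1 + |y|) := by nlinarith [abs_nonneg y]
      _ ≤ _ := by gcongr
  dsimp only [potWeight]
  rw [← mul_assoc C]
  gcongr

lemma continuous_expQuot (l : ℂ) : Continuous (expQuot l) := by
  unfold expQuot; fun_prop

lemma RightPotential.continuous_kernel (h : RightPotential κ p r a b) (z : ℂ) :
    Continuous fun q : ℝ × ℝ => jostKernel κ p r a b z q.1 q.2 := by
  have h1 := h.contDiff_p.continuous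
  have h2 := h.contDiff_r.continuous
  have h3 := continuous_expQuot (Λ κ z)
  unfold jostKernel
  refine continuous_matrix fun i j => ?_
  fin_cases i <;> fin_cases j <;> simp <;> fun_prop

lemma differentiableAt_Λ (hz : z ≠ 0) : DifferentiableAt ℂ (Λ κ) z := by
  unfold Λ
  exact ((differentiableAt_id).sub ((differentiableAt_const _).div differentiableAt_id hz)).div_const _

lemma differentiableOn_jostKernel (x y : ℝ) (i j : Fin 2) :
    DifferentiableOn ℂ (fun z => jostKernel κ p r a b z x y i j)
      {z | z ≠ 0 ∧ Λ κ z ≠ 0} := by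
  intro z hz
  refine DifferentiableAt.differentiableWithinAt ?_
  have h1 : DifferentiableAt ℂ (fun z => expQuot (Λ κ z) (y - x)) z := by
    have h := differentiableAt_Λ (κ := κ) hz.1
    unfold expQuot
    refine DifferentiableAt.div ?_ ?_ (by simp [hz.2])
    · fun_prop
    · fun_prop
  have h2 : DifferentiableAt ℂ (fun z => I * κ / z) z :=
    (differentiableAt_const _).div differentiableAt_id hz.1
  unfold jostKernel
  fin_cases i <;> fin_cases j <;> simp <;> fun_prop

lemma differentiableOn_jostLimit : DifferentiableOn ℂ (jostLimit b) {z | z ≠ 0} := by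
  intro z hz
  refine DifferentiableAt.differentiableWithinAt ?_
  rw [differentiableAt_pi]
  have h2 : DifferentiableAt ℂ (fun z => I * b / z) z :=
    (differentiableAt_const _).div differentiableAt_id hz
  intro i
  fin_cases i <;> simp [jostLimit]
  simpa using h2

lemma Ω_sub : Ω κ ⊆ {z | z ≠ 0 ∧ Λ κ z ≠ 0} := fun _ hz => ⟨hz.1, hz.2.1⟩

lemma RightPotential.continuous_iter (h : RightPotential κ p r a b) (hz : z ∈ Ω κ)
    (e : Fin 2 → ℂ) (n : ℕ) : Continuous (volterraIter (jostKernel κ p r a b z) e n) :=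
  continuous_volterraIter (h.majorant z)
    (fun x => kernelBound_of_lam hz le_rfl x) (h.continuous_kernel z) n

lemma RightPotential.continuous_jostM (h : RightPotential κ p r a b) (hz : z ∈ Ω κ) :
    Continuous (jostM κ p r a b z) :=
  continuous_volterraSol (h.majorant z)
    (fun x => kernelBound_of_lam hz le_rfl x) (h.continuous_kernel z)

lemma RightPotential.tendsto_jostM (h : RightPotential κ p r a b) (hz : z ∈ Ω κ) :
    Tendsto (jostM κ p r a b z) atTop (𝓝 (jostLimit b z)) :=
  tendsto_volterraSol (h.majorant z)
    (fun x => kernelBound_of_lam hz le_rfl x) (h.continuous_kernel z)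

lemma RightPotential.jostM_eq (h : RightPotential κ p r a b) (hz : z ∈ Ω κ) (x : ℝ) :
    jostM κ p r a b z x = jostLimit b z +
      ∫ y in Ioi x, (jostKernel κ p r a b z x y).mulVec (jostM κ p r a b z y) :=
  volterraSol_eq (h.majorant z)
    (fun x => kernelBound_of_lam hz le_rfl x) (h.continuous_kernel z) x

lemma RightPotential.norm_jostM_le (h : RightPotential κ p r a b) {C : ℝ} {x0 : ℝ}
    (hC : KernelBound x0 (fun y => C * potWeight p r a b y) (jostKernel κ p r a b z))
    (hC0 : 0 ≤ C) {x : ℝ} (hx : x0 ≤ x) :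
    ‖jostM κ p r a b z x‖ ≤ 2 * ‖jostLimit b z‖ *
      Real.exp (2 * tailInt (fun y => C * potWeight p r a b y) x) :=
  norm_volterraSol_le (h.tailMajorant hC0) hC hx

lemma norm_jostLimit_le (hz : z ≠ 0) : ‖jostLimit b z‖ ≤ 1 + |b| / ‖z‖ := by
  rw [pi_norm_le_iff_of_nonneg (by positivity)]
  intro i
  fin_cases i
  · simp [jostLimit]; positivity
  · simp [jostLimit]

/-- Points at which `z` and `1 / z` are bounded by `R`. -/
def annulus (R : ℝ) : Set ℂ := {z | ‖z‖ < R ∧ ‖z‖⁻¹ < R ∧ z ≠ 0}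

lemma isOpen_annulus (R : ℝ) : IsOpen (annulus R) :=
  isOpen_iff_mem_nhds.2 fun z hz => by
    filter_upwards [continuous_norm.continuousAt.eventually_lt_const hz.1,
      (continuous_norm.continuousAt.inv₀ (norm_ne_zero_iff.2 hz.2.2)).eventually_lt_const hz.2.1,
      isOpen_ne.mem_nhds hz.2.2] with w h1 h2 h3 using ⟨h1, h2, h3⟩

lemma exists_mem_annulus (hz : z ≠ 0) : ∃ R, 0 ≤ R ∧ z ∈ annulus R :=
  ⟨max ‖z‖ ‖z‖⁻¹ + 1, by positivity, lt_of_le_of_lt (le_max_left _ _) (lt_add_one _),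
    lt_of_le_of_lt (le_max_right _ _) (lt_add_one _), hz⟩

lemma bgSize_le_of_annulus {R : ℝ} (hz : z ∈ annulus R) :
    bgSize κ a b z ≤ |a| + |b| + |κ| * R + R := by
  have h1 := hz.1.le
  have h2 := hz.2.1.le
  unfold bgSize
  rw [div_eq_mul_inv]
  gcongr

lemma RightPotential.kernelBound_annulus {R : ℝ} (hz : z ∈ Ω κ ∩ annulus R) :
    KernelBound 0 (fun y => (1 + (|a| + |b| + |κ| * R + R)) * potWeight p r a b y)
      (jostKernel κ p r a b z) :=
  kernelBound_of_bgSize hz.1 (by linarith [bgSize_le_of_annulus (κ := κ) (a := a) (b := b) hz.2])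

lemma norm_jostLimit_le_of_annulus {R : ℝ} (hz : z ∈ annulus R) :
    ‖jostLimit b z‖ ≤ 1 + |b| * R := by
  refine (norm_jostLimit_le hz.2.2).trans ?_
  have := hz.2.1.le
  rw [div_eq_mul_inv]
  gcongr

/-- The Jost solution stays bounded near the branch points. -/
lemma RightPotential.exists_bound_annulus (h : RightPotential κ p r a b) {R : ℝ} (hR : 0 ≤ R) :
    ∃ C, ∀ z ∈ Ω κ ∩ annulus R, ‖jostM κ p r a b z 0‖ ≤ C := by
  refine ⟨2 * (1 + |b| * R) * Real.exp (2 * tailInt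
    (fun y => (1 + (|a| + |b| + |κ| * R + R)) * potWeight p r a b y) 0), fun z hz => ?_⟩
  refine (h.norm_jostM_le (RightPotential.kernelBound_annulus hz) (by positivity)
    le_rfl).trans ?_
  have := norm_jostLimit_le_of_annulus (b := b) hz.2
  gcongr

lemma RightPotential.continuousOn_jostM (h : RightPotential κ p r a b) :
    ContinuousOn (fun z => jostM κ p r a b z 0) (Ω κ) := by
  intro z0 hz₀
  obtain ⟨R, hR, hzR⟩ := exists_mem_annulus hz₀.1
  have hc : ContinuousOn (fun z => jostM κ p r a b z 0) (Ω κ ∩ annulus R) := by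
    refine continuousOn_volterraSol_param (a := 0) (h.tailMajorant
      (show 0 ≤ 1 + (|a| + |b| + |κ| * R + R) by positivity))
      (fun z hz => RightPotential.kernelBound_annulus hz) ?_
      (fun z hz => norm_jostLimit_le_of_annulus hz.2) (fun z _ => h.continuous_kernel z) ?_
      (fun z hz n => h.continuous_iter hz.1 _ n) le_rfl
    · exact differentiableOn_jostLimit.continuousOn.mono fun z hz => hz.1.1
    · intro x y
      refine continuousOn_pi.2 fun i => continuousOn_pi.2 fun j => ?_
      exact (differentiableOn_jostKernel x y i j).continuousOn.mono
        (inter_subset_left.trans Ω_sub)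
  exact ((hc z0 ⟨hz₀, hzR⟩).mono_of_mem_nhdsWithin
    (inter_mem_nhdsWithin _ ((isOpen_annulus R).mem_nhds hzR)))

/-- The interior of `Ω κ`. -/
def upperDomain (κ : ℝ) : Set ℂ := {z | z ≠ 0 ∧ 0 < (Λ κ z).im}

lemma upperDomain_subset : upperDomain κ ⊆ Ω κ :=
  fun _ hz => ⟨hz.1, fun h0 => by simpa [h0] using hz.2, hz.2.le⟩

lemma isOpen_upperDomain : IsOpen (upperDomain κ) :=
  isOpen_iff_mem_nhds.2 fun z hz => by
    filter_upwards [isOpen_ne.mem_nhds hz.1, (continuous_im.continuousAt.comp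
      (differentiableAt_Λ hz.1).continuousAt).eventually_const_lt hz.2] with w h1 h2
      using ⟨h1, h2⟩

lemma RightPotential.differentiableOn_jostM (h : RightPotential κ p r a b) :
    DifferentiableOn ℂ (fun z => jostM κ p r a b z 0) (upperDomain κ) := by
  intro z0 hz₀
  obtain ⟨R, hR, hzR⟩ := exists_mem_annulus hz₀.1
  have hopen : IsOpen (upperDomain κ ∩ annulus R) :=
    isOpen_upperDomain.inter (isOpen_annulus R)
  have hc : DifferentiableOn ℂ (fun z => jostM κ p r a b z 0)
      (upperDomain κ ∩ annulus R) := by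
    refine differentiableOn_volterraSol_param (a := 0) hopen (h.tailMajorant
      (show 0 ≤ 1 + (|a| + |b| + |κ| * R + R) by positivity))
      (fun z hz => RightPotential.kernelBound_annulus ⟨upperDomain_subset hz.1, hz.2⟩) ?_
      (fun z hz => norm_jostLimit_le_of_annulus hz.2) (fun z _ => h.continuous_kernel z) ?_
      (fun z hz n => h.continuous_iter (upperDomain_subset hz.1) _ n) le_rfl
    · exact differentiableOn_jostLimit.mono fun z hz => hz.1.1
    · exact fun x y i j => (differentiableOn_jostKernel x y i j).mono
        (inter_subset_left.trans (upperDomain_subset.trans Ω_sub))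
  exact (hc.differentiableAt (hopen.mem_nhds ⟨hz₀, hzR⟩)).differentiableWithinAt

end

section

variable {κ a b : ℝ} {p r : ℝ → ℝ} {z : ℂ}

/-! ### The differential equation and uniqueness of the Jost solution -/

/-- A bound for the Jost solution on a half-line, for a fixed spectral parameter. -/
lemma RightPotential.exists_bound_Ioi (h : RightPotential κ p r a b) (hz : z ∈ Ω κ)
    (x : ℝ) : ∃ K, 0 ≤ K ∧ ∀ y ∈ Ioi x, ‖jostM κ p r a b z y‖ ≤ K := by
  have hB := h.majorant z
  refine ⟨2 * ‖jostLimit b z‖ * Real.exp (2 * tailInt (fun y =>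
    (1 + bgSize κ a b z / ‖Λ κ z‖) * potWeight p r a b y) x), by positivity,
    fun y hy => (norm_volterraSol_le hB (kernelBound_of_lam hz le_rfl x) (le_of_lt hy)).trans ?_⟩
  have := hB.antitone_tailInt (le_of_lt hy)
  gcongr

lemma RightPotential.integrableOn_potWeight (h : RightPotential κ p r a b) (x : ℝ) :
    IntegrableOn (potWeight p r a b) (Ioi x) := by
  simpa using (h.tailMajorant zero_le_one).integrable x

lemma abs_sub_le_potWeight_left (y : ℝ) : |p y - a| ≤ potWeight p r a b y := by
  unfold potWeight
  nlinarith [abs_nonneg (p y - a), abs_nonneg (r y - b),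
    mul_nonneg (abs_nonneg y) (add_nonneg (abs_nonneg (p y - a)) (abs_nonneg (r y - b)))]

lemma abs_sub_le_potWeight_right (y : ℝ) : |r y - b| ≤ potWeight p r a b y := by
  have := abs_sub_le_potWeight_left (p := r) (a := b) (r := p) (b := a) y
  rwa [potWeight, add_comm |r y - b|] at this

/-- The components of the Volterra equation, with the exponential kernel split into factors. -/
lemma RightPotential.jostM_components (h : RightPotential κ p r a b) (hz : z ∈ Ω κ) :
    ∃ F G : ℝ → ℂ, Continuous F ∧ Continuous G ∧
      (∀ y, F y = ((p y - a : ℝ) : ℂ) * jostM κ p r a b z y 1) ∧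
      (∀ y, G y = ((r y - b : ℝ) : ℂ) * jostM κ p r a b z y 0) ∧
      (∀ x, IntegrableOn F (Ioi x)) ∧ (∀ x, IntegrableOn G (Ioi x)) ∧
      (∀ x, IntegrableOn (fun y => expQuot (Λ κ z) (y - x) * F y) (Ioi x)) ∧
      (∀ x, IntegrableOn (fun y => expQuot (Λ κ z) (y - x) * G y) (Ioi x)) ∧
      (∀ x, jostM κ p r a b z x 0 = 1 - (∫ y in Ioi x, F y) +
        (I * κ / z * (∫ y in Ioi x, expQuot (Λ κ z) (y - x) * F y) +
        a * ∫ y in Ioi x, expQuot (Λ κ z) (y - x) * G y)) ∧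
      (∀ x, jostM κ p r a b z x 1 = -(I * b / z) - (∫ y in Ioi x, G y) +
        (b * (∫ y in Ioi x, expQuot (Λ κ z) (y - x) * F y) -
        I * z * ∫ y in Ioi x, expQuot (Λ κ z) (y - x) * G y)) := by
  set m := jostM κ p r a b z with hm
  have hmc : Continuous m := h.continuous_jostM hz
  have hm0 : Continuous fun y => m y 0 := (continuous_apply 0).comp hmc
  have hm1 : Continuous fun y => m y 1 := (continuous_apply 1).comp hmc
  have hp := h.contDiff_p.continuous
  have hr := h.contDiff_r.continuous
  have hFc : Continuous fun y => ((p y - a : ℝ) : ℂ) * m y 1 := by fun_prop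
  have hGc : Continuous fun y => ((r y - b : ℝ) : ℂ) * m y 0 := by fun_prop
  have hi : ∀ (f : ℝ → ℝ) (i : Fin 2), Continuous f → (∀ y, |f y| ≤ potWeight p r a b y) →
      ∀ x, IntegrableOn (fun y => (f y : ℂ) * m y i) (Ioi x) := by
    intro f i hf hfw x
    obtain ⟨K, hK0, hK⟩ := h.exists_bound_Ioi hz x
    refine Integrable.mono' ((h.integrableOn_potWeight x).mul_const K)
      (((continuous_ofReal.comp hf).mul ((continuous_apply i).comp hmc)).aestronglyMeasurable)
      ((ae_restrict_mem measurableSet_Ioi).mono fun y hy => ?_)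
    rw [norm_mul, norm_real, Real.norm_eq_abs]
    exact mul_le_mul (hfw y) ((norm_le_pi_norm _ _).trans (hK y hy))
      (norm_nonneg _) ((abs_nonneg _).trans (hfw y))
  have hFi := hi (fun y => p y - a) 1 (by fun_prop) abs_sub_le_potWeight_left
  have hGi := hi (fun y => r y - b) 0 (by fun_prop) abs_sub_le_potWeight_right
  have hq : ∀ (F : ℝ → ℂ), (∀ x, IntegrableOn F (Ioi x)) → ∀ x,
      IntegrableOn (fun y => expQuot (Λ κ z) (y - x) * F y) (Ioi x) := by
    intro F hF x
    refine (hF x).bdd_mul (c := 1 / ‖Λ κ z‖) ?_ ?_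
    · exact ((continuous_expQuot _).comp (continuous_sub_right x)).aestronglyMeasurable
    · refine (ae_restrict_mem measurableSet_Ioi).mono fun y hy => ?_
      exact norm_expQuot_le_inv hz.2.2 (sub_nonneg.2 (le_of_lt hy))
  refine ⟨_, _, hFc, hGc, fun _ => rfl, fun _ => rfl, hFi, hGi, hq _ hFi, hq _ hGi, ?_, ?_⟩
  all_goals
    intro x
    have hint : IntegrableOn (fun y => (jostKernel κ p r a b z x y).mulVec (m y)) (Ioi x) :=
      integrableOn_volterra (h.majorant z) (kernelBound_of_lam hz le_rfl x) (h.continuous_kernel z)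
        hmc (fun y => norm_volterraSol_le (h.majorant z) (kernelBound_of_lam hz le_rfl x)) le_rfl
    have heq := h.jostM_eq hz x
    rw [← hm] at heq
    have hproj := fun i => (ContinuousLinearMap.proj (R := ℂ) (φ := fun _ : Fin 2 => ℂ)
      i).integral_comp_comm hint
    simp only [ContinuousLinearMap.proj_apply] at hproj
  · have h0 := congrFun heq 0
    rw [Pi.add_apply] at h0
    rw [h0, ← hproj, sub_add, sub_eq_add_neg]
    congr 1
    have hadd : IntegrableOn (fun y =>
        I * κ / z * (expQuot (Λ κ z) (y - x) * (((p y - a : ℝ) : ℂ) * m y 1)) +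
        a * (expQuot (Λ κ z) (y - x) * (((r y - b : ℝ) : ℂ) * m y 0))) (Ioi x) :=
      ((hq _ hFi x).const_mul _).add ((hq _ hGi x).const_mul _)
    rw [← integral_const_mul, ← integral_const_mul,
      ← integral_add ((hq _ hFi x).const_mul _) ((hq _ hGi x).const_mul _),
      ← integral_sub (hFi x) hadd, ← integral_neg]
    refine integral_congr_ae (.of_forall fun y => ?_)
    simp [jostKernel, Matrix.mulVec, dotProduct, Fin.sum_univ_two]
    ring
  · have h0 := congrFun heq 1
    rw [Pi.add_apply] at h0
    rw [h0, ← hproj, sub_add, sub_eq_add_neg (-(I * b / z))]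
    congr 1
    have hsub : IntegrableOn (fun y =>
        b * (expQuot (Λ κ z) (y - x) * (((p y - a : ℝ) : ℂ) * m y 1)) -
        I * z * (expQuot (Λ κ z) (y - x) * (((r y - b : ℝ) : ℂ) * m y 0))) (Ioi x) :=
      ((hq _ hFi x).const_mul _).sub ((hq _ hGi x).const_mul _)
    rw [← integral_const_mul, ← integral_const_mul,
      ← integral_sub ((hq _ hFi x).const_mul _) ((hq _ hGi x).const_mul _),
      ← integral_sub (hGi x) hsub, ← integral_neg]
    refine integral_congr_ae (.of_forall fun y => ?_)
    simp [jostKernel, Matrix.mulVec, dotProduct, Fin.sum_univ_two]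
    ring

lemma hasDerivAt_integral_expQuot {l : ℂ} (hl : l ≠ 0) (hl' : 0 ≤ l.im) {F : ℝ → ℂ}
    (hF : Continuous F) (hi : ∀ x, IntegrableOn F (Ioi x)) (x : ℝ) :
    HasDerivAt (fun x => ∫ y in Ioi x, expQuot l (y - x) * F y)
      (-(2 * I * l) * (∫ y in Ioi x, expQuot l (y - x) * F y) -
        ∫ y in Ioi x, F y) x := by
  have hl2 : 2 * I * l ≠ 0 := by simp [hl]
  have hPc : Continuous fun y : ℝ => exp (2 * I * l * y) * F y := by fun_prop
  have hPi : ∀ x, IntegrableOn (fun y : ℝ => exp (2 * I * l * y) * F y) (Ioi x) := by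
    intro x
    refine (hi x).bdd_mul (c := Real.exp (-(2 * l.im * x))) ?_ ?_
    · exact Continuous.aestronglyMeasurable (by fun_prop)
    · refine (ae_restrict_mem measurableSet_Ioi).mono fun y hy => ?_
      rw [norm_exp, show (2 * I * l * y).re = -(2 * l.im * y) by simp]
      have := mul_le_mul_of_nonneg_left (le_of_lt hy) hl'
      gcongr Real.exp ?_
      linarith
  have heq : (fun x => ∫ y in Ioi x, expQuot l (y - x) * F y) = fun x : ℝ =>
      (exp (-(2 * I * l * x)) *
        (∫ y in Ioi x, exp (2 * I * l * y) * F y) -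
      ∫ y in Ioi x, F y) / (2 * I * l) := by
    funext x
    rw [← integral_const_mul, ← integral_sub ((hPi x).const_mul _) (hi x), ← integral_div]
    refine integral_congr_ae (.of_forall fun y => ?_)
    simp only [expQuot]
    rw [show 2 * I * l * ((y - x : ℝ) : ℂ) = -(2 * I * l * x) + 2 * I * l * y by push_cast; ring,
      exp_add]
    ring
  have hderiv : HasDerivAt (fun x : ℝ => exp (-(2 * I * l * x)))
      (exp (-(2 * I * l * x)) * (-(2 * I * l))) x := by
    have h1 : HasDerivAt (fun t : ℝ => -(2 * I * l * (t : ℂ))) (-(2 * I * l)) x := by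
      simpa [neg_mul] using (ofRealCLM.hasDerivAt (x := x)).const_mul (-(2 * I * l))
    exact h1.cexp
  have key := (((hderiv.mul (hasDerivAt_integral_Ioi hPc hPi x)).sub
    (hasDerivAt_integral_Ioi hF hi x)).div_const (2 * I * l))
  rw [congrFun heq x, heq]
  refine key.congr_deriv ?_
  have he : exp (-(2 * I * l * x)) * exp (2 * I * l * x) = 1 := by
    rw [← exp_add]; simp
  field_simp
  linear_combination (-F x) * he

lemma RightPotential.hasDerivAt_jostM (h : RightPotential κ p r a b) (hz : z ∈ Ω κ)
    (x : ℝ) :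
    HasDerivAt (fun x => jostM κ p r a b z x 0)
      (I * κ / z * jostM κ p r a b z x 0 + p x * jostM κ p r a b z x 1) x ∧
    HasDerivAt (fun x => jostM κ p r a b z x 1)
      (r x * jostM κ p r a b z x 0 - I * z * jostM κ p r a b z x 1) x := by
  obtain ⟨F, G, hFc, hGc, hF, hG, hFi, hGi, -, -, h0, h1⟩ := h.jostM_components hz
  have hdF := hasDerivAt_integral_Ioi hFc hFi x
  have hdG := hasDerivAt_integral_Ioi hGc hGi x
  have hcF := hasDerivAt_integral_expQuot hz.2.1 hz.2.2 hFc hFi x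
  have hcG := hasDerivAt_integral_expQuot hz.2.1 hz.2.2 hGc hGi x
  have hz0 := hz.1
  have hab : (a : ℂ) * b = κ := by exact_mod_cast h.mul_eq
  have hlam : 2 * I * Λ κ z = I * z - I * κ / z := by unfold Λ; ring
  have hI := I_mul_I
  constructor
  · rw [show (fun x => jostM κ p r a b z x 0) = _ from funext h0]
    have hx0 := h0 x
    have hx1 := h1 x
    have hFx : F x = ((p x : ℂ) - a) * jostM κ p r a b z x 1 := by rw [hF x]; push_cast; rfl
    refine (((hasDerivAt_const x (1 : ℂ)).sub hdF).add
      ((hcF.const_mul (I * κ / z)).add (hcG.const_mul (a : ℂ)))).congr_deriv ?_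
    rw [hFx, hx0, hx1]
    generalize (∫ y in Ioi x, F y) = A at *
    generalize (∫ y in Ioi x, G y) = A' at *
    generalize (∫ y in Ioi x, expQuot (Λ κ z) (y - x) * F y) = C at *
    generalize (∫ y in Ioi x, expQuot (Λ κ z) (y - x) * G y) = C' at *
    rw [hlam, ← hab]
    field_simp
    linear_combination (-(a : ℂ) * b * C * z ^ 2) * hI
  · rw [show (fun x => jostM κ p r a b z x 1) = _ from funext h1]
    have hx0 := h0 x
    have hx1 := h1 x
    have hGx : G x = ((r x : ℂ) - b) * jostM κ p r a b z x 0 := by rw [hG x]; push_cast; rfl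
    refine (((hasDerivAt_const x (-(I * b / z))).sub hdG).add
      ((hcF.const_mul (b : ℂ)).sub (hcG.const_mul (I * z)))).congr_deriv ?_
    rw [hGx, hx0, hx1]
    generalize (∫ y in Ioi x, F y) = A at *
    generalize (∫ y in Ioi x, G y) = A' at *
    generalize (∫ y in Ioi x, expQuot (Λ κ z) (y - x) * F y) = C at *
    generalize (∫ y in Ioi x, expQuot (Λ κ z) (y - x) * G y) = C' at *
    rw [hlam, ← hab]
    field_simp
    linear_combination (-(z * b) - z * a * b * C') * hI

/-- `φ` solves `φ' = [[ik, p], [r, -ik]] φ`. -/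
def IsLaxSolution (κ : ℝ) (p r : ℝ → ℝ) (z : ℂ) (φ : ℝ → Fin 2 → ℂ) : Prop :=
  ∀ x, HasDerivAt (fun y => φ y 0) (I * unifK κ z * φ x 0 + p x * φ x 1) x ∧
    HasDerivAt (fun y => φ y 1) (r x * φ x 0 - I * unifK κ z * φ x 1) x

/-- `φ` is the Jost solution at `+∞` that behaves like `e^{iλx} (1, -ib/z)`. -/
def IsRightJost (κ : ℝ) (p r : ℝ → ℝ) (b : ℝ) (z : ℂ) (φ : ℝ → Fin 2 → ℂ) : Prop :=
  IsLaxSolution κ p r z φ ∧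
    Tendsto (fun x : ℝ => exp (-(I * Λ κ z * x)) • φ x) atTop (𝓝 (jostLimit b z))

lemma RightPotential.isRightJost (h : RightPotential κ p r a b) (hz : z ∈ Ω κ) :
    IsRightJost κ p r b z fun x => exp (I * Λ κ z * x) • jostM κ p r a b z x := by
  constructor
  · intro x
    have hd : HasDerivAt (fun t : ℝ => exp (I * Λ κ z * t))
        (exp (I * Λ κ z * x) * (I * Λ κ z)) x := by
      have h1 : HasDerivAt (fun t : ℝ => I * Λ κ z * (t : ℂ)) (I * Λ κ z) x := by
        simpa using (ofRealCLM.hasDerivAt (x := x)).const_mul (I * Λ κ z)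
      exact h1.cexp
    obtain ⟨h0, h1⟩ := h.hasDerivAt_jostM hz x
    have hz0 := hz.1
    constructor
    · simp only [Pi.smul_apply, smul_eq_mul]
      refine (hd.mul h0).congr_deriv ?_
      simp only [unifK, Λ]; ring
    · simp only [Pi.smul_apply, smul_eq_mul]
      refine (hd.mul h1).congr_deriv ?_
      simp only [unifK, Λ]; ring
  · refine (h.tendsto_jostM hz).congr fun x => ?_
    rw [smul_smul, ← exp_add]; simp

/-- The Wronskian of two solutions is constant: the coefficient matrix is trace-free. -/
lemma wr_const {φ ψ : ℝ → Fin 2 → ℂ} (hφ : IsLaxSolution κ p r z φ) (hψ : IsLaxSolution κ p r z ψ)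
    (x y : ℝ) : wr (φ x) (ψ x) = wr (φ y) (ψ y) := by
  have hd : ∀ x, HasDerivAt (fun x => wr (φ x) (ψ x)) 0 x := by
    intro x
    refine (((hφ x).1.mul (hψ x).2).sub ((hφ x).2.mul (hψ x).1)).congr_deriv ?_
    ring
  exact is_const_of_deriv_eq_zero (fun x => (hd x).differentiableAt) (fun x => (hd x).deriv) x y

/-- A solution with a zero vanishes identically. -/
lemma IsLaxSolution.eq_zero {φ : ℝ → Fin 2 → ℂ} (hp : Continuous p) (hr : Continuous r)
    (hφ : IsLaxSolution κ p r z φ) {x0 : ℝ} (h0 : φ x0 = 0) (x : ℝ) : φ x = 0 := by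
  obtain ⟨A, hA, hA'⟩ : ∃ A, x < A ∧ x0 < A := ⟨max x x0 + 1, by
    linarith [le_max_left x x0], by linarith [le_max_right x x0]⟩
  obtain ⟨A', hB, hB'⟩ : ∃ A', A' < x ∧ A' < x0 := ⟨min x x0 - 1, by
    linarith [min_le_left x x0], by linarith [min_le_right x x0]⟩
  obtain ⟨K, hK⟩ := isCompact_Icc.exists_bound_of_continuousOn (s := Icc A' A)
    (f := fun t => |p t| + |r t| + ‖unifK κ z‖) (by fun_prop)
  have hK0 : 0 ≤ K := (norm_nonneg _).trans (hK x ⟨hB.le, hA.le⟩)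
  let A0 : ℝ → Matrix (Fin 2) (Fin 2) ℂ := fun t => !![I * unifK κ z, p t; r t, -(I * unifK κ z)]
  have hderiv : ∀ t, HasDerivAt φ ((A0 t).mulVec (φ t)) t := fun t => hasDerivAt_pi.2 fun i => by
    fin_cases i
    · simpa [A0, Matrix.mulVec, dotProduct] using (hφ t).1
    · simpa [A0, Matrix.mulVec, dotProduct, sub_eq_add_neg] using (hφ t).2
  have hv : ∀ t ∈ Ioo A' A, LipschitzOnWith (Real.toNNReal K) (fun v => (A0 t).mulVec v) univ := by
    refine fun t ht => LipschitzOnWith.of_dist_le_mul fun u _ w _ => ?_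
    have hKt := hK t (Ioo_subset_Icc_self ht)
    rw [Real.norm_eq_abs, abs_of_nonneg (by positivity)] at hKt
    rw [dist_eq_norm, dist_eq_norm, Real.coe_toNNReal _ hK0, ← Matrix.mulVec_sub]
    refine norm_mulVec_le_of_rows (fun i => ?_) _
    have hp := abs_nonneg (p t)
    have hr := abs_nonneg (r t)
    fin_cases i <;> simp [A0] <;> linarith
  have := ODE_solution_unique_of_mem_Icc (v := fun t v => (A0 t).mulVec v)
    (s := fun _ => univ) (f := φ) (g := fun _ => 0) hv (t₀ := x0) ⟨hB', hA'⟩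
    (fun t _ => (hderiv t).continuousAt.continuousWithinAt) (fun t _ => hderiv t)
    (fun _ _ => mem_univ _) continuousOn_const
    (fun t _ => by simpa using hasDerivAt_const t (0 : Fin 2 → ℂ))
    (fun _ _ => mem_univ _) h0
  exact this ⟨hB.le, hA.le⟩

lemma IsLaxSolution.sub {φ ψ : ℝ → Fin 2 → ℂ} (hφ : IsLaxSolution κ p r z φ)
    (hψ : IsLaxSolution κ p r z ψ) : IsLaxSolution κ p r z fun x => φ x - ψ x := by
  intro x
  refine ⟨((hφ x).1.sub (hψ x).1).congr_deriv ?_, ((hφ x).2.sub (hψ x).2).congr_deriv ?_⟩ <;>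
    · simp only [Pi.sub_apply]; ring

lemma norm_exp_mul_real_le {l : ℂ} (hl : 0 ≤ l.im) {x : ℝ} (hx : 0 ≤ x) :
    ‖exp (I * l * x)‖ ≤ 1 := by
  rw [norm_exp, Real.exp_le_one_iff, show (I * l * x).re = -(l.im * x) by simp]
  linarith [mul_nonneg hl hx]

/-- Uniqueness of the Jost solution in the closed half-plane `Im λ ≥ 0`. -/
lemma IsRightJost.unique {φ ψ : ℝ → Fin 2 → ℂ} (hp : Continuous p) (hr : Continuous r)
    (hl : 0 ≤ (Λ κ z).im) (hφ : IsRightJost κ p r b z φ) (hψ : IsRightJost κ p r b z ψ) :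
    φ = ψ := by
  set E : ℝ → ℂ := fun x => exp (-(I * Λ κ z * x)) with hE
  have hE0 : ∀ x, E x ≠ 0 := fun x => exp_ne_zero _
  have hdsol := hφ.1.sub hψ.1
  set d : ℝ → Fin 2 → ℂ := fun x => φ x - ψ x with hd
  have hdlim : Tendsto (fun x => E x • d x) atTop (𝓝 0) := by
    have := hφ.2.sub hψ.2
    rw [sub_self] at this
    exact this.congr fun x => (smul_sub _ _ _).symm
  have hd0 : Tendsto (fun x => E x * d x 0) atTop (𝓝 0) := by
    simpa using (tendsto_pi_nhds.1 hdlim) 0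
  have hd1 : Tendsto (fun x => E x * d x 1) atTop (𝓝 0) := by
    simpa using (tendsto_pi_nhds.1 hdlim) 1
  have hψ0 : Tendsto (fun x => E x * ψ x 0) atTop (𝓝 1) := by
    simpa [jostLimit] using (tendsto_pi_nhds.1 hψ.2) 0
  have hψ1 : Tendsto (fun x => E x * ψ x 1) atTop (𝓝 (-(I * b / z))) := by
    simpa [jostLimit] using (tendsto_pi_nhds.1 hψ.2) 1
  -- the Wronskian of the difference with `ψ` is constant and tends to `0`
  have hW : ∀ x, wr (d x) (ψ x) = 0 := by
    intro x
    have h1 : Tendsto (fun y : ℝ => wr (E y • d y) (E y • ψ y)) atTop (𝓝 0) := by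
      have := (hd0.mul hψ1).sub (hd1.mul hψ0)
      simpa [wr] using this
    have h2 : Tendsto (fun y : ℝ => wr (d y) (ψ y)) atTop (𝓝 0) := by
      rw [tendsto_zero_iff_norm_tendsto_zero] at h1 ⊢
      refine squeeze_zero' (.of_forall fun _ => norm_nonneg _) ?_ h1
      filter_upwards [eventually_ge_atTop 0] with y hy
      have hle : ‖exp (I * Λ κ z * y)‖ ≤ 1 := norm_exp_mul_real_le hl hy
      have he : exp (I * Λ κ z * y) * E y = 1 := by
        rw [hE, ← exp_add]; simp
      have heq : wr (d y) (ψ y) = exp (I * Λ κ z * y) *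
          exp (I * Λ κ z * y) * wr (E y • d y) (E y • ψ y) := by
        simp only [wr, Pi.smul_apply, smul_eq_mul]
        linear_combination (-(d y 0 * ψ y 1 - d y 1 * ψ y 0) *
          (exp (I * Λ κ z * y) * E y + 1)) * he
      rw [heq, norm_mul, norm_mul]
      calc _ ≤ 1 * 1 * ‖wr (E y • d y) (E y • ψ y)‖ := by gcongr
        _ = _ := by ring
    have h3 : Tendsto (fun y : ℝ => wr (d y) (ψ y)) atTop (𝓝 (wr (d x) (ψ x))) :=
      tendsto_const_nhds.congr fun y => wr_const hdsol hψ.1 x y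
    exact tendsto_nhds_unique h3 h2
  obtain ⟨X, hX⟩ : ∃ X, ∀ x ≥ X, ψ x 0 ≠ 0 := by
    have := hψ0.eventually_ne one_ne_zero
    obtain ⟨X, hX⟩ := eventually_atTop.1 this
    exact ⟨X, fun x hx h => hX x hx (by simp [h])⟩
  have hratio : ∀ x ∈ Ici X, HasDerivWithinAt (fun x => d x 0 / ψ x 0) 0 (Ici X) x := by
    intro x hx
    refine HasDerivAt.hasDerivWithinAt ?_
    refine ((hdsol x).1.div (hψ.1 x).1 (hX x hx)).congr_deriv ?_
    have := hW x
    simp only [wr] at this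
    rw [div_eq_zero_iff]; left
    simp only [Pi.sub_apply, hd] at this ⊢
    linear_combination (-(p x : ℂ)) * this
  have hconst : ∀ x ∈ Ici X, d x 0 / ψ x 0 = d X 0 / ψ X 0 := by
    intro x hx
    have := (convex_Ici X).norm_image_sub_le_of_norm_hasDerivWithin_le (C := 0) hratio
      (fun y _ => by simp) (mem_Ici.2 le_rfl) hx
    rw [zero_mul] at this
    exact sub_eq_zero.1 (norm_le_zero_iff.1 this)
  have hlim : Tendsto (fun x => d x 0 / ψ x 0) atTop (𝓝 0) := by
    have := hd0.div hψ0 one_ne_zero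
    rw [zero_div] at this
    exact this.congr fun x => mul_div_mul_left _ _ (hE0 x)
  have hc : d X 0 / ψ X 0 = 0 := by
    refine tendsto_nhds_unique (tendsto_const_nhds.congr' ?_) hlim
    filter_upwards [eventually_ge_atTop X] with x hx using (hconst x hx).symm
  have hX0 : d X 0 = 0 := (div_eq_zero_iff.1 hc).resolve_right (hX X le_rfl)
  have hX1 : d X 1 = 0 := by
    have := hW X
    simp only [wr, hX0, zero_mul, zero_sub, neg_eq_zero, mul_eq_zero] at this
    exact this.resolve_right (hX X le_rfl)
  have hdX : d X = 0 := by ext i; fin_cases i <;> assumption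
  funext x
  exact sub_eq_zero.1 (hdsol.eq_zero hp hr hdX x)

end

/-! ### A mean square bound for Fourier integrals -/

/-- `∫ e^{ixy} h(y) dy`. -/
def fint (h : ℝ → ℂ) (x : ℝ) : ℂ := ∫ y : ℝ, exp (I * x * y) * h y

lemma norm_exp_I_mul (x y : ℝ) : ‖exp (I * x * y)‖ = 1 := by
  rw [norm_exp]; simp

lemma integrable_exp_mul {h : ℝ → ℂ} (hh : Integrable h) (x : ℝ) :
    Integrable fun y : ℝ => exp (I * x * y) * h y :=
  hh.bdd_mul (c := 1) (Continuous.aestronglyMeasurable (by fun_prop))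
    (.of_forall fun y => (norm_exp_I_mul x y).le)

lemma norm_fint_le {h : ℝ → ℂ} (x : ℝ) : ‖fint h x‖ ≤ ∫ y, ‖h y‖ := by
  refine (norm_integral_le_integral_norm _).trans (le_of_eq ?_)
  exact integral_congr_ae (.of_forall fun y => by
    simp only [norm_mul, norm_exp_I_mul, one_mul])

lemma continuous_fint {h : ℝ → ℂ} (hh : Integrable h) : Continuous (fint h) := by
  refine continuous_of_dominated (bound := fun y => ‖h y‖)
    (fun x => (integrable_exp_mul hh x).aestronglyMeasurable) (fun x => ?_) hh.norm ?_
  · exact Eventually.of_forall fun y => by simp only [norm_mul, norm_exp_I_mul, one_mul]; exact le_rfl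
  · exact Eventually.of_forall fun y => by fun_prop

lemma integral_gaussian_exp {ε : ℝ} (hε : 0 < ε) (u : ℝ) :
    ∫ x : ℝ, exp (I * x * u) * Real.exp (-ε * x ^ 2) =
      ((Real.sqrt (π / ε) * Real.exp (-(1 / (4 * ε)) * u ^ 2) : ℝ) : ℂ) := by
  have h := fourierIntegral_gaussian (b := ε) (by simpa using hε) u
  have h2 : ((π : ℂ) / ε) ^ (1 / 2 : ℂ) = (Real.sqrt (π / ε) : ℝ) := by
    rw [Real.sqrt_eq_rpow, ofReal_cpow (by positivity)]
    push_cast; rfl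
  rw [h2] at h
  push_cast
  rw [show (-(1 / (4 * (ε : ℂ))) * (u : ℂ) ^ 2) = -(u : ℂ) ^ 2 / (4 * ε) by ring, ← h]
  refine integral_congr_ae (.of_forall fun x => ?_)
  simp only
  rw [show I * (x : ℂ) * u = I * u * x by ring]

/-- Gaussian-regularised form of the mean square bound. -/
lemma integral_fint_sq_gaussian_le {h : ℝ → ℂ} (hh : Integrable h) {S : ℝ} (hS : ∀ y, ‖h y‖ ≤ S)
    {ε : ℝ} (hε : 0 < ε) :
    ∫ x : ℝ, ‖fint h x‖ ^ 2 * Real.exp (-ε * x ^ 2) ≤ 2 * π * S * ∫ y, ‖h y‖ := by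
  have hγ : Integrable fun x : ℝ => ((Real.exp (-ε * x ^ 2) : ℝ) : ℂ) :=
    (integrable_exp_neg_mul_sq hε).ofReal
  set c : ℝ → ℂ := fun x => conj (fint h x) * (Real.exp (-ε * x ^ 2) : ℝ) with hc
  have hci : Integrable c := by
    refine hγ.bdd_mul (c := ∫ y, ‖h y‖) ?_ (.of_forall fun x => ?_)
    · exact (continuous_conj.comp (continuous_fint hh)).aestronglyMeasurable
    · rw [RCLike.norm_conj]; exact norm_fint_le x
  -- first exchange: move the transform from `h` to `c`
  have hex : ∀ (u v : ℝ → ℂ), Integrable u → Integrable v →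
      Integrable (Function.uncurry fun x y : ℝ => exp (I * x * y) * (u x * v y))
        (volume.prod volume) := by
    intro u v hu hv
    refine (hu.mul_prod hv).bdd_mul (c := 1) (Continuous.aestronglyMeasurable (by fun_prop))
      (.of_forall fun q => ?_)
    exact (norm_exp_I_mul q.1 q.2).le
  have h1 : ∫ x, fint h x * c x = ∫ y, h y * fint c y := by
    have := integral_integral_swap (hex c h hci hh)
    have e1 : ∀ x : ℝ, ∫ y : ℝ, exp (I * x * y) * (c x * h y) = fint h x * c x := by
      intro x
      rw [fint, ← integral_mul_const]
      exact integral_congr_ae (.of_forall fun y => by simp only; ring)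
    have e2 : ∀ y : ℝ, ∫ x : ℝ, exp (I * x * y) * (c x * h y) = h y * fint c y := by
      intro y
      rw [fint, ← integral_const_mul]
      refine integral_congr_ae (.of_forall fun x => ?_)
      simp only
      rw [show I * (y : ℂ) * x = I * x * y by ring]; ring
    simp_rw [e1, e2] at this
    exact this
  -- second exchange: `fint c` is the convolution of `conj h` with a Gaussian
  have h2 : ∀ y : ℝ, ‖fint c y‖ ≤ 2 * π * S := by
    intro y
    have hsw := integral_integral_swap
      (hex (fun x => exp (I * x * y) * (Real.exp (-ε * x ^ 2) : ℝ))
        (fun t => conj (h (-t)))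
        (hγ.bdd_mul (c := 1) (Continuous.aestronglyMeasurable (by fun_prop))
          (.of_forall fun x => (norm_exp_I_mul x y).le))
        ((LinearIsometryEquiv.integrable_comp_iff
          (conjLIE)).2 hh.comp_neg))
    have e1 : ∀ x : ℝ, ∫ t : ℝ, exp (I * x * t) *
        (exp (I * x * y) * (Real.exp (-ε * x ^ 2) : ℝ) * conj (h (-t))) =
        exp (I * y * x) * c x := by
      intro x
      have hconj : conj (fint h x) =
          ∫ t : ℝ, exp (I * x * t) * conj (h (-t)) := by
        rw [fint, ← integral_conj, ← integral_neg_eq_self]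
        refine integral_congr_ae (.of_forall fun t => ?_)
        simp only [map_mul, ← exp_conj, conj_I, conj_ofReal]
        push_cast
        ring_nf
      rw [hc]
      simp only
      rw [hconj, ← integral_mul_const, ← integral_const_mul]
      refine integral_congr_ae (.of_forall fun t => ?_)
      simp only
      rw [show I * (y : ℂ) * x = I * x * y by ring]; ring
    have e2 : ∀ t : ℝ, ∫ x : ℝ, exp (I * x * t) *
        (exp (I * x * y) * (Real.exp (-ε * x ^ 2) : ℝ) * conj (h (-t))) =
        ((Real.sqrt (π / ε) * Real.exp (-(1 / (4 * ε)) * (t + y) ^ 2) : ℝ) : ℂ) *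
          conj (h (-t)) := by
      intro t
      rw [← integral_gaussian_exp hε, ← integral_mul_const]
      refine integral_congr_ae (.of_forall fun x => ?_)
      simp only
      rw [show I * (x : ℂ) * ((t + y : ℝ) : ℂ) = I * x * t + I * x * y by push_cast; ring,
        exp_add]
      ring
    simp_rw [e1, e2] at hsw
    rw [fint, hsw]
    have hgi : Integrable fun t : ℝ => Real.sqrt (π / ε) *
        Real.exp (-(1 / (4 * ε)) * (t + y) ^ 2) * S :=
      (((integrable_exp_neg_mul_sq (b := 1 / (4 * ε)) (by positivity)).comp_add_right
        y).const_mul _).mul_const _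
    refine (norm_integral_le_of_norm_le hgi (.of_forall fun t => ?_)).trans ?_
    · rw [norm_mul, RCLike.norm_conj, norm_real, Real.norm_eq_abs,
        abs_of_nonneg (by positivity)]
      exact mul_le_mul_of_nonneg_left (hS _) (by positivity)
    · rw [integral_mul_const, integral_const_mul,
        integral_add_right_eq_self (fun t : ℝ => Real.exp (-(1 / (4 * ε)) * t ^ 2)) y,
        integral_gaussian, ← Real.sqrt_mul (by positivity)]
      rw [show π / ε * (π / (1 / (4 * ε))) = (2 * π) ^ 2 by field_simp; ring,
        Real.sqrt_sq (by positivity)]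
  have h3 : ((∫ x : ℝ, ‖fint h x‖ ^ 2 * Real.exp (-ε * x ^ 2) : ℝ) : ℂ) = ∫ y, h y * fint c y := by
    rw [← h1, ← integral_complex_ofReal]
    refine integral_congr_ae (.of_forall fun x => ?_)
    simp only [hc]
    push_cast
    rw [← mul_conj']
    ring
  have h4 : ‖∫ y, h y * fint c y‖ ≤ ∫ y, ‖h y‖ * (2 * π * S) := by
    refine norm_integral_le_of_norm_le (hh.norm.mul_const _) (.of_forall fun y => ?_)
    rw [norm_mul]
    exact mul_le_mul_of_nonneg_left (h2 y) (norm_nonneg _)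
  rw [← h3, norm_real, integral_mul_const] at h4
  calc _ ≤ _ := Real.le_norm_self _
    _ ≤ _ := h4
    _ = _ := by ring

lemma lintegral_fint_sq_le {h : ℝ → ℂ} (hh : Integrable h) {S : ℝ} (hS : ∀ y, ‖h y‖ ≤ S) :
    ∫⁻ x : ℝ, ENNReal.ofReal (‖fint h x‖ ^ 2) ≤
      ENNReal.ofReal (2 * π * S * ∫ y, ‖h y‖) := by
  have hε : ∀ n : ℕ, (0 : ℝ) < 1 / ((n : ℝ) + 1) := fun n => by positivity
  have hlim : ∀ x : ℝ, Tendsto (fun n : ℕ => ENNReal.ofReal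
      (‖fint h x‖ ^ 2 * Real.exp (-(1 / ((n : ℝ) + 1)) * x ^ 2))) atTop
      (𝓝 (ENNReal.ofReal (‖fint h x‖ ^ 2))) := by
    intro x
    refine ENNReal.tendsto_ofReal ?_
    have h0 : Tendsto (fun n : ℕ => Real.exp (-(1 / ((n : ℝ) + 1)) * x ^ 2)) atTop (𝓝 1) := by
      have := (tendsto_one_div_add_atTop_nhds_zero_nat (𝕜 := ℝ)).neg.mul_const (x ^ 2)
      simpa [Function.comp_def] using (Real.continuous_exp.tendsto _).comp this
    simpa using h0.const_mul (‖fint h x‖ ^ 2)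
  have hc := continuous_fint hh
  calc ∫⁻ x : ℝ, ENNReal.ofReal (‖fint h x‖ ^ 2)
      = ∫⁻ x : ℝ, liminf (fun n : ℕ => ENNReal.ofReal
          (‖fint h x‖ ^ 2 * Real.exp (-(1 / ((n : ℝ) + 1)) * x ^ 2))) atTop :=
        lintegral_congr fun x => ((hlim x).liminf_eq).symm
    _ ≤ liminf (fun n : ℕ => ∫⁻ x : ℝ, ENNReal.ofReal
          (‖fint h x‖ ^ 2 * Real.exp (-(1 / ((n : ℝ) + 1)) * x ^ 2))) atTop := by
        refine lintegral_liminf_le fun n => ?_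
        exact (ENNReal.continuous_ofReal.comp (by fun_prop)).measurable
    _ ≤ _ := by
        refine liminf_le_of_frequently_le' (Frequently.of_forall fun n => ?_)
        rw [← ofReal_integral_eq_lintegral_ofReal]
        · exact ENNReal.ofReal_le_ofReal (integral_fint_sq_gaussian_le hh hS (hε n))
        · refine (integrable_exp_neg_mul_sq (hε n)).bdd_mul (c := (∫ y, ‖h y‖) ^ 2)
            (hc.norm.pow 2).aestronglyMeasurable (.of_forall fun x => ?_)
          rw [Real.norm_eq_abs, abs_of_nonneg (by positivity)]
          have := norm_fint_le (h := h) x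
          gcongr
        · exact Eventually.of_forall fun x => by positivity

/-- The set `{|x| ≥ 1}`. -/
def farSet : Set ℝ := {x | 1 ≤ |x|}

lemma measurableSet_farSet : MeasurableSet farSet :=
  measurableSet_le measurable_const (continuous_abs.measurable)

lemma lintegral_farSet_inv_sq_lt_top : ∫⁻ x in farSet, ENNReal.ofReal (1 / x ^ 2) < ⊤ := by
  have hp : IntegrableOn (fun x : ℝ => 1 / x ^ 2) (Ici 1) := by
    have := integrableOn_Ioi_rpow_of_lt (a := -2) (by norm_num) (show (0 : ℝ) < 1 by norm_num)
    rw [integrableOn_Ici_iff_integrableOn_Ioi]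
    refine this.congr_fun (fun x hx => ?_) measurableSet_Ioi
    have : (0 : ℝ) < x := lt_trans one_pos hx
    simp only
    rw [Real.rpow_neg this.le, one_div]
    norm_num
  have hn : IntegrableOn (fun x : ℝ => 1 / x ^ 2) (Iic (-1)) := by
    have := hp.comp_neg
    simpa using this
  have hu : farSet = Iic (-1) ∪ Ici 1 := by
    ext x; simp only [farSet, mem_ofPred_eq, mem_union, mem_Iic, mem_Ici, le_abs]
    constructor <;> rintro (h | h)
    · right; exact h
    · left; linarith
    · right; linarith
    · left; exact h
  have := hn.union hp
  rw [← hu] at this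
  have h2 := this.2
  rw [hasFiniteIntegral_iff_ofReal (.of_forall fun x => by positivity)] at h2
  exact h2

/-- Fourier integrals of bounded integrable functions are integrable against `dx / |x|` at
infinity, with a bound that depends only on the size of the function. -/
lemma exists_lintegral_fint_div_le (S T : ℝ) : ∃ Q : ENNReal, Q < ⊤ ∧ ∀ h : ℝ → ℂ, Integrable h →
    (∀ y, ‖h y‖ ≤ S) → ∫ y, ‖h y‖ ≤ T →
    ∫⁻ x in farSet, ENNReal.ofReal (‖fint h x‖ / |x|) ≤ Q := by
  refine ⟨ENNReal.ofReal (2 * π * S * T) + ∫⁻ x in farSet, ENNReal.ofReal (1 / x ^ 2),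
    ENNReal.add_lt_top.2 ⟨ENNReal.ofReal_lt_top, lintegral_farSet_inv_sq_lt_top⟩,
    fun h hh hS hT => ?_⟩
  have hS0 : 0 ≤ S := (norm_nonneg _).trans (hS 0)
  have hc := continuous_fint hh
  calc ∫⁻ x in farSet, ENNReal.ofReal (‖fint h x‖ / |x|)
      ≤ ∫⁻ x in farSet, (ENNReal.ofReal (‖fint h x‖ ^ 2) + ENNReal.ofReal (1 / x ^ 2)) := by
        refine setLIntegral_mono' measurableSet_farSet fun x _ => ?_
        rw [← ENNReal.ofReal_add (by positivity) (by positivity)]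
        refine ENNReal.ofReal_le_ofReal ?_
        have h1 := two_mul_le_add_sq ‖fint h x‖ (1 / |x|)
        have h2 : (1 / |x|) ^ 2 = 1 / x ^ 2 := by rw [div_pow, one_pow, sq_abs]
        have h3 : 0 ≤ ‖fint h x‖ * (1 / |x|) := by positivity
        rw [h2] at h1
        rw [div_eq_mul_one_div]
        linarith
    _ = (∫⁻ x in farSet, ENNReal.ofReal (‖fint h x‖ ^ 2)) +
        ∫⁻ x in farSet, ENNReal.ofReal (1 / x ^ 2) :=
        lintegral_add_left (ENNReal.continuous_ofReal.comp (by fun_prop)).measurable _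
    _ ≤ _ := by
        gcongr
        refine (setLIntegral_le_lintegral _ _).trans ((lintegral_fint_sq_le hh hS).trans ?_)
        gcongr

section

variable {κ a b : ℝ} {p r : ℝ → ℝ} {z : ℂ}

/-! ### The Jost solution for large spectral parameter -/

lemma norm_div_four_le_Λ (hz : 1 + 2 * |κ| ≤ ‖z‖) : ‖z‖ / 4 ≤ ‖Λ κ z‖ := by
  have h1 : 1 ≤ ‖z‖ := by linarith [abs_nonneg κ]
  have h2 : ‖(κ : ℂ) / z‖ ≤ ‖z‖ / 2 := by
    rw [norm_div, norm_real, Real.norm_eq_abs, div_le_iff₀ (by linarith)]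
    nlinarith [abs_nonneg κ]
  have h3 := norm_sub_norm_le z (κ / z)
  rw [Λ, norm_div, norm_ofNat]
  linarith

/-- A bound for the normalised Jost solution, uniform for large `z`. -/
lemma RightPotential.exists_bound_large (h : RightPotential κ p r a b) :
    ∃ K, 0 ≤ K ∧ ∀ z ∈ Ω κ, 1 + 2 * |κ| ≤ ‖z‖ → ∀ x, 0 ≤ x →
      ‖jostM κ p r a b z x‖ ≤ K := by
  set C := 1 + 4 * (|a| + |b| + |κ| + 1) with hC
  have hC0 : 0 ≤ C := by positivity
  refine ⟨2 * (1 + |b|) * Real.exp (2 * tailInt (fun y => C * potWeight p r a b y) 0),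
    by positivity, fun z hz hzR x hx => ?_⟩
  have h1 : 1 ≤ ‖z‖ := by linarith [abs_nonneg κ]
  have hl := norm_div_four_le_Λ hzR
  have hb : bgSize κ a b z ≤ ‖z‖ * (|a| + |b| + |κ| + 1) := by
    have : |κ| / ‖z‖ ≤ |κ| := div_le_self (abs_nonneg _) h1
    unfold bgSize
    nlinarith [abs_nonneg a, abs_nonneg b, abs_nonneg κ]
  have hker : KernelBound 0 (fun y => C * potWeight p r a b y) (jostKernel κ p r a b z) := by
    refine kernelBound_of_lam hz ?_ 0
    have : bgSize κ a b z / ‖Λ κ z‖ ≤ 4 * (|a| + |b| + |κ| + 1) := by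
      rw [div_le_iff₀ (by linarith)]
      nlinarith [abs_nonneg a, abs_nonneg b, abs_nonneg κ]
    linarith
  refine (h.norm_jostM_le hker hC0 hx).trans ?_
  have h2 := (h.tailMajorant hC0).antitone_tailInt hx
  have h3 : ‖jostLimit b z‖ ≤ 1 + |b| :=
    (norm_jostLimit_le hz.1).trans (by linarith [div_le_self (abs_nonneg b) h1])
  gcongr

/-- The exponentially weighted tail that dominates the second component of the Jost solution. -/
def jostTail (κ : ℝ) (p r : ℝ → ℝ) (a b : ℝ) (z : ℂ) (x : ℝ) : ℂ :=
  ∫ y in Ioi x, exp (2 * I * Λ κ z * (y - x : ℝ)) *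
    (((r y - b : ℝ) : ℂ) * jostM κ p r a b z y 0)

lemma RightPotential.tailMajorant_potWeight (h : RightPotential κ p r a b) :
    TailMajorant (potWeight p r a b) := by
  simpa using h.tailMajorant zero_le_one

lemma norm_ofReal_mul_le {s W K : ℝ} {w : ℂ} (h : |s| ≤ W) (hw : ‖w‖ ≤ K) :
    ‖(s : ℂ) * w‖ ≤ K * W := by
  rw [norm_mul, norm_real, Real.norm_eq_abs, mul_comm]
  exact mul_le_mul hw h (abs_nonneg _) ((norm_nonneg _).trans hw)

lemma norm_setIntegral_le_of_potWeight (h : RightPotential κ p r a b) {u : ℝ → ℂ} {D x : ℝ}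
    (hx : 0 ≤ x) (hD : 0 ≤ D) (hu : ∀ y, x < y → ‖u y‖ ≤ D * potWeight p r a b y) :
    ‖∫ y in Ioi x, u y‖ ≤ D * tailInt (potWeight p r a b) 0 := by
  refine (norm_integral_le_of_norm_le ((h.integrableOn_potWeight x).const_mul D)
    ((ae_restrict_mem measurableSet_Ioi).mono fun y hy => hu y hy)).trans ?_
  rw [integral_const_mul]
  exact mul_le_mul_of_nonneg_left (h.tailMajorant_potWeight.antitone_tailInt hx) hD

/-- Up to `O(1 / z)`, the second component of the Jost solution is an exponentially weighted tail,
and the first is `1` minus an integral of the second. -/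
lemma RightPotential.exists_approx (h : RightPotential κ p r a b) :
    ∃ C, 0 ≤ C ∧ ∀ z ∈ Ω κ, 1 + 2 * |κ| ≤ ‖z‖ → ∀ x, 0 ≤ x →
      ‖jostM κ p r a b z x 0 - 1 +
        ∫ y in Ioi x, ((p y - a : ℝ) : ℂ) * jostM κ p r a b z y 1‖ ≤ C / ‖z‖ ∧
      ‖jostM κ p r a b z x 1 + jostTail κ p r a b z x‖ ≤ C / ‖z‖ := by
  obtain ⟨K, hK0, hK⟩ := h.exists_bound_large
  set L := tailInt (potWeight p r a b) 0 with hL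
  have hL0 : 0 ≤ L := h.tailMajorant_potWeight.tailInt_nonneg 0
  refine ⟨(|κ| + |a| + |b| + |κ|) * (4 * K * L) + |b|, by positivity, fun z hz hzR x hx => ?_⟩
  obtain ⟨F, G, hFc, hGc, hF, hG, hFi, hGi, hcF, hcG, h0, h1⟩ := h.jostM_components hz
  have hz1 : 1 ≤ ‖z‖ := by linarith [abs_nonneg κ]
  have hl := norm_div_four_le_Λ hzR
  have hW0 : ∀ y, 0 ≤ potWeight p r a b y := fun y => by unfold potWeight; positivity
  have hJ : ∀ y, x < y → ∀ i, ‖jostM κ p r a b z y i‖ ≤ K := fun y hy i =>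
    (norm_le_pi_norm _ _).trans (hK z hz hzR y (hx.trans hy.le))
  have hFb : ∀ y, x < y → ‖F y‖ ≤ K * potWeight p r a b y := fun y hy =>
    hF y ▸ norm_ofReal_mul_le (abs_sub_le_potWeight_left y) (hJ y hy 1)
  have hGb : ∀ y, x < y → ‖G y‖ ≤ K * potWeight p r a b y := fun y hy =>
    hG y ▸ norm_ofReal_mul_le (abs_sub_le_potWeight_right y) (hJ y hy 0)
  have hcb : ∀ y, x < y → ‖expQuot (Λ κ z) (y - x)‖ ≤ 4 / ‖z‖ := by
    intro y hy
    refine (norm_expQuot_le_inv hz.2.2 (sub_nonneg.2 hy.le)).trans ?_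
    rw [div_le_div_iff₀ (by linarith) (by linarith)]
    linarith
  have hQ (f : ℝ → ℂ) (hf : ∀ y, x < y → ‖f y‖ ≤ K * potWeight p r a b y) :
      ‖∫ y in Ioi x, expQuot (Λ κ z) (y - x) * f y‖ ≤ 4 * K * L / ‖z‖ := by
    refine (norm_setIntegral_le_of_potWeight h (D := 4 / ‖z‖ * K) hx (by positivity)
      fun y hy => ?_).trans (le_of_eq (by ring))
    rw [norm_mul, mul_assoc]
    exact mul_le_mul (hcb y hy) (hf y hy) (norm_nonneg _) (by positivity)
  have hcFb := hQ F hFb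
  have hcGb := hQ G hGb
  constructor
  · simp_rw [← hF]
    rw [h0 x, show ∀ A X Y : ℂ, 1 - A + (X + Y) - 1 + A = X + Y from fun _ _ _ => by ring]
    refine (norm_add_le _ _).trans ?_
    rw [norm_mul, norm_mul, norm_div, norm_mul, norm_I, one_mul, norm_real,
      norm_real, Real.norm_eq_abs, Real.norm_eq_abs]
    calc _ ≤ |κ| * (4 * K * L / ‖z‖) + |a| * (4 * K * L / ‖z‖) := by
          have := div_le_self (abs_nonneg κ) hz1
          gcongr
      _ = ((|κ| + |a|) * (4 * K * L)) / ‖z‖ := by ring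
      _ ≤ _ := by
          have h3 : 0 ≤ (|b| + |κ|) * (4 * K * L) + |b| := by positivity
          gcongr
          linarith
  · set ex : ℝ → ℂ := fun y => exp (2 * I * Λ κ z * (y - x : ℝ)) with hex
    have hexb : ∀ y, x < y → ‖ex y‖ ≤ 1 := fun y hy =>
      norm_exp_le_one hz.2.2 (sub_nonneg.2 hy.le)
    have hexG : IntegrableOn (fun y => ex y * G y) (Ioi x) :=
      (hGi x).bdd_mul (c := 1) (Continuous.aestronglyMeasurable (by rw [hex]; fun_prop))
        ((ae_restrict_mem measurableSet_Ioi).mono fun y hy => hexb y hy)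
    have hT : jostTail κ p r a b z x = ∫ y in Ioi x, ex y * G y := by
      unfold jostTail; simp_rw [← hG]; rfl
    have hz0 := hz.1
    -- the diagonal part of the kernel agrees with the pure exponential up to `O(1 / z)`
    have hd : (∫ y in Ioi x, ex y * G y) - (∫ y in Ioi x, G y) -
        I * z * (∫ y in Ioi x, expQuot (Λ κ z) (y - x) * G y) =
        ∫ y in Ioi x, (κ / z / (2 * Λ κ z)) * ((1 - ex y) * G y) := by
      rw [← integral_const_mul, ← integral_sub hexG (hGi x)]
      have hsub : IntegrableOn (fun y => ex y * G y - G y) (Ioi x) := hexG.sub (hGi x)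
      rw [← integral_sub hsub ((hcG x).const_mul _)]
      refine integral_congr_ae (.of_forall fun y => ?_)
      simp only [expQuot, hex]
      generalize exp (2 * I * Λ κ z * (y - x : ℝ)) = E
      have hl0 := hz.2.1
      have hk : (κ : ℂ) / z = z - 2 * Λ κ z := by unfold Λ; ring
      rw [hk]
      have hI := I_ne_zero
      field_simp
      ring
    have hdb : ‖∫ y in Ioi x, (κ / z / (2 * Λ κ z)) * ((1 - ex y) * G y)‖ ≤
        |κ| * (4 * K * L) / ‖z‖ := by
      refine (norm_setIntegral_le_of_potWeight h (D := |κ| * (4 * K) / ‖z‖) hx (by positivity)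
        fun y hy => ?_).trans (le_of_eq (by ring))
      rw [norm_mul, norm_mul]
      have e1 : ‖(κ : ℂ) / z / (2 * Λ κ z)‖ ≤ |κ| * 2 / ‖z‖ := by
        rw [norm_div, norm_div, norm_mul, norm_real, Real.norm_eq_abs, norm_ofNat, div_div,
          div_le_div_iff₀ (by nlinarith) (by linarith)]
        have : ‖z‖ * 1 ≤ ‖z‖ * (2 * ‖Λ κ z‖) * 2 := by nlinarith
        nlinarith [abs_nonneg κ]
      have e2 : ‖1 - ex y‖ ≤ 2 := by
        refine (norm_sub_le _ _).trans ?_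
        rw [norm_one]; linarith [hexb y hy]
      calc _ ≤ (|κ| * 2 / ‖z‖) * (2 * (K * potWeight p r a b y)) :=
            mul_le_mul e1 (mul_le_mul e2 (hGb y hy) (norm_nonneg _) (by norm_num))
              (by positivity) (by positivity)
        _ = _ := by ring
    rw [hT, h1 x, show ∀ N A X Y E : ℂ, N - A + (X - Y) + E = N + X + (E - A - Y) from
      fun _ _ _ _ _ => by ring, hd]
    refine (norm_add₃_le).trans ?_
    rw [norm_neg, norm_div, norm_mul, norm_mul, norm_I, one_mul, norm_real,
      Real.norm_eq_abs]
    calc _ ≤ |b| / ‖z‖ + |b| * (4 * K * L / ‖z‖) + |κ| * (4 * K * L) / ‖z‖ := by gcongr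
      _ = ((|b| + |κ|) * (4 * K * L) + |b|) / ‖z‖ := by ring
      _ ≤ _ := by
          have h3 : 0 ≤ (|κ| + |a|) * (4 * K * L) := by positivity
          refine div_le_div_of_nonneg_right ?_ (by positivity)
          linarith

/-- Riemann–Lebesgue, uniformly on the closed half-plane: integrate by parts on a compact interval
and estimate the tail. -/
lemma RightPotential.jostTail_small (h : RightPotential κ p r a b) {ε : ℝ} (hε : 0 < ε) :
    ∃ R, 1 + 2 * |κ| ≤ R ∧ ∀ z ∈ Ω κ, R ≤ ‖z‖ → ∀ x, 0 ≤ x →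
      ‖jostTail κ p r a b z x‖ ≤ ε := by
  obtain ⟨K, hK0, hK⟩ := h.exists_bound_large
  have hW := h.tailMajorant_potWeight
  obtain ⟨T, hT0, hT⟩ : ∃ T, 0 ≤ T ∧ K * tailInt (potWeight p r a b) T ≤ ε / 2 := by
    have h1 := hW.tendsto_tailInt.const_mul K
    rw [mul_zero] at h1
    obtain ⟨T, hT⟩ := ((h1.eventually (ge_mem_nhds (half_pos hε))).and
      (eventually_ge_atTop 0)).exists
    exact ⟨T, hT.2, hT.1⟩
  have hp := h.contDiff_p.continuous
  have hr := h.contDiff_r.continuous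
  have hr' : Continuous (deriv r) := h.contDiff_r.continuous_deriv le_rfl
  obtain ⟨D, hD⟩ := (isCompact_Icc (a := (0 : ℝ)) (b := T)).exists_bound_of_continuousOn
    (f := fun y => |r y - b| + |deriv r y| + |r y - b| * |p y|) (by fun_prop)
  have hD0 : 0 ≤ D := (norm_nonneg _).trans (hD 0 ⟨le_rfl, hT0⟩)
  set U := D * K * (2 + |κ|) with hU
  have hU0 : 0 ≤ U := by positivity
  set R := max (1 + 2 * |κ|) ((2 * D * K + U * T) * 4 / ε) with hR
  refine ⟨R, le_max_left _ _, fun z hz hzR x hx => ?_⟩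
  have hzR1 := (le_max_left _ _).trans hzR
  have hzR2 := (le_max_right _ _).trans hzR
  have hz1 : 1 ≤ ‖z‖ := by linarith [abs_nonneg κ]
  have hl := norm_div_four_le_Λ hzR1
  set m := jostM κ p r a b z with hm
  have hmc : Continuous m := h.continuous_jostM hz
  have hm0 : Continuous fun y => m y 0 := (continuous_apply 0).comp hmc
  have hm1 : Continuous fun y => m y 1 := (continuous_apply 1).comp hmc
  set u : ℝ → ℂ := fun y => ((r y - b : ℝ) : ℂ) * m y 0 with hu
  set ex : ℝ → ℂ := fun y => exp (2 * I * Λ κ z * (y - x : ℝ)) with hex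
  have huc : Continuous u := by rw [hu]; fun_prop
  have hexc : Continuous ex := by rw [hex]; fun_prop
  have hexb : ∀ y, x ≤ y → ‖ex y‖ ≤ 1 := fun y hy =>
    norm_exp_le_one hz.2.2 (sub_nonneg.2 hy)
  have hmb : ∀ y, 0 ≤ y → ∀ i, ‖m y i‖ ≤ K := fun y hy i =>
    (norm_le_pi_norm _ _).trans (hK z hz hzR1 y hy)
  have hub : ∀ s, x ≤ s → ∀ᵐ y ∂volume.restrict (Ioi s), ‖ex y * u y‖ ≤ K * potWeight p r a b y :=
    fun s hs => (ae_restrict_mem measurableSet_Ioi).mono fun y hy => by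
      have hy' := hs.trans (le_of_lt hy)
      rw [norm_mul, ← one_mul (K * _)]
      exact mul_le_mul (hexb y hy') (norm_ofReal_mul_le (abs_sub_le_potWeight_right y)
        (hmb y (hx.trans hy') 0)) (norm_nonneg _) zero_le_one
  have hint : ∀ s, x ≤ s → IntegrableOn (fun y => ex y * u y) (Ioi s) := fun s hs =>
    Integrable.mono' ((h.integrableOn_potWeight s).const_mul K)
      (hexc.mul huc).aestronglyMeasurable (hub s hs)
  have htail : ∀ s, T ≤ s → x ≤ s → ‖∫ y in Ioi s, ex y * u y‖ ≤ ε / 2 := fun s hTs hxs => by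
    refine (norm_integral_le_of_norm_le ((h.integrableOn_potWeight s).const_mul K)
      (hub s hxs)).trans (le_trans ?_ hT)
    rw [integral_const_mul]
    exact mul_le_mul_of_nonneg_left (hW.antitone_tailInt hTs) hK0
  change ‖∫ y in Ioi x, ex y * u y‖ ≤ ε
  rcases le_total T x with hTx | hxT
  · exact (htail x hTx le_rfl).trans (by linarith)
  rw [← intervalIntegral.integral_interval_add_Ioi (hint x le_rfl) (hint T hxT)]
  refine (norm_add_le _ _).trans ?_
  suffices hs : ‖∫ y in x..T, ex y * u y‖ ≤ ε / 2 by linarith [htail T le_rfl hxT]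
  -- integration by parts
  set u' : ℝ → ℂ := fun y => ((deriv r y : ℝ) : ℂ) * m y 0 +
    ((r y - b : ℝ) : ℂ) * (I * κ / z * m y 0 + p y * m y 1) with hu'
  have hud : ∀ y, HasDerivAt u (u' y) y := fun y =>
    ((h.contDiff_r.differentiable one_ne_zero y).hasDerivAt.sub_const b).ofReal_comp.mul
      (h.hasDerivAt_jostM hz y).1
  have hl2 : 2 * I * Λ κ z ≠ 0 := by simp [hz.2.1]
  have hexd : ∀ y, HasDerivAt ex (ex y * (2 * I * Λ κ z)) y := fun y => by
    simpa [hex] using ((((hasDerivAt_id y).sub_const x).ofReal_comp).const_mul (2 * I * Λ κ z)).cexp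
  have hHd : ∀ y, HasDerivAt (fun y => ex y * u y / (2 * I * Λ κ z))
      (ex y * u y + ex y * u' y / (2 * I * Λ κ z)) y := by
    intro y
    refine (((hexd y).mul (hud y)).div_const (2 * I * Λ κ z)).congr_deriv ?_
    have hl0 := hz.2.1
    field_simp
  have hu'c : Continuous u' := by rw [hu']; fun_prop
  have hFTC := intervalIntegral.integral_eq_sub_of_hasDerivAt (a := x) (b := T)
    (fun y _ => hHd y) (Continuous.intervalIntegrable (by fun_prop) _ _)
  rw [intervalIntegral.integral_add (Continuous.intervalIntegrable (by fun_prop) _ _)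
    (Continuous.intervalIntegrable (by fun_prop) _ _)] at hFTC
  have hval : ∫ y in x..T, ex y * u y = ex T * u T / (2 * I * Λ κ z) -
      ex x * u x / (2 * I * Λ κ z) - ∫ y in x..T, ex y * u' y / (2 * I * Λ κ z) := by
    rw [← hFTC]; ring
  have hq (v : ℂ) {V y : ℝ} (hy : x ≤ y) (hv : ‖v‖ ≤ V) :
      ‖ex y * v / (2 * I * Λ κ z)‖ ≤ V * (2 / ‖z‖) := by
    have hlz : 1 / ‖2 * I * Λ κ z‖ ≤ 2 / ‖z‖ := by
      rw [norm_mul, norm_mul, norm_I, norm_ofNat, mul_one,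
        div_le_div_iff₀ (by linarith) (by linarith)]
      linarith
    rw [norm_div, div_eq_mul_one_div, norm_mul, ← one_mul V]
    have := hexb y hy
    have := (norm_nonneg v).trans hv
    gcongr
  have hDy : ∀ y ∈ Icc 0 T, |r y - b| ≤ D ∧ |deriv r y| ≤ D ∧ |r y - b| * |p y| ≤ D := by
    intro y hy
    have := hD y hy
    rw [Real.norm_eq_abs, abs_of_nonneg (by positivity)] at this
    have h1 := abs_nonneg (r y - b)
    have h2 := abs_nonneg (deriv r y)
    have h3 : 0 ≤ |r y - b| * |p y| := by positivity
    refine ⟨by linarith, by linarith, by linarith⟩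
  have hu1 : ∀ y ∈ Icc 0 T, ‖u y‖ ≤ D * K := fun y hy =>
    (norm_ofReal_mul_le (hDy y hy).1 (hmb y hy.1 0)).trans_eq (mul_comm _ _)
  have hu2 : ∀ y ∈ Icc 0 T, ‖u' y‖ ≤ U := fun y hy => by
    obtain ⟨h2, h3, h4⟩ := hDy y hy
    have h5 := hmb y hy.1 0
    have h6 := hmb y hy.1 1
    have e : u' y = ((deriv r y : ℝ) : ℂ) * m y 0 + ((r y - b : ℝ) : ℂ) * (I * κ / z) * m y 0 +
        ((r y - b : ℝ) : ℂ) * p y * m y 1 := by rw [hu']; ring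
    rw [e]
    refine norm_add₃_le.trans ?_
    simp only [norm_mul, norm_div, norm_real, Real.norm_eq_abs, norm_I, one_mul]
    have h8 := div_le_self (abs_nonneg κ) hz1
    calc _ ≤ D * K + D * |κ| * K + D * K := by gcongr
      _ = U := by rw [hU]; ring
  rw [hval]
  have hI1 := hq _ hxT (hu1 T ⟨hT0, le_rfl⟩)
  have hI2 := hq _ le_rfl (hu1 x ⟨hx, hxT⟩)
  have hI3 := intervalIntegral.norm_integral_le_of_norm_le_const (a := x) (b := T)
    (f := fun y => ex y * u' y / (2 * I * Λ κ z)) (C := U * (2 / ‖z‖)) fun y hy => by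
      rw [uIoc_of_le hxT] at hy
      exact hq _ hy.1.le (hu2 y ⟨hx.trans hy.1.le, hy.2⟩)
  rw [abs_of_nonneg (sub_nonneg.2 hxT)] at hI3
  have hI4 : U * (2 / ‖z‖) * (T - x) ≤ U * (2 / ‖z‖) * T := by gcongr; linarith
  refine (norm_sub_le _ _).trans ?_
  refine (add_le_add_left (norm_sub_le _ _) _).trans ?_
  have hfin : (2 * D * K + U * T) * (2 / ‖z‖) ≤ ε / 2 := by
    rw [div_le_iff₀ hε] at hzR2
    rw [← mul_div_assoc, div_le_iff₀ (by linarith)]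
    linarith
  linarith

/-- The normalised Jost solution tends to `(1, 0)` as `z → ∞`. -/
lemma RightPotential.tendsto_jostM_infty (h : RightPotential κ p r a b) :
    Tendsto (fun z => jostM κ p r a b z 0) (cocompact ℂ ⊓ 𝓟 (Ω κ))
      (𝓝 ![1, 0]) := by
  obtain ⟨C, hC0, hC⟩ := h.exists_approx
  set L := tailInt (potWeight p r a b) 0 with hL
  have hL0 : 0 ≤ L := h.tailMajorant_potWeight.tailInt_nonneg 0
  rw [Metric.tendsto_nhds]
  intro ε hε
  set ε' := ε / (4 * (1 + L)) with hε'
  have hε'0 : 0 < ε' := by positivity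
  obtain ⟨R, hR, hRt⟩ := h.jostTail_small hε'0
  have hev : ∀ᶠ z in cocompact ℂ ⊓ 𝓟 (Ω κ), R ≤ ‖z‖ ∧ C / ε' ≤ ‖z‖ ∧ z ∈ Ω κ := by
    rw [eventually_inf_principal]
    have h1 := (tendsto_norm_cocompact_atTop (E := ℂ)).eventually_ge_atTop R
    have h2 := (tendsto_norm_cocompact_atTop (E := ℂ)).eventually_ge_atTop (C / ε')
    filter_upwards [h1, h2] with z h1 h2 hz using ⟨h1, h2, hz⟩
  filter_upwards [hev] with z ⟨hzR, hzC, hz⟩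
  have hz1 : 1 ≤ ‖z‖ := by linarith [abs_nonneg κ]
  have hCz : C / ‖z‖ ≤ ε' := by
    rw [div_le_iff₀ hε'0] at hzC
    rw [div_le_iff₀ (by linarith)]; linarith
  have hm1 : ∀ x, 0 ≤ x → ‖jostM κ p r a b z x 1‖ ≤ 2 * ε' := by
    intro x hx
    have h1 := (hC z hz (hR.trans hzR) x hx).2
    have h2 := hRt z hz hzR x hx
    have h3 := norm_le_norm_add_norm_sub' (jostM κ p r a b z x 1) (-jostTail κ p r a b z x)
    rw [norm_neg, sub_neg_eq_add] at h3
    linarith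
  have hm0 : ‖jostM κ p r a b z 0 0 - 1‖ ≤ ε' + 2 * ε' * L := by
    have h1 := (hC z hz (hR.trans hzR) 0 le_rfl).1
    have h2 := norm_setIntegral_le_of_potWeight h (D := 2 * ε') (x := 0)
      (u := fun y => ((p y - a : ℝ) : ℂ) * jostM κ p r a b z y 1) le_rfl (by positivity)
      fun y hy => norm_ofReal_mul_le (abs_sub_le_potWeight_left y) (hm1 y hy.le)
    have h3 := norm_le_norm_add_norm_sub' (jostM κ p r a b z 0 0 - 1)
      (-∫ y in Ioi 0, ((p y - a : ℝ) : ℂ) * jostM κ p r a b z y 1)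
    rw [norm_neg, sub_neg_eq_add] at h3
    linarith
  have hee : 4 * ε' * (1 + L) = ε := by rw [hε']; field_simp
  rw [dist_eq_norm]
  refine lt_of_le_of_lt ((pi_norm_le_iff_of_nonneg (r := 3 * ε' * (1 + L)) (by positivity)).2 ?_)
    (by nlinarith)
  intro i
  fin_cases i
  · simp only [Fin.zero_eta, Pi.sub_apply, Matrix.cons_val_zero]
    nlinarith
  · simp only [Fin.mk_one, Pi.sub_apply, Matrix.cons_val_one, Matrix.cons_val_zero, sub_zero]
    have := hm1 0 le_rfl
    nlinarith

end

section

variable {κ a b : ℝ} {p r : ℝ → ℝ} {z : ℂ}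

/-! ### Integrability of the off-diagonal Jost component at infinity -/

/-- The difference of the potential component to its limit, restricted to a subset of the line. -/
def cutPot (r : ℝ → ℝ) (b : ℝ) (A : Set ℝ) : ℝ → ℂ :=
  A.indicator fun y => ((r y - b : ℝ) : ℂ)

lemma RightPotential.integrable_cutPot (h : RightPotential κ p r a b) {A : Set ℝ}
    (hA : MeasurableSet A) (hA0 : A ⊆ Ioi 0) : Integrable (cutPot r b A) := by
  have hr := h.contDiff_r.continuous
  refine (integrable_indicator_iff hA).2 ?_
  refine IntegrableOn.mono_set ?_ hA0
  refine Integrable.mono' (h.integrableOn_potWeight 0)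
    (Continuous.aestronglyMeasurable (by fun_prop)) (.of_forall fun y => ?_)
  rw [norm_real, Real.norm_eq_abs]
  exact abs_sub_le_potWeight_right y

lemma RightPotential.integral_cutPot_le (h : RightPotential κ p r a b) {A : Set ℝ}
    (hA : MeasurableSet A) (hA0 : A ⊆ Ioi 0) :
    ∫ y, ‖cutPot r b A y‖ ≤ tailInt (potWeight p r a b) 0 := by
  rw [tailInt, ← integral_indicator measurableSet_Ioi]
  refine integral_mono (h.integrable_cutPot hA hA0).norm
    ((integrable_indicator_iff measurableSet_Ioi).2 (h.integrableOn_potWeight 0)) fun y => ?_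
  simp only [cutPot]
  by_cases hy : y ∈ A
  · rw [indicator_of_mem hy, indicator_of_mem (hA0 hy), norm_real, Real.norm_eq_abs]
    exact abs_sub_le_potWeight_right y
  · rw [indicator_of_notMem hy, norm_zero]
    exact indicator_nonneg (fun y _ => by unfold potWeight; positivity) y

lemma RightPotential.exists_cutPot_bound (h : RightPotential κ p r a b) :
    ∃ S, ∀ A : Set ℝ, A ⊆ Ioi 0 → ∀ y, ‖cutPot r b A y‖ ≤ S := by
  have hr := h.contDiff_r.continuous
  obtain ⟨X, hX⟩ : ∃ X, ∀ x ≥ X, |r x - b| < 1 := by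
    obtain ⟨X, hX⟩ := Metric.tendsto_atTop.1 h.tendsto_r 1 one_pos
    exact ⟨X, fun x hx => by simpa [Real.dist_eq] using hX x hx⟩
  obtain ⟨D, hD⟩ := (isCompact_Icc (a := (0 : ℝ)) (b := X)).exists_bound_of_continuousOn
    (f := fun y => r y - b) (by fun_prop)
  refine ⟨max 1 D, fun A hA y => ?_⟩
  simp only [cutPot]
  by_cases hy : y ∈ A
  · rw [indicator_of_mem hy, norm_real]
    rcases le_total X y with hXy | hXy
    · exact (hX y hXy).le.trans (le_max_left _ _)
    · exact (hD y ⟨le_of_lt (hA hy), hXy⟩).trans (le_max_right _ _)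
  · rw [indicator_of_notMem hy, norm_zero]
    exact zero_le_one.trans (le_max_left _ _)

lemma ofReal_mem_Ω {x : ℝ} (hx : 1 + 2 * |κ| ≤ |x|) : (x : ℂ) ∈ Ω κ := by
  have hn : 1 + 2 * |κ| ≤ ‖(x : ℂ)‖ := by rwa [norm_real, Real.norm_eq_abs]
  have hl := norm_div_four_le_Λ hn
  have h0 : 0 < ‖(x : ℂ)‖ := by linarith [abs_nonneg κ]
  refine ⟨norm_pos_iff.1 h0, norm_pos_iff.1 (by linarith), ?_⟩
  have : Λ κ x = (((x - κ / x) / 2 : ℝ) : ℂ) := by unfold Λ; push_cast; rfl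
  rw [this, ofReal_im]

/-- For real `x`, replacing `2λ` by `x` in the exponential costs a factor `y / |x|`. -/
lemma norm_exp_lam_sub_le {x y : ℝ} (hy : 0 ≤ y) :
    ‖exp (2 * I * Λ κ x * y) - exp (I * x * y)‖ ≤ |κ| / |x| * y := by
  have e : 2 * I * Λ κ x * y = I * x * y + I * ((-(κ / x * y) : ℝ) : ℂ) := by
    unfold Λ; push_cast; ring
  rw [e, exp_add, ← mul_sub_one, norm_mul, norm_exp_I_mul, one_mul]
  refine (Real.norm_exp_I_mul_ofReal_sub_one_le).trans ?_
  rw [Real.norm_eq_abs, abs_neg, abs_mul, abs_div, abs_of_nonneg hy]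

/-- The Fourier integrals of `r - b` over `[0, ∞)` and over all `[0, s]` dominate the second
component of the Jost solution on the real line. -/
lemma RightPotential.exists_pointwise_bound (h : RightPotential κ p r a b) :
    ∃ C K, 0 ≤ C ∧ 0 ≤ K ∧ ∀ x : ℝ, 1 + 2 * |κ| ≤ |x| →
      ‖jostM κ p r a b x 0 1‖ₑ ≤ ENNReal.ofReal (C / |x|) + ‖fint (cutPot r b (Ioi 0)) x‖ₑ +
        ∫⁻ s in Ioi 0, ENNReal.ofReal (K * |p s - a|) * ‖fint (cutPot r b (Ioo 0 s)) x‖ₑ := by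
  obtain ⟨C, hC0, hC⟩ := h.exists_approx
  obtain ⟨K, hK0, hK⟩ := h.exists_bound_large
  set L := tailInt (potWeight p r a b) 0 with hL
  have hL0 : 0 ≤ L := h.tailMajorant_potWeight.tailInt_nonneg 0
  refine ⟨C + |κ| * K * L + C * L, K, by positivity, hK0, fun x hx => ?_⟩
  have hz := ofReal_mem_Ω hx
  have hn : ‖(x : ℂ)‖ = |x| := by rw [norm_real, Real.norm_eq_abs]
  have hzR : 1 + 2 * |κ| ≤ ‖(x : ℂ)‖ := by rwa [hn]
  set m := jostM κ p r a b x with hm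
  have hmc : Continuous m := h.continuous_jostM hz
  have hm0 : Continuous fun y => m y 0 := (continuous_apply 0).comp hmc
  have hm1 : Continuous fun y => m y 1 := (continuous_apply 1).comp hmc
  have hp := h.contDiff_p.continuous
  have hr := h.contDiff_r.continuous
  have hmb : ∀ y, 0 ≤ y → ∀ i, ‖m y i‖ ≤ K := fun y hy i =>
    (norm_le_pi_norm _ _).trans (hK x hz hzR y hy)
  have hWi := h.integrableOn_potWeight 0
  set F : ℝ → ℂ := fun y => ((p y - a : ℝ) : ℂ) * m y 1 with hF
  have hFc : Continuous F := by rw [hF]; fun_prop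
  have hFb : ∀ y, 0 < y → ‖F y‖ ≤ K * |p y - a| := fun y hy =>
    norm_ofReal_mul_le le_rfl (hmb y hy.le 1)
  have hFi : IntegrableOn F (Ioi 0) :=
    Integrable.mono' (hWi.const_mul K) hFc.aestronglyMeasurable
      ((ae_restrict_mem measurableSet_Ioi).mono fun y hy => (hFb y hy).trans
        (mul_le_mul_of_nonneg_left (abs_sub_le_potWeight_left y) hK0))
  set g : ℝ → ℂ := fun y => ((r y - b : ℝ) : ℂ) with hg
  have hgc : Continuous g := by rw [hg]; fun_prop
  have hgW : ∀ y, ‖g y‖ ≤ potWeight p r a b y := fun y => by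
    rw [hg, norm_real, Real.norm_eq_abs]; exact abs_sub_le_potWeight_right y
  have hgi : IntegrableOn g (Ioi 0) :=
    Integrable.mono' hWi hgc.aestronglyMeasurable (.of_forall hgW)
  set ex : ℝ → ℂ := fun y => exp (I * x * y) with hex
  have hexc : Continuous ex := by rw [hex]; fun_prop
  have hexn : ∀ y, ‖ex y‖ = 1 := fun y => norm_exp_I_mul x y
  have hexi : ∀ {u : ℝ → ℂ}, IntegrableOn u (Ioi 0) →
      IntegrableOn (fun y => ex y * u y) (Ioi 0) := fun hu =>
    hu.bdd_mul (c := 1) hexc.aestronglyMeasurable (.of_forall fun y => (hexn y).le)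
  set H : ℝ → ℂ := fun y => ∫ s in Ioi y, F s with hH
  have hgm : IntegrableOn (fun y => g y * m y 0) (Ioi 0) :=
    hgi.mul_bdd (c := K) hm0.aestronglyMeasurable
      ((ae_restrict_mem measurableSet_Ioi).mono fun y hy => hmb y (le_of_lt hy) 0)
  -- replace the exponent `2λ` by `x`
  have step1 : ‖jostTail κ p r a b x 0 - ∫ y in Ioi 0, ex y * (g y * m y 0)‖ ≤
      |κ| * K * L / |x| := by
    have hi1 : IntegrableOn (fun y : ℝ => exp (2 * I * Λ κ x * (y - 0 : ℝ)) *
        (g y * m y 0)) (Ioi 0) :=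
      hgm.bdd_mul (c := 1) (Continuous.aestronglyMeasurable (by fun_prop))
        ((ae_restrict_mem measurableSet_Ioi).mono fun y hy =>
          norm_exp_le_one hz.2.2 (sub_nonneg.2 (le_of_lt hy)))
    rw [jostTail, ← integral_sub hi1 (hexi hgm)]
    refine (norm_setIntegral_le_of_potWeight h (D := |κ| / |x| * K) le_rfl (by positivity)
      fun y hy => ?_).trans (le_of_eq (by ring))
    have h1 := norm_exp_lam_sub_le (κ := κ) (x := x) hy.le
    have h2 : y * ‖g y‖ ≤ potWeight p r a b y := by
      rw [hg, norm_real, Real.norm_eq_abs, potWeight, abs_of_pos hy]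
      nlinarith [abs_nonneg (p y - a), abs_nonneg (r y - b),
        mul_nonneg hy.le (abs_nonneg (p y - a))]
    rw [sub_zero, ← sub_mul, norm_mul, norm_mul]
    calc _ ≤ (|κ| / |x| * y) * (‖g y‖ * K) := by
          gcongr
          exact hmb y hy.le 0
      _ = |κ| / |x| * K * (y * ‖g y‖) := by ring
      _ ≤ _ := by gcongr
  -- replace `m0` by `1 - ∫ F`
  have hFi' : ∀ y, IntegrableOn F (Ioi y) := by
    intro y
    rcases le_total 0 y with hy | hy
    · exact hFi.mono_set (Ioi_subset_Ioi hy)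
    · rw [← Ioc_union_Ioi_eq_Ioi hy]
      exact (hFc.integrableOn_Ioc).union hFi
  have hHc : Continuous H := continuous_iff_continuousAt.2 fun y =>
    (hasDerivAt_integral_Ioi hFc hFi' y).continuousAt
  have hHb : ∀ y, 0 < y → ‖H y‖ ≤ K * L := fun y hy =>
    norm_setIntegral_le_of_potWeight h hy.le hK0 fun s hs =>
      (hFb s (hy.trans hs)).trans (mul_le_mul_of_nonneg_left (abs_sub_le_potWeight_left s) hK0)
  have hgH : IntegrableOn (fun y => g y * H y) (Ioi 0) :=
    hgi.mul_bdd (c := K * L) hHc.aestronglyMeasurable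
      ((ae_restrict_mem measurableSet_Ioi).mono fun y hy => hHb y hy)
  have step2 : ‖(∫ y in Ioi 0, ex y * (g y * m y 0)) -
      ((∫ y in Ioi 0, ex y * g y) - ∫ y in Ioi 0, ex y * (g y * H y))‖ ≤
      C * L / |x| := by
    have hsub : IntegrableOn (fun y => ex y * g y - ex y * (g y * H y)) (Ioi 0) :=
      (hexi hgi).sub (hexi hgH)
    rw [← integral_sub (hexi hgi) (hexi hgH), ← integral_sub (hexi hgm) hsub]
    refine (norm_setIntegral_le_of_potWeight h (D := C / |x|) le_rfl (by positivity)
      fun y hy => ?_).trans (le_of_eq (by ring))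
    have h1 := (hC x hz hzR y hy.le).1
    rw [hn] at h1
    rw [show ex y * (g y * m y 0) - (ex y * g y - ex y * (g y * H y)) =
      ex y * ((m y 0 - 1 + H y) * g y) by ring, norm_mul, hexn, one_mul, norm_mul]
    exact mul_le_mul h1 (hgW y) (norm_nonneg _) (by positivity)
  have hfint : ∀ A : Set ℝ, MeasurableSet A →
      fint (cutPot r b A) x = ∫ y in A, ex y * g y := by
    intro A hA
    rw [fint, ← integral_indicator hA]
    exact integral_congr_ae (.of_forall fun y => by simp [cutPot, indicator, hex, hg])
  -- exchange the order of integration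
  have step3 : ∫ y in Ioi 0, ex y * (g y * H y) =
      ∫ s in Ioi 0, F s * fint (cutPot r b (Ioo 0 s)) x := by
    set μ := (volume : Measure ℝ).restrict (Ioi 0) with hμ
    have hms : MeasurableSet {q : ℝ × ℝ | q.1 < q.2} := measurableSet_lt measurable_fst measurable_snd
    have hprod : Integrable (Function.uncurry fun y s : ℝ =>
        (Ioi y).indicator (fun s => (ex y * g y) * F s) s) (μ.prod μ) := by
      have h1 := (Integrable.mul_prod (hexi hgi) hFi).indicator hms
      exact h1.congr (.of_forall fun q => by simp [Function.uncurry, indicator])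
    have hsw := integral_integral_swap hprod
    have e1 : ∀ y ∈ Ioi (0 : ℝ), ∫ s, (Ioi y).indicator (fun s => (ex y * g y) * F s) s ∂μ =
        ex y * (g y * H y) := by
      intro y hy
      rw [hμ, setIntegral_indicator measurableSet_Ioi, Ioi_inter_Ioi,
        max_eq_right (le_of_lt hy), integral_const_mul]
      ring
    have e2 : ∀ s : ℝ, ∫ y, (Ioi y).indicator (fun s => (ex y * g y) * F s) s ∂μ =
        F s * fint (cutPot r b (Ioo 0 s)) x := by
      intro s
      rw [hfint _ measurableSet_Ioo, ← integral_const_mul]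
      have (y : ℝ) : (Ioi y).indicator (fun s => (ex y * g y) * F s) s =
          (Iio s).indicator (fun y => F s * (ex y * g y)) y := by
        simp [indicator, mul_comm (F s)]
      simp_rw [this]
      rw [hμ, setIntegral_indicator measurableSet_Iio, Ioi_inter_Iio]
    rw [← setIntegral_congr_fun measurableSet_Ioi e1, hsw]
    exact integral_congr_ae (.of_forall e2)
  have hx0 : 0 < |x| := by linarith [abs_nonneg κ]
  have h1 := (hC x hz hzR 0 le_rfl).2
  rw [hn] at h1
  have hdecomp : m 0 1 = ((m 0 1 + jostTail κ p r a b x 0) -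
      (jostTail κ p r a b x 0 - ∫ y in Ioi 0, ex y * (g y * m y 0)) -
      ((∫ y in Ioi 0, ex y * (g y * m y 0)) -
      ((∫ y in Ioi 0, ex y * g y) - ∫ y in Ioi 0, ex y * (g y * H y)))) -
      fint (cutPot r b (Ioi 0)) x +
      ∫ s in Ioi 0, F s * fint (cutPot r b (Ioo 0 s)) x := by
    rw [hfint _ measurableSet_Ioi, ← step3]; ring
  rw [hdecomp]
  refine (enorm_add_le _ _).trans ?_
  refine add_le_add ((enorm_sub_le).trans (add_le_add ?_ le_rfl)) ?_
  · rw [← ofReal_norm]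
    refine ENNReal.ofReal_le_ofReal ?_
    refine (norm_sub_le_of_le (norm_sub_le _ _) le_rfl).trans ?_
    calc _ ≤ C / |x| + |κ| * K * L / |x| + C * L / |x| := by gcongr
      _ = _ := by ring
  · refine (enorm_integral_le_lintegral_enorm _).trans ?_
    refine setLIntegral_mono' measurableSet_Ioi fun s hs => ?_
    rw [enorm_mul]
    gcongr
    rw [← ofReal_norm]
    exact ENNReal.ofReal_le_ofReal (hFb s hs)

lemma RightPotential.measurable_fint_cutPot (h : RightPotential κ p r a b) :
    Measurable fun q : ℝ × ℝ => fint (cutPot r b (Ioo 0 q.2)) q.1 := by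
  have hr := h.contDiff_r.continuous
  have hm : StronglyMeasurable (Function.uncurry fun (q : ℝ × ℝ) (y : ℝ) =>
      exp (I * q.1 * y) * cutPot r b (Ioo 0 q.2) y) := by
    refine Measurable.stronglyMeasurable ?_
    have hs : MeasurableSet {w : (ℝ × ℝ) × ℝ | 0 < w.2 ∧ w.2 < w.1.2} :=
      (measurableSet_lt measurable_const measurable_snd).inter
        (measurableSet_lt measurable_snd (measurable_snd.comp measurable_fst))
    have h1 : Measurable (fun w : (ℝ × ℝ) × ℝ =>
        exp (I * w.1.1 * w.2) * ((r w.2 - b : ℝ) : ℂ)) :=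
      Continuous.measurable (by fun_prop)
    have h2 : (Function.uncurry fun (q : ℝ × ℝ) (y : ℝ) =>
        exp (I * q.1 * y) * cutPot r b (Ioo 0 q.2) y) =
        {w : (ℝ × ℝ) × ℝ | 0 < w.2 ∧ w.2 < w.1.2}.indicator (fun w =>
          exp (I * w.1.1 * w.2) * ((r w.2 - b : ℝ) : ℂ)) := by
      funext w
      simp [Function.uncurry, cutPot, indicator]
    rw [h2]
    exact h1.indicator hs
  exact hm.integral_prod_right.measurable

/-- The second component of the Jost solution is integrable against `dx / |x|` at infinity. -/
lemma RightPotential.lintegral_jostM_lt_top (h : RightPotential κ p r a b) :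
    ∫⁻ x in {x : ℝ | 1 + 2 * |κ| ≤ |x|}, ‖jostM κ p r a b x 0 1‖ₑ * ENNReal.ofReal (1 / |x|) < ⊤ := by
  obtain ⟨C, K, hC0, hK0, hb⟩ := h.exists_pointwise_bound
  obtain ⟨S, hS⟩ := h.exists_cutPot_bound
  obtain ⟨Q, hQ, hQb⟩ := exists_lintegral_fint_div_le S (tailInt (potWeight p r a b) 0)
  have hp := h.contDiff_p.continuous
  set A := {x : ℝ | 1 + 2 * |κ| ≤ |x|} with hA
  have hms : MeasurableSet A := measurableSet_le measurable_const continuous_abs.measurable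
  have hsub : A ⊆ farSet := fun x hx => by
    rw [hA, mem_ofPred_eq] at hx
    change 1 ≤ |x|
    linarith [abs_nonneg κ]
  have hfm : ∀ A : Set ℝ, ∀ x : ℝ, ‖fint (cutPot r b A) x‖ₑ * ENNReal.ofReal (1 / |x|) =
      ENNReal.ofReal (‖fint (cutPot r b A) x‖ / |x|) := by
    intro A x
    rw [← ofReal_norm, ← ENNReal.ofReal_mul (norm_nonneg _), mul_one_div]
  have hjm := h.measurable_fint_cutPot
  set P : ℝ → ENNReal := fun x => ∫⁻ s in Ioi 0, ENNReal.ofReal (K * |p s - a|) *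
    ‖fint (cutPot r b (Ioo 0 s)) x‖ₑ with hP
  calc ∫⁻ x in A, ‖jostM κ p r a b x 0 1‖ₑ * ENNReal.ofReal (1 / |x|)
      ≤ ∫⁻ x in A, (ENNReal.ofReal C * ENNReal.ofReal (1 / x ^ 2) +
          ENNReal.ofReal (‖fint (cutPot r b (Ioi 0)) x‖ / |x|) +
          P x * ENNReal.ofReal (1 / |x|)) := by
        refine setLIntegral_mono' hms fun x hx => ?_
        rw [← hfm, ← ENNReal.ofReal_mul hC0]
        have e : ENNReal.ofReal (C * (1 / x ^ 2)) = ENNReal.ofReal (C / |x|) * ENNReal.ofReal (1 / |x|) := by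
          rw [← ENNReal.ofReal_mul (by positivity), ← sq_abs x]
          congr 1
          ring
        rw [e, ← add_mul, ← add_mul]
        gcongr
        exact hb x hx
    _ ≤ ∫⁻ x in farSet, (ENNReal.ofReal C * ENNReal.ofReal (1 / x ^ 2) +
          ENNReal.ofReal (‖fint (cutPot r b (Ioi 0)) x‖ / |x|) +
          P x * ENNReal.ofReal (1 / |x|)) := lintegral_mono_set hsub
    _ = ENNReal.ofReal C * (∫⁻ x in farSet, ENNReal.ofReal (1 / x ^ 2)) +
          (∫⁻ x in farSet, ENNReal.ofReal (‖fint (cutPot r b (Ioi 0)) x‖ / |x|)) +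
          ∫⁻ x in farSet, P x * ENNReal.ofReal (1 / |x|) := by
        have hm1 : Measurable fun x : ℝ => ENNReal.ofReal (1 / x ^ 2) := by fun_prop
        have hm2 : Measurable fun x : ℝ =>
            ENNReal.ofReal (‖fint (cutPot r b (Ioi 0)) x‖ / |x|) := by
          have := (continuous_fint (h.integrable_cutPot measurableSet_Ioi
            (subset_refl (Ioi (0 : ℝ))))).measurable
          fun_prop
        rw [lintegral_add_left (by fun_prop), lintegral_add_left (by fun_prop),
          lintegral_const_mul _ hm1]
    _ < ⊤ := by
        refine ENNReal.add_lt_top.2 ⟨ENNReal.add_lt_top.2 ⟨?_, ?_⟩, ?_⟩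
        · exact ENNReal.mul_lt_top ENNReal.ofReal_lt_top lintegral_farSet_inv_sq_lt_top
        · exact lt_of_le_of_lt (hQb _ (h.integrable_cutPot measurableSet_Ioi (subset_refl _))
            (hS _ (subset_refl _)) (h.integral_cutPot_le measurableSet_Ioi (subset_refl _))) hQ
        · have hKi : ∫⁻ s in Ioi 0, ENNReal.ofReal (K * |p s - a|) < ⊤ := by
            have hi := ((h.integrableOn_potWeight 0).mono'
              (f := fun s => |p s - a|) (Continuous.aestronglyMeasurable (by fun_prop))
              (.of_forall fun s => by simpa using abs_sub_le_potWeight_left s)).const_mul K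
            exact (hasFiniteIntegral_iff_ofReal (.of_forall fun s => by positivity)).1 hi.2
          calc ∫⁻ x in farSet, P x * ENNReal.ofReal (1 / |x|)
              = ∫⁻ x in farSet, ∫⁻ s in Ioi 0, ENNReal.ofReal (K * |p s - a|) *
                  ENNReal.ofReal (‖fint (cutPot r b (Ioo 0 s)) x‖ / |x|) := by
                refine lintegral_congr fun x => ?_
                rw [hP, ← lintegral_mul_const' _ _ ENNReal.ofReal_ne_top]
                refine lintegral_congr fun s => ?_
                rw [← hfm, mul_assoc]
            _ = ∫⁻ s in Ioi 0, ∫⁻ x in farSet, ENNReal.ofReal (K * |p s - a|) *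
                  ENNReal.ofReal (‖fint (cutPot r b (Ioo 0 s)) x‖ / |x|) := by
                refine lintegral_lintegral_swap (Measurable.aemeasurable ?_)
                have h1 : Measurable fun q : ℝ × ℝ => ENNReal.ofReal (K * |p q.2 - a|) :=
                  Measurable.ennreal_ofReal (Continuous.measurable (by fun_prop))
                have h2 : Measurable fun q : ℝ × ℝ =>
                    ENNReal.ofReal (‖fint (cutPot r b (Ioo 0 q.2)) q.1‖ / |q.1|) :=
                  Measurable.ennreal_ofReal (hjm.norm.div
                    (Continuous.measurable (by fun_prop)))
                exact h1.mul h2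
            _ ≤ ∫⁻ s in Ioi 0, ENNReal.ofReal (K * |p s - a|) * Q := by
                refine lintegral_mono fun s => ?_
                rw [lintegral_const_mul' _ _ ENNReal.ofReal_ne_top]
                gcongr
                have hIoo : Ioo (0 : ℝ) s ⊆ Ioi 0 := fun y hy => hy.1
                exact hQb _ (h.integrable_cutPot measurableSet_Ioo hIoo) (hS _ hIoo)
                  (h.integral_cutPot_le measurableSet_Ioo hIoo)
            _ < ⊤ := by
                rw [lintegral_mul_const' _ _ hQ.ne]
                exact ENNReal.mul_lt_top hKi hQ

end

section

variable {κ a b a' b' : ℝ} {p r : ℝ → ℝ} {z : ℂ}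

/-! ### Symmetries of the Lax system and the transmission coefficient -/

/-- `φ' = [[K, p], [r, -K]] φ`. -/
def LaxODE (K : ℂ) (p r : ℝ → ℝ) (φ : ℝ → Fin 2 → ℂ) : Prop :=
  ∀ x, HasDerivAt (fun y => φ y 0) (K * φ x 0 + p x * φ x 1) x ∧
    HasDerivAt (fun y => φ y 1) (r x * φ x 0 - K * φ x 1) x

/-- Exchange of the two components. -/
def swapVec (v : Fin 2 → ℂ) : Fin 2 → ℂ := ![v 1, v 0]

@[simp] lemma swapVec_zero (v : Fin 2 → ℂ) : swapVec v 0 = v 1 := rfl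
@[simp] lemma swapVec_one (v : Fin 2 → ℂ) : swapVec v 1 = v 0 := rfl
@[simp] lemma swapVec_swapVec (v : Fin 2 → ℂ) : swapVec (swapVec v) = v := by
  ext i; fin_cases i <;> rfl
lemma swapVec_smul (c : ℂ) (v : Fin 2 → ℂ) : swapVec (c • v) = c • swapVec v := by
  ext i; fin_cases i <;> rfl
lemma continuous_swapVec : Continuous swapVec := by
  refine continuous_pi fun i => ?_
  fin_cases i
  · exact continuous_apply 1
  · exact continuous_apply 0

lemma wr_smul_smul (c d : ℂ) (v w : Fin 2 → ℂ) : wr (c • v) (d • w) = c * d * wr v w := by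
  simp only [wr, Pi.smul_apply, smul_eq_mul]; ring

lemma norm_swapVec_le (v : Fin 2 → ℂ) : ‖swapVec v‖ ≤ ‖v‖ :=
  (pi_norm_le_iff_of_nonneg (norm_nonneg _)).2
    (Fin.forall_fin_two.2 ⟨norm_le_pi_norm v 1, norm_le_pi_norm v 0⟩)

@[simp] lemma wr_swapVec (v w : Fin 2 → ℂ) : wr (swapVec v) (swapVec w) = -wr v w := by
  simp [wr]

lemma norm_wr_le (v w : Fin 2 → ℂ) : ‖wr v w‖ ≤ ‖v 1‖ * ‖w‖ + ‖v‖ * ‖w 1‖ := by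
  refine (norm_sub_le _ _).trans ?_
  rw [norm_mul, norm_mul, add_comm]
  gcongr <;> exact norm_le_pi_norm _ _

lemma isLaxSolution_iff {φ : ℝ → Fin 2 → ℂ} :
    IsLaxSolution κ p r z φ ↔ LaxODE (I * unifK κ z) p r φ := Iff.rfl

lemma LaxODE.smul {K : ℂ} {φ : ℝ → Fin 2 → ℂ} (h : LaxODE K p r φ) (c : ℂ) :
    LaxODE K p r fun x => c • φ x := by
  intro x
  refine ⟨((h x).1.const_mul c).congr_deriv ?_, ((h x).2.const_mul c).congr_deriv ?_⟩ <;>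
    · simp only [Pi.smul_apply, smul_eq_mul]; ring

lemma LaxODE.swap {K : ℂ} {φ : ℝ → Fin 2 → ℂ} (h : LaxODE K p r φ) :
    LaxODE (-K) r p fun x => swapVec (φ x) := by
  intro x
  refine ⟨(h x).2.congr_deriv ?_, (h x).1.congr_deriv ?_⟩ <;>
    · simp only [swapVec_zero, swapVec_one]; ring

lemma LaxODE.reflect {K : ℂ} {φ : ℝ → Fin 2 → ℂ} (h : LaxODE K p r φ) :
    LaxODE (-K) (fun x => -p (-x)) (fun x => -r (-x)) fun x => φ (-x) := by
  intro x
  have h0 := (h (-x)).1.scomp x (hasDerivAt_neg x)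
  have h1 := (h (-x)).2.scomp x (hasDerivAt_neg x)
  refine ⟨h0.congr_deriv ?_, h1.congr_deriv ?_⟩ <;>
    · simp only [neg_smul, one_smul]; push_cast; ring

@[simp] lemma exp_smul_exp_neg_smul (c : ℂ) (v : Fin 2 → ℂ) : exp c • exp (-c) • v = v := by
  rw [smul_smul, ← exp_add, add_neg_cancel, exp_zero, one_smul]

@[simp] lemma exp_neg_smul_exp_smul (c : ℂ) (v : Fin 2 → ℂ) : exp (-c) • exp c • v = v := by
  simpa using exp_smul_exp_neg_smul (-c) v

lemma LaxODE.exp_smul_iff {K c : ℂ} {φ : ℝ → Fin 2 → ℂ} :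
    LaxODE K p r (fun x => exp c • φ x) ↔ LaxODE K p r φ :=
  ⟨fun h => by simpa using h.smul (exp (-c)), fun h => h.smul _⟩

lemma LaxODE.swap_iff {K : ℂ} {φ : ℝ → Fin 2 → ℂ} :
    LaxODE (-K) r p (fun x => swapVec (φ x)) ↔ LaxODE K p r φ :=
  ⟨fun h => by simpa using h.swap, .swap⟩

lemma LaxODE.reflect_iff {K : ℂ} {φ : ℝ → Fin 2 → ℂ} :
    LaxODE (-K) (fun x => -p (-x)) (fun x => -r (-x)) (fun x => φ (-x)) ↔ LaxODE K p r φ :=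
  ⟨fun h => by simpa using h.reflect, .reflect⟩

lemma tendsto_swapVec_iff {l : Filter ℝ} {φ : ℝ → Fin 2 → ℂ} {v : Fin 2 → ℂ} :
    Tendsto (fun x => swapVec (φ x)) l (𝓝 (swapVec v)) ↔ Tendsto φ l (𝓝 v) := by
  simp only [tendsto_pi_nhds, Fin.forall_fin_two, swapVec_zero, swapVec_one, and_comm]

lemma LaxODE.conj {K : ℂ} {φ : ℝ → Fin 2 → ℂ} (h : LaxODE K p r φ) :
    LaxODE (conj K) p r fun x i => conj (φ x i) := by
  intro x
  have hc : ∀ {f : ℝ → ℂ} {f' : ℂ}, HasDerivAt f f' x →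
      HasDerivAt (fun y => conj (f y)) (conj f') x := fun hf =>
    (conjCLE.toContinuousLinearMap.hasFDerivAt.comp_hasDerivAt x hf)
  refine ⟨(hc (h x).1).congr_deriv ?_, (hc (h x).2).congr_deriv ?_⟩ <;> simp

lemma unifK_neg (z : ℂ) : unifK κ (-z) = -unifK κ z := by unfold unifK; rw [div_neg]; ring
lemma Λ_neg (z : ℂ) : Λ κ (-z) = -Λ κ z := by unfold Λ; rw [div_neg]; ring
lemma unifK_hat (hκ : κ ≠ 0) (hz : z ≠ 0) : unifK κ (κ / z) = unifK κ z := by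
  have : (κ : ℂ) ≠ 0 := by exact_mod_cast hκ
  unfold unifK; field_simp; ring
lemma Λ_hat (hκ : κ ≠ 0) (hz : z ≠ 0) : Λ κ (κ / z) = -Λ κ z := by
  have : (κ : ℂ) ≠ 0 := by exact_mod_cast hκ
  unfold Λ; field_simp; ring
lemma unifK_conj (z : ℂ) :
    unifK κ (-conj z) = -conj (unifK κ z) := by
  unfold unifK; simp only [map_div₀, map_add, conj_ofReal, map_ofNat, div_neg]; ring
lemma Λ_conj (z : ℂ) :
    Λ κ (-conj z) = -conj (Λ κ z) := by
  unfold Λ; simp only [map_div₀, map_sub, conj_ofReal, map_ofNat, div_neg]; ring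

lemma RightPotential.swap (h : RightPotential κ p r a b) : RightPotential κ r p b a :=
  ⟨h.contDiff_r, h.contDiff_p, by rw [mul_comm]; exact h.mul_eq, h.integrable_r, h.integrable_p,
    h.tendsto_r, h.tendsto_p⟩

lemma conj_mem_Ω (hz : z ∈ Ω κ) : -conj z ∈ Ω κ := by
  refine ⟨by simpa using hz.1, ?_, ?_⟩
  · rw [Λ_conj]; simpa using hz.2.1
  · rw [Λ_conj]; simpa using hz.2.2

/-- Two Jost solutions agree as soon as both are characterised by the same normalisation. -/
lemma RightPotential.jostM_zero_eq (h : RightPotential κ p r a b) (hz : z ∈ Ω κ)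
    {φ : ℝ → Fin 2 → ℂ} (hφ : IsRightJost κ p r b z φ) : φ 0 = jostM κ p r a b z 0 := by
  have := IsRightJost.unique h.contDiff_p.continuous h.contDiff_r.continuous hz.2.2 hφ
    (h.isRightJost hz)
  rw [this]; simp

/-- Reality of the potential: `z ↦ -z^*` acts on the Jost solution by complex conjugation. -/
lemma RightPotential.jostM_conj (h : RightPotential κ p r a b) (hz : z ∈ Ω κ) :
    jostM κ p r a b (-conj z) 0 = fun i => conj (jostM κ p r a b z 0 i) := by
  have h1 := h.isRightJost hz
  have h2 : IsRightJost κ p r b (-conj z) fun x i => conj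
      ((exp (I * Λ κ z * x) • jostM κ p r a b z x) i) := by
    constructor
    · have := h1.1
      rw [isLaxSolution_iff] at this ⊢
      have := this.conj
      rw [unifK_conj]
      convert this using 1
      simp
    · have hc : Continuous fun v : Fin 2 → ℂ => fun i => conj (v i) := by
        refine continuous_pi fun i => continuous_conj.comp (continuous_apply i)
      have h3 := (hc.tendsto _).comp h1.2
      have e : (fun i => conj (jostLimit b z i)) =
          jostLimit b (-conj z) := by
        ext i; fin_cases i <;> simp [jostLimit, div_neg, neg_div]
      rw [e] at h3
      refine h3.congr fun x => ?_
      ext i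
      simp only [Function.comp_apply, Pi.smul_apply, smul_eq_mul, map_mul, ← exp_conj]
      rw [Λ_conj]
      simp
  have h3 := h.jostM_zero_eq (conj_mem_Ω hz) h2
  rw [← h3]
  simp

/-- The involution `z ↦ κ / z` exchanges the two sheets of `λ`. -/
lemma RightPotential.jostM_hat (hκ : κ ≠ 0) (h : RightPotential κ p r a b) (hz0 : z ≠ 0)
    (hz : -z ∈ Ω κ) :
    jostM κ p r a b (κ / z) 0 = (-(I * z / a)) • swapVec (jostM κ r p b a (-z) 0) := by
  have hκ' : (κ : ℂ) ≠ 0 := by exact_mod_cast hκ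
  have ha : (a : ℂ) ≠ 0 := by
    have := h.mul_eq
    intro ha
    have : a = 0 := by exact_mod_cast ha
    simp_all
  have hb : (b : ℂ) ≠ 0 := by
    have := h.mul_eq
    intro ha
    have : b = 0 := by exact_mod_cast ha
    simp_all
  have hlam : Λ κ (κ / z) = Λ κ (-z) := by rw [Λ_hat hκ hz0, Λ_neg]
  have hdom : (κ : ℂ) / z ∈ Ω κ := by
    refine ⟨div_ne_zero hκ' hz0, ?_, ?_⟩ <;> rw [hlam]
    exacts [hz.2.1, hz.2.2]
  have h1 := h.swap.isRightJost hz
  have h2 : IsRightJost κ p r b (κ / z) fun x => (-(I * z / a)) • swapVec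
      (exp (I * Λ κ (-z) * x) • jostM κ r p b a (-z) x) := by
    constructor
    · have h3 := (isLaxSolution_iff.1 h1.1).swap.smul (-(I * z / a))
      rw [isLaxSolution_iff, unifK_hat hκ hz0]
      rw [unifK_neg] at h3
      convert h3 using 1
      ring
    · have h3 := ((continuous_swapVec.tendsto _).comp h1.2).const_smul (-(I * z / a))
      have e : (-(I * z / a)) • swapVec (jostLimit a (-z)) = jostLimit b (κ / z) := by
        have hab : (a : ℂ) * b = κ := by exact_mod_cast h.mul_eq
        have hI := I_mul_I
        ext i; fin_cases i
        · simp [jostLimit, swapVec]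
          field_simp
          linear_combination -hI
        · simp [jostLimit, swapVec]
          rw [← hab]
          field_simp
      rw [e] at h3
      refine h3.congr fun x => ?_
      rw [hlam, Function.comp_apply, swapVec_smul, smul_comm]
  have h3 := h.jostM_zero_eq hdom h2
  rw [← h3]
  simp

/-- The Wronskian of the two columns of the fundamental Jost matrix, for real `λ`. -/
lemma RightPotential.wr_jostM (h : RightPotential κ p r a b) (hz : z ∈ Ω κ)
    (hz' : -z ∈ Ω κ) :
    wr (jostM κ p r a b z 0) (swapVec (jostM κ r p b a (-z) 0)) = 1 - κ / z ^ 2 := by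
  have h1 := h.isRightJost hz
  have h2 := h.swap.isRightJost hz'
  have h3 := (isLaxSolution_iff.1 h2.1).swap
  rw [unifK_neg, mul_neg, neg_neg, ← isLaxSolution_iff] at h3
  have hval : ∀ x : ℝ, wr (exp (I * Λ κ z * x) • jostM κ p r a b z x)
      (swapVec (exp (I * Λ κ (-z) * x) • jostM κ r p b a (-z) x)) =
      wr (jostM κ p r a b z x) (swapVec (jostM κ r p b a (-z) x)) := by
    intro x
    rw [swapVec_smul, wr_smul_smul, ← exp_add, Λ_neg]
    simp [wr]
  have hc : ∀ x, wr (jostM κ p r a b z x) (swapVec (jostM κ r p b a (-z) x)) =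
      wr (jostM κ p r a b z 0) (swapVec (jostM κ r p b a (-z) 0)) := fun x => by
    rw [← hval, ← hval]; exact wr_const h1.1 h3 x 0
  have l1 := tendsto_pi_nhds.1 (h.tendsto_jostM hz)
  have l2 := tendsto_pi_nhds.1 (h.swap.tendsto_jostM hz')
  have hlim := ((l1 0).mul (l2 0)).sub ((l1 1).mul (l2 1))
  have e : jostLimit b z 0 * jostLimit a (-z) 0 - jostLimit b z 1 * jostLimit a (-z) 1 =
      1 - κ / z ^ 2 := by
    have hab : (a : ℂ) * b = κ := by exact_mod_cast h.mul_eq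
    have hI := I_mul_I
    have := hz.1
    simp [jostLimit]
    rw [← hab]
    field_simp
    linear_combination (-(a * b : ℂ)) * hI
  rw [e] at hlim
  exact tendsto_nhds_unique (tendsto_const_nhds.congr fun x => (hc x).symm) hlim

/-- A pair of potentials with limits `a`, `b` at `+∞` and `a'`, `b'` at `-∞`. -/
structure LinePotential (κ : ℝ) (p r : ℝ → ℝ) (a b a' b' : ℝ) : Prop where
  right : RightPotential κ p r a b
  left : RightPotential κ (fun x => -r (-x)) (fun x => -p (-x)) (-b') (-a')

lemma LinePotential.swap (h : LinePotential κ p r a b a' b') : LinePotential κ r p b a b' a' :=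
  ⟨h.right.swap, h.left.swap⟩

/-- The numerator of the coefficient `s₁₁` of the system with potentials `p`, `r`. -/
def transNum (κ : ℝ) (p r : ℝ → ℝ) (a b a' b' : ℝ) (z : ℂ) : ℂ :=
  wr (jostM κ p r a b z 0)
    (swapVec (jostM κ (fun x => -r (-x)) (fun x => -p (-x)) (-b') (-a') z 0))

/-- The coefficient `s₁₁` of the system with potentials `p`, `r`. -/
def transCoef (κ : ℝ) (p r : ℝ → ℝ) (a b a' b' : ℝ) (z : ℂ) : ℂ :=
  transNum κ p r a b a' b' z / (1 - κ / z ^ 2)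

lemma one_sub_div_sq (hz : z ≠ 0) : 1 - (κ : ℂ) / z ^ 2 = 2 * Λ κ z / z := by
  unfold Λ; field_simp

lemma one_sub_div_sq_ne (hz : z ≠ 0) (hl : Λ κ z ≠ 0) : 1 - (κ : ℂ) / z ^ 2 ≠ 0 := by
  rw [one_sub_div_sq hz]; exact div_ne_zero (mul_ne_zero two_ne_zero hl) hz

lemma differentiableAt_one_sub (hz : z ≠ 0) :
    DifferentiableAt ℂ (fun z : ℂ => 1 - (κ : ℂ) / z ^ 2) z :=
  (differentiableAt_const _).sub ((differentiableAt_const _).div (differentiableAt_id.pow 2)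
    (pow_ne_zero 2 hz))

lemma LinePotential.continuousOn_transCoef (h : LinePotential κ p r a b a' b') :
    ContinuousOn (transCoef κ p r a b a' b') (Ω κ) := by
  have h1 := continuousOn_pi.1 h.right.continuousOn_jostM
  have h2 := continuousOn_pi.1 h.left.continuousOn_jostM
  refine ContinuousOn.div (((h1 0).mul (h2 0)).sub ((h1 1).mul (h2 1))) ?_ ?_
  · exact fun z hz => (differentiableAt_one_sub hz.1).continuousAt.continuousWithinAt
  · exact fun z hz => one_sub_div_sq_ne hz.1 hz.2.1

lemma LinePotential.differentiableOn_transCoef (h : LinePotential κ p r a b a' b') :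
    DifferentiableOn ℂ (transCoef κ p r a b a' b') (upperDomain κ) := by
  have h1 := differentiableOn_pi.1 h.right.differentiableOn_jostM
  have h2 := differentiableOn_pi.1 h.left.differentiableOn_jostM
  refine DifferentiableOn.div (((h1 0).mul (h2 0)).sub ((h1 1).mul (h2 1))) ?_ ?_
  · exact fun z hz => (differentiableAt_one_sub hz.1).differentiableWithinAt
  · exact fun z hz => one_sub_div_sq_ne hz.1 fun h0 => by have := hz.2; simp [h0] at this

lemma tendsto_one_sub_div_sq :
    Tendsto (fun z : ℂ => 1 - (κ : ℂ) / z ^ 2) (cocompact ℂ) (𝓝 1) := by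
  have h := tendsto_inv₀_cobounded (α := ℂ)
  rw [Metric.cobounded_eq_cocompact] at h
  simpa [div_eq_mul_inv] using ((h.pow 2).const_mul (κ : ℂ)).const_sub 1

lemma LinePotential.tendsto_transCoef (h : LinePotential κ p r a b a' b') :
    Tendsto (transCoef κ p r a b a' b') (cocompact ℂ ⊓ 𝓟 (Ω κ)) (𝓝 1) := by
  have h1 := tendsto_pi_nhds.1 h.right.tendsto_jostM_infty
  have h2 := tendsto_pi_nhds.1 h.left.tendsto_jostM_infty
  have h3 := (((h1 0).mul (h2 0)).sub ((h1 1).mul (h2 1))).div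
    (tendsto_one_sub_div_sq (κ := κ).mono_left inf_le_left) one_ne_zero
  simp only [Matrix.cons_val_zero, Matrix.cons_val_one, mul_one, mul_zero, sub_zero, div_one] at h3
  exact h3

lemma LinePotential.exists_bound_transNum (h : LinePotential κ p r a b a' b') {R : ℝ}
    (hR : 0 ≤ R) : ∃ C, ∀ z ∈ Ω κ ∩ annulus R, ‖transNum κ p r a b a' b' z‖ ≤ C := by
  obtain ⟨C, hC⟩ := h.right.exists_bound_annulus hR
  obtain ⟨D, hD⟩ := h.left.exists_bound_annulus hR
  refine ⟨C * D + C * D, fun z hz => (norm_wr_le _ _).trans ?_⟩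
  have h1 := hC z hz
  have h2 := hD z hz
  have h0 := (norm_nonneg _).trans h1
  gcongr
  exacts [(norm_le_pi_norm _ _).trans h1, (norm_swapVec_le _).trans h2,
    ((norm_le_pi_norm _ _).trans (norm_swapVec_le _)).trans h2]

lemma LinePotential.transCoef_conj (h : LinePotential κ p r a b a' b') (hz : z ∈ Ω κ) :
    transCoef κ p r a b a' b' (-conj z) =
      conj (transCoef κ p r a b a' b' z) := by
  rw [transCoef, transCoef, transNum, transNum, h.right.jostM_conj hz, h.left.jostM_conj hz]
  simp [wr]

lemma LinePotential.transCoef_hat (hκ : κ ≠ 0) (h : LinePotential κ p r a b a' b') (hz0 : z ≠ 0)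
    (hz : -z ∈ Ω κ) :
    transCoef κ p r a b a' b' (κ / z) = b / b' * transCoef κ r p b a b' a' (-z) := by
  have hκ' : (κ : ℂ) ≠ 0 := by exact_mod_cast hκ
  have hab : (a : ℂ) * b = κ := by exact_mod_cast h.right.mul_eq
  have ha : (a : ℂ) ≠ 0 := fun h0 => hκ' (by rw [← hab, h0, zero_mul])
  have hab' : -(b' : ℂ) * -a' = κ := by exact_mod_cast h.left.mul_eq
  have hb' : (b' : ℂ) ≠ 0 := fun h0 => hκ' (by rw [← hab', h0]; ring)
  have hl : Λ κ (-z) ≠ 0 := hz.2.1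
  have hd := one_sub_div_sq_ne (κ := κ) (neg_ne_zero.2 hz0) hl
  rw [transCoef, transCoef, transNum, transNum, h.right.jostM_hat hκ hz0 hz,
    h.left.jostM_hat hκ hz0 hz]
  rw [neg_sq] at hd ⊢
  simp only [wr, Pi.smul_apply, smul_eq_mul, swapVec_zero, swapVec_one]
  generalize jostM κ r p b a (-z) 0 = u
  generalize jostM κ (fun x => -p (-x)) (fun x => -r (-x)) (-a') (-b') (-z) 0 = v
  have e : 1 - (κ : ℂ) / (κ / z) ^ 2 = -(z ^ 2 / κ) * (1 - κ / z ^ 2) := by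
    field_simp; ring
  have hI := I_mul_I
  rw [e]
  push_cast
  generalize hd' : 1 - (κ : ℂ) / z ^ 2 = d at *
  rw [← hab] at *
  field_simp
  linear_combination ((u 1 * v 1 - u 0 * v 0) * b) * hI

end

section

/-! ### The scattering data in terms of the normalised Jost solutions -/

variable {σ δ q0 qm t : ℝ} {q : ℝ → ℝ → ℝ} {z : ℂ} {κ : ℝ} {p r : ℝ → ℝ} {a b a' b' : ℝ}

/-- The lower left entry `σ q(-x,-t)` of the Lax matrix. -/
def mirrorPot (σ : ℝ) (q : ℝ → ℝ → ℝ) (t x : ℝ) : ℝ := σ * q (-x) (-t)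

local notation "κ₀" => δ * σ * q0 ^ 2
local notation "R₁" => jostM κ₀ (fun x => q x t) (mirrorPot σ q t) (δ * qm) (σ * qm)
local notation "R₂" => jostM κ₀ (mirrorPot σ q t) (fun x => q x t) (σ * qm) (δ * qm)
local notation "L₁" => jostM κ₀ (fun x => -mirrorPot σ q t (-x)) (fun x => -q (-x) t) (-(σ * δ * qm)) (-qm)
local notation "L₂" => jostM κ₀ (fun x => -q (-x) t) (fun x => -mirrorPot σ q t (-x)) (-qm) (-(σ * δ * qm))

lemma lax_iff {φ : ℝ → Fin 2 → ℂ} :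
    (∀ x i, HasDerivAt (fun y => φ y i) ((laxX σ δ q0 q x t z).mulVec (φ x) i) x) ↔
      LaxODE (I * unifK (δ * σ * q0 ^ 2) z) (fun x => q x t) (mirrorPot σ q t) φ := by
  have e : ∀ x : ℝ, (laxX σ δ q0 q x t z).mulVec (φ x) 0 =
      I * unifK (δ * σ * q0 ^ 2) z * φ x 0 + (q x t : ℂ) * φ x 1 := fun x => by
    simp [laxX, Matrix.mulVec, dotProduct, Fin.sum_univ_two, kz, unifK]
  have e' : ∀ x : ℝ, (laxX σ δ q0 q x t z).mulVec (φ x) 1 =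
      (mirrorPot σ q t x : ℂ) * φ x 0 - I * unifK (δ * σ * q0 ^ 2) z * φ x 1 := fun x => by
    simp [laxX, Matrix.mulVec, dotProduct, Fin.sum_univ_two, kz, unifK, mirrorPot, sub_eq_add_neg]
  constructor
  · intro h x
    refine ⟨?_, ?_⟩
    · rw [← e]; exact h x 0
    · rw [← e']; exact h x 1
  · intro h x i
    fin_cases i
    · have := (h x).1; rw [← e] at this; exact this
    · have := (h x).2; rw [← e'] at this; exact this

/-- The part of the phase `θ` that does not depend on `x`. -/
def timePhase (σ δ q0 t : ℝ) (z : ℂ) : ℂ :=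
  lam σ δ q0 z * ((4 * kz σ δ q0 z ^ 2 + (2 * σ * δ * q0 ^ 2 : ℝ)) * t)

/-- The boundary data of the nonlocal equation give a pair of potentials on the line. -/
lemma linePotential (hσ : σ = 1 ∨ σ = -1) (hδ : δ = 1 ∨ δ = -1) (hsol : IsSolution σ q)
    (hbc : HasNZBC δ q0 qm q) (t : ℝ) :
    LinePotential (δ * σ * q0 ^ 2) (fun x => q x t) (mirrorPot σ q t) (δ * qm) (σ * qm) qm
      (σ * δ * qm) := by
  have hσ2 : σ * σ = 1 := by rcases hσ with rfl | rfl <;> norm_num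
  have hδ2 : δ * δ = 1 := by rcases hδ with rfl | rfl <;> norm_num
  have hq2 : qm ^ 2 = q0 ^ 2 := by rw [← hbc.abs_eq, sq_abs]
  have c1 : ∀ t, ContDiff ℝ 1 (fun x => q x t) := fun t =>
    (hsol.contDiff_space t).of_le (by norm_num)
  have c2 : ContDiff ℝ 1 (mirrorPot σ q t) := contDiff_const.mul ((c1 (-t)).comp contDiff_neg)
  have flipR : ∀ {f : ℝ → ℝ}, IntegrableOn f (Iio 0) →
      IntegrableOn (fun x => f (-x)) (Ioi 0) := fun {f} hf => by
    have := (Measure.measurePreserving_neg (volume : Measure ℝ)).integrableOn_comp_preimage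
      (Homeomorph.neg ℝ).measurableEmbedding (f := f) (s := Iio 0)
    have h2 := this.2 hf
    have e : (Neg.neg : ℝ → ℝ) ⁻¹' Iio 0 = Ioi 0 := by ext x; simp
    rw [e] at h2
    exact h2
  refine ⟨⟨c1 t, c2, ?_, hbc.decay_right t, ?_, hbc.tendsto_atTop t, ?_⟩,
    ⟨?_, ?_, ?_, ?_, ?_, ?_, ?_⟩⟩
  · rw [← hq2]; ring
  · have h := (flipR (hbc.decay_left (-t))).const_mul σ
    refine h.congr (.of_forall fun x => ?_)
    simp only [abs_neg, mirrorPot]; ring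
  · exact ((hbc.tendsto_atBot (-t)).comp tendsto_neg_atTop_atBot).const_mul σ
  · exact (c2.comp contDiff_neg).neg
  · exact ((c1 t).comp contDiff_neg).neg
  · rw [← hq2]; ring
  · have h := (hbc.decay_right (-t)).const_mul (-σ)
    refine h.congr (.of_forall fun x => ?_)
    simp only [mirrorPot, neg_neg]; ring
  · have h := (flipR (hbc.decay_left t)).const_mul (-1)
    refine h.congr (.of_forall fun x => ?_)
    simp only [abs_neg]; ring
  · have h := ((hbc.tendsto_atTop (-t)).const_mul σ).neg
    simp only [mirrorPot, neg_neg]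
    rwa [← mul_assoc] at h
  · exact ((hbc.tendsto_atBot t).comp tendsto_neg_atTop_atBot).neg

/-- The potentials of the nonlocal equation at time `t` form a pair of potentials on the line. -/
abbrev IsLinePotential (σ δ q0 qm : ℝ) (q : ℝ → ℝ → ℝ) (t : ℝ) : Prop :=
  LinePotential (δ * σ * q0 ^ 2) (fun x => q x t) (mirrorPot σ q t) (δ * qm) (σ * qm) qm
    (σ * δ * qm)

lemma exp_theta_smul (j : Fin 2) (x : ℝ) (v : Fin 2 → ℂ) :
    exp (-(pauli3 j * I * theta σ δ q0 x t z)) • v =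
      exp (-(pauli3 j * I * (Λ κ₀ z * x))) • exp (-(pauli3 j * (I * timePhase σ δ q0 t z))) • v := by
  rw [smul_smul, ← exp_add, theta, timePhase, lam, Λ]
  ring_nf

/-- If an invertible transformation `T` identifies the Jost columns with the right Jost solutions
of a system, then it maps the selected Jost column to the normalised right Jost solution. -/
lemma RightPotential.apply_jostColumn {l : Filter ℝ} {c : ℝ} {j : Fin 2} {w : ℂ}
    (h : RightPotential κ p r a b) (hw : w ∈ Ω κ) (T T' : (ℝ → Fin 2 → ℂ) → ℝ → Fin 2 → ℂ)
    (hT : ∀ φ, IsJostColumn σ δ q0 q t z l c j φ ↔ IsRightJost κ p r b w (T φ))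
    (hTT : ∀ φ, T (T' φ) = φ) :
    T (jostColumn σ δ q0 q t z l c j) 0 = jostM κ p r a b w 0 :=
  h.jostM_zero_eq hw ((hT _).1 (Classical.epsilon_spec
    (p := IsJostColumn σ δ q0 q t z l c j) ⟨_, (hT (T' _)).2 (by
      rw [hTT]; exact h.isRightJost hw)⟩))

lemma jostPlus_first (hδ : δ = 1 ∨ δ = -1) (h : IsLinePotential σ δ q0 qm q t) (hz : z ∈ Ω κ₀) :
    jostPlus σ δ q0 qm q t z 0 0 = exp (I * timePhase σ δ q0 t z) • R₁ z 0 := by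
  rw [← h.right.apply_jostColumn hz (fun φ x => exp (-(I * timePhase σ δ q0 t z)) • φ x)
    (fun φ x => exp (I * timePhase σ δ q0 t z) • φ x) (fun φ => ?_) fun φ => by simp]
  · exact (exp_smul_exp_neg_smul _ _).symm
  have hbg : (fun i => bgE σ δ (δ * qm) z i 0) = jostLimit (σ * qm) z := by
    ext i; fin_cases i
    · simp [bgE, jostLimit]
    · rcases hδ with rfl | rfl <;> simp [bgE, jostLimit] <;> ring
  rw [IsJostColumn, IsRightJost, lax_iff, isLaxSolution_iff, LaxODE.exp_smul_iff, hbg]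
  simp only [exp_theta_smul]
  simp [pauli3, mul_assoc]

lemma jostMinus_second (h : IsLinePotential σ δ q0 qm q t) (hz : z ∈ Ω κ₀) :
    jostMinus σ δ q0 qm q t z 1 0 = exp (-(I * timePhase σ δ q0 t z)) • swapVec (L₁ z 0) := by
  rw [← h.left.apply_jostColumn hz
    (fun φ x => swapVec (exp (I * timePhase σ δ q0 t z) • φ (-x)))
    (fun φ x => exp (-(I * timePhase σ δ q0 t z)) • swapVec (φ (-x))) (fun φ => ?_)
    fun φ => by simp]
  · simp [jostMinus]; rfl
  have hbg : (fun i => bgE σ δ qm z i 1) = swapVec (jostLimit (-qm) z) := by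
    ext i; fin_cases i <;> simp [bgE, jostLimit]; ring
  have hode := (LaxODE.swap_iff (p := fun x => -q (-x) t) (r := fun x => -mirrorPot σ q t (-x))
    (K := -(I * unifK κ₀ z)) (φ := fun x => exp (I * timePhase σ δ q0 t z) • φ (-x)))
  rw [neg_neg] at hode
  rw [IsJostColumn, IsRightJost, lax_iff, isLaxSolution_iff, hode, LaxODE.exp_smul_iff,
    LaxODE.reflect_iff (p := fun x => q x t), hbg, ← map_neg_atTop, tendsto_map'_iff,
    ← tendsto_swapVec_iff]
  simp only [exp_theta_smul, Function.comp_def]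
  simp [pauli3, mul_assoc, swapVec_smul]

lemma jostPlus_second (h : IsLinePotential σ δ q0 qm q t) (hz : -z ∈ Ω κ₀) :
    jostPlus σ δ q0 qm q t z 1 0 = exp (-(I * timePhase σ δ q0 t z)) • swapVec (R₂ (-z) 0) := by
  rw [← h.right.swap.apply_jostColumn hz
    (fun φ x => swapVec (exp (I * timePhase σ δ q0 t z) • φ x))
    (fun φ x => exp (-(I * timePhase σ δ q0 t z)) • swapVec (φ x)) (fun φ => ?_) fun φ => by simp]
  · simp [jostPlus]; rfl
  have hbg : (fun i => bgE σ δ (δ * qm) z i 1) = swapVec (jostLimit (δ * qm) (-z)) := by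
    ext i; fin_cases i <;> simp [bgE, jostLimit, div_neg]
  rw [IsJostColumn, IsRightJost, lax_iff, isLaxSolution_iff, unifK_neg, Λ_neg, mul_neg,
    LaxODE.swap_iff, LaxODE.exp_smul_iff, hbg, ← tendsto_swapVec_iff]
  simp only [exp_theta_smul]
  simp [pauli3, mul_assoc, swapVec_smul]

lemma jostMinus_first (h : IsLinePotential σ δ q0 qm q t) (hz : -z ∈ Ω κ₀) :
    jostMinus σ δ q0 qm q t z 0 0 = exp (I * timePhase σ δ q0 t z) • L₂ (-z) 0 := by
  rw [← h.left.swap.apply_jostColumn hz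
    (fun φ x => exp (-(I * timePhase σ δ q0 t z)) • φ (-x))
    (fun φ x => exp (I * timePhase σ δ q0 t z) • φ (-x)) (fun φ => ?_) fun φ => by simp]
  · simp [jostMinus]; rfl
  have hbg : (fun i => bgE σ δ qm z i 0) = jostLimit (-(σ * δ * qm)) (-z) := by
    ext i; fin_cases i <;> simp [bgE, jostLimit, div_neg]; ring
  rw [IsJostColumn, IsRightJost, lax_iff, isLaxSolution_iff, unifK_neg, Λ_neg, mul_neg,
    LaxODE.exp_smul_iff, LaxODE.reflect_iff (p := fun x => q x t), hbg, ← map_neg_atTop,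
    tendsto_map'_iff]
  simp only [exp_theta_smul, Function.comp_def]
  simp [pauli3, mul_assoc]

lemma detE_eq : detE σ δ q0 z = 1 - ((κ₀ : ℝ) : ℂ) / z ^ 2 := rfl

lemma s11_eq (hδ : δ = 1 ∨ δ = -1) (h : IsLinePotential σ δ q0 qm q t) (hz : z ∈ Ω κ₀) :
    s11 σ δ q0 qm q t z = transCoef κ₀ (fun x => q x t) (mirrorPot σ q t)
      (δ * qm) (σ * qm) qm (σ * δ * qm) z := by
  rw [s11, jostPlus_first hδ h hz, jostMinus_second h hz, wr_smul_smul, ← exp_add,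
    add_neg_cancel, exp_zero, one_mul, detE, transCoef, transNum]

lemma s22_eq (h : IsLinePotential σ δ q0 qm q t) (hz : -z ∈ Ω κ₀) :
    s22 σ δ q0 qm q t z = transCoef κ₀ (mirrorPot σ q t) (fun x => q x t)
      (σ * qm) (δ * qm) (σ * δ * qm) qm (-z) := by
  rw [s22, jostPlus_second h hz, jostMinus_first h hz, wr_smul_smul, ← exp_add,
    add_neg_cancel, exp_zero, one_mul, detE, transCoef, transNum, neg_sq]
  congr 1
  simp only [wr, swapVec_zero, swapVec_one]; ring

/-- `det S = 1`. -/
lemma one_add_s12_mul_s21 (hδ : δ = 1 ∨ δ = -1) (h : IsLinePotential σ δ q0 qm q t)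
    (hz : z ∈ Ω κ₀) (hz' : -z ∈ Ω κ₀) :
    1 + s12 σ δ q0 qm q t z * s21 σ δ q0 qm q t z =
      s11 σ δ q0 qm q t z * s22 σ δ q0 qm q t z := by
  have hd := one_sub_div_sq_ne hz.1 hz.2.1
  rw [← detE_eq] at hd
  have h1 : wr (jostPlus σ δ q0 qm q t z 0 0) (jostPlus σ δ q0 qm q t z 1 0) = detE σ δ q0 z := by
    rw [jostPlus_first hδ h hz, jostPlus_second h hz', wr_smul_smul, ← exp_add,
      add_neg_cancel, exp_zero, one_mul, h.right.wr_jostM hz hz', detE_eq]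
  have h2 : wr (jostMinus σ δ q0 qm q t z 0 0) (jostMinus σ δ q0 qm q t z 1 0) =
      detE σ δ q0 z := by
    rw [jostMinus_first h hz', jostMinus_second h hz, wr_smul_smul, ← exp_add,
      add_neg_cancel, exp_zero, one_mul, detE_eq, ← h.left.wr_jostM hz hz']
    simp only [wr, swapVec_zero, swapVec_one]; ring
  rw [s11, s12, s21, s22]
  field_simp
  rw [sq]
  nth_rewrite 1 [← h1]
  rw [← h2]
  simp only [wr]; ring

/-- On the real axis the product of the reflection coefficients is integrable near `±∞` with
respect to `dx / |x|`. -/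
lemma lintegral_s12_mul_s21 (hδ : δ = 1 ∨ δ = -1) (h : IsLinePotential σ δ q0 qm q t) :
    ∃ X : ℝ, 0 < X ∧ ∫⁻ x in {x : ℝ | X ≤ |x|}, ‖s12 σ δ q0 qm q t x * s21 σ δ q0 qm q t x‖ₑ *
      ENNReal.ofReal (1 / |x|) < ⊤ := by
  have n1 : ‖(![1, 0] : Fin 2 → ℂ)‖ < 2 := by
    simp [pi_norm_lt_iff, Fin.forall_fin_two]
  have ev := ((h.right.tendsto_jostM_infty.norm.eventually_lt_const n1).and
    (h.left.tendsto_jostM_infty.norm.eventually_lt_const n1)).and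
    (((h.right.swap.tendsto_jostM_infty.norm.eventually_lt_const n1).and
    (h.left.swap.tendsto_jostM_infty.norm.eventually_lt_const n1)).and
    ((tendsto_one_sub_div_sq (κ := κ₀)).norm.mono_left inf_le_left |>.eventually_const_lt
      (show (1 / 2 : ℝ) < ‖(1 : ℂ)‖ by norm_num)))
  rw [eventually_inf_principal, ← Metric.cobounded_eq_cocompact, ← comap_norm_atTop,
    eventually_comap] at ev
  obtain ⟨X, hX⟩ := eventually_atTop.1 ev
  refine ⟨max X (1 + 2 * |κ₀|), lt_max_of_lt_right (by positivity), ?_⟩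
  set Y := max X (1 + 2 * |κ₀|)
  have hbound : ∀ x : ℝ, Y ≤ |x| → ‖s12 σ δ q0 qm q t x * s21 σ δ q0 qm q t x‖ ≤
      64 * (‖R₂ (-x : ℝ) 0 1‖ + ‖L₁ x 0 1‖) := by
    intro x hx
    have hf : 1 + 2 * |κ₀| ≤ |x| := (le_max_right _ _).trans hx
    have hz := ofReal_mem_Ω hf
    have hz' : ((-x : ℝ) : ℂ) ∈ Ω κ₀ := ofReal_mem_Ω (by rwa [abs_neg])
    have hxX := (le_max_left _ _).trans hx
    obtain ⟨⟨h1, h2⟩, -, h5⟩ := hX |x| hxX x (by simp) hz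
    obtain ⟨-, ⟨h3, h4⟩, -⟩ := hX |x| hxX (-x : ℝ) (by simp) hz'
    have e : s12 σ δ q0 qm q t x * s21 σ δ q0 qm q t x =
        -(wr (R₂ (-x : ℝ) 0) (L₁ x 0) * wr (L₂ (-x : ℝ) 0) (R₁ x 0) / detE σ δ q0 x ^ 2) := by
      rw [ofReal_neg] at hz' ⊢
      rw [s12, s21, jostPlus_first hδ h hz, jostMinus_second h hz,
        jostPlus_second h hz', jostMinus_first h hz', wr_smul_smul, wr_smul_smul,
        div_mul_div_comm, mul_mul_mul_comm, ← exp_add, ← exp_add, ← exp_add, wr_swapVec]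
      ring_nf
      rw [exp_zero, one_mul]
    have b1 := norm_wr_le (R₂ (-x : ℝ) 0) (L₁ x 0)
    have b2 := norm_wr_le (L₂ (-x : ℝ) 0) (R₁ x 0)
    have b3 : (1 / 4 : ℝ) ≤ ‖detE σ δ q0 x‖ ^ 2 := by rw [detE_eq]; nlinarith
    rw [e, norm_neg, norm_div, norm_mul, norm_pow, div_le_iff₀ (by linarith)]
    have b1' : ‖wr (R₂ (-x : ℝ) 0) (L₁ x 0)‖ ≤ 2 * (‖R₂ (-x : ℝ) 0 1‖ + ‖L₁ x 0 1‖) := by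
      nlinarith [norm_nonneg (R₂ (-x : ℝ) 0 1), norm_nonneg (L₁ x 0 1)]
    have b2' : ‖wr (L₂ (-x : ℝ) 0) (R₁ x 0)‖ ≤ 8 := by
      nlinarith [(norm_le_pi_norm (L₂ (-x : ℝ) 0) 1), norm_le_pi_norm (R₁ x 0) 1,
        norm_nonneg (L₂ (-x : ℝ) 0 1), norm_nonneg (R₁ x 0 1)]
    nlinarith [mul_le_mul b1' b2' (norm_nonneg _) (by positivity),
      mul_le_mul_of_nonneg_left b3 (show 0 ≤ ‖R₂ (-x : ℝ) 0 1‖ + ‖L₁ x 0 1‖ by positivity)]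
  set U : Set ℝ := {x : ℝ | 1 + 2 * |κ₀| ≤ |x|}
  have iA : ∫⁻ x in U, ‖R₂ (-x : ℝ) 0 1‖ₑ * ENNReal.ofReal (1 / |x|) < ⊤ := by
    have := h.right.swap.lintegral_jostM_lt_top
    rw [← (Measure.measurePreserving_neg (volume : Measure ℝ)).setLIntegral_comp_preimage_emb
      (Homeomorph.neg ℝ).measurableEmbedding] at this
    have e : (Neg.neg : ℝ → ℝ) ⁻¹' U = U := ext fun x => by simp [U]
    change ∫⁻ x in (Neg.neg : ℝ → ℝ) ⁻¹' U, _ < ⊤ at this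
    simpa only [e, abs_neg] using this
  have hms : ∀ c : ℝ, MeasurableSet {x : ℝ | c ≤ |x|} := fun c =>
    measurableSet_le measurable_const continuous_abs.measurable
  have hcB : AEMeasurable (fun x : ℝ => ‖L₁ x 0 1‖ₑ * ENNReal.ofReal (1 / |x|))
      (volume.restrict U) :=
    (AEMeasurable.enorm (((continuousOn_pi.1 h.left.continuousOn_jostM 1).comp
      continuous_ofReal.continuousOn fun x (hx : x ∈ U) => ofReal_mem_Ω hx).aemeasurable
      (hms _))).mul (by fun_prop)
  calc _ ≤ ∫⁻ x in {x : ℝ | Y ≤ |x|}, 64 * (‖R₂ (-x : ℝ) 0 1‖ₑ * ENNReal.ofReal (1 / |x|) +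
        ‖L₁ x 0 1‖ₑ * ENNReal.ofReal (1 / |x|)) := by
        refine setLIntegral_mono' (hms _) fun x hx => ?_
        rw [← add_mul, ← mul_assoc]
        gcongr
        rw [← ofReal_norm, ← ofReal_norm, ← ofReal_norm, ← ENNReal.ofReal_add (norm_nonneg _)
          (norm_nonneg _), show (64 : ENNReal) = ENNReal.ofReal 64 by simp,
          ← ENNReal.ofReal_mul (by norm_num)]
        exact ENNReal.ofReal_le_ofReal (hbound x hx)
    _ ≤ ∫⁻ x in U, 64 * (‖R₂ (-x : ℝ) 0 1‖ₑ * ENNReal.ofReal (1 / |x|) +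
        ‖L₁ x 0 1‖ₑ * ENNReal.ofReal (1 / |x|)) :=
        lintegral_mono_set fun x hx => (le_max_right X _).trans hx
    _ < ⊤ := by
        rw [lintegral_const_mul' _ _ (by norm_num), lintegral_add_right' _ hcB]
        exact ENNReal.mul_lt_top (by norm_num)
          (ENNReal.add_lt_top.2 ⟨iA, h.left.lintegral_jostM_lt_top⟩)

end

/-! ### Cauchy's formula on rectangles, with a logarithmic singularity on the boundary -/

/-- A sequence that is bounded in `L²` of a finite measure and converges almost everywhere
converges in `L¹`. -/
lemma tendsto_integral_of_eLpNorm_two_le {α : Type*} [MeasurableSpace α] {μ : Measure α}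
    [IsFiniteMeasure μ] {f : ℕ → α → ℂ} {g : α → ℂ} {M : ENNReal} (hM : M ≠ ⊤)
    (hf : ∀ n, AEStronglyMeasurable (f n) μ) (hb : ∀ n, eLpNorm (f n) 2 μ ≤ M)
    (hl : ∀ᵐ x ∂μ, Tendsto (fun n => f n x) atTop (𝓝 (g x))) :
    MemLp g 2 μ ∧ Tendsto (fun n => ∫ x, f n x ∂μ) atTop (𝓝 (∫ x, g x ∂μ)) := by
  have hgm : AEStronglyMeasurable g μ := aestronglyMeasurable_of_tendsto_ae atTop hf hl
  have hg2 : MemLp g 2 μ :=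
    ⟨hgm, ((Lp.eLpNorm_lim_le_liminf_eLpNorm hf g hl).trans
      (liminf_le_of_frequently_le' (.of_forall hb))).trans_lt hM.lt_top⟩
  have hg1 : MemLp g 1 μ := hg2.mono_exponent (by norm_num)
  have hui : UnifIntegrable f 1 μ := by
    intro ε hε
    have hMr : 0 ≤ M.toReal := ENNReal.toReal_nonneg
    refine ⟨(ε / (M.toReal + 1)) ^ 2, by positivity, fun n s hs hsm => ?_⟩
    rw [eLpNorm_indicator_eq_eLpNorm_restrict hs]
    refine (eLpNorm_le_eLpNorm_mul_rpow_measure_univ (p := 1) (q := 2) (by norm_num)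
      (hf n).restrict).trans ?_
    rw [Measure.restrict_apply_univ]
    calc _ ≤ ENNReal.ofReal M.toReal * ENNReal.ofReal (ε / (M.toReal + 1)) := by
          refine mul_le_mul' ?_ ?_
          · rw [ENNReal.ofReal_toReal hM]
            exact (eLpNorm_mono_measure _ Measure.restrict_le_self).trans (hb n)
          · have e : (1 / (1 : ENNReal).toReal - 1 / (2 : ENNReal).toReal : ℝ) = 1 / 2 := by
              norm_num
            rw [e]
            refine (ENNReal.rpow_le_rpow hsm (by norm_num)).trans ?_
            rw [ENNReal.ofReal_rpow_of_nonneg (by positivity) (by norm_num), ← Real.sqrt_eq_rpow,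
              Real.sqrt_sq (by positivity)]
      _ ≤ ENNReal.ofReal ε := by
          rw [← ENNReal.ofReal_mul hMr]
          refine ENNReal.ofReal_le_ofReal ?_
          rw [mul_div_assoc', div_le_iff₀ (by positivity)]
          nlinarith
  refine ⟨hg2, ?_⟩
  have := tendsto_Lp_finite_of_tendsto_ae le_rfl (by norm_num) hf hg1 hui hl
  refine tendsto_integral_of_L1' g hgm (.of_forall fun n => ?_) this
  have h2 : MemLp (f n) 2 μ := ⟨hf n, lt_of_le_of_lt (hb n) hM.lt_top⟩
  exact memLp_one_iff_integrable.1 (h2.mono_exponent (by norm_num))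

/-- The integral of `f` along the boundary of `[x0, x1] × [y0, y1]`. -/
def rectInt (f : ℂ → ℂ) (x0 x1 y0 y1 : ℝ) : ℂ :=
  (∫ x in x0..x1, f (x + y0 * I)) - (∫ x in x0..x1, f (x + y1 * I)) +
    I * (∫ y in y0..y1, f (x1 + y * I)) - I * ∫ y in y0..y1, f (x0 + y * I)

lemma rectInt_eq_zero {f : ℂ → ℂ} {x0 x1 y0 y1 : ℝ} (hx : x0 ≤ x1) (hy : y0 ≤ y1)
    (hc : ContinuousOn f (Icc x0 x1 ×ℂ Icc y0 y1))
    (hd : DifferentiableOn ℂ f (Ioo x0 x1 ×ℂ Ioo y0 y1)) : rectInt f x0 x1 y0 y1 = 0 := by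
  have := integral_boundary_rect_eq_zero_of_continuousOn_of_differentiableOn f
    ⟨x0, y0⟩ ⟨x1, y1⟩ (by simpa [uIcc_of_le hx, uIcc_of_le hy] using hc)
    (by simpa [hx, hy] using hd)
  simpa [rectInt] using this

lemma continuousOn_horizontal {f : ℂ → ℂ} {s : Set ℂ} (hf : ContinuousOn f s) {y : ℝ} {u : Set ℝ}
    (hu : ∀ x ∈ u, (x + y * I : ℂ) ∈ s) : ContinuousOn (fun x : ℝ => f (x + y * I)) u :=
  hf.comp (by fun_prop) hu

lemma continuousOn_vertical {f : ℂ → ℂ} {s : Set ℂ} (hf : ContinuousOn f s) {x : ℝ} {u : Set ℝ}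
    (hu : ∀ y ∈ u, (x + y * I : ℂ) ∈ s) : ContinuousOn (fun y : ℝ => f (x + y * I)) u :=
  hf.comp (by fun_prop) hu

lemma mem_rect {s t : Set ℝ} {x y : ℝ} : (x + y * I : ℂ) ∈ (s ×ℂ t) ↔ x ∈ s ∧ y ∈ t := by
  simp [mem_reProdIm]

lemma intervalIntegrable_log_sq (C c x0 x1 : ℝ) :
    IntervalIntegrable (fun u => (C + |Real.log (u - c)|) ^ 2) volume x0 x1 := by
  have h0 (A B : ℝ) : IntervalIntegrable (fun u : ℝ => (√|u|)⁻¹) volume A B := by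
    refine intervalIntegrable_of_even (fun u => by simp) (fun B hB => ?_)
    refine (intervalIntegral.intervalIntegrable_rpow' (r := -(1 / 2 : ℝ))
      (by norm_num)).congr fun x hx => ?_
    rw [uIoc_of_le hB.le] at hx
    simp only [abs_of_pos hx.1, Real.sqrt_eq_rpow, Real.rpow_neg hx.1.le]
  have h1 := (h0 (x0 - c) (x1 - c)).comp_sub_right c
  simp only [sub_add_cancel] at h1
  refine ((Continuous.intervalIntegrable (u := fun u => 2 * C ^ 2 + 64 * √|u - c|)
    (by fun_prop) x0 x1).add (h1.const_mul 64)).mono_fun' ?_ (.of_forall fun u => ?_)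
  · have : Measurable fun u : ℝ => Real.log (u - c) := Real.measurable_log.comp (by fun_prop)
    exact Measurable.aestronglyMeasurable (by fun_prop)
  · -- `|log v| = 4 |log s| ≤ 4 (s + s⁻¹)` for `s = v ^ (1 / 4)`
    simp only [norm_pow, Real.norm_eq_abs, sq_abs]
    rw [← Real.log_abs (u - c)]
    obtain ⟨s, hs, e⟩ : ∃ s : ℝ, 0 ≤ s ∧ s ^ 2 = √|u - c| := ⟨√√|u - c|, by simp, by simp⟩
    have hv : |u - c| = s ^ 4 := by rw [← Real.sq_sqrt (abs_nonneg (u - c)), ← e]; ring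
    rw [← e, hv, Real.log_pow, abs_mul]
    have hl : |Real.log s| ≤ s + s⁻¹ := by
      have h1 := Real.log_le_self hs
      have h2 := Real.log_le_self (inv_nonneg.2 hs)
      have := inv_nonneg.2 hs
      rw [Real.log_inv] at h2
      exact abs_le.2 ⟨by linarith, by linarith⟩
    have h3 := pow_le_pow_left₀ (abs_nonneg _) hl 2
    norm_num at h3 ⊢
    rw [← inv_pow]
    linarith [sq_nonneg (C - 4 * |Real.log s|), sq_nonneg (s - s⁻¹), sq_abs (Real.log s)]

/-- The primitive mean-square bound: `∮ g² = 0` controls the imaginary part of `g` on a horizontal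
line by the real part of `g` there and by the size of `g` on the rest of the rectangle. -/
lemma integral_normSq_le {g : ℂ → ℂ} {x0 x1 t d S C c : ℝ} (hx : x0 ≤ x1) (ht0 : 0 ≤ t) (ht : t ≤ d)
    (hg : ContinuousOn g (Icc x0 x1 ×ℂ Icc t d))
    (hg' : DifferentiableOn ℂ g (Ioo x0 x1 ×ℂ Ioo t d))
    (hre : ∀ u ∈ Icc x0 x1, u ≠ c → |(g (u + t * I)).re| ≤ C + |Real.log (u - c)|)
    (htop : ∀ u ∈ Icc x0 x1, ‖g (u + d * I)‖ ≤ S)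
    (hl : ∀ y ∈ Icc t d, ‖g (x0 + y * I)‖ ≤ S) (hr : ∀ y ∈ Icc t d, ‖g (x1 + y * I)‖ ≤ S) :
    ∫ u in x0..x1, ‖g (u + t * I)‖ ^ 2 ≤
      2 * (∫ u in x0..x1, (C + |Real.log (u - c)|) ^ 2) + S ^ 2 * (x1 - x0) + 2 * (S ^ 2 * d) := by
  have h0 := rectInt_eq_zero hx ht (f := fun w => g w ^ 2) (hg.pow 2) (hg'.pow 2)
  have hcb : ContinuousOn (fun u : ℝ => g (u + t * I)) (Icc x0 x1) :=
    continuousOn_horizontal hg fun u hu => mem_rect.2 ⟨hu, le_rfl, ht⟩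
  have hb (f : ℝ → ℂ) {a b : ℝ} (hab : a ≤ b) (hf : ∀ x ∈ Icc a b, ‖f x‖ ≤ S) :
      ‖∫ x in a..b, f x ^ 2‖ ≤ S ^ 2 * (b - a) := by
    refine (intervalIntegral.norm_integral_le_of_norm_le_const (C := S ^ 2) fun x hx => ?_).trans
      (by rw [abs_of_nonneg (sub_nonneg.2 hab)])
    rw [norm_pow]
    exact pow_le_pow_left₀ (norm_nonneg _)
      (hf x (Ioc_subset_Icc_self (by rwa [uIoc_of_le hab] at hx))) 2
  have hsq : ‖∫ x in x0..x1, g (x + t * I) ^ 2‖ ≤ S ^ 2 * (x1 - x0) + 2 * (S ^ 2 * d) := by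
    have e : (∫ x in x0..x1, g (x + t * I) ^ 2) = (∫ x in x0..x1, g (x + d * I) ^ 2) -
        I * (∫ y in t..d, g (x1 + y * I) ^ 2) + I * ∫ y in t..d, g (x0 + y * I) ^ 2 := by
      unfold rectInt at h0
      linear_combination h0
    rw [e]
    refine (norm_add_le_of_le (norm_sub_le _ _) le_rfl).trans ?_
    simp only [norm_mul, norm_I, one_mul]
    have h1 := hb _ hx htop
    have h2 := hb _ ht hl
    have h3 := hb _ ht hr
    nlinarith [mul_nonneg (sq_nonneg S) ht0]
  have hi1 : IntervalIntegrable (fun u : ℝ => g (u + t * I) ^ 2) volume x0 x1 :=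
    ContinuousOn.intervalIntegrable_of_Icc hx (hcb.pow 2)
  have hi2 : IntervalIntegrable (fun u : ℝ => (g (u + t * I)).re ^ 2) volume x0 x1 :=
    ContinuousOn.intervalIntegrable_of_Icc hx ((continuous_re.comp_continuousOn hcb).pow 2)
  have e1 : ∀ u : ℝ, ‖g (u + t * I)‖ ^ 2 =
      2 * (g (u + t * I)).re ^ 2 - (g (u + t * I) ^ 2).re := fun u => by
    rw [← normSq_eq_norm_sq, normSq_apply, sq (g _), mul_re]; ring
  have e2 : ∫ u in x0..x1, (g (u + t * I) ^ 2).re = (∫ u in x0..x1, g (u + t * I) ^ 2).re := by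
    have := intervalIntegral.intervalIntegral_re (𝕜 := ℂ) hi1
    simpa using this
  have hi3 : IntervalIntegrable (fun u : ℝ => (g (u + t * I) ^ 2).re) volume x0 x1 :=
    ContinuousOn.intervalIntegrable_of_Icc hx (continuous_re.comp_continuousOn (hcb.pow 2))
  calc ∫ u in x0..x1, ‖g (u + t * I)‖ ^ 2
      = 2 * (∫ u in x0..x1, (g (u + t * I)).re ^ 2) - (∫ u in x0..x1, g (u + t * I) ^ 2).re := by
        rw [← e2, ← intervalIntegral.integral_const_mul, ← intervalIntegral.integral_sub
          (hi2.const_mul 2) hi3]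
        simp_rw [e1]
    _ ≤ _ := by
        have h1 : ∫ u in x0..x1, (g (u + t * I)).re ^ 2 ≤
            ∫ u in x0..x1, (C + |Real.log (u - c)|) ^ 2 := by
          refine intervalIntegral.integral_mono_ae_restrict hx hi2
            (intervalIntegrable_log_sq C c x0 x1) ?_
          have hne : ∀ᵐ u ∂(volume : Measure ℝ), u ≠ c := by
            simp [ae_iff]
          filter_upwards [ae_restrict_of_ae hne, ae_restrict_mem measurableSet_Icc] with u hu hu'
          have := hre u hu' hu
          rw [← sq_abs]
          exact pow_le_pow_left₀ (abs_nonneg _) this 2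
        have := (abs_le.1 (abs_re_le_norm (∫ u in x0..x1, g (u + t * I) ^ 2))).1
        linarith

/-- The behaviour at an edge of a rectangle of a holomorphic function whose real part has a
logarithmic singularity at a point of this edge. -/
lemma edge_limit {g K : ℂ → ℂ} {x0 x1 c d C : ℝ} (h0 : x0 < c) (h1 : c < x1) (hd : 0 < d)
    (hg : ContinuousOn g ((Icc x0 x1 ×ℂ Icc 0 d) \ {(c : ℂ)}))
    (hg' : DifferentiableOn ℂ g (Ioo x0 x1 ×ℂ Ioo 0 d))
    (hre : ∀ w ∈ Icc x0 x1 ×ℂ Icc 0 d, w.re ≠ c → |(g w).re| ≤ C + |Real.log (w.re - c)|)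
    (hK : ContinuousOn K (Icc x0 x1 ×ℂ Icc 0 d)) :
    IntervalIntegrable (fun u : ℝ => g u) volume x0 x1 ∧
      Tendsto (fun t : ℝ => ∫ u in x0..x1, K (u + t * I) * g (u + t * I)) (𝓝[>] 0)
        (𝓝 (∫ u in x0..x1, K u * g u)) := by
  have hx : x0 ≤ x1 := (h0.trans h1).le
  set R := Icc x0 x1 ×ℂ Icc 0 d with hR
  have hRc : IsCompact R := isCompact_Icc.reProdIm isCompact_Icc
  have hne : ∀ {u y : ℝ}, (u + y * I : ℂ) = c → u = c ∧ y = 0 := fun {u y} h => by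
    have h1 := congrArg re h
    have h2 := congrArg im h
    simp at h1 h2
    exact ⟨h1, h2⟩
  obtain ⟨S, hS⟩ : ∃ S, ∀ w ∈ R, (w.im = d ∨ w.re = x0 ∨ w.re = x1) → ‖g w‖ ≤ S := by
    have hcl : IsClosed {w : ℂ | w.im = d ∨ w.re = x0 ∨ w.re = x1} :=
      (isClosed_eq continuous_im continuous_const).union
        ((isClosed_eq continuous_re continuous_const).union
          (isClosed_eq continuous_re continuous_const))
    obtain ⟨S, hS⟩ := (hRc.inter_right hcl).exists_bound_of_continuousOn (hg.mono fun w hw =>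
      ⟨hw.1, fun hwc => by
        rw [mem_singleton_iff] at hwc
        have h2 := hw.2
        simp only [hwc, mem_ofPred_eq, ofReal_im, ofReal_re] at h2
        rcases h2 with h | h | h <;> linarith⟩)
    exact ⟨S, fun w hw h => hS w ⟨hw, h⟩⟩
  set M : ℝ := 2 * (∫ u in x0..x1, (C + |Real.log (u - c)|) ^ 2) + S ^ 2 * (x1 - x0) +
    2 * (S ^ 2 * d) with hM
  have hline : ∀ t ∈ Ioc 0 d, ContinuousOn (fun u : ℝ => g (u + t * I)) (Icc x0 x1) :=
    fun t ht => continuousOn_horizontal hg fun u hu => ⟨mem_rect.2 ⟨hu, ht.1.le, ht.2⟩, fun h =>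
      ht.1.ne' (hne h).2⟩
  have hb : ∀ t ∈ Ioo 0 d, ∫ u in x0..x1, ‖g (u + t * I)‖ ^ 2 ≤ M := by
    intro t ht
    refine integral_normSq_le hx ht.1.le ht.2.le
      (hg.mono fun w hw => ⟨⟨hw.1, ht.1.le.trans hw.2.1, hw.2.2⟩, fun h => ?_⟩)
      (hg'.mono fun w hw => ⟨hw.1, ht.1.trans hw.2.1, hw.2.2⟩) (fun u hu huc => ?_)
      (fun u hu => ?_) (fun y hy => ?_) (fun y hy => ?_)
    · exact ht.1.not_ge (by simpa [mem_singleton_iff.1 h] using hw.2.1)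
    · simpa [huc] using hre (u + t * I) (mem_rect.2 ⟨hu, ht.1.le, ht.2.le⟩)
    · exact hS _ (mem_rect.2 ⟨hu, hd.le, le_rfl⟩) (Or.inl (by simp))
    · exact hS _ (mem_rect.2 ⟨⟨le_rfl, hx⟩, ht.1.le.trans hy.1, hy.2⟩) (Or.inr (Or.inl (by simp)))
    · exact hS _ (mem_rect.2 ⟨⟨hx, le_rfl⟩, ht.1.le.trans hy.1, hy.2⟩) (Or.inr (Or.inr (by simp)))
  set μ : Measure ℝ := volume.restrict (Ioc x0 x1) with hμ
  have hmeas : ∀ t ∈ Ioo 0 d, AEStronglyMeasurable (fun u : ℝ => g (u + t * I)) μ := fun t ht =>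
    ((hline t ⟨ht.1, ht.2.le⟩).mono Ioc_subset_Icc_self).aestronglyMeasurable measurableSet_Ioc
  -- the common bound on the norms in `L²`
  have hL2 : ∀ t ∈ Ioo 0 d, eLpNorm (fun u : ℝ => g (u + t * I)) 2 μ ≤
      ENNReal.ofReal M ^ (1 / 2 : ℝ) := by
    intro t ht
    rw [eLpNorm_eq_lintegral_rpow_enorm_toReal (by norm_num) (by norm_num)]
    simp only [ENNReal.toReal_ofNat]
    refine ENNReal.rpow_le_rpow ?_ (by norm_num)
    have hi : Integrable (fun u : ℝ => ‖g (u + t * I)‖ ^ 2) μ :=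
      (((hline t ⟨ht.1, ht.2.le⟩).norm.pow 2).integrableOn_Icc).mono_set Ioc_subset_Icc_self
    have := hb t ht
    rw [intervalIntegral.integral_of_le hx] at this
    refine le_trans (le_of_eq ?_) (ENNReal.ofReal_le_ofReal this)
    rw [ofReal_integral_eq_lintegral_ofReal hi (.of_forall fun u => sq_nonneg _)]
    refine lintegral_congr fun u => ?_
    rw [← ofReal_norm, ENNReal.ofReal_rpow_of_nonneg (norm_nonneg _) (by norm_num)]
    norm_num
  have hnec : ∀ᵐ u ∂μ, u ≠ c := ae_restrict_of_ae (by simp [ae_iff])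
  -- convergence along sequences
  have key : ∀ (J : ℂ → ℂ), ContinuousOn J R → ∀ s : ℕ → ℝ,
      Tendsto s atTop (𝓝[>] 0) → (∀ n, s n ∈ Ioo 0 d) →
      MemLp (fun u : ℝ => J u * g u) 2 μ ∧
      Tendsto (fun n => ∫ u, J (u + s n * I) * g (u + s n * I) ∂μ) atTop
        (𝓝 (∫ u, J u * g u ∂μ)) := by
    intro J hJ s hs hsd
    obtain ⟨k, hk⟩ := hRc.exists_bound_of_continuousOn hJ
    have hJm : ∀ n, AEStronglyMeasurable (fun u : ℝ => J (u + s n * I)) μ := fun n =>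
      ((continuousOn_horizontal hJ fun u hu => mem_rect.2 ⟨hu, (hsd n).1.le, (hsd n).2.le⟩ :
        ContinuousOn (fun u : ℝ => J (u + s n * I)) (Icc x0 x1)).mono
        Ioc_subset_Icc_self).aestronglyMeasurable measurableSet_Ioc
    refine tendsto_integral_of_eLpNorm_two_le (M := ENNReal.ofReal k *
      ENNReal.ofReal M ^ (1 / 2 : ℝ)) ?_ (fun n => (hJm n).mul (hmeas _ (hsd n))) (fun n => ?_) ?_
    · exact ENNReal.mul_ne_top ENNReal.ofReal_ne_top
        (ENNReal.rpow_ne_top_of_nonneg (by norm_num) ENNReal.ofReal_ne_top)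
    · have : eLpNorm (fun u : ℝ => J (u + s n * I) * g (u + s n * I)) 2 μ ≤
          ENNReal.ofReal k * eLpNorm (fun u : ℝ => g (u + s n * I)) 2 μ := by
        refine eLpNorm_le_mul_eLpNorm_of_ae_le_mul ?_ 2
        filter_upwards [ae_restrict_mem measurableSet_Ioc] with u hu
        rw [norm_mul]
        exact mul_le_mul_of_nonneg_right
          (hk _ (mem_rect.2 ⟨⟨hu.1.le, hu.2⟩, (hsd n).1.le, (hsd n).2.le⟩)) (norm_nonneg _)
      exact this.trans (mul_le_mul' le_rfl (hL2 _ (hsd n)))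
    · filter_upwards [hnec, ae_restrict_mem measurableSet_Ioc] with u huc hu
      have hmem : (u : ℂ) ∈ R := by
        simpa using (mem_rect (x := u) (y := 0)).2
          ⟨Ioc_subset_Icc_self hu, left_mem_Icc.2 hd.le⟩
      have hlim : Tendsto (fun n => (u + s n * I : ℂ)) atTop (𝓝[R \ {(c : ℂ)}] u) := by
        refine tendsto_nhdsWithin_iff.2 ⟨?_, .of_forall fun n =>
          ⟨mem_rect.2 ⟨⟨hu.1.le, hu.2⟩, (hsd n).1.le, (hsd n).2.le⟩, fun h => huc (hne h).1⟩⟩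
        have h3 : Continuous fun y : ℝ => (u + y * I : ℂ) := by fun_prop
        simpa [Function.comp_def] using (h3.tendsto 0).comp (hs.mono_right nhdsWithin_le_nhds)
      exact ((hJ u hmem).mono sdiff_subset).tendsto.comp hlim |>.mul
        ((hg u ⟨hmem, fun h => huc (by simpa using h)⟩).tendsto.comp hlim)
  constructor
  · obtain ⟨s, -, hs1, hs2⟩ := exists_seq_strictAnti_tendsto' hd
    have := (key (fun _ => 1) continuousOn_const s
      (tendsto_nhdsWithin_iff.2 ⟨hs2, .of_forall fun n => (hs1 n).1⟩) hs1).1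
    rw [intervalIntegrable_iff_integrableOn_Ioc_of_le hx]
    simpa [IntegrableOn] using memLp_one_iff_integrable.1 (this.mono_exponent (p := 1) (by norm_num))
  · refine tendsto_of_seq_tendsto fun s hs => ?_
    obtain ⟨N, hN⟩ := eventually_atTop.1 (hs.eventually (Ioo_mem_nhdsGT hd))
    rw [← tendsto_add_atTop_iff_nat N]
    have := (key K hK (fun n => s (n + N))
      (hs.comp (tendsto_add_atTop_nat N)) (fun n => hN _ (Nat.le_add_left _ _))).2
    simp only [intervalIntegral.integral_of_le hx]
    exact this

section

/-- Rotation by a right angle turns vertical into horizontal edges. -/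
lemma rectInt_rotate (f : ℂ → ℂ) (x0 x1 y0 y1 : ℝ) :
    rectInt f x0 x1 y0 y1 = rectInt (fun w => I * f (I * w)) y0 y1 (-x1) (-x0) := by
  have hI := I_mul_I
  have e1 : ∀ x y : ℝ, I * (x + ((-y : ℝ) : ℂ) * I) = y + x * I := fun x y => by
    push_cast; linear_combination (-y : ℂ) * hI
  have e2 : ∀ y : ℝ, (∫ x in -x1..-x0, I * f (I * (y + x * I))) =
      I * ∫ x in x0..x1, f (x + y * I) := fun y => by
    rw [intervalIntegral.integral_const_mul, ← intervalIntegral.integral_comp_neg]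
    simp_rw [e1]
  unfold rectInt
  simp only [e1, e2, intervalIntegral.integral_const_mul]
  linear_combination ((∫ x in x0..x1, f (x + y0 * I)) - ∫ x in x0..x1, f (x + y1 * I)) * hI

lemma integral_div_line {α v : ℂ} (h : ∀ t : ℝ, α + t * v ∈ slitPlane) (a b : ℝ) :
    ∫ t in a..b, v / (α + t * v) = log (α + b * v) - log (α + a * v) := by
  refine intervalIntegral.integral_eq_sub_of_hasDerivAt (f := fun t : ℝ => log (α + t * v))
    (fun t _ => HasDerivAt.clog_real ?_ (h t)) ?_
  · simpa using ((ofRealCLM.hasDerivAt (x := t)).mul_const v).const_add α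
  · exact (continuous_const.div (by fun_prop) fun t => slitPlane_ne_zero (h t)).intervalIntegrable _ _

variable {f g : ℂ → ℂ} {x0 x1 y0 y1 q0 : ℝ} {p : ℂ}

local notation "R" => Icc x0 x1 ×ℂ Icc y0 y1
local notation "R°" => Ioo x0 x1 ×ℂ Ioo y0 y1

/-- The winding number of the boundary of a rectangle about an interior point. -/
lemma rectInt_inv_sub (hp : p ∈ R°) : rectInt (fun w => (w - p)⁻¹) x0 x1 y0 y1 = 2 * π * I := by
  obtain ⟨⟨h1, h2⟩, h3, h4⟩ := hp
  have hor : ∀ y : ℝ, y ≠ p.im → ∫ x in x0..x1, (x + y * I - p : ℂ)⁻¹ =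
      log (x1 + y * I - p) - log (x0 + y * I - p) := fun y hy => by
    have := integral_div_line (α := y * I - p) (v := 1)
      (fun t => Or.inr (by simpa [sub_eq_zero] using hy)) x0 x1
    simpa only [mul_one, one_div, add_comm _ (_ : ℂ), ← add_sub_assoc] using this
  have hright : I * ∫ y in y0..y1, (x1 + y * I - p : ℂ)⁻¹ =
      log (x1 + y1 * I - p) - log (x1 + y0 * I - p) := by
    have := integral_div_line (α := x1 - p) (v := I) (fun t => Or.inl (by simpa using h2)) y0 y1
    simpa only [div_eq_mul_inv, intervalIntegral.integral_const_mul, sub_add_eq_add_sub] using this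
  -- on the left edge the branch of the logarithm of the opposite vector is used
  have hleft : I * ∫ y in y0..y1, (x0 + y * I - p : ℂ)⁻¹ =
      log (-(x0 + y1 * I - p)) - log (-(x0 + y0 * I - p)) := by
    have := integral_div_line (α := -(x0 - p)) (v := -I) (fun t => Or.inl (by simpa using h1)) y0 y1
    simpa only [mul_neg, ← neg_add, div_eq_mul_inv, inv_neg, intervalIntegral.integral_neg,
      intervalIntegral.integral_const_mul, sub_add_eq_add_sub, neg_mul, neg_neg] using this
  have l1 : log (-(x0 + y1 * I - p)) = log (x0 + y1 * I - p) - π * I := by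
    simp only [log, norm_neg, arg_neg_eq_arg_sub_pi_of_im_pos
      (show 0 < (x0 + y1 * I - p : ℂ).im by simpa using h4)]
    push_cast; ring
  have l0 : log (-(x0 + y0 * I - p)) = log (x0 + y0 * I - p) + π * I := by
    simp only [log, norm_neg, arg_neg_eq_arg_add_pi_of_im_neg
      (show (x0 + y0 * I - p : ℂ).im < 0 by simpa using h3)]
    push_cast; ring
  unfold rectInt
  rw [hor y0 h3.ne, hor y1 h4.ne', hright, hleft, l1, l0]
  ring

/-- The boundary of a rectangle does not meet its interior. -/
lemma rect_edges (hp : p ∈ R°) :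
    (∀ x ∈ Icc x0 x1, (x + y0 * I : ℂ) ∈ R \ {p} ∧ (x + y1 * I : ℂ) ∈ R \ {p}) ∧
    ∀ y ∈ Icc y0 y1, (x0 + y * I : ℂ) ∈ R \ {p} ∧ (x1 + y * I : ℂ) ∈ R \ {p} := by
  obtain ⟨⟨h1, h2⟩, h3, h4⟩ := hp
  have hx : x0 ≤ x1 := (h1.trans h2).le
  have hy : y0 ≤ y1 := (h3.trans h4).le
  refine ⟨fun x hx' => ⟨⟨mem_rect.2 ⟨hx', le_rfl, hy⟩, ?_⟩, mem_rect.2 ⟨hx', hy, le_rfl⟩, ?_⟩,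
    fun y hy' => ⟨⟨mem_rect.2 ⟨⟨le_rfl, hx⟩, hy'⟩, ?_⟩, mem_rect.2 ⟨⟨hx, le_rfl⟩, hy'⟩, ?_⟩⟩ <;>
  · rintro rfl
    simp at h1 h2 h3 h4

lemma rectInt_congr (hp : p ∈ R°) (h : EqOn f g (R \ {p})) :
    rectInt f x0 x1 y0 y1 = rectInt g x0 x1 y0 y1 := by
  obtain ⟨e1, e2⟩ := rect_edges hp
  have hx := (uIcc_of_le (hp.1.1.trans hp.1.2).le).subset
  have hy := (uIcc_of_le (hp.2.1.trans hp.2.2).le).subset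
  rw [rectInt, rectInt, intervalIntegral.integral_congr fun x h' => h (e1 x (hx h')).1,
    intervalIntegral.integral_congr fun x h' => h (e1 x (hx h')).2,
    intervalIntegral.integral_congr fun x h' => h (e2 x (hy h')).1,
    intervalIntegral.integral_congr fun x h' => h (e2 x (hy h')).2]

lemma rectInt_add (hp : p ∈ R°) (hf : ContinuousOn f (R \ {p})) (hg : ContinuousOn g (R \ {p})) :
    rectInt (fun w => f w + g w) x0 x1 y0 y1 = rectInt f x0 x1 y0 y1 + rectInt g x0 x1 y0 y1 := by
  obtain ⟨e1, e2⟩ := rect_edges hp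
  have ih : ∀ {f : ℂ → ℂ} (_ : ContinuousOn f (R \ {p})) (y : ℝ),
      (∀ x ∈ Icc x0 x1, (x + y * I : ℂ) ∈ R \ {p}) →
      IntervalIntegrable (fun x : ℝ => f (x + y * I)) volume x0 x1 := fun hf y h =>
    (continuousOn_horizontal hf h).intervalIntegrable_of_Icc (hp.1.1.trans hp.1.2).le
  have iv : ∀ {f : ℂ → ℂ} (_ : ContinuousOn f (R \ {p})) (x : ℝ),
      (∀ y ∈ Icc y0 y1, (x + y * I : ℂ) ∈ R \ {p}) →
      IntervalIntegrable (fun y : ℝ => f (x + y * I)) volume y0 y1 := fun hf x h =>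
    (continuousOn_vertical hf h).intervalIntegrable_of_Icc (hp.2.1.trans hp.2.2).le
  unfold rectInt
  rw [intervalIntegral.integral_add (ih hf _ fun x h => (e1 x h).1) (ih hg _ fun x h => (e1 x h).1),
    intervalIntegral.integral_add (ih hf _ fun x h => (e1 x h).2) (ih hg _ fun x h => (e1 x h).2),
    intervalIntegral.integral_add (iv hf _ fun x h => (e2 x h).1) (iv hg _ fun x h => (e2 x h).1),
    intervalIntegral.integral_add (iv hf _ fun x h => (e2 x h).2) (iv hg _ fun x h => (e2 x h).2)]
  ring

lemma openRect_subset : R° ⊆ R :=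
  fun _ hw => ⟨Ioo_subset_Icc_self hw.1, Ioo_subset_Icc_self hw.2⟩

/-- Cauchy's integral formula for a rectangle. -/
lemma rectInt_div_sub (hp : p ∈ R°) (hc : ContinuousOn f R) (hd : DifferentiableOn ℂ f R°) :
    rectInt (fun w => f w / (w - p)) x0 x1 y0 y1 = 2 * π * I * f p := by
  have hn := (isOpen_Ioo.reProdIm isOpen_Ioo).mem_nhds hp
  have hcs := (continuousOn_dslope (mem_of_superset hn openRect_subset)).2
    ⟨hc, hd.differentiableAt hn⟩
  have h0 := rectInt_eq_zero (hp.1.1.trans hp.1.2).le (hp.2.1.trans hp.2.2).le hcs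
    ((differentiableOn_dslope hn).2 hd)
  rw [rectInt_congr hp (g := fun w => dslope f p w + f p * (w - p)⁻¹), rectInt_add
    (g := fun w => f p * (w - p)⁻¹) hp (hcs.mono sdiff_subset) (continuousOn_const.mul (ContinuousOn.inv₀ (by fun_prop) fun w hw =>
      sub_ne_zero.2 hw.2)), h0, zero_add]
  · have := rectInt_inv_sub hp
    unfold rectInt at this ⊢
    simp only [intervalIntegral.integral_const_mul]
    linear_combination f p * this
  · intro w hw
    have := sub_ne_zero.2 hw.2
    simp only [dslope_of_ne _ hw.2, slope_def_field]
    field_simp; ring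

/-- `dζ / (ζ - z)` in the coordinate `ζ = q0 e^w`. -/
def expK (q0 : ℝ) (z w : ℂ) : ℂ := q0 * exp w / (q0 * exp w - z)

lemma rectInt_expK_eq_zero {z : ℂ} (hx : x0 ≤ x1) (hy : y0 ≤ y1)
    (hz : ∀ w ∈ R, (q0 : ℂ) * exp w ≠ z) (hc : ContinuousOn g R) (hd : DifferentiableOn ℂ g R°) :
    rectInt (fun w => expK q0 z w * g w) x0 x1 y0 y1 = 0 := by
  have hK : DifferentiableOn ℂ (expK q0 z) R :=
    DifferentiableOn.div (by fun_prop) (by fun_prop) fun w hw => sub_ne_zero.2 (hz w hw)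
  exact rectInt_eq_zero hx hy (hK.continuousOn.mul hc) ((hK.mono openRect_subset).mul hd)

/-- The residue of `dζ / (ζ - z)` at `ζ = z`, in the coordinate `ζ = q0 e^w`. -/
lemma rectInt_expK (hq : 0 < q0) (hp : p ∈ R°) (hy : y1 - y0 < 2 * π) (hc : ContinuousOn g R)
    (hd : DifferentiableOn ℂ g R°) :
    rectInt (fun w => expK q0 (q0 * exp p) w * g w) x0 x1 y0 y1 = 2 * π * I * g p := by
  have hq' : (q0 : ℂ) ≠ 0 := by exact_mod_cast hq.ne'
  set Z : ℂ → ℂ := fun w => q0 * exp w with hZ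
  have hZd : Differentiable ℂ Z := by fun_prop
  have hZ' : deriv Z p = Z p := by simp [hZ]
  have hds : Differentiable ℂ (dslope Z p) := by
    rw [← differentiableOn_univ] at hZd ⊢
    exact (differentiableOn_dslope univ_mem).2 hZd
  have hne : ∀ w ∈ R, dslope Z p w ≠ 0 := by
    intro w hw
    by_cases h : w = p
    · rw [h, dslope_same, hZ']; exact mul_ne_zero hq' (exp_ne_zero _)
    · rw [dslope_of_ne _ h, slope_def_field]
      refine div_ne_zero (fun h0 => h ?_) (sub_ne_zero.2 h)
      have h1 := mul_left_cancel₀ hq' (sub_eq_zero.1 h0)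
      obtain ⟨n, hn⟩ := exp_eq_exp_iff_exists_int.1 h1
      have him := congrArg im hn
      rw [show (p + n * (2 * π * I) : ℂ).im = p.im + n * (2 * π) by simp [mul_im, mul_re]] at him
      obtain ⟨b1, b2⟩ := hw.2
      obtain ⟨b3, b4⟩ := hp.2
      have h3 : (n : ℝ) < 1 := by nlinarith [Real.pi_pos]
      have h4 : (-1 : ℝ) < n := by nlinarith [Real.pi_pos]
      have hn0 : n = 0 := by
        have h3' : n < 1 := by exact_mod_cast h3
        have h4' : -1 < n := by exact_mod_cast h4
        omega
      rw [hn, hn0]; simp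
  have key := rectInt_div_sub hp (f := fun w => Z w / dslope Z p w * g w)
    ((hZd.continuous.continuousOn.div hds.continuous.continuousOn hne).mul hc)
    ((hZd.differentiableOn.div hds.differentiableOn fun w hw => hne w (openRect_subset hw)).mul hd)
  have hval : Z p / dslope Z p p = 1 := by
    rw [dslope_same, hZ']
    exact div_self (mul_ne_zero hq' (exp_ne_zero _))
  simp only [hval, one_mul] at key
  rw [← key]
  refine rectInt_congr hp fun w hw => ?_
  have h2 := hne w hw.1
  rw [dslope_of_ne _ hw.2, slope_def_field] at h2
  have h3 := sub_ne_zero.2 hw.2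
  have h4 : Z w - Z p ≠ 0 := fun h => h2 (by rw [h, zero_div])
  simp only [dslope_of_ne _ hw.2, slope_def_field]
  change Z w / (Z w - Z p) * g w = _
  field_simp

/-- A boundary integral formula that holds for the inner rectangles
`[x0, x1] × [y0 + t, y1 - t]` extends to `t = 0`, if the real part of the holomorphic function has
at most logarithmic singularities at `c + i y0` and `c + i y1`. -/
lemma rectInt_of_horizontal_singularity {K : ℂ → ℂ} {c C : ℝ} {r : ℂ}
    (h0 : x0 < c) (h1 : c < x1) (hp : p ∈ R°)
    (hg : ContinuousOn g (R \ {w | w.re = c ∧ (w.im = y0 ∨ w.im = y1)}))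
    (hg' : DifferentiableOn ℂ g R°)
    (hre : ∀ w ∈ R, w.re ≠ c → |(g w).re| ≤ C + |Real.log (w.re - c)|)
    (hK : ContinuousOn K (R \ {p}))
    (hres : ∀ᶠ t in 𝓝[>] (0 : ℝ), rectInt (fun w => K w * g w) x0 x1 (y0 + t) (y1 - t) = r) :
    IntervalIntegrable (fun u : ℝ => g (u + y0 * I)) volume x0 x1 ∧
    IntervalIntegrable (fun u : ℝ => g (u + y1 * I)) volume x0 x1 ∧
    rectInt (fun w => K w * g w) x0 x1 y0 y1 = r := by
  obtain ⟨⟨p1, p2⟩, p3, p4⟩ := id hp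
  have hy : y0 ≤ y1 := (p3.trans p4).le
  obtain ⟨d, hd0, hd⟩ := exists_between (lt_min (sub_pos.2 p3) (sub_pos.2 p4))
  obtain ⟨hd1, hd2⟩ := lt_min_iff.1 hd
  -- both horizontal edges are affine images of the lower edge of `[x0, x1] × [0, d]`
  have aux : ∀ φ : ℂ → ℂ, Differentiable ℂ φ → ∀ c', x0 < c' → c' < x1 →
      (∀ w ∈ Icc x0 x1 ×ℂ Icc 0 d, φ w ∈ R ∧ (φ w).im ≠ p.im ∧
        ((φ w).im = y0 ∨ (φ w).im = y1 → w.im = 0) ∧ |(φ w).re - c| = |w.re - c'|) →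
      (∀ w ∈ Ioo x0 x1 ×ℂ Ioo 0 d, φ w ∈ R°) →
      IntervalIntegrable (fun u : ℝ => g (φ u)) volume x0 x1 ∧
      Tendsto (fun t : ℝ => ∫ u in x0..x1, K (φ (u + t * I)) * g (φ (u + t * I))) (𝓝[>] 0)
        (𝓝 (∫ u in x0..x1, K (φ u) * g (φ u))) := by
    intro φ hφ c' h0' h1' hcl hop
    have hre0 : ∀ w ∈ Icc x0 x1 ×ℂ Icc 0 d, (φ w).re = c → w.re = c' := fun w hw h => by
      simpa [h, eq_comm, sub_eq_zero] using (hcl w hw).2.2.2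
    refine edge_limit (g := fun w => g (φ w)) (K := fun w => K (φ w)) h0' h1' hd0 (C := C)
      (hg.comp hφ.continuous.continuousOn fun w hw => ⟨(hcl w hw.1).1, fun hh => hw.2
        (ext (hre0 w hw.1 hh.1) ((hcl w hw.1).2.2.1 hh.2))⟩)
      (hg'.comp hφ.differentiableOn hop) (fun w hw hwc => ?_)
      (hK.comp hφ.continuous.continuousOn fun w hw =>
        ⟨(hcl w hw).1, fun hh => (hcl w hw).2.1 (congrArg im hh)⟩)
    rw [← Real.log_abs, ← (hcl w hw).2.2.2, Real.log_abs]
    exact hre _ (hcl w hw).1 (mt (hre0 w hw) hwc)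
  obtain ⟨A1, A2⟩ := aux (fun w => w + y0 * I) (by fun_prop) c h0 h1 (fun w hw => by
      simp [mem_reProdIm] at hw ⊢; grind) fun w hw => by simp [mem_reProdIm] at hw ⊢; grind
  obtain ⟨B1, B2⟩ := aux (fun w => ((x0 + x1 : ℝ) : ℂ) + y1 * I - w) (by fun_prop) (x0 + x1 - c)
    (by linarith) (by linarith) (fun w hw => by
      rw [show w.re - (x0 + x1 - c) = -((x0 + x1 - w.re) - c) by ring, abs_neg]
      simp [mem_reProdIm] at hw ⊢; grind) fun w hw => by simp [mem_reProdIm] at hw ⊢; grind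
  have eB : ∀ (f : ℂ → ℂ) (t : ℝ),
      ∫ u in x0..x1, f (((x0 + x1 : ℝ) : ℂ) + y1 * I - (u + t * I)) =
      ∫ u in x0..x1, f (u + ((y1 - t : ℝ) : ℂ) * I) := by
    intro f t
    have := intervalIntegral.integral_comp_sub_left (a := x0) (b := x1)
      (fun u : ℝ => f (u + ((y1 - t : ℝ) : ℂ) * I)) (x0 + x1)
    rw [add_sub_cancel_right, add_sub_cancel_left] at this
    rw [← this]
    refine intervalIntegral.integral_congr fun u _ => ?_
    congr 1
    push_cast; ring
  refine ⟨A1, ?_, ?_⟩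
  · have := B1.comp_sub_left (x0 + x1)
    rw [add_sub_cancel_left, add_sub_cancel_right] at this
    refine this.symm.congr fun u _ => ?_
    congr 1
    push_cast; ring
  · obtain ⟨he1, he2⟩ := rect_edges hp
    have hside : ∀ x : ℝ, x ≠ c → (∀ y ∈ Icc y0 y1, (x + y * I : ℂ) ∈ R \ {p}) →
        Tendsto (fun t : ℝ => ∫ y in (y0 + t)..(y1 - t), K (x + y * I) * g (x + y * I)) (𝓝[>] 0)
          (𝓝 (∫ y in y0..y1, K (x + y * I) * g (x + y * I))) := by
      intro x hxc hx
      have hfc : ContinuousOn (fun y : ℝ => K (x + y * I) * g (x + y * I)) (Icc y0 y1) :=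
        (continuousOn_vertical hK hx).mul (continuousOn_vertical hg fun y hy => ⟨(hx y hy).1,
          fun h => hxc (by simpa using h.1)⟩)
      set f : ℝ → ℂ := IccExtend hy ((Icc y0 y1).domRestrict fun y : ℝ => K (x + y * I) * g (x + y * I))
      have hf : Continuous f := (continuousOn_iff_continuous_domRestrict.1 hfc).Icc_extend'
      have hfe : ∀ y ∈ Icc y0 y1, f y = K (x + y * I) * g (x + y * I) := fun y hy' =>
        IccExtend_of_mem hy _ hy'
      have hi : ∀ a b, IntervalIntegrable f volume a b := fun a b => hf.intervalIntegrable a b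
      have hP : Continuous fun t : ℝ => ∫ y in (y0 + t)..(y1 - t), f y := by
        have := intervalIntegral.continuous_primitive hi y0
        rw [funext fun t : ℝ => (intervalIntegral.integral_interval_sub_left (hi y0 (y1 - t))
          (hi y0 (y0 + t))).symm]
        fun_prop
      have := (hP.tendsto 0).mono_left (nhdsWithin_le_nhds (s := Ioi 0))
      rw [add_zero, sub_zero, intervalIntegral.integral_congr fun y h => hfe y
        ((uIcc_of_le hy).subset h)] at this
      refine this.congr' ?_
      filter_upwards [Ioo_mem_nhdsGT hd0] with t ht
      refine intervalIntegral.integral_congr fun y h => hfe y ?_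
      rw [uIcc_of_le (by linarith [ht.2])] at h
      exact ⟨by linarith [h.1, ht.1], by linarith [h.2, ht.1]⟩
    have lim := ((A2.sub B2).add ((hside x1 h1.ne' fun y hy => (he2 y hy).2).const_mul I)).sub
      ((hside x0 h0.ne fun y hy => (he2 y hy).1).const_mul I)
    have hlim : Tendsto (fun t : ℝ => rectInt (fun w => K w * g w) x0 x1 (y0 + t) (y1 - t))
        (𝓝[>] 0) (𝓝 (rectInt (fun w => K w * g w) x0 x1 y0 y1)) := by
      have e0 := eB (fun w => K w * g w) 0
      simp only [ofReal_zero, zero_mul, add_zero, sub_zero] at e0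
      rw [e0] at lim
      refine lim.congr fun t => ?_
      rw [eB (fun w => K w * g w) t]
      unfold rectInt
      congr 3
      refine intervalIntegral.integral_congr fun u _ => ?_
      simp only
      congr 2 <;> push_cast <;> ring
    exact tendsto_nhds_unique hlim (tendsto_const_nhds.congr' (hres.mono fun t ht => ht.symm))

end

/-- The analogue of `rectInt_of_horizontal_singularity` for singularities on the vertical edges. -/
lemma rectInt_of_vertical_singularity {g K : ℂ → ℂ} {x0 x1 y0 y1 c C : ℝ} {p r : ℂ}
    (h0 : y0 < c) (h1 : c < y1) (hp : p ∈ Ioo x0 x1 ×ℂ Ioo y0 y1)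
    (hg : ContinuousOn g ((Icc x0 x1 ×ℂ Icc y0 y1) \ {w | w.im = c ∧ (w.re = x0 ∨ w.re = x1)}))
    (hg' : DifferentiableOn ℂ g (Ioo x0 x1 ×ℂ Ioo y0 y1))
    (hre : ∀ w ∈ Icc x0 x1 ×ℂ Icc y0 y1, w.im ≠ c →
      |(g w).re| ≤ C + |Real.log (w.im - c)|)
    (hK : ContinuousOn K ((Icc x0 x1 ×ℂ Icc y0 y1) \ {p}))
    (hres : ∀ᶠ t in 𝓝[>] (0 : ℝ), rectInt (fun w => K w * g w) (x0 + t) (x1 - t) y0 y1 = r) :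
    IntervalIntegrable (fun y : ℝ => g (x0 + y * I)) volume y0 y1 ∧
    IntervalIntegrable (fun y : ℝ => g (x1 + y * I)) volume y0 y1 ∧
    rectInt (fun w => K w * g w) x0 x1 y0 y1 = r := by
  have hcl : ∀ w ∈ Icc y0 y1 ×ℂ Icc (-x1) (-x0), I * w ∈ Icc x0 x1 ×ℂ Icc y0 y1 := fun w hw => by
    simp [mem_reProdIm] at hw ⊢; grind
  have hop : ∀ w ∈ Ioo y0 y1 ×ℂ Ioo (-x1) (-x0), I * w ∈ Ioo x0 x1 ×ℂ Ioo y0 y1 := fun w hw => by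
    simp [mem_reProdIm] at hw ⊢; grind
  obtain ⟨k1, k2, k3⟩ := rectInt_of_horizontal_singularity (g := fun w => g (I * w))
    (K := fun w => I * K (I * w)) (c := c) (C := C) (p := -I * p) (r := r) h0 h1
    (by simp [mem_reProdIm] at hp ⊢; grind)
    (hg.comp (by fun_prop) fun w hw => ⟨hcl w hw.1, fun hh => hw.2 (by simp at hh ⊢; grind)⟩)
    (hg'.comp (by fun_prop) hop)
    (fun w hw hwc => by simpa using hre (I * w) (hcl w hw) (by simpa using hwc))
    (continuousOn_const.mul (hK.comp (by fun_prop) fun w hw => ⟨hcl w hw.1, fun hh => hw.2 (by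
      rw [mem_singleton_iff, ← show I * w = p from hh, ← mul_assoc, neg_mul, I_mul_I]; ring)⟩))
    (by
      filter_upwards [hres] with t ht
      rw [← ht, rectInt_rotate _ (x0 + t), show -(x1 - t) = -x1 + t by ring,
        show -(x0 + t) = -x0 - t by ring]
      simp only [mul_assoc])
  have e : ∀ x y : ℝ, I * (y + ((-x : ℝ) : ℂ) * I) = x + y * I := fun x y => by
    push_cast; linear_combination (-x : ℂ) * I_mul_I
  refine ⟨by simpa only [e] using k2, by simpa only [e] using k1, ?_⟩
  rw [rectInt_rotate, ← k3]
  simp only [mul_assoc]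

/-! ### Logarithms on star-shaped sets -/

/-- A continuous function without zeros on a star-shaped set has a continuous logarithm: the
contraction to the centre lifts along the covering `exp`. -/
lemma exists_continuousOn_log {T : Set ℂ} {w0 : ℂ} (hw₀ : w0 ∈ T) (hT : StarConvex ℝ w0 T)
    {f : ℂ → ℂ} (hf : ContinuousOn f T) (hne : ∀ w ∈ T, f w ≠ 0) :
    ∃ L : ℂ → ℂ, ContinuousOn L T ∧ ∀ w ∈ T, exp (L w) = f w := by
  classical
  have hmem : ∀ (s : unitInterval) (w : T), w0 + (s : ℝ) • ((w : ℂ) - w0) ∈ T := fun s w => by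
    have := hT w.2 (sub_nonneg.2 s.2.2) s.2.1 (sub_add_cancel _ _)
    convert this using 1
    simp only [real_smul]; push_cast; ring
  let H : C(unitInterval × T, {z : ℂ // z ≠ 0}) :=
    ⟨fun x => ⟨f (w0 + (x.1 : ℝ) • ((x.2 : ℂ) - w0)), hne _ (hmem x.1 x.2)⟩, by
      refine Continuous.subtype_mk ?_ _
      have h1 : Continuous fun x : unitInterval × T =>
          (⟨w0 + (x.1 : ℝ) • ((x.2 : ℂ) - w0), hmem x.1 x.2⟩ : T) :=
        Continuous.subtype_mk (by fun_prop) _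
      exact (continuousOn_iff_continuous_domRestrict.1 hf).comp h1⟩
  have H0 : ∀ a : T, H (0, a) = (⟨_, (log (f w0)).exp_ne_zero⟩ : {z : ℂ // z ≠ 0}) := fun a => by
    apply Subtype.ext
    simp [H, exp_log (hne w0 hw₀)]
  let G := isCoveringMap_exp.liftHomotopy H (ContinuousMap.const T (log (f w0))) H0
  have hG := isCoveringMap_exp.liftHomotopy_lifts H
    (ContinuousMap.const T (log (f w0))) H0
  refine ⟨fun w => if h : w ∈ T then G (1, ⟨w, h⟩) else 0, ?_, ?_⟩
  · rw [continuousOn_iff_continuous_domRestrict]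
    have : Continuous fun w : T => G (1, w) := G.continuous.comp (by fun_prop)
    convert this using 1
    ext w
    simp [domRestrict]
  · intro w hw
    have := congrArg Subtype.val (congrFun hG (1, ⟨w, hw⟩))
    simp only [Function.comp_apply] at this
    simp only [hw, dif_pos]
    change exp (G (1, ⟨w, hw⟩)) = f w
    rw [show exp (G (1, ⟨w, hw⟩)) = _ from this]
    simp [H]

/-- A continuous logarithm of a holomorphic function is holomorphic. -/
lemma differentiableOn_of_exp_eq {U : Set ℂ} (hU : IsOpen U) {f L : ℂ → ℂ} (hL : ContinuousOn L U)
    (hf : DifferentiableOn ℂ f U) (he : ∀ w ∈ U, exp (L w) = f w) :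
    DifferentiableOn ℂ L U := by
  intro w hw
  refine DifferentiableAt.differentiableWithinAt ?_
  have hn := hU.mem_nhds hw
  have hfw : f w ≠ 0 := by rw [← he w hw]; exact exp_ne_zero _
  have hc : ContinuousAt L w := hL.continuousAt hn
  have hlim : Tendsto (fun v => (L v - L w).im) (𝓝 w) (𝓝 0) := by
    have := (continuous_im.tendsto _).comp (hc.tendsto.sub_const (L w))
    simpa [Function.comp_def] using this
  have hev : ∀ᶠ v in 𝓝 w, L v = log (f v / f w) + L w := by
    filter_upwards [hn, hlim.eventually_lt_const Real.pi_pos,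
      hlim.eventually_const_lt (neg_lt_zero.2 Real.pi_pos)] with v hv h1 h2
    rw [← he v hv, ← he w hw, ← exp_sub, log_exp h2 h1.le]
    ring
  refine DifferentiableAt.congr_of_eventuallyEq ?_ hev
  refine DifferentiableAt.add_const _ (DifferentiableAt.clog ?_ ?_)
  · exact (hf.differentiableAt hn).div_const _
  · rw [div_self hfw]; exact one_mem_slitPlane

/-- Two continuous logarithms on a preconnected set that agree in the limit are equal. -/
lemma eqOn_of_exp_eq {X : Type*} [TopologicalSpace X] {T : Set X} (hT : IsPreconnected T)
    {L1 L2 : X → ℂ} (h1 : ContinuousOn L1 T)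
    (h2 : ContinuousOn L2 T) (he : ∀ x ∈ T, exp (L1 x) = exp (L2 x))
    {l : Filter X} [l.NeBot] (hl : l ≤ 𝓟 T) (hlim : Tendsto (fun x => L1 x - L2 x) l (𝓝 0)) :
    EqOn L1 L2 T := by
  have hint : ∀ x ∈ T, ∃ n : ℤ, L1 x - L2 x = n * (2 * π * I) := fun x hx => by
    obtain ⟨n, hn⟩ := exp_eq_exp_iff_exists_int.1 (he x hx)
    exact ⟨n, by rw [hn]; ring⟩
  have hmaps : MapsTo (fun x => L1 x - L2 x) T
      (range fun n : ℤ => (n : ℂ) * (2 * π * I)) := fun x hx => by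
    obtain ⟨n, hn⟩ := hint x hx
    exact ⟨n, hn.symm⟩
  have hdisc : ∀ n : ℤ, ‖(n : ℂ) * (2 * π * I)‖ < 1 → n = 0 := fun n hn => by
    rw [norm_mul, norm_mul, norm_mul, norm_I, norm_real, norm_intCast,
      Real.norm_of_nonneg Real.pi_pos.le] at hn
    simp at hn
    have : |(n : ℝ)| < 1 := by
      by_contra hcon
      have := Real.pi_gt_three
      nlinarith
    exact Int.abs_lt_one_iff.1 (by exact_mod_cast this)
  -- the set where the two agree is relatively clopen
  have hconst : ∀ x ∈ T, ∀ y ∈ T, L1 x - L2 x = L1 y - L2 y := by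
    have hD : DiscreteTopology (range fun n : ℤ => (n : ℂ) * (2 * π * I)) := by
      have : DiscreteTopology (AddSubgroup.zmultiples (2 * π * I : ℂ)) :=
        NormedSpace.discreteTopology_zmultiples _
      have e : (range fun n : ℤ => (n : ℂ) * (2 * π * I)) =
          (AddSubgroup.zmultiples (2 * π * I : ℂ) : Set ℂ) := by
        ext w; simp [AddSubgroup.mem_zmultiples_iff]
      rw [e]; exact this
    intro x hx y hy
    exact hT.constant_of_mapsTo ⟨hD⟩ (h1.sub h2) hmaps hx hy
  intro x hx
  have hev := (hlim.eventually (Metric.ball_mem_nhds 0 one_pos)).and (le_principal_iff.1 hl)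
  obtain ⟨y, hy, hyT⟩ := hev.exists
  obtain ⟨n, hn⟩ := hint y hyT
  rw [dist_zero_right, hn] at hy
  have hn0 := hdisc n hy
  rw [hn0] at hn
  have := hconst x hx y hyT
  rw [hn] at this
  exact sub_eq_zero.1 (by simpa using this)

/-- A continuous logarithm of a function with a non-zero limit along `l` has a limit, if `l` has a
basis of preconnected sets. -/
lemma exists_tendsto_log {X : Type*} [TopologicalSpace X] {T : Set X} {f L : X → ℂ} {c : ℂ}
    (hL : ContinuousOn L T) (he : ∀ x ∈ T, exp (L x) = f x) {l : Filter X} [l.NeBot]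
    (hc : c ≠ 0) (hf : Tendsto f l (𝓝 c))
    (hb : ∀ s ∈ l, ∃ t ∈ l, t ⊆ s ∧ t ⊆ T ∧ IsPreconnected t) :
    ∃ m : ℂ, exp m = c ∧ Tendsto L l (𝓝 m) := by
  have hf1 : Tendsto (fun x => f x / c) l (𝓝 1) := by
    have := hf.div_const c
    rwa [div_self hc] at this
  have h1 : ∀ᶠ x in l, f x / c ∈ slitPlane :=
    hf1.eventually (isOpen_slitPlane.mem_nhds one_mem_slitPlane)
  obtain ⟨t, htl, hts, htT, htc⟩ := hb _ h1
  obtain ⟨x0, hx₀⟩ := Filter.nonempty_of_mem htl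
  have hlog : Tendsto (fun x => log (f x / c)) l (𝓝 0) := by
    have := hf1.clog one_mem_slitPlane
    simpa using this
  set m := L x0 - log (f x0 / c) with hm
  have hne : ∀ x ∈ T, f x ≠ 0 := fun x hx => by rw [← he x hx]; exact exp_ne_zero _
  have hexp : ∀ x ∈ T, exp (log (f x / c)) = f x / c := fun x hx =>
    exp_log (div_ne_zero (hne x hx) hc)
  have hem : exp m = c := by
    rw [hm, exp_sub, he _ (htT hx₀), hexp _ (htT hx₀)]
    have := hne _ (htT hx₀)
    field_simp
  have hfc : ContinuousOn f t := by
    refine ((continuous_exp.comp_continuousOn hL).mono htT).congr fun x hx => ?_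
    exact (he x (htT hx)).symm
  have heq : EqOn (fun x => L x - m) (fun x => log (f x / c)) t := by
    refine eqOn_of_exp_eq htc ((hL.mono htT).sub continuousOn_const)
      ((hfc.div_const c).clog fun x hx => hts hx) (fun x hx => ?_) (l := pure x0)
      (by rw [le_principal_iff]; exact hx₀) ?_
    · rw [exp_sub, hem, he x (htT hx), hexp x (htT hx)]
    · rw [tendsto_pure_left]
      intro s hs
      have : L x0 - m - log (f x0 / c) = 0 := by rw [hm]; ring
      rw [this]
      exact mem_of_mem_nhds hs
  refine ⟨m, hem, ?_⟩
  have := hlog.add_const m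
  rw [zero_add] at this
  refine this.congr' ?_
  filter_upwards [htl] with x hx
  have := heq hx
  simp only at this
  rw [← this]; ring

section

/-! ### Pairs of scattering coefficients and the removal of their zeros -/

/-- The properties shared by the pair `(s₁₁, s₂₂)` (with `β = δ`) and by the pair obtained from it
by dividing out the zeros: `F` lives on `D₊ ∪ Σ⁰` and `G` on `D₋ ∪ Σ⁰`. -/
structure ScatteringPair (κ β : ℝ) (F G : ℂ → ℂ) : Prop where
  continuousOn : ContinuousOn F (Ω κ)
  differentiableOn : DifferentiableOn ℂ F (upperDomain κ)
  tendsto_fst : Tendsto F (cocompact ℂ ⊓ 𝓟 (Ω κ)) (𝓝 1)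
  tendsto_snd : Tendsto G (cocompact ℂ ⊓ 𝓟 {z | -z ∈ Ω κ}) (𝓝 1)
  hat : ∀ z, -z ∈ Ω κ → F (κ / z) = β * G z
  map_conj : ∀ z ∈ Ω κ, F (-conj z) = conj (F z)
  bound : ∀ R, 0 ≤ R → ∃ C, ∀ z ∈ Ω κ ∩ annulus R, ‖F z‖ * ‖Λ κ z‖ ≤ C
  integrable : ∃ X > 0, ∫⁻ x in {x : ℝ | X ≤ |x|},
    ‖F x * G x - 1‖ₑ * ENNReal.ofReal (1 / |x|) < ⊤

/-- A scattering pair without zeros and spectral singularities. -/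
structure ZeroFreePair (κ β : ℝ) (F G : ℂ → ℂ) : Prop extends ScatteringPair κ β F G where
  ne_zero : ∀ z ∈ Ω κ, F z ≠ 0
  branch : ∀ b : ℂ, b ^ 2 = κ → ∃ c > 0, ∀ᶠ z in 𝓝[Ω κ] b, c ≤ ‖F z‖

variable {σ δ q0 qm t : ℝ} {q : ℝ → ℝ → ℝ} {z : ℂ} {κ β : ℝ}

lemma neg_mem_of_im_eq_zero (hz : z ∈ Ω κ) (h : (Λ κ z).im = 0) :
    -z ∈ Ω κ := by
  refine ⟨neg_ne_zero.2 hz.1, ?_, ?_⟩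
  · rw [Λ_neg]; exact neg_ne_zero.2 hz.2.1
  · rw [Λ_neg, neg_im, h, neg_zero]

lemma hat_mem_Ω (hκ : κ ≠ 0) (hz : -z ∈ Ω κ) : (κ : ℂ) / z ∈ Ω κ := by
  have h0 : z ≠ 0 := neg_ne_zero.1 hz.1
  have hκ' : (κ : ℂ) ≠ 0 := by exact_mod_cast hκ
  refine ⟨div_ne_zero hκ' h0, ?_, ?_⟩ <;> rw [Λ_hat hκ h0, ← Λ_neg]
  exacts [hz.2.1, hz.2.2]

lemma lintegral_lt_top_of_eq {f g : ℝ → ℂ}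
    (hg : ∃ X > 0, ∫⁻ x in {x : ℝ | X ≤ |x|}, ‖g x‖ₑ * ENNReal.ofReal (1 / |x|) < ⊤)
    (hfg : ∀ x : ℝ, (x : ℂ) ∈ Ω κ → -(x : ℂ) ∈ Ω κ → f x = g x) :
    ∃ X > 0, ∫⁻ x in {x : ℝ | X ≤ |x|}, ‖f x‖ₑ * ENNReal.ofReal (1 / |x|) < ⊤ := by
  obtain ⟨X, hX, hi⟩ := hg
  refine ⟨max X (1 + 2 * |κ|), lt_max_of_lt_left hX, lt_of_le_of_lt ((setLIntegral_mono'
    (measurableSet_le measurable_const continuous_abs.measurable) fun x hx => le_of_eq ?_).trans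
    (lintegral_mono_set fun x hx => (le_max_left X _).trans hx)) hi⟩
  have hx' : 1 + 2 * |κ| ≤ |x| := (le_max_right X _).trans hx
  have hz' := ofReal_mem_Ω (κ := κ) (x := -x) (by rwa [abs_neg])
  rw [hfg x (ofReal_mem_Ω hx') (by simpa using hz')]

/-- The scattering coefficients of the nonlocal equation form a scattering pair. -/
lemma scatteringPair (hσ : σ = 1 ∨ σ = -1) (hδ : δ = 1 ∨ δ = -1) (hq : 0 < q0)
    (hqm : |qm| = q0) (h : IsLinePotential σ δ q0 qm q t) :
    ScatteringPair (δ * σ * q0 ^ 2) δ (s11 σ δ q0 qm q t) (s22 σ δ q0 qm q t) := by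
  have hκ : δ * σ * q0 ^ 2 ≠ 0 := by
    rcases hσ with rfl | rfl <;> rcases hδ with rfl | rfl <;> simp [hq.ne']
  have hqm0 : qm ≠ 0 := fun h0 => by rw [h0, abs_zero] at hqm; exact hq.ne hqm
  have e11 := fun z hz => s11_eq (z := z) hδ h hz
  have e22 := fun z hz => s22_eq (z := z) h hz
  refine ⟨h.continuousOn_transCoef.congr e11,
    h.differentiableOn_transCoef.congr fun z hz => e11 z (upperDomain_subset hz), ?_, ?_, ?_, ?_, ?_, ?_⟩
  · refine h.tendsto_transCoef.congr' ?_
    filter_upwards [mem_inf_of_right (mem_principal_self _)] with z hz using (e11 z hz).symm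
  · have hneg : Tendsto (fun z : ℂ => -z)
        (cocompact ℂ ⊓ 𝓟 {z | -z ∈ Ω (δ * σ * q0 ^ 2)})
        (cocompact ℂ ⊓ 𝓟 (Ω (δ * σ * q0 ^ 2))) := by
      refine tendsto_inf.2 ⟨((Homeomorph.neg ℂ).isClosedEmbedding.tendsto_cocompact).mono_left
        inf_le_left, tendsto_principal.2 ?_⟩
      filter_upwards [mem_inf_of_right (mem_principal_self _)] with z hz using hz
    refine (h.swap.tendsto_transCoef.comp hneg).congr' ?_
    filter_upwards [mem_inf_of_right (mem_principal_self _)] with z hz using (e22 z hz).symm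
  · intro z hz
    rw [e11 _ (hat_mem_Ω hκ hz), e22 z hz, h.transCoef_hat hκ (neg_ne_zero.1 hz.1) hz]
    congr 1
    have hσ0 : (σ : ℂ) ≠ 0 := by rcases hσ with rfl | rfl <;> simp
    have hδ0 : (δ : ℂ) ≠ 0 := by rcases hδ with rfl | rfl <;> simp
    have hδ2 : (δ : ℂ) * δ = 1 := by rcases hδ with rfl | rfl <;> norm_num
    have hq' : (qm : ℂ) ≠ 0 := by exact_mod_cast hqm0
    push_cast
    field_simp
    linear_combination -hδ2
  · intro z hz
    rw [e11 _ (conj_mem_Ω hz), e11 z hz, h.transCoef_conj hz]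
  · intro R hR
    obtain ⟨C, hC⟩ := h.exists_bound_transNum hR
    refine ⟨C * R, fun z hz => ?_⟩
    have hl := norm_ne_zero_iff.2 hz.1.2.1
    have hz0 := norm_ne_zero_iff.2 hz.1.1
    rw [e11 z hz.1, transCoef, one_sub_div_sq hz.1.1, norm_div, norm_div, norm_mul, norm_ofNat,
      show ∀ n l w : ℝ, l ≠ 0 → w ≠ 0 → n / (2 * l / w) * l = n * (w / 2) from
        fun n l w h1 h2 => by field_simp, mul_comm, mul_comm C]
    · exact mul_le_mul (by linarith [hz.2.1, norm_nonneg z]) (hC z hz) (norm_nonneg _) hR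
    · exact hl
    · exact hz0
  · exact lintegral_lt_top_of_eq (lintegral_s12_mul_s21 hδ h) fun x hz hz' => by
      rw [← one_add_s12_mul_s21 hδ h hz hz', add_sub_cancel_left]

/-- The quotient of `F` by a function `Q` with simple zeros, filled in at the zeros of `Q`. -/
def fillQuot (F Q : ℂ → ℂ) (z : ℂ) : ℂ :=
  if Q z = 0 then deriv F z / deriv Q z else F z / Q z

lemma mul_fillQuot {F Q : ℂ → ℂ} (h : Q z = 0 → F z = 0) : Q z * fillQuot F Q z = F z := by
  unfold fillQuot
  split_ifs with h0
  · rw [h0, zero_mul, h h0]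
  · exact mul_div_cancel₀ _ h0

lemma differentiableAt_fillQuot {F Q : ℂ → ℂ} {U : Set ℂ} (hU : IsOpen U) (hF : DifferentiableOn ℂ F U)
    (hQ : Differentiable ℂ Q) (hz : z ∈ U) (h0 : Q z = 0 → F z = 0) (h1 : Q z = 0 → deriv Q z ≠ 0) :
    DifferentiableAt ℂ (fillQuot F Q) z := by
  by_cases hQz : Q z = 0
  · have hQd := (hQ z).hasDerivAt
    have hFd := (hF.differentiableAt (hU.mem_nhds hz)).hasDerivAt
    have hne : ∀ᶠ w in 𝓝[≠] z, Q w ≠ 0 := by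
      have := hQd.eventually_ne (c := 0) (h1 hQz)
      exact this
    refine AnalyticAt.differentiableAt
      (analyticAt_of_differentiable_on_punctured_nhds_of_continuousAt ?_ ?_)
    · have hU' : ∀ᶠ w in 𝓝[≠] z, ∀ᶠ v in 𝓝 w, v ∈ U :=
        nhdsWithin_le_nhds (eventually_eventually_nhds.2 (hU.mem_nhds hz))
      filter_upwards [hne, hU'] with w hw hwU
      have hev : ∀ᶠ v in 𝓝 w, fillQuot F Q v = F v / Q v := by
        filter_upwards [(hQ w).continuousAt.eventually_ne hw] with v hv
        rw [fillQuot, if_neg hv]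
      exact ((hF.differentiableAt hwU).div (hQ w) hw).congr_of_eventuallyEq hev
    · rw [continuousAt_iff_punctured_nhds]
      have hs := (hasDerivAt_iff_tendsto_slope.1 hFd).div (hasDerivAt_iff_tendsto_slope.1 hQd) (h1 hQz)
      have e : fillQuot F Q z = deriv F z / deriv Q z := by rw [fillQuot, if_pos hQz]
      rw [e]
      refine hs.congr' ?_
      filter_upwards [hne, self_mem_nhdsWithin] with w hw hwz
      have hwz' : w - z ≠ 0 := sub_ne_zero.2 hwz
      rw [Pi.div_apply, fillQuot, if_neg hw, slope_def_field, slope_def_field, hQz, h0 hQz, sub_zero, sub_zero,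
        div_div_div_cancel_right₀ hwz']
  · have hev : ∀ᶠ v in 𝓝 z, fillQuot F Q v = F v / Q v := by
      filter_upwards [(hQ z).continuousAt.eventually_ne hQz] with v hv
      rw [fillQuot, if_neg hv]
    exact ((hF.differentiableAt (hU.mem_nhds hz)).div (hQ z) hQz).congr_of_eventuallyEq hev

section Reduce

variable {ι : Type*} [Fintype ι]

/-- `∏ (z - η_n)`. -/
def zeroPoly (η : ι → ℂ) (z : ℂ) : ℂ := ∏ n, (z - η n)

/-- `∏ (z - η_n) / (z - κ / η_n)`. -/
def blaschke (κ : ℝ) (η : ι → ℂ) (z : ℂ) : ℂ := ∏ n, (z - η n) / (z - κ / η n)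

/-- The scattering coefficient `F` divided by the Blaschke product of its zeros. -/
def zeroFreePart (κ : ℝ) (η : ι → ℂ) (F : ℂ → ℂ) (z : ℂ) : ℂ :=
  fillQuot F (zeroPoly η) z * zeroPoly (fun n => κ / η n) z

lemma zeroPoly_eq_zero_iff {η : ι → ℂ} : zeroPoly η z = 0 ↔ ∃ n, z = η n := by
  simp [zeroPoly, Finset.prod_eq_zero_iff, sub_eq_zero]

lemma differentiable_zeroPoly (η : ι → ℂ) : Differentiable ℂ (zeroPoly η) := by
  unfold zeroPoly; fun_prop

lemma deriv_zeroPoly [DecidableEq ι] (η : ι → ℂ) (j : ι) :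
    deriv (zeroPoly η) (η j) = ∏ n ∈ Finset.univ.erase j, (η j - η n) := by
  have h : ∀ i ∈ Finset.univ, HasDerivAt (fun z : ℂ => z - η i) 1 (η j) := fun i _ =>
    (hasDerivAt_id _).sub_const _
  have := HasDerivAt.fun_finsetProd h
  have e : zeroPoly η = fun z => ∏ n, (z - η n) := rfl
  rw [e, this.deriv, Finset.sum_eq_single j]
  · simp
  · intro i _ hij
    rw [Finset.prod_eq_zero (i := j) (by simp [hij.symm]) (sub_self _), zero_smul]
  · simp

lemma deriv_zeroPoly_ne {η : ι → ℂ} (hη : Function.Injective η) (h : zeroPoly η z = 0) :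
    deriv (zeroPoly η) z ≠ 0 := by
  classical
  obtain ⟨j, rfl⟩ := zeroPoly_eq_zero_iff.1 h
  rw [deriv_zeroPoly]
  refine Finset.prod_ne_zero_iff.2 fun i hi => sub_ne_zero.2 fun h => ?_
  exact (Finset.ne_of_mem_erase hi) (hη h.symm)

lemma blaschke_hat (hκ : κ ≠ 0) {η : ι → ℂ} (hη : ∀ n, η n ≠ 0) (hz : z ≠ 0) :
    blaschke κ η (κ / z) = (∏ n, η n ^ 2 / κ) * ∏ n, (z - κ / η n) / (z - η n) := by
  have hκ' : (κ : ℂ) ≠ 0 := by exact_mod_cast hκ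
  rw [blaschke, ← Finset.prod_mul_distrib]
  refine Finset.prod_congr rfl fun n _ => ?_
  have h1 := hη n
  by_cases h : z = η n
  · rw [h, sub_self, div_zero, sub_self, div_zero, mul_zero]
  · have h2 : z - η n ≠ 0 := sub_ne_zero.2 h
    have h3 : (κ : ℂ) / z - κ / η n = -(κ * (z - η n) / (z * η n)) := by field_simp; ring
    rw [h3]
    have h4 : (κ : ℂ) / z - η n = -(η n * (z - κ / η n) / z) := by field_simp; ring
    rw [h4, neg_div_neg_eq]
    field_simp

lemma blaschke_conj {η : ι → ℂ} (e : ι ≃ ι) (he : ∀ n, η (e n) = -conj (η n)) :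
    blaschke κ η (-conj z) = conj (blaschke κ η z) := by
  rw [blaschke, blaschke, map_prod, ← Equiv.prod_comp e]
  refine Finset.prod_congr rfl fun n _ => ?_
  simp only [he, map_div₀, map_sub, conj_ofReal]
  rw [← neg_div_neg_eq]
  congr 1 <;> simp [div_neg] <;> ring

lemma tendsto_div_sub (a b : ℂ) : Tendsto (fun z : ℂ => (z - a) / (z - b)) (cocompact ℂ) (𝓝 1) := by
  have h3 := tendsto_inv₀_cobounded (α := ℂ)
  rw [Metric.cobounded_eq_cocompact] at h3
  have h4 := ((h3.const_mul a).const_sub 1).div ((h3.const_mul b).const_sub 1) (by simp)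
  simp only [mul_zero, sub_zero, div_one] at h4
  refine h4.congr' ?_
  filter_upwards [(isCompact_singleton (x := (0 : ℂ))).compl_mem_cocompact] with z hz
  have hz0 : z ≠ 0 := hz
  rw [Pi.div_apply]
  rw [show z - a = z * (1 - a * z⁻¹) by field_simp, show z - b = z * (1 - b * z⁻¹) by field_simp,
    mul_div_mul_left _ _ hz0]

lemma tendsto_prod_div_sub (a b : ι → ℂ) :
    Tendsto (fun z : ℂ => ∏ n, (z - a n) / (z - b n)) (cocompact ℂ) (𝓝 1) := by
  simpa only [Finset.prod_const_one] using
    tendsto_finsetProd Finset.univ fun n _ => tendsto_div_sub (a n) (b n)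

lemma tendsto_blaschke (κ : ℝ) (η : ι → ℂ) : Tendsto (blaschke κ η) (cocompact ℂ) (𝓝 1) :=
  tendsto_prod_div_sub η fun n => κ / η n

lemma blaschke_mul_inv {η : ι → ℂ} (hκ : κ ≠ 0)
    (hη : ∀ n, η n ∈ upperDomain κ) (hl : (Λ κ z).im = 0) : blaschke κ η z * ∏ n, (z - κ / η n) / (z - η n) = 1 := by
  rw [blaschke, ← Finset.prod_mul_distrib]
  refine Finset.prod_eq_one fun n _ => ?_
  have h1 : z - κ / η n ≠ 0 := fun h0 => (hη n).2.not_ge (by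
    rw [sub_eq_zero.1 h0] at hl; rw [Λ_hat hκ (hη n).1, neg_im, neg_eq_zero] at hl; exact hl.le)
  have h2 : z - η n ≠ 0 := sub_ne_zero.2 fun h2 => (hη n).2.ne' (h2 ▸ hl)
  field_simp

/-- A function on `Ω κ` that is bounded near every point of its closure other than `0` is
bounded on annuli. -/
lemma exists_bound_of_local {f : ℂ → ℝ} (hloc : ∀ x : ℂ, x ≠ 0 → 0 ≤ (Λ κ x).im →
    ∃ C, ∀ᶠ z in 𝓝[Ω κ] x, f z ≤ C) (R : ℝ) :
    ∃ C, ∀ z ∈ Ω κ ∩ annulus R, f z ≤ C := by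
  have hK : IsCompact (Metric.closedBall (0 : ℂ) R ∩ {z | 1 ≤ R * ‖z‖}) :=
    (isCompact_closedBall 0 R).inter_right (isClosed_le continuous_const (by fun_prop))
  have key : ∃ C, ∀ z ∈ Metric.closedBall (0 : ℂ) R ∩ {z | 1 ≤ R * ‖z‖}, z ∈ Ω κ →
      f z ≤ C := by
    refine hK.induction_on (p := fun s => ∃ C, ∀ z ∈ s, z ∈ Ω κ → f z ≤ C)
      ⟨0, fun z hz => absurd hz (notMem_empty z)⟩ ?_ ?_ ?_
    · rintro s u hsu ⟨C, hC⟩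
      exact ⟨C, fun z hz => hC z (hsu hz)⟩
    · rintro s u ⟨C, hC⟩ ⟨D, hD⟩
      exact ⟨max C D, fun z hz hj => hz.elim (fun hz => (hC z hz hj).trans (le_max_left _ _))
        fun hz => (hD z hz hj).trans (le_max_right _ _)⟩
    · intro x hx
      have hx0 : x ≠ 0 := by
        rintro rfl
        exact absurd hx.2 (by simp)
      obtain ⟨C, hC⟩ : ∃ C, ∀ᶠ z in 𝓝[Ω κ] x, f z ≤ C := by
        rcases le_or_gt 0 (Λ κ x).im with h | h
        · exact hloc x hx0 h
        · refine ⟨0, ?_⟩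
          have hc : ContinuousAt (fun z => (Λ κ z).im) x :=
            continuous_im.continuousAt.comp (differentiableAt_Λ hx0).continuousAt
          filter_upwards [nhdsWithin_le_nhds (hc.eventually_lt_const h), self_mem_nhdsWithin] with z h1 h2
          exact absurd h2.2.2 (not_le.2 h1)
      exact ⟨_, nhdsWithin_le_nhds (eventually_nhdsWithin_iff.1 hC), C, fun z hz => hz⟩
  obtain ⟨C, hC⟩ := key
  refine ⟨C, fun z hz => hC z ⟨by simpa using hz.2.1.le, ?_⟩ hz.1⟩
  have h0 : 0 < ‖z‖ := norm_pos_iff.2 hz.2.2.2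
  have := hz.2.2.1.le
  change 1 ≤ R * ‖z‖
  rwa [inv_le_iff_one_le_mul₀ h0] at this

lemma lam_eq_zero_of_sq (hκ : κ ≠ 0) {b : ℂ} (hb : b ^ 2 = κ) : b ≠ 0 ∧ Λ κ b = 0 := by
  have hκ' : (κ : ℂ) ≠ 0 := by exact_mod_cast hκ
  have hb0 : b ≠ 0 := by rintro rfl; exact hκ' (by rw [← hb]; ring)
  refine ⟨hb0, ?_⟩
  rw [Λ, ← hb]; field_simp; ring

/-- Dividing out the zeros of a scattering pair. -/
lemma ScatteringPair.zeroFreePair (hκ : κ ≠ 0) {δ : ℝ} (hδ : δ * δ = 1) {F G : ℂ → ℂ}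
    (h : ScatteringPair κ δ F G) {η : ι → ℂ} (hinj : Function.Injective η) (e : ι ≃ ι)
    (he : ∀ n, η (e n) = -conj (η n)) (hη : ∀ n, η n ∈ upperDomain κ)
    (hz0 : ∀ n, F (η n) = 0) (hall : ∀ z ∈ Ω κ, F z = 0 → ∃ n, z = η n)
    (hs : ∀ n, deriv F (η n) ≠ 0)
    (hbr : ∀ b : ℂ, b ^ 2 = κ → ∃ c > 0, ∀ᶠ z in 𝓝[Ω κ] b, c ≤ ‖F z‖)
    {B : ℝ} (hB : (B : ℂ) = ∏ n, η n ^ 2 / κ) :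
    ZeroFreePair κ (δ / B) (zeroFreePart κ η F)
        (fun z => zeroFreePart κ η F (κ / z) / ((δ / B : ℝ) : ℂ)) ∧
      (∀ z ∈ Ω κ, F z = zeroFreePart κ η F z * blaschke κ η z) ∧
      ∀ z, -z ∈ Ω κ → G z = zeroFreePart κ η F (κ / z) / ((δ / B : ℝ) : ℂ) *
        ∏ n, (z - κ / η n) / (z - η n) := by
  have hκ' : (κ : ℂ) ≠ 0 := by exact_mod_cast hκ
  have hδ0 : (δ : ℂ) ≠ 0 := ofReal_ne_zero.2 (left_ne_zero_of_mul (hδ.symm ▸ one_ne_zero))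
  have hB0 : (B : ℂ) ≠ 0 := by
    rw [hB]
    exact Finset.prod_ne_zero_iff.2 fun n _ => div_ne_zero (pow_ne_zero 2 (hη n).1) hκ'
  have hβ0 : ((δ / B : ℝ) : ℂ) ≠ 0 := by push_cast; exact div_ne_zero hδ0 hB0
  have hQF : ∀ z, zeroPoly η z = 0 → F z = 0 := fun z hz => by
    obtain ⟨n, rfl⟩ := zeroPoly_eq_zero_iff.1 hz
    exact hz0 n
  have hQhat : ∀ z : ℂ, z ≠ 0 → 0 ≤ (Λ κ z).im → zeroPoly (fun n => κ / η n) z ≠ 0 := by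
    intro z hz hl h0
    obtain ⟨n, rfl⟩ := zeroPoly_eq_zero_iff.1 h0
    rw [Λ_hat hκ (hη n).1, neg_im] at hl
    linarith [(hη n).2]
  have hQ0 : ∀ z : ℂ, (Λ κ z).im = 0 → zeroPoly η z ≠ 0 := by
    intro z hl h0
    obtain ⟨n, rfl⟩ := zeroPoly_eq_zero_iff.1 h0
    exact (hη n).2.ne' hl
  have hbl : ∀ z, blaschke κ η z = zeroPoly η z / zeroPoly (fun n => κ / η n) z := fun z =>
    Finset.prod_div_distrib _ _ 
  have hfac : ∀ z ∈ Ω κ, F z = zeroFreePart κ η F z * blaschke κ η z := by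
    intro z hz
    have := hQhat z hz.1 hz.2.2
    rw [hbl, zeroFreePart, mul_assoc, mul_div_cancel₀ _ this, mul_comm,
      mul_fillQuot (hQF z)]
  have hquot : ∀ z, zeroPoly η z ≠ 0 → zeroFreePart κ η F z = F z / blaschke κ η z := by
    intro z hz
    rw [hbl, zeroFreePart, fillQuot, if_neg hz, div_div_eq_mul_div, div_mul_eq_mul_div]
  have hdiff : ∀ z ∈ upperDomain κ, DifferentiableAt ℂ (zeroFreePart κ η F) z := fun z hz =>
    (differentiableAt_fillQuot isOpen_upperDomain h.differentiableOn (differentiable_zeroPoly η) hz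
      (hQF z) (deriv_zeroPoly_ne hinj)).mul (differentiable_zeroPoly _ z)
  have hblc : ∀ z : ℂ, z ≠ 0 → 0 ≤ (Λ κ z).im → ContinuousAt (blaschke κ η) z := by
    intro z hz hl
    have := (differentiable_zeroPoly η z).continuousAt.div
      (differentiable_zeroPoly (fun n => κ / η n) z).continuousAt (hQhat z hz hl)
    exact this.congr (.of_forall fun w => (hbl w).symm)
  have hblne : ∀ z : ℂ, z ≠ 0 → (Λ κ z).im = 0 → blaschke κ η z ≠ 0 := fun z hz hl => by
    rw [hbl]; exact div_ne_zero (hQ0 z hl) (hQhat z hz hl.ge)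
  have hev : ∀ z : ℂ, (Λ κ z).im = 0 →
      ∀ᶠ w in 𝓝 z, zeroFreePart κ η F w = F w / blaschke κ η w := fun z hl => by
    filter_upwards [(differentiable_zeroPoly η z).continuousAt.eventually_ne (hQ0 z hl)] with w hw
      using hquot w hw
  have hcont : ContinuousOn (zeroFreePart κ η F) (Ω κ) := by
    intro z hz
    rcases hz.2.2.lt_or_eq with hl | hl
    · exact (hdiff z ⟨hz.1, hl⟩).continuousAt.continuousWithinAt
    · have h1 := (h.continuousOn z hz).div (hblc z hz.1 hl.le).continuousWithinAt
        (hblne z hz.1 hl.symm)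
      exact h1.congr_of_eventuallyEq (nhdsWithin_le_nhds (hev z hl.symm)) (hev z hl.symm).self_of_nhds
  have hne : ∀ z ∈ Ω κ, zeroFreePart κ η F z ≠ 0 := by
    intro z hz
    refine mul_ne_zero ?_ (hQhat z hz.1 hz.2.2)
    unfold fillQuot
    split_ifs with h0
    · obtain ⟨n, rfl⟩ := zeroPoly_eq_zero_iff.1 h0
      exact div_ne_zero (hs n) (deriv_zeroPoly_ne hinj h0)
    · exact div_ne_zero (fun h1 => h0 (zeroPoly_eq_zero_iff.2 (hall z hz h1))) h0
  have hsnd : ∀ z, -z ∈ Ω κ → G z = zeroFreePart κ η F (κ / z) / ((δ / B : ℝ) : ℂ) *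
        ∏ n, (z - κ / η n) / (z - η n) := by
    intro z hz
    have h1 := h.hat z hz
    rw [hfac _ (hat_mem_Ω hκ hz), blaschke_hat hκ (fun n => (hη n).1)
      (neg_ne_zero.1 hz.1), ← hB] at h1
    push_cast
    field_simp
    linear_combination -h1
  refine ⟨⟨⟨hcont, fun z hz => (hdiff z hz).differentiableWithinAt, ?_, ?_, ?_, ?_, ?_, ?_⟩, hne, ?_⟩,
    hfac, hsnd⟩
  · have := h.tendsto_fst.div ((tendsto_blaschke κ η).mono_left inf_le_left) one_ne_zero
    rw [div_one] at this
    refine this.congr' ?_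
    have h1 := (((tendsto_blaschke κ η).eventually_ne one_ne_zero).filter_mono
      (inf_le_left : cocompact ℂ ⊓ 𝓟 (Ω κ) ≤ _))
    filter_upwards [h1] with z hz
    refine (hquot z fun h0 => hz ?_).symm
    rw [hbl, h0, zero_div]
  · have ht := tendsto_prod_div_sub (fun n => (κ : ℂ) / η n) η
    have := h.tendsto_snd.div (ht.mono_left inf_le_left) one_ne_zero
    rw [div_one] at this
    refine this.congr' ?_
    have h1 := ((ht.eventually_ne one_ne_zero).filter_mono
      (inf_le_left : cocompact ℂ ⊓ 𝓟 {z | -z ∈ Ω κ} ≤ _))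
    filter_upwards [h1, mem_inf_of_right (mem_principal_self _)] with z hz hz'
    rw [Pi.div_apply, hsnd z hz', mul_div_cancel_right₀ _ hz]
  · intro z _
    rw [mul_div_cancel₀ _ hβ0]
  · intro z hz
    have hgen : ∀ z ∈ Ω κ, zeroPoly η z ≠ 0 → zeroFreePart κ η F (-conj z) =
        conj (zeroFreePart κ η F z) := by
      intro z hz h0
      have h1 : zeroPoly η (-conj z) ≠ 0 := by
        intro h1
        obtain ⟨n, hn⟩ := zeroPoly_eq_zero_iff.1 h1
        refine h0 (zeroPoly_eq_zero_iff.2 ⟨e n, ?_⟩)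
        rw [he, ← hn]; simp
      rw [hquot _ h0, hquot _ h1, h.map_conj z hz, blaschke_conj e he, map_div₀]
    rcases hz.2.2.lt_or_eq with hl | hl
    · have hd := hdiff z ⟨hz.1, hl⟩
      have hz' := conj_mem_Ω hz
      have hd' := hdiff (-conj z) ⟨hz'.1, by rw [Λ_conj]; simpa using hl⟩
      refine tendsto_nhds_unique ((ContinuousAt.comp (f := fun w : ℂ => -conj w) hd'.continuousAt
        continuous_conj.neg.continuousAt).tendsto.mono_left (nhdsWithin_le_nhds (s := {z}ᶜ)))
        (((continuous_conj.continuousAt.comp hd.continuousAt).tendsto.mono_left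
          nhdsWithin_le_nhds).congr' ?_)
      have hnz : ∀ᶠ w in 𝓝[≠] z, zeroPoly η w ≠ 0 := by
        by_cases h0 : zeroPoly η z = 0
        · exact ((differentiable_zeroPoly η z).hasDerivAt).eventually_ne (deriv_zeroPoly_ne hinj h0)
        · exact nhdsWithin_le_nhds ((differentiable_zeroPoly η z).continuousAt.eventually_ne h0)
      filter_upwards [hnz, nhdsWithin_le_nhds (isOpen_upperDomain.mem_nhds ⟨hz.1, hl⟩)] with w h1 h2
      exact (hgen w (upperDomain_subset h2) h1).symm
    · exact hgen z hz (hQ0 z hl.symm)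
  · intro R _
    refine exists_bound_of_local (f := fun z => ‖zeroFreePart κ η F z‖ * ‖Λ κ z‖) ?_ R
    intro x hx hl
    by_cases hx' : x ∈ Ω κ
    · have hc : ContinuousWithinAt (fun z => ‖zeroFreePart κ η F z‖ * ‖Λ κ z‖) (Ω κ) x :=
        (hcont x hx').norm.mul (differentiableAt_Λ hx).continuousAt.norm.continuousWithinAt
      exact ⟨_, (hc.eventually_lt_const (lt_add_one _)).mono fun z hz => hz.le⟩
    · have hlz : Λ κ x = 0 := by
        by_contra h0
        exact hx' ⟨hx, h0, hl⟩
      have hli : (Λ κ x).im = 0 := by rw [hlz]; rfl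
      obtain ⟨R', hR', hxR'⟩ := exists_mem_annulus hx
      obtain ⟨C, hC⟩ := h.bound R' hR'
      have hb := hblne x hx hli
      have hbc := (hblc x hx hl).norm.eventually_const_lt (half_lt_self (norm_pos_iff.2 hb))
      refine ⟨C / (‖blaschke κ η x‖ / 2), ?_⟩
      filter_upwards [self_mem_nhdsWithin, nhdsWithin_le_nhds ((isOpen_annulus R').mem_nhds hxR'),
        nhdsWithin_le_nhds hbc, nhdsWithin_le_nhds (hev x hli)] with z h1 h2 h3 h4
      have hpos : 0 < ‖blaschke κ η x‖ / 2 := half_pos (norm_pos_iff.2 hb)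
      rw [h4, norm_div, div_mul_eq_mul_div]
      have h5 := hC z ⟨h1, h2⟩
      exact div_le_div₀ ((by positivity : (0 : ℝ) ≤ _).trans h5) h5 hpos h3.le
  · refine lintegral_lt_top_of_eq (κ := κ) h.integrable fun x hz hz' => ?_
    have hl : (Λ κ x).im = 0 :=
      le_antisymm (neg_nonneg.1 (by rw [← neg_im, ← Λ_neg]; exact hz'.2.2)) hz.2.2
    rw [hfac _ hz, hsnd _ hz']
    linear_combination (-(zeroFreePart κ η F x * (zeroFreePart κ η F (κ / x) / ((δ / B : ℝ) : ℂ)))) *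
      blaschke_mul_inv hκ hη hl
  · intro b hb
    obtain ⟨hb0, hlb⟩ := lam_eq_zero_of_sq hκ hb
    have hli : (Λ κ b).im = 0 := by rw [hlb]; rfl
    obtain ⟨c, hc, hev'⟩ := hbr b hb
    have hbn := hblne b hb0 hli
    have hb1 := (hblc b hb0 hli.ge).norm.eventually_lt_const (lt_add_one _)
    refine ⟨c / (‖blaschke κ η b‖ + 1), by positivity, ?_⟩
    filter_upwards [hev', nhdsWithin_le_nhds hb1, nhdsWithin_le_nhds (hev b hli),
      nhdsWithin_le_nhds ((hblc b hb0 hli.ge).eventually_ne hbn)] with z h1 h2 h3 h4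
    rw [h3, norm_div]
    exact div_le_div₀ (norm_nonneg _) h1 (norm_pos_iff.2 h4) h2.le

end Reduce

end

section

/-! ### Logarithms on half-strips and the Cauchy kernel in exponential coordinates -/

lemma starConvex_diff {S P : Set ℂ} {w0 : ℂ} (hS : Convex ℝ S) (hw₀ : w0 ∈ interior S)
    (hP : Disjoint P (interior S)) : StarConvex ℝ w0 (S \ P) := by
  intro x hx a b ha hb hab
  rcases ha.eq_or_lt with h | h
  · have : b = 1 := by linarith
    rw [← h, this]; simpa using hx
  · have := hS.combo_interior_self_mem_interior hw₀ hx.1 h hb hab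
    exact ⟨interior_subset this, fun hp => disjoint_left.1 hP hp this⟩

/-- The filter `Re w → l` inside the horizontal strip `y0 ≤ Im w ≤ y1`. -/
def stripEnd (l : Filter ℝ) (y0 y1 : ℝ) : Filter ℂ := comap re l ⊓ 𝓟 {w | w.im ∈ Icc y0 y1}

lemma mem_stripEnd {l : Filter ℝ} {y0 y1 : ℝ} {s : Set ℝ} (hs : s ∈ l) :
    s ×ℂ Icc y0 y1 ∈ stripEnd l y0 y1 :=
  inter_mem_inf (preimage_mem_comap hs) (mem_principal_self _)

lemma stripEnd_atTop_basis {y0 y1 : ℝ} {s : Set ℂ} (hs : s ∈ stripEnd atTop y0 y1) :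
    ∃ A : ℝ, 0 ≤ A ∧ Ioi A ×ℂ Icc y0 y1 ⊆ s := by
  rw [stripEnd, mem_inf_principal] at hs
  obtain ⟨u, hu, hus⟩ := mem_comap.1 hs
  obtain ⟨A, hA⟩ := mem_atTop_sets.1 hu
  exact ⟨max A 0, le_max_right _ _, fun w hw => hus (hA _ ((le_max_left _ _).trans hw.1.le)) hw.2⟩

lemma stripEnd_atBot_basis {y0 y1 : ℝ} {s : Set ℂ} (hs : s ∈ stripEnd atBot y0 y1) :
    ∃ A : ℝ, A ≤ 0 ∧ Iio A ×ℂ Icc y0 y1 ⊆ s := by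
  rw [stripEnd, mem_inf_principal] at hs
  obtain ⟨u, hu, hus⟩ := mem_comap.1 hs
  obtain ⟨A, hA⟩ := mem_atBot_sets.1 hu
  exact ⟨min A 0, min_le_right _ _, fun w hw => hus (hA _ (hw.1.le.trans (min_le_left _ _))) hw.2⟩

lemma isPreconnected_reProdIm {s t : Set ℝ} (hs : Convex ℝ s) (ht : Convex ℝ t) :
    IsPreconnected (s ×ℂ t) := ((hs.is_linear_preimage reLm.isLinear).inter
    (ht.is_linear_preimage imLm.isLinear)).isPreconnected

lemma tendsto_line {l : Filter ℝ} {y0 y1 y : ℝ} (hy : y ∈ Icc y0 y1) :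
    Tendsto (fun u : ℝ => (u + y * I : ℂ)) l (stripEnd l y0 y1) := by
  refine tendsto_inf.2 ⟨tendsto_comap_iff.2 ?_, tendsto_principal.2 (.of_forall fun u => ?_)⟩
  · have : (re ∘ fun u : ℝ => (u + y * I : ℂ)) = id := by ext u; simp
    rw [this]; exact tendsto_id
  · simpa using hy

lemma stripEnd_neBot {l : Filter ℝ} [l.NeBot] {y0 y1 : ℝ} (hy : y0 ≤ y1) : (stripEnd l y0 y1).NeBot :=
  (tendsto_line (l := l) (y := y0) ⟨le_rfl, hy⟩).neBot

lemma stripEnd_atTop_preconnected {y0 y1 : ℝ} {T : Set ℂ}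
    (hT : Ioi 0 ×ℂ Icc y0 y1 ⊆ T) :
    ∀ s ∈ stripEnd atTop y0 y1, ∃ t ∈ stripEnd atTop y0 y1, t ⊆ s ∧ t ⊆ T ∧ IsPreconnected t :=
  fun s hs => by
  obtain ⟨A, hA, h⟩ := stripEnd_atTop_basis hs
  exact ⟨_, mem_stripEnd (Ioi_mem_atTop A), h, fun w hw => hT ⟨hA.trans_lt hw.1, hw.2⟩,
    isPreconnected_reProdIm (convex_Ioi A) (convex_Icc _ _)⟩

lemma stripEnd_atBot_preconnected {y0 y1 : ℝ} {T : Set ℂ}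
    (hT : Iio 0 ×ℂ Icc y0 y1 ⊆ T) :
    ∀ s ∈ stripEnd atBot y0 y1, ∃ t ∈ stripEnd atBot y0 y1, t ⊆ s ∧ t ⊆ T ∧ IsPreconnected t :=
  fun s hs => by
  obtain ⟨A, hA, h⟩ := stripEnd_atBot_basis hs
  exact ⟨_, mem_stripEnd (Iio_mem_atBot A), h, fun w hw => hT ⟨lt_of_lt_of_le hw.1 hA, hw.2⟩,
    isPreconnected_reProdIm (convex_Iio A) (convex_Icc _ _)⟩

/-- The logarithm of a function without zeros on a convex set that contains the end of a strip,
normalised at `+∞`; finitely many boundary points may be left out. -/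
lemma exists_stripLog {S P : Set ℂ} {w0 : ℂ} {y0 y1 : ℝ} (hy : y0 ≤ y1) (hS : Convex ℝ S)
    (hw₀ : w0 ∈ interior S) (hP : Disjoint P (interior S))
    (hT : Ioi 0 ×ℂ Icc y0 y1 ⊆ S \ P) {f : ℂ → ℂ} (hf : ContinuousOn f (S \ P))
    (hne : ∀ w ∈ S \ P, f w ≠ 0) (hd : DifferentiableOn ℂ f (interior S))
    (hlim : Tendsto f (stripEnd atTop y0 y1) (𝓝 1)) :
    ∃ H : ℂ → ℂ, ContinuousOn H (S \ P) ∧ (∀ w ∈ S \ P, exp (H w) = f w) ∧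
      DifferentiableOn ℂ H (interior S) ∧ Tendsto H (stripEnd atTop y0 y1) (𝓝 0) := by
  have hint : interior S ⊆ S \ P := fun w hw =>
    ⟨interior_subset hw, fun hp => disjoint_left.1 hP hp hw⟩
  obtain ⟨L, hL, he⟩ := exists_continuousOn_log (hint hw₀) (starConvex_diff hS hw₀ hP) hf hne
  have := stripEnd_neBot (l := atTop) hy
  obtain ⟨m, hm, hlim'⟩ := exists_tendsto_log hL he one_ne_zero hlim (stripEnd_atTop_preconnected hT)
  have he' : ∀ w ∈ S \ P, exp (L w - m) = f w := fun w hw => by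
    rw [exp_sub, hm, div_one, he w hw]
  have hc : ContinuousOn (fun w => L w - m) (S \ P) := hL.sub continuousOn_const
  refine ⟨fun w => L w - m, hc, he', ?_, ?_⟩
  · exact differentiableOn_of_exp_eq isOpen_interior (hc.mono hint) hd fun w hw => he' w (hint hw)
  · simpa using hlim'.sub_const m

lemma tendsto_side {f : ℂ → ℂ} {y0 y1 : ℝ} {l : Filter ℝ} {c : ℂ} (hy : y0 ≤ y1)
    (hf : Tendsto f (stripEnd l y0 y1) (𝓝 c))
    (hc : ∀ᶠ x : ℝ in l, ContinuousOn (fun y : ℝ => f (x + y * I)) (Icc y0 y1)) :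
    Tendsto (fun x : ℝ => ∫ y in y0..y1, f (x + y * I)) l (𝓝 ((y1 - y0 : ℝ) * c)) := by
  rw [Metric.tendsto_nhds]
  intro ε hε
  have h0 : 0 < y1 - y0 + 1 := by linarith
  have h1 := hf.eventually (Metric.ball_mem_nhds c (div_pos hε h0))
  rw [stripEnd, eventually_inf_principal, eventually_comap] at h1
  filter_upwards [h1, hc] with x hx hxc
  have hi : IntervalIntegrable (fun y : ℝ => f (x + y * I)) volume y0 y1 :=
    hxc.intervalIntegrable_of_Icc hy
  have e : (∫ y in y0..y1, f (x + y * I)) - (y1 - y0 : ℝ) * c = ∫ y in y0..y1, (f (x + y * I) - c) := by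
    rw [intervalIntegral.integral_sub hi intervalIntegrable_const, intervalIntegral.integral_const,
      real_smul]
  rw [dist_eq_norm, e]
  have := intervalIntegral.norm_integral_le_of_norm_le_const (a := y0) (b := y1)
    (f := fun y : ℝ => f (x + y * I) - c) (C := ε / (y1 - y0 + 1)) fun y hy' => by
      rw [uIoc_of_le hy] at hy'
      have := hx (x + y * I) (by simp) (by simpa using ⟨hy'.1.le, hy'.2⟩)
      rw [← dist_eq_norm]; exact this.le
  refine this.trans_lt ?_
  rw [abs_of_nonneg (by linarith), div_mul_eq_mul_div, div_lt_iff₀ h0]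
  nlinarith

variable {q0 : ℝ} {z : ℂ}

lemma norm_expMul (hq : 0 < q0) (w : ℂ) : ‖(q0 : ℂ) * exp w‖ = q0 * Real.exp w.re := by
  rw [norm_mul, norm_real, Real.norm_of_nonneg hq.le, norm_exp]

lemma tendsto_expMul_atTop (hq : 0 < q0) (y0 y1 : ℝ) :
    Tendsto (fun w : ℂ => (q0 : ℂ) * exp w) (stripEnd atTop y0 y1) (cocompact ℂ) := by
  rw [← Metric.cobounded_eq_cocompact, ← tendsto_norm_atTop_iff_cobounded]
  simp only [norm_expMul hq]
  exact ((Real.tendsto_exp_atTop.comp tendsto_comap).const_mul_atTop hq).mono_left inf_le_left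

lemma tendsto_expMul_atBot (hq : 0 < q0) (y0 y1 : ℝ) :
    Tendsto (fun w : ℂ => (q0 : ℂ) * exp w) (stripEnd atBot y0 y1) (𝓝 0) := by
  rw [tendsto_zero_iff_norm_tendsto_zero]
  simp only [norm_expMul hq]
  have := (Real.tendsto_exp_atBot.comp (tendsto_comap (f := re))).const_mul q0
  rw [mul_zero] at this
  exact this.mono_left inf_le_left

lemma tendsto_expK_atTop (hq : 0 < q0) (y0 y1 : ℝ) :
    Tendsto (expK q0 z) (stripEnd atTop y0 y1) (𝓝 1) := by
  have := (tendsto_div_sub 0 z).comp (tendsto_expMul_atTop hq y0 y1)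
  refine this.congr fun w => ?_
  simp [expK]

lemma expK_zero (hq : 0 < q0) (w : ℂ) : expK q0 0 w = 1 := by
  have : (q0 : ℂ) ≠ 0 := by exact_mod_cast hq.ne'
  rw [expK, sub_zero, div_self (mul_ne_zero this (exp_ne_zero _))]

open Classical in
lemma tendsto_expK_atBot (hq : 0 < q0) (z : ℂ) (y0 y1 : ℝ) :
    Tendsto (expK q0 z) (stripEnd atBot y0 y1) (𝓝 (if z = 0 then 1 else 0)) := by
  split_ifs with h
  · rw [h]
    exact tendsto_const_nhds.congr fun w => (expK_zero hq w).symm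
  · have h1 := tendsto_expMul_atBot hq y0 y1
    have := h1.div (h1.sub_const z) (by simpa using h)
    rwa [zero_div] at this

/-- The kernel is bounded on the two real half-lines. -/
lemma norm_expK_le {u : ℝ} {y : ℂ} (hy : exp y = 1 ∨ exp y = -1)
    (hq : 0 < q0) (hz : z.im ≠ 0 ∨ z = 0) : ‖expK q0 z (u + y)‖ ≤ 1 + ‖z‖ / |z.im| := by
  rcases hz with hz | rfl
  · obtain ⟨x, hx⟩ : ∃ x : ℝ, (q0 : ℂ) * exp (u + y) = x := by
      rw [exp_add]
      rcases hy with h | h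
      · exact ⟨q0 * Real.exp u, by rw [h]; push_cast; ring⟩
      · exact ⟨-(q0 * Real.exp u), by rw [h]; push_cast; ring⟩
    rw [expK, hx]
    have h1 : |z.im| ≤ ‖(x : ℂ) - z‖ := by
      have := abs_im_le_norm ((x : ℂ) - z)
      simpa using this
    have h2 : 0 < |z.im| := abs_pos.2 hz
    have h3 : (x : ℂ) - z ≠ 0 := norm_pos_iff.1 (h2.trans_le h1)
    have e : (x : ℂ) / (x - z) = 1 + z / (x - z) := by field_simp; ring
    rw [e]
    refine (norm_add_le _ _).trans ?_
    rw [norm_one, norm_div]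
    gcongr
  · rw [expK_zero hq]; simp

lemma expK_ne {w : ℂ} (hz : (q0 : ℂ) * exp w ≠ z) : ContinuousAt (expK q0 z) w := by
  unfold expK
  exact ContinuousAt.div (by fun_prop) (by fun_prop) (sub_ne_zero.2 hz)

/-- The substitution `x = s q0 e^u`, `s = ±1`, on a half-line. -/
lemma integral_expMul (hq : 0 < q0) {s : ℝ} (hs : s = 1 ∨ s = -1) {A : Set ℝ} (hA : MeasurableSet A)
    (ℓ : ℂ → ℂ) (z : ℂ) :
    (IntegrableOn (fun x : ℝ => ℓ x / (x - z)) ((fun u => s * (q0 * Real.exp u)) '' A) ↔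
      IntegrableOn (fun u : ℝ => (s * (q0 * Real.exp u) : ℂ) / (s * (q0 * Real.exp u) - z) *
        ℓ (s * (q0 * Real.exp u) : ℂ)) A) ∧
    ∫ x in (fun u => s * (q0 * Real.exp u)) '' A, ℓ x / (x - z) =
      s * ∫ u in A, (s * (q0 * Real.exp u) : ℂ) / (s * (q0 * Real.exp u) - z) *
        ℓ (s * (q0 * Real.exp u) : ℂ) := by
  have hs0 : s ≠ 0 := by rcases hs with rfl | rfl <;> norm_num
  have hss : (s : ℂ) * s = 1 := by rcases hs with rfl | rfl <;> norm_num
  have hd : ∀ u ∈ A, HasDerivWithinAt (fun u => s * (q0 * Real.exp u)) (s * (q0 * Real.exp u)) A u :=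
    fun u _ => (((Real.hasDerivAt_exp u).const_mul q0).const_mul s).hasDerivWithinAt
  have hinj : InjOn (fun u => s * (q0 * Real.exp u)) A := fun u _ v _ h =>
    Real.exp_injective (mul_left_cancel₀ hq.ne' (mul_left_cancel₀ hs0 h))
  have habs : ∀ u : ℝ, |s * (q0 * Real.exp u)| = q0 * Real.exp u := fun u => by
    rw [abs_mul, abs_of_pos (mul_pos hq (Real.exp_pos u))]
    rcases hs with rfl | rfl <;> simp
  have e : ∀ u : ℝ, |s * (q0 * Real.exp u)| • (ℓ ((s * (q0 * Real.exp u) : ℝ) : ℂ) /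
      (((s * (q0 * Real.exp u) : ℝ) : ℂ) - z)) = s * ((s * (q0 * Real.exp u) : ℂ) /
        (s * (q0 * Real.exp u) - z) * ℓ (s * (q0 * Real.exp u) : ℂ)) := fun u => by
    rw [habs, real_smul]
    push_cast
    linear_combination (-(q0 * exp u) / (s * (q0 * exp u) - z) *
      ℓ (s * (q0 * exp u) : ℂ)) * hss
  constructor
  · rw [integrableOn_image_iff_integrableOn_abs_deriv_smul hA hd hinj]
    simp only [e]
    exact ⟨fun h => by
      have := h.const_mul (s : ℂ)
      simp only [← mul_assoc, hss, one_mul] at this ⊢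
      exact this, fun h => h.const_mul _⟩
  · rw [integral_image_eq_integral_abs_deriv_smul hA hd hinj]
    simp only [e]
    rw [integral_const_mul]

/-- A logarithm that tends to `0` inherits integrability from its exponential. -/
lemma eventually_norm_le_exp_sub_one {ρ : ℝ → ℂ} {l : Filter ℝ} (hlim : Tendsto ρ l (𝓝 0)) :
    ∀ᶠ u in l, ‖ρ u‖ ≤ 2 * ‖exp (ρ u) - 1‖ := by
  filter_upwards [hlim.norm.eventually_lt_const (show ‖(0 : ℂ)‖ < 1 / 2 by norm_num)] with u hu
  have h1 := norm_exp_sub_one_sub_id_le (x := ρ u) (by linarith)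
  have h2 : ‖ρ u‖ ≤ ‖exp (ρ u) - 1‖ + ‖exp (ρ u) - 1 - ρ u‖ := by
    have := norm_sub_le (exp (ρ u) - 1) (exp (ρ u) - 1 - ρ u)
    simpa using this
  nlinarith [norm_nonneg (ρ u)]

end

section

variable {q0 κ β : ℝ} {z : ℂ} {F G : ℂ → ℂ}

/-- The two situations in which the boundary integral of `g dζ / (ζ - z)` is computed: `z` is an
interior point, with coordinate `p`, or it is not in the closed rectangle. -/
def IsResidue (q0 : ℝ) (z : ℂ) (g : ℂ → ℂ) (x0 x1 y0 y1 : ℝ) (r : ℂ) : Prop :=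
  (∃ p ∈ Ioo x0 x1 ×ℂ Ioo y0 y1, z = q0 * exp p ∧ r = 2 * π * I * g p) ∨
  ((∀ w ∈ Icc x0 x1 ×ℂ Icc y0 y1, (q0 : ℂ) * exp w ≠ z) ∧ r = 0)

lemma eventually_Ioo_shrink {x0 x1 x : ℝ} (h : x ∈ Ioo x0 x1) :
    ∀ᶠ t in 𝓝[>] (0 : ℝ), 0 < t ∧ x ∈ Ioo (x0 + t) (x1 - t) := by
  have h1 : ∀ᶠ t in 𝓝 (0 : ℝ), x0 + t < x := by
    have : Tendsto (fun t : ℝ => x0 + t) (𝓝 0) (𝓝 (x0 + 0)) := tendsto_id.const_add _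
    exact this.eventually_lt_const (by simpa using h.1)
  have h2 : ∀ᶠ t in 𝓝 (0 : ℝ), x < x1 - t := by
    have : Tendsto (fun t : ℝ => x1 - t) (𝓝 0) (𝓝 (x1 - 0)) := tendsto_id.const_sub _
    exact this.eventually_const_lt (by simpa using h.2)
  filter_upwards [self_mem_nhdsWithin, nhdsWithin_le_nhds h1, nhdsWithin_le_nhds h2] with t h1 h2 h3
    using ⟨h1, h2, h3⟩

lemma continuousAt_expK {w p : ℂ} {x0 x1 y0 y1 : ℝ} (hq : 0 < q0) (hy : y1 - y0 < 2 * π)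
    (hp : p.im ∈ Ioo y0 y1) (hw : w ∈ Icc x0 x1 ×ℂ Icc y0 y1) (hne : w ≠ p) :
    ContinuousAt (expK q0 (q0 * exp p)) w := by
  refine expK_ne fun h => hne ?_
  have h1 := mul_left_cancel₀ (by exact_mod_cast hq.ne' : (q0 : ℂ) ≠ 0) h
  obtain ⟨n, hn⟩ := exp_eq_exp_iff_exists_int.1 h1
  have him : w.im = p.im + n * (2 * π) := by
    have := congrArg im hn
    simpa [mul_im, mul_re] using this
  have hn0 : n = 0 := by
    have hlt : |(n : ℝ) * (2 * π)| < 2 * π := by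
      rw [show (n : ℝ) * (2 * π) = w.im - p.im by linarith, abs_lt]
      constructor <;> linarith [hw.2.1, hw.2.2, hp.1, hp.2]
    rw [abs_mul, abs_of_pos Real.two_pi_pos] at hlt
    have : |(n : ℝ)| < 1 := by
      by_contra hcon
      nlinarith [Real.pi_pos]
    exact Int.abs_lt_one_iff.1 (by exact_mod_cast this)
  rw [hn, hn0]; simp

lemma rectInt_kernel_vertical {g : ℂ → ℂ} {x0 x1 y0 y1 c C : ℝ} {r : ℂ} (hq : 0 < q0) (hx : x0 < x1)
    (h0 : y0 < c) (h1 : c < y1) (hy : y1 - y0 < 2 * π)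
    (hg : ContinuousOn g ((Icc x0 x1 ×ℂ Icc y0 y1) \ {w | w.im = c ∧ (w.re = x0 ∨ w.re = x1)}))
    (hg' : DifferentiableOn ℂ g (Ioo x0 x1 ×ℂ Ioo y0 y1))
    (hre : ∀ w ∈ Icc x0 x1 ×ℂ Icc y0 y1, w.im ≠ c →
      |(g w).re| ≤ C + |Real.log (w.im - c)|)
    (hr : IsResidue q0 z g x0 x1 y0 y1 r) :
    IntervalIntegrable (fun y : ℝ => g (x0 + y * I)) volume y0 y1 ∧
    IntervalIntegrable (fun y : ℝ => g (x1 + y * I)) volume y0 y1 ∧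
    rectInt (fun w => expK q0 z w * g w) x0 x1 y0 y1 = r := by
  have hcl : ∀ t : ℝ, 0 < t → Icc (x0 + t) (x1 - t) ×ℂ Icc y0 y1 ⊆
      (Icc x0 x1 ×ℂ Icc y0 y1) \ {w | w.im = c ∧ (w.re = x0 ∨ w.re = x1)} := by
    intro t ht w hw
    obtain ⟨w1, w2⟩ := hw.1
    refine ⟨⟨⟨by linarith, by linarith⟩, hw.2⟩, ?_⟩
    rintro ⟨-, h | h⟩ <;> linarith
  have hop : ∀ t : ℝ, 0 < t → Ioo (x0 + t) (x1 - t) ×ℂ Ioo y0 y1 ⊆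
      Ioo x0 x1 ×ℂ Ioo y0 y1 := fun t ht w hw =>
    ⟨⟨by linarith [hw.1.1], by linarith [hw.1.2]⟩, hw.2⟩
  rcases hr with ⟨p, hp, rfl, rfl⟩ | ⟨hz, rfl⟩
  · refine rectInt_of_vertical_singularity h0 h1 hp hg hg' hre (fun w hw =>
      (continuousAt_expK hq hy hp.2 hw.1 hw.2).continuousWithinAt) ?_
    filter_upwards [eventually_Ioo_shrink hp.1] with t ht
    exact rectInt_expK hq ⟨ht.2, hp.2⟩ hy (hg.mono (hcl t ht.1)) (hg'.mono (hop t ht.1))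
  · have hm : (x0 + x1) / 2 ∈ Ioo x0 x1 := ⟨by linarith, by linarith⟩
    refine rectInt_of_vertical_singularity (p := ⟨(x0 + x1) / 2, c⟩) h0 h1 ⟨hm, h0, h1⟩ hg hg' hre
      (fun w hw => (expK_ne (hz w hw.1)).continuousWithinAt) ?_
    filter_upwards [eventually_Ioo_shrink hm] with t ht
    exact rectInt_expK_eq_zero (ht.2.1.trans ht.2.2).le (h0.trans h1).le
      (fun w hw => hz w (hcl t ht.1 hw).1) (hg.mono (hcl t ht.1)) (hg'.mono (hop t ht.1))

lemma rectInt_kernel_horizontal {g : ℂ → ℂ} {x0 x1 y0 y1 c C : ℝ} {r : ℂ} (hq : 0 < q0)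
    (h0 : x0 < c) (h1 : c < x1) (hy' : y0 < y1) (hy : y1 - y0 < 2 * π)
    (hg : ContinuousOn g ((Icc x0 x1 ×ℂ Icc y0 y1) \ {w | w.re = c ∧ (w.im = y0 ∨ w.im = y1)}))
    (hg' : DifferentiableOn ℂ g (Ioo x0 x1 ×ℂ Ioo y0 y1))
    (hre : ∀ w ∈ Icc x0 x1 ×ℂ Icc y0 y1, w.re ≠ c →
      |(g w).re| ≤ C + |Real.log (w.re - c)|)
    (hr : IsResidue q0 z g x0 x1 y0 y1 r) :
    IntervalIntegrable (fun u : ℝ => g (u + y0 * I)) volume x0 x1 ∧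
    IntervalIntegrable (fun u : ℝ => g (u + y1 * I)) volume x0 x1 ∧
    rectInt (fun w => expK q0 z w * g w) x0 x1 y0 y1 = r := by
  have hcl : ∀ t : ℝ, 0 < t → Icc x0 x1 ×ℂ Icc (y0 + t) (y1 - t) ⊆
      (Icc x0 x1 ×ℂ Icc y0 y1) \ {w | w.re = c ∧ (w.im = y0 ∨ w.im = y1)} := by
    intro t ht w hw
    obtain ⟨w1, w2⟩ := hw.2
    refine ⟨⟨hw.1, ⟨by linarith, by linarith⟩⟩, ?_⟩
    rintro ⟨-, h | h⟩ <;> linarith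
  have hop : ∀ t : ℝ, 0 < t → Ioo x0 x1 ×ℂ Ioo (y0 + t) (y1 - t) ⊆
      Ioo x0 x1 ×ℂ Ioo y0 y1 := fun t ht w hw =>
    ⟨hw.1, ⟨by linarith [hw.2.1], by linarith [hw.2.2]⟩⟩
  rcases hr with ⟨p, hp, rfl, rfl⟩ | ⟨hz, rfl⟩
  · refine rectInt_of_horizontal_singularity h0 h1 hp hg hg' hre (fun w hw =>
      (continuousAt_expK hq hy hp.2 hw.1 hw.2).continuousWithinAt) ?_
    filter_upwards [eventually_Ioo_shrink hp.2] with t ht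
    exact rectInt_expK hq ⟨hp.1, ht.2⟩ (by linarith) (hg.mono (hcl t ht.1))
      (hg'.mono (hop t ht.1))
  · have hm : (y0 + y1) / 2 ∈ Ioo y0 y1 := ⟨by linarith, by linarith⟩
    refine rectInt_of_horizontal_singularity (p := ⟨c, (y0 + y1) / 2⟩) h0 h1 ⟨⟨h0, h1⟩, hm⟩ hg hg' hre
      (fun w hw => (expK_ne (hz w hw.1)).continuousWithinAt) ?_
    filter_upwards [eventually_Ioo_shrink hm] with t ht
    exact rectInt_expK_eq_zero (h0.trans h1).le (ht.2.1.trans ht.2.2).le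
      (fun w hw => hz w (hcl t ht.1 hw).1) (hg.mono (hcl t ht.1)) (hg'.mono (hop t ht.1))

/-! ### Zero-free scattering pairs -/

lemma Λ_im (z : ℂ) : (Λ κ z).im = z.im * (1 + κ / ‖z‖ ^ 2) / 2 := by
  have : (Λ κ z) = ((z - (κ : ℂ) / z) * ((1 / 2 : ℝ) : ℂ)) := by
    unfold Λ; push_cast; ring
  rw [this, im_mul_ofReal, sub_im, div_im, ofReal_im,
    ofReal_re, normSq_eq_norm_sq]
  ring

lemma ofReal_mem {x : ℝ} (h0 : x ≠ 0) (h1 : x ^ 2 ≠ κ) :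
    (x : ℂ) ∈ Ω κ ∧ -(x : ℂ) ∈ Ω κ := by
  have hx : (x : ℂ) ≠ 0 := by exact_mod_cast h0
  have him : (Λ κ (x : ℂ)).im = 0 := by rw [Λ_im]; simp
  have hm : (x : ℂ) ∈ Ω κ := by
    refine ⟨hx, fun h => h1 ?_, him.ge⟩
    rw [Λ, div_eq_zero_iff, sub_eq_zero] at h
    rcases h with h | h
    · rw [eq_div_iff hx, ← sq] at h
      exact_mod_cast h
    · norm_num at h
  exact ⟨hm, neg_mem_of_im_eq_zero hm him⟩

lemma ScatteringPair.mul_hat (h : ScatteringPair κ β F G) (hκ : κ ≠ 0) (hβ : β ≠ 0)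
    (h1 : z ∈ Ω κ) (h2 : -z ∈ Ω κ) :
    F (κ / z) * G (κ / z) = F z * G z := by
  have hκ' : (κ : ℂ) ≠ 0 := by exact_mod_cast hκ
  have hβ' : (β : ℂ) ≠ 0 := by exact_mod_cast hβ
  have e1 := h.hat z h2
  have e2 := h.hat (κ / z) (by
    have := hat_mem_Ω (z := -z) hκ (by rwa [neg_neg])
    rwa [div_neg] at this)
  rw [div_div_cancel₀ hκ'] at e2
  rw [e1, e2]; ring

/-- The logarithm of `F G` is integrable along the real axis with respect to `dx / x`. -/
lemma ScatteringPair.integrable_log (h : ScatteringPair κ β F G) (hβ : β ≠ 0) (hq : 0 < q0) {ε : ℝ}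
    (hε : ε = 1 ∨ ε = -1) (hκ : κ = ε * q0 ^ 2) {s : ℝ} (hs : s = 1 ∨ s = -1) {ρ : ℝ → ℂ}
    (hexp : ∀ u ≠ 0, exp (ρ u) = F (s * (q0 * Real.exp u) : ℝ) * G (s * (q0 * Real.exp u) : ℝ))
    (hT : Tendsto ρ atTop (𝓝 0)) (hB : Tendsto ρ atBot (𝓝 0))
    (hloc : ∀ R, 0 < R → IntervalIntegrable ρ volume (-R) R) : Integrable ρ := by
  have hκ0 : κ ≠ 0 := by rcases hε with rfl | rfl <;> simp [hκ, hq.ne']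
  obtain ⟨X, hX, hi⟩ := h.integrable
  set Ψ : ℝ → ENNReal := fun x => ‖F x * G x - 1‖ₑ with hΨ
  set U := max 1 (Real.log (X / q0)) with hU
  have hfin : ∀ s : ℝ, (s = 1 ∨ s = -1) → ∫⁻ u in Ioi U, Ψ (s * (q0 * Real.exp u)) < ⊤ := by
    intro s hs
    have hs0 : s ≠ 0 := by rcases hs with rfl | rfl <;> norm_num
    have habs : ∀ u : ℝ, |s * (q0 * Real.exp u)| = q0 * Real.exp u := fun u => by
      rw [abs_mul, abs_of_pos (mul_pos hq (Real.exp_pos u))]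
      rcases hs with rfl | rfl <;> simp
    have hd : ∀ u ∈ Ioi U, HasDerivWithinAt (fun u => s * (q0 * Real.exp u))
        (s * (q0 * Real.exp u)) (Ioi U) u :=
      fun u _ => (((Real.hasDerivAt_exp u).const_mul q0).const_mul s).hasDerivWithinAt
    have hinj : InjOn (fun u => s * (q0 * Real.exp u)) (Ioi U) := fun u _ v _ h =>
      Real.exp_injective (mul_left_cancel₀ hq.ne' (mul_left_cancel₀ hs0 h))
    have := lintegral_image_eq_lintegral_abs_deriv_mul measurableSet_Ioi hd hinj
      (fun x => Ψ x * ENNReal.ofReal (1 / |x|))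
    have e : ∀ u : ℝ, ENNReal.ofReal |s * (q0 * Real.exp u)| * (Ψ (s * (q0 * Real.exp u)) *
        ENNReal.ofReal (1 / |s * (q0 * Real.exp u)|)) = Ψ (s * (q0 * Real.exp u)) := fun u => by
      rw [mul_left_comm, ← ENNReal.ofReal_mul (abs_nonneg _), habs,
        mul_one_div_cancel (mul_pos hq (Real.exp_pos u)).ne', ENNReal.ofReal_one, mul_one]
    simp only [e] at this
    rw [← this]
    refine lt_of_le_of_lt (lintegral_mono_set ?_) hi
    rintro _ ⟨u, hu, rfl⟩
    change X ≤ |s * (q0 * Real.exp u)|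
    rw [habs]
    have h1 : Real.log (X / q0) ≤ u := (le_max_right _ _).trans (le_of_lt hu)
    have h2 := Real.exp_le_exp.2 h1
    rw [Real.exp_log (div_pos hX hq), div_le_iff₀ hq] at h2
    linarith
  have hU0 : 0 < U := lt_max_of_lt_left one_pos
  have hsym : ∀ u : ℝ, u ≠ 0 → Ψ (s * (q0 * Real.exp (-u))) = Ψ ((s * ε) * (q0 * Real.exp u)) := by
    intro u hu
    have hx0 : s * (q0 * Real.exp (-u)) ≠ 0 := mul_ne_zero
      (by rcases hs with rfl | rfl <;> norm_num) (mul_pos hq (Real.exp_pos _)).ne'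
    have hx1 : (s * (q0 * Real.exp (-u))) ^ 2 ≠ κ := by
      have hss : s ^ 2 = 1 := by rcases hs with rfl | rfl <;> norm_num
      rw [hκ, mul_pow, mul_pow, hss, one_mul, mul_comm]
      intro h
      have h2 := mul_right_cancel₀ (pow_ne_zero 2 hq.ne') h
      rw [← Real.exp_nat_mul] at h2
      rcases hε with rfl | rfl
      · rw [Real.exp_eq_one_iff] at h2
        push_cast at h2
        exact hu (by linarith)
      · linarith [Real.exp_pos ((2 : ℕ) * -u)]
    obtain ⟨m1, m2⟩ := ofReal_mem hx0 hx1
    have e : ((s * ε * (q0 * Real.exp u) : ℝ) : ℂ) = κ / ((s * (q0 * Real.exp (-u)) : ℝ) : ℂ) := by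
      rw [← ofReal_div]
      congr 1
      rw [eq_div_iff hx0, hκ]
      have h1 : Real.exp u * Real.exp (-u) = 1 := by rw [← Real.exp_add]; simp
      have hss : s * s = 1 := by rcases hs with rfl | rfl <;> norm_num
      linear_combination (s * s * ε * q0 ^ 2) * h1 + ε * q0 ^ 2 * hss
    simp only [hΨ]
    rw [e, h.mul_hat hκ0 hβ m1 m2]
  have hm : AEStronglyMeasurable ρ volume := by
    have : (volume : Measure ℝ) = volume.restrict (⋃ n : ℕ, Ioc (-((n : ℝ) + 1)) (n + 1)) := by
      rw [show (⋃ n : ℕ, Ioc (-((n : ℝ) + 1)) (n + 1)) = univ from ?_, Measure.restrict_univ]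
      refine eq_univ_of_forall fun x => mem_iUnion.2 ?_
      obtain ⟨n, hn⟩ := exists_nat_gt |x|
      exact ⟨n, by linarith [neg_abs_le x], by linarith [le_abs_self x]⟩
    rw [this]
    refine (aestronglyMeasurable_iUnion_iff).2 fun n => ?_
    have := (hloc (n + 1) (by positivity)).1
    exact this.aestronglyMeasurable
  -- the two ends
  have hend : ∀ {l : Filter ℝ}, Tendsto ρ l (𝓝 0) → ∀ᶠ u in l, u ≠ 0 →
      ‖ρ u‖ₑ ≤ 2 * Ψ (s * (q0 * Real.exp u)) := fun {l} hl => by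
    filter_upwards [eventually_norm_le_exp_sub_one hl] with u hu hu0
    rw [hexp u hu0] at hu
    rw [hΨ]
    simp only
    rw [← ofReal_norm, ← ofReal_norm, show (2 : ENNReal) = ENNReal.ofReal 2 by simp,
      ← ENNReal.ofReal_mul zero_le_two]
    exact ENNReal.ofReal_le_ofReal hu
  obtain ⟨A, hA⟩ := eventually_atTop.1 (hend hT)
  obtain ⟨A', hA'⟩ := eventually_atBot.1 (hend hB)
  set R := max U (max A (-A')) with hR
  have hR0 : 0 < R := lt_max_of_lt_left hU0
  have hRU : U ≤ R := le_max_left _ _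
  have hRA : A ≤ R := (le_max_left _ _).trans (le_max_right _ _)
  have hRA' : -A' ≤ R := (le_max_right _ _).trans (le_max_right _ _)
  have i1 : IntegrableOn ρ (Ioi R) := by
    refine ⟨hm.restrict, ?_⟩
    refine lt_of_le_of_lt (setLIntegral_mono' measurableSet_Ioi fun u hu =>
      hA u (hRA.trans (le_of_lt hu)) (hR0.trans hu).ne') ?_
    rw [lintegral_const_mul' _ _ (by norm_num)]
    exact ENNReal.mul_lt_top (by norm_num)
      ((lintegral_mono_set (Ioi_subset_Ioi hRU)).trans_lt (hfin s hs))
  have i2 : IntegrableOn ρ (Iic (-R)) := by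
    refine ⟨hm.restrict, ?_⟩
    refine lt_of_le_of_lt (setLIntegral_mono' measurableSet_Iic fun u hu =>
      hA' u (by linarith [show u ≤ -R from hu]) (by
        have : u ≤ -R := hu
        linarith : u < 0).ne) ?_
    rw [lintegral_const_mul' _ _ (by norm_num)]
    refine ENNReal.mul_lt_top (by norm_num) ?_
    rw [← (Measure.measurePreserving_neg (volume : Measure ℝ)).setLIntegral_comp_preimage_emb
      (Homeomorph.neg ℝ).measurableEmbedding]
    have e : (Neg.neg : ℝ → ℝ) ⁻¹' Iic (-R) = Ici R := by ext x; simp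
    rw [e, setLIntegral_congr Ioi_ae_eq_Ici.symm]
    refine lt_of_le_of_lt (setLIntegral_mono' measurableSet_Ioi fun u hu =>
      (hsym u (hR0.trans hu).ne').le) ?_
    have hsε : s * ε = 1 ∨ s * ε = -1 := by
      rcases hs with rfl | rfl <;> rcases hε with rfl | rfl <;> norm_num
    exact (lintegral_mono_set (Ioi_subset_Ioi hRU)).trans_lt (hfin _ hsε)
  have i3 : IntegrableOn ρ (Ioc (-R) R) := (hloc R hR0).1
  have := (i2.union i3).union i1
  rwa [Iic_union_Ioc_eq_Iic (by linarith), Iic_union_Ioi, integrableOn_univ] at this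

/-- `log |F|` is bounded on annuli up to the logarithmic singularities at the branch points. -/
lemma ZeroFreePair.exists_log_bound (h : ZeroFreePair κ β F G) {R : ℝ} (hR : 0 ≤ R) :
    ∃ C, ∀ z ∈ Ω κ ∩ annulus R, ∀ m, 0 < m → m ≤ ‖Λ κ z‖ →
      |Real.log ‖F z‖| ≤ C + |Real.log m| := by
  obtain ⟨C1, hC₁⟩ := exists_bound_of_local (κ := κ) (f := fun z => ‖F z‖⁻¹) (fun x hx hl => by
    by_cases hx' : x ∈ Ω κ
    · have hc : ContinuousWithinAt (fun z => ‖F z‖⁻¹) (Ω κ) x :=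
        (h.continuousOn x hx').norm.inv₀ (norm_ne_zero_iff.2 (h.ne_zero x hx'))
      exact ⟨_, (hc.eventually_lt_const (lt_add_one _)).mono fun z hz => hz.le⟩
    · have hlz : Λ κ x = 0 := by
        by_contra h0
        exact hx' ⟨hx, h0, hl⟩
      have hb : x ^ 2 = κ := by
        rw [Λ, div_eq_zero_iff, sub_eq_zero, eq_div_iff hx] at hlz
        rcases hlz with h | h
        · rw [sq, h]
        · norm_num at h
      obtain ⟨c, hc, hev⟩ := h.branch x hb
      exact ⟨c⁻¹, hev.mono fun z hz => inv_anti₀ hc hz⟩) R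
  obtain ⟨C2, hC₂⟩ := h.bound R hR
  refine ⟨|Real.log C1| + |Real.log C2|, fun z hz m hm hml => ?_⟩
  have hF : 0 < ‖F z‖ := norm_pos_iff.2 (h.ne_zero z hz.1)
  have hl : 0 < ‖Λ κ z‖ := hm.trans_le hml
  have h1 := Real.log_le_log (inv_pos.2 hF) (hC₁ z hz)
  rw [Real.log_inv] at h1
  have h2 := Real.log_le_log (mul_pos hF hl) (hC₂ z hz)
  rw [Real.log_mul hF.ne' hl.ne'] at h2
  have h3 := Real.log_le_log hm hml
  have := le_abs_self (Real.log C1)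
  have := le_abs_self (Real.log C2)
  have := neg_abs_le (Real.log m)
  rw [abs_le]
  constructor <;> linarith [abs_nonneg (Real.log C1), abs_nonneg (Real.log C2), abs_nonneg (Real.log m)]

end

section

/-! ### Logarithmic branches on the continuous spectrum -/

/-- A branch on `Σ` of the logarithm of a general function `f`, normalised as in `IsLogBranch`. -/
structure IsBranch (σ δ q0 : ℝ) (f ℓ : ℂ → ℂ) : Prop where
  exp_eq : ∀ ζ ∈ Sig0 σ δ q0, exp (ℓ ζ) = f ζ
  continuousOn : ContinuousOn ℓ (Sig0 σ δ q0 \ {(q0 : ℂ), -(q0 : ℂ)})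
  tendsto_infty : Tendsto ℓ (cocompact ℂ ⊓ 𝓟 (Sig σ δ q0)) (𝓝 0)
  tendsto_zero : Tendsto ℓ (𝓝[Sig σ δ q0] 0) (𝓝 0)
  circle : δ * σ = -1 → ∃ c : ℝ, ∀ ζ ∈ Sig0 σ δ q0, ‖ζ‖ = q0 →
    (0 < ζ.im → (ℓ ζ).im = c) ∧ (ζ.im < 0 → (ℓ ζ).im = -c)

variable {σ δ q0 κ : ℝ} {z : ℂ} {f ℓ : ℂ → ℂ} {s y : ℝ}

lemma expMul_line (hy : exp (y * I) = s) (u : ℝ) :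
    (q0 : ℂ) * exp (u + y * I) = ((s * (q0 * Real.exp u) : ℝ) : ℂ) := by
  rw [exp_add, hy]; push_cast; ring

/-- The substitution `x = s q0 e^u`, `s = e^{iy} = ±1`, on subsets of the half-lines. -/
lemma line_integral (hq : 0 < q0) (hs : s = 1 ∨ s = -1) (hy : exp (y * I) = s) {A B : Set ℝ}
    (hA : MeasurableSet A) (hB : ∀ x ∈ B, 0 < s * x) (hAB : ∀ u, s * (q0 * Real.exp u) ∈ B ↔ u ∈ A)
    (ℓ : ℂ → ℂ) (z : ℂ) :
    (IntegrableOn (fun x : ℝ => ℓ x / (x - z)) B ↔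
      IntegrableOn (fun u : ℝ => expK q0 z (u + y * I) * ℓ (q0 * exp (u + y * I))) A) ∧
    ∫ x in B, ℓ x / (x - z) =
      s * ∫ u in A, expK q0 z (u + y * I) * ℓ (q0 * exp (u + y * I)) := by
  have himg : (fun u => s * (q0 * Real.exp u)) '' A = B := by
    ext x
    refine ⟨fun ⟨u, hu, h⟩ => h ▸ (hAB u).2 hu, fun hx => ?_⟩
    have hpos := div_pos (hB x hx) hq
    have e : s * (q0 * Real.exp (Real.log (s * x / q0))) = x := by
      rw [Real.exp_log hpos, mul_div_cancel₀ _ hq.ne', ← mul_assoc]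
      rcases hs with rfl | rfl <;> norm_num
    exact ⟨_, (hAB _).1 (e.symm ▸ hx), e⟩
  have e : ∀ u : ℝ, expK q0 z (u + y * I) * ℓ (q0 * exp (u + y * I)) =
      (s * (q0 * Real.exp u) : ℂ) / (s * (q0 * Real.exp u) - z) *
        ℓ (s * (q0 * Real.exp u) : ℂ) := fun u => by
    rw [expK, expMul_line hy]; push_cast; ring
  simp only [e]
  rw [← himg]
  exact integral_expMul hq hs hA ℓ z

lemma expMul_line_ne (hq : 0 < q0) (hs : s = 1 ∨ s = -1) (hy : exp (y * I) = s)
    (hz : z.im ≠ 0 ∨ z = 0) (u : ℝ) : (q0 : ℂ) * exp (u + y * I) ≠ z := by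
  rw [expMul_line hy]
  have h0 : s * (q0 * Real.exp u) ≠ 0 := mul_ne_zero
    (by rcases hs with rfl | rfl <;> norm_num) (mul_pos hq (Real.exp_pos _)).ne'
  rintro rfl
  rcases hz with h | h
  · exact h (ofReal_im _)
  · exact h0 (by exact_mod_cast h)

lemma continuous_expK_line (hq : 0 < q0) (hs : s = 1 ∨ s = -1) (hy : exp (y * I) = s)
    (hz : z.im ≠ 0 ∨ z = 0) : Continuous fun u : ℝ => expK q0 z (u + y * I) :=
  continuous_iff_continuousAt.2 fun u =>
    ContinuousAt.comp (g := expK q0 z) (expK_ne (expMul_line_ne hq hs hy hz u)) (by fun_prop)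

lemma integrable_expK_mul (hq : 0 < q0) (hs : s = 1 ∨ s = -1) (hy : exp (y * I) = s)
    (hz : z.im ≠ 0 ∨ z = 0) {ρ : ℝ → ℂ} (hρ : Integrable ρ) :
    Integrable fun u : ℝ => expK q0 z (u + y * I) * ρ u := by
  refine hρ.bdd_mul (c := 1 + ‖z‖ / |z.im|) (continuous_expK_line hq hs hy hz).aestronglyMeasurable
    (.of_forall fun u => ?_)
  exact norm_expK_le (by rw [hy]; rcases hs with rfl | rfl <;> simp) hq hz

lemma expMul_mem_Sig (hq : 0 < q0) (hs : s = 1 ∨ s = -1) (hy : exp (y * I) = s) (u : ℝ) :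
    (q0 : ℂ) * exp (u + y * I) ∈ Sig σ δ q0 := by
  refine Or.inl ⟨by rw [expMul_line hy, ofReal_im], expMul_line_ne hq hs hy (Or.inr rfl) u⟩

lemma sq_line (hs : s = 1 ∨ s = -1) (u : ℝ) :
    (s * (q0 * Real.exp u)) ^ 2 = q0 ^ 2 * Real.exp (2 * u) := by
  have hss : s ^ 2 = 1 := by rcases hs with rfl | rfl <;> norm_num
  rw [mul_pow, hss, mul_pow, ← Real.exp_nat_mul]; push_cast; ring

lemma expMul_mem_Sig0 (hq : 0 < q0) (hε : δ * σ = 1 ∨ δ * σ = -1) (hs : s = 1 ∨ s = -1)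
    (hy : exp (y * I) = s) {u : ℝ} (hu : u ≠ 0) :
    (q0 : ℂ) * exp (u + y * I) ∈ Sig0 σ δ q0 \ {(q0 : ℂ), -(q0 : ℂ)} := by
  have hq2 : 0 < q0 ^ 2 := by positivity
  have hne : (s * (q0 * Real.exp u)) ^ 2 ≠ q0 ^ 2 := by
    rw [sq_line hs]
    intro h
    have := mul_left_cancel₀ hq2.ne' (h.trans (mul_one _).symm)
    rw [Real.exp_eq_one_iff] at this
    exact hu (by linarith)
  refine ⟨⟨expMul_mem_Sig hq hs hy u, fun hb => ?_⟩, fun hb => ?_⟩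
  · have hb' : (q0 * exp (u + y * I)) ^ 2 = ((δ * σ * q0 ^ 2 : ℝ) : ℂ) := hb
    rw [expMul_line hy] at hb'
    have hb2 : (s * (q0 * Real.exp u)) ^ 2 = δ * σ * q0 ^ 2 := by exact_mod_cast hb'
    rcases hε with h | h
    · exact hne (by rw [hb2, h, one_mul])
    · rw [h] at hb2
      nlinarith [sq_nonneg (s * (q0 * Real.exp u))]
  · rw [expMul_line hy] at hb
    rcases hb with h | h
    · have : s * (q0 * Real.exp u) = q0 := by exact_mod_cast h
      exact hne (by rw [this])
    · have h' : ((s * (q0 * Real.exp u) : ℝ) : ℂ) = -(q0 : ℂ) := h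
      have : s * (q0 * Real.exp u) = -q0 := by exact_mod_cast h'
      exact hne (by rw [this, neg_sq])

lemma tendsto_of_infty (hq : 0 < q0) (hs : s = 1 ∨ s = -1) (hy : exp (y * I) = s)
    (h : Tendsto ℓ (cocompact ℂ ⊓ 𝓟 (Sig σ δ q0)) (𝓝 0)) :
    Tendsto (fun u : ℝ => ℓ (q0 * exp (u + y * I))) atTop (𝓝 0) :=
  h.comp (tendsto_inf.2 ⟨(tendsto_expMul_atTop hq y y).comp (tendsto_line ⟨le_rfl, le_rfl⟩),
    tendsto_principal.2 (.of_forall fun u => expMul_mem_Sig hq hs hy u)⟩)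

lemma tendsto_of_zero (hq : 0 < q0) (hs : s = 1 ∨ s = -1) (hy : exp (y * I) = s)
    (h : Tendsto ℓ (𝓝[Sig σ δ q0] 0) (𝓝 0)) :
    Tendsto (fun u : ℝ => ℓ (q0 * exp (u + y * I))) atBot (𝓝 0) :=
  h.comp (tendsto_inf.2 ⟨(tendsto_expMul_atBot hq y y).comp (tendsto_line ⟨le_rfl, le_rfl⟩),
    tendsto_principal.2 (.of_forall fun u => expMul_mem_Sig hq hs hy u)⟩)

/-- On a half-line of `Σ` that ends at `0` or `∞` a branch is determined by its limit there. -/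
lemma IsBranch.eq_of_line (h : IsBranch σ δ q0 f ℓ) (hq : 0 < q0) (hε : δ * σ = 1 ∨ δ * σ = -1)
    (hs : s = 1 ∨ s = -1) (hy : exp (y * I) = s) {ρ : ℝ → ℂ} :
    (ContinuousOn ρ (Ioi 0) → (∀ u : ℝ, 0 < u → exp (ρ u) = f (q0 * exp (u + y * I))) →
      Tendsto ρ atTop (𝓝 0) → ∀ u : ℝ, 0 < u → ℓ (q0 * exp (u + y * I)) = ρ u) ∧
    (ContinuousOn ρ (Iio 0) → (∀ u : ℝ, u < 0 → exp (ρ u) = f (q0 * exp (u + y * I))) →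
      Tendsto ρ atBot (𝓝 0) → ∀ u : ℝ, u < 0 → ℓ (q0 * exp (u + y * I)) = ρ u) := by
  have hm := fun {u : ℝ} hu => expMul_mem_Sig0 hq hε hs hy (u := u) hu
  have hc : ContinuousOn (fun u : ℝ => ℓ (q0 * exp (u + y * I))) {0}ᶜ :=
    h.continuousOn.comp (by fun_prop) fun u hu => hm hu
  constructor
  · intro hρ he hl u hu
    refine eqOn_of_exp_eq (convex_Ioi (0 : ℝ)).isPreconnected
      (hc.mono fun v hv => (show (0 : ℝ) < v from hv).ne') hρ
      (fun v hv => by rw [he v hv, h.exp_eq _ (hm (show (0 : ℝ) < v from hv).ne').1])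
      (l := atTop) (le_principal_iff.2 (Ioi_mem_atTop 0)) ?_ hu
    simpa using (tendsto_of_infty hq hs hy h.tendsto_infty).sub hl
  · intro hρ he hl u hu
    refine eqOn_of_exp_eq (convex_Iio (0 : ℝ)).isPreconnected
      (hc.mono fun v hv => (show v < (0 : ℝ) from hv).ne) hρ
      (fun v hv => by rw [he v hv, h.exp_eq _ (hm (show v < (0 : ℝ) from hv).ne).1])
      (l := atBot) (le_principal_iff.2 (Iio_mem_atBot 0)) ?_ hu
    simpa using (tendsto_of_zero hq hs hy h.tendsto_zero).sub hl

lemma IsBranch.eq_of_ray (h : IsBranch σ δ q0 f ℓ) (hq : 0 < q0) (hε : δ * σ = 1 ∨ δ * σ = -1)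
    (hs : s = 1 ∨ s = -1) (hy : exp (y * I) = s) {ρ : ℝ → ℂ} (hc : ContinuousOn ρ {0}ᶜ)
    (he : ∀ u : ℝ, u ≠ 0 → exp (ρ u) = f (q0 * exp (u + y * I)))
    (h1 : Tendsto ρ atTop (𝓝 0)) (h2 : Tendsto ρ atBot (𝓝 0)) (u : ℝ) (hu : u ≠ 0) :
    ℓ (q0 * exp (u + y * I)) = ρ u := by
  obtain ⟨k1, k2⟩ := h.eq_of_line (ρ := ρ) hq hε hs hy
  rcases lt_or_gt_of_ne hu with hu | hu
  · exact k2 (hc.mono fun v hv => (show v < (0 : ℝ) from hv).ne) (fun v hv => he v hv.ne) h2 u hu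
  · exact k1 (hc.mono fun v hv => (show (0 : ℝ) < v from hv).ne') (fun v hv => he v hv.ne') h1 u hu

open Classical in
/-- The function on `ℝ ∖ {0}` with the values `a u` at `q0 e^u` and `b u` at `-q0 e^u`. -/
def lineFun (q0 : ℝ) (a b : ℝ → ℂ) (ζ : ℂ) : ℂ :=
  if 0 < ζ.re then a (Real.log (‖ζ‖ / q0)) else b (Real.log (‖ζ‖ / q0))

lemma continuousAt_lineFun (hq : 0 < q0) {a b : ℝ → ℂ} (ha : ContinuousOn a {0}ᶜ)
    (hb : ContinuousOn b {0}ᶜ) {ζ : ℂ} (h0 : ζ.re ≠ 0) (h1 : ‖ζ‖ ≠ q0) :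
    ContinuousAt (lineFun q0 a b) ζ := by
  have hζ : ζ ≠ 0 := by rintro rfl; exact h0 rfl
  have hpos : 0 < ‖ζ‖ / q0 := div_pos (norm_pos_iff.2 hζ) hq
  have hu : Real.log (‖ζ‖ / q0) ≠ 0 := by
    refine Real.log_ne_zero_of_pos_of_ne_one hpos fun h => h1 ?_
    rw [div_eq_one_iff_eq hq.ne'] at h; exact h
  have hl : ContinuousAt (fun ζ : ℂ => Real.log (‖ζ‖ / q0)) ζ :=
    ContinuousAt.log (by fun_prop) hpos.ne'
  have hmem : ({0}ᶜ : Set ℝ) ∈ 𝓝 (Real.log (‖ζ‖ / q0)) := isOpen_compl_singleton.mem_nhds hu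
  have ca : ContinuousAt (fun ζ : ℂ => a (Real.log (‖ζ‖ / q0))) ζ :=
    ContinuousAt.comp (g := a) (ha.continuousAt hmem) hl
  have cb : ContinuousAt (fun ζ : ℂ => b (Real.log (‖ζ‖ / q0))) ζ :=
    ContinuousAt.comp (g := b) (hb.continuousAt hmem) hl
  rcases lt_or_gt_of_ne h0 with h | h
  · refine cb.congr ?_
    filter_upwards [(isOpen_lt continuous_re continuous_const).mem_nhds h] with w hw
    exact (if_neg (not_lt.2 (le_of_lt hw))).symm
  · refine ca.congr ?_
    filter_upwards [(isOpen_lt continuous_const continuous_re).mem_nhds h] with w hw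
    exact (if_pos hw).symm

lemma tendsto_lineFun {a b : ℝ → ℂ} {l : Filter ℝ} {L : Filter ℂ} (ha : Tendsto a l (𝓝 0))
    (hb : Tendsto b l (𝓝 0)) (hL : Tendsto (fun ζ : ℂ => Real.log (‖ζ‖ / q0)) L l) :
    Tendsto (lineFun q0 a b) L (𝓝 0) :=
  Tendsto.if' (ha.comp hL) (hb.comp hL)

lemma tendsto_log_norm_infty (hq : 0 < q0) :
    Tendsto (fun ζ : ℂ => Real.log (‖ζ‖ / q0)) (cocompact ℂ) atTop :=
  Real.tendsto_log_atTop.comp ((tendsto_norm_cocompact_atTop (E := ℂ)).atTop_div_const hq)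

lemma tendsto_log_norm_zero (hq : 0 < q0) {T : Set ℂ} (hT : (0 : ℂ) ∉ T) :
    Tendsto (fun ζ : ℂ => Real.log (‖ζ‖ / q0)) (𝓝[T] 0) atBot := by
  refine Real.tendsto_log_nhdsGT_zero.comp (tendsto_nhdsWithin_iff.2 ⟨?_, ?_⟩)
  · have : Continuous fun ζ : ℂ => ‖ζ‖ / q0 := by fun_prop
    simpa using (this.tendsto 0).mono_left nhdsWithin_le_nhds
  · filter_upwards [self_mem_nhdsWithin] with ζ hζ
    exact div_pos (norm_pos_iff.2 fun h => hT (h ▸ hζ)) hq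

lemma zero_notMem_Sig (hq : 0 < q0) : (0 : ℂ) ∉ Sig σ δ q0 := by
  rintro (⟨-, h⟩ | ⟨-, h⟩)
  · exact h rfl
  · rw [norm_zero] at h; exact hq.ne h

/-- A non-zero real point in exponential coordinates. -/
lemma exists_line_of_real (hq : 0 < q0) {ζ : ℂ} (h : ζ.im = 0) (h0 : ζ ≠ 0) :
    (0 < ζ.re ∧ ζ = q0 * exp ((Real.log (‖ζ‖ / q0) : ℝ) + (0 : ℝ) * I)) ∨
    (ζ.re < 0 ∧ ζ = q0 * exp ((Real.log (‖ζ‖ / q0) : ℝ) + π * I)) := by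
  have hζ : ζ = (ζ.re : ℂ) := ext (by simp) (by simp [h])
  have hpos : 0 < ‖ζ‖ / q0 := div_pos (norm_pos_iff.2 h0) hq
  have hre : ζ.re ≠ 0 := fun hr => h0 (ext hr h)
  have hn : ‖ζ‖ = |ζ.re| := by rw [hζ, norm_real]; simp
  rcases lt_or_gt_of_ne hre with hr | hr
  · refine Or.inr ⟨hr, ?_⟩
    rw [expMul_line (s := -1) (by rw [exp_pi_mul_I]; simp), Real.exp_log hpos,
      mul_div_cancel₀ _ hq.ne', hn, abs_of_neg hr, neg_mul_neg, one_mul]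
    exact hζ
  · refine Or.inl ⟨hr, ?_⟩
    rw [expMul_line (s := 1) (by simp), Real.exp_log hpos,
      mul_div_cancel₀ _ hq.ne', hn, abs_of_pos hr, one_mul]
    exact hζ

end

section

/-! ### The domains in exponential coordinates -/

variable {σ δ q0 κ β ε : ℝ} {z w : ℂ} {F G H ℓ : ℂ → ℂ}

lemma expMul_im (w : ℂ) : ((q0 : ℂ) * exp w).im = q0 * Real.exp w.re * Real.sin w.im := by
  rw [im_ofReal_mul, exp_im, mul_assoc]

lemma Λ_expMul (hq : 0 < q0) (w : ℂ) : Λ (ε * q0 ^ 2) (q0 * exp w) =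
    q0 * (exp w - ε * exp (-w)) / 2 := by
  have h0 : (q0 : ℂ) ≠ 0 := by exact_mod_cast hq.ne'
  have h1 := exp_ne_zero w
  rw [Λ, exp_neg]; push_cast; field_simp

lemma Λ_expMul_im (hq : 0 < q0) (w : ℂ) : (Λ (ε * q0 ^ 2) (q0 * exp w)).im =
    q0 * Real.sin w.im * (Real.exp w.re + ε * Real.exp (-w.re)) / 2 := by
  have := Real.exp_ne_zero w.re
  rw [Λ_im, expMul_im, norm_expMul hq, Real.exp_neg]
  field_simp

lemma abs_re_le_norm_Λ (hq : 0 < q0) (w : ℂ) :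
    q0 * |w.re| ≤ ‖Λ (1 * q0 ^ 2) (q0 * exp w)‖ := by
  rw [Λ_expMul hq, norm_div, norm_mul, norm_real, Real.norm_of_nonneg hq.le,
    Complex.norm_two, ofReal_one, one_mul, mul_div_assoc]
  refine mul_le_mul_of_nonneg_left ?_ hq.le
  have h1 := abs_norm_sub_norm_le (exp w) (exp (-w))
  rw [norm_exp, norm_exp, neg_re] at h1
  have h2 : |w.re| ≤ |Real.sinh w.re| := by
    rw [Real.abs_sinh]
    exact Real.self_le_sinh_iff.2 (abs_nonneg _)
  rw [Real.sinh_eq, abs_div, abs_two] at h2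
  linarith

lemma abs_im_sub_le_norm_Λ (hq : 0 < q0) (hw : w.im ∈ Icc 0 π) :
    q0 * (2 / π * |w.im - π / 2|) ≤ ‖Λ (-1 * q0 ^ 2) (q0 * exp w)‖ := by
  rw [Λ_expMul hq, norm_div, norm_mul, norm_real, Real.norm_of_nonneg hq.le,
    Complex.norm_two, mul_div_assoc]
  refine mul_le_mul_of_nonneg_left ?_ hq.le
  have h1 := abs_re_le_norm (exp w - ((-1 : ℝ) : ℂ) * exp (-w))
  rw [sub_re, re_ofReal_mul, exp_re, exp_re, neg_re,
    neg_im, Real.cos_neg, show Real.exp w.re * Real.cos w.im - -1 * (Real.exp (-w.re) *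
      Real.cos w.im) = 2 * (Real.cosh w.re * Real.cos w.im) by rw [Real.cosh_eq]; ring, abs_mul,
    abs_two, abs_mul, abs_of_pos (Real.cosh_pos _)] at h1
  have h2 : 2 / π * |w.im - π / 2| ≤ |Real.cos w.im| := by
    have := Real.mul_abs_le_abs_sin (x := π / 2 - w.im) (by
      rw [abs_le]; constructor <;> linarith [hw.1, hw.2])
    rw [Real.sin_pi_div_two_sub] at this
    rwa [abs_sub_comm]
  have h3 := Real.one_le_cosh w.re
  nlinarith [abs_nonneg (Real.cos w.im)]

lemma exists_log_coord (hq : 0 < q0) (hz : z ≠ 0) :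
    z = q0 * exp (log (z / q0)) ∧ (log (z / q0)).re = Real.log (‖z‖ / q0) ∧
      (0 < z.im → (log (z / q0)).im ∈ Ioo 0 π) ∧
      (z.im < 0 → (log (z / q0)).im ∈ Ioo (-π) 0) := by
  have h0 : (q0 : ℂ) ≠ 0 := by exact_mod_cast hq.ne'
  have harg : arg (z / q0) = arg z := by
    rw [div_eq_mul_inv, ← ofReal_inv, arg_mul_real (inv_pos.2 hq)]
  refine ⟨?_, ?_, fun h => ?_, fun h => ?_⟩
  · rw [exp_log (div_ne_zero hz h0), mul_div_cancel₀ _ h0]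
  · rw [log_re, norm_div, norm_real, Real.norm_of_nonneg hq.le]
  · rw [log_im, harg]
    refine ⟨lt_of_le_of_ne (arg_nonneg_iff.2 h.le) fun h' => ?_,
      lt_of_le_of_ne (arg_le_pi z) fun h' => ?_⟩
    · exact h.ne' (arg_eq_zero_iff.1 h'.symm).2.symm.symm
    · exact h.ne' (arg_eq_pi_iff.1 h').2
  · rw [log_im, harg]
    exact ⟨neg_pi_lt_arg z, arg_neg_iff.2 h⟩

lemma expMul_ne_of_strip (hq : 0 < q0) (hw : w.im ∈ Icc 0 π) (hz : z.im < 0 ∨ z = 0) :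
    (q0 : ℂ) * exp w ≠ z := by
  rintro rfl
  rcases hz with h | h
  · rw [expMul_im] at h
    exact h.not_ge (mul_nonneg (mul_pos hq (Real.exp_pos _)).le
      (Real.sin_nonneg_of_nonneg_of_le_pi hw.1 hw.2))
  · exact mul_ne_zero (by exact_mod_cast hq.ne') (exp_ne_zero _) h

lemma expK_congr {z w w' : ℂ} (h : exp w = exp w') :
    expK q0 z w = expK q0 z w' := by rw [expK, expK, h]

lemma continuousAt_expK_of_re_ne (hq : 0 < q0) (h : w.re ≠ Real.log (‖z‖ / q0)) :
    ContinuousAt (expK q0 z) w :=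
  expK_ne fun he => h (by
    rw [← he, norm_expMul hq, mul_div_cancel_left₀ _ hq.ne', Real.log_exp])

/-- The limit of the contribution of a vertical side of a rectangle that moves to infinity. -/
lemma tendsto_kernel_side (hq : 0 < q0) {g : ℂ → ℂ} {y0 y1 : ℝ} {l : Filter ℝ} {k c : ℂ} (hy : y0 ≤ y1)
    (hl : ∀ c : ℝ, ∀ᶠ x in l, x ≠ c) (hk : Tendsto (expK q0 z) (stripEnd l y0 y1) (𝓝 k))
    (hg : Tendsto g (stripEnd l y0 y1) (𝓝 c))
    (hc : ∀ᶠ x : ℝ in l, ContinuousOn (fun y : ℝ => g (x + y * I)) (Icc y0 y1)) :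
    Tendsto (fun x : ℝ => ∫ y in y0..y1, expK q0 z (x + y * I) * g (x + y * I)) l
      (𝓝 ((y1 - y0 : ℝ) * (k * c))) := by
  refine tendsto_side (f := fun w => expK q0 z w * g w) hy (hk.mul hg) ?_
  filter_upwards [hl (Real.log (‖z‖ / q0)), hc] with x hx hxc
  refine ContinuousOn.mul (fun y _ => ContinuousAt.continuousWithinAt ?_) hxc
  exact ContinuousAt.comp (g := expK q0 z)
    (continuousAt_expK_of_re_ne hq (by simpa using hx)) (by fun_prop)

/-! ### The Riemann–Hilbert problem on the real line -/

/-- A point of the closed strip `0 ≤ Im w ≤ π`, other than `0` and `iπ`. -/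
def slitStrip : Set ℂ := (univ ×ℂ Icc 0 π) \ {0, (π : ℂ) * I}

lemma mem_slitStrip (h : w.im ∈ Icc 0 π) (h' : w.re ≠ 0 ∨ w.im ∈ Ioo 0 π) :
    w ∈ slitStrip := by
  refine ⟨⟨trivial, h⟩, ?_⟩
  rintro (rfl | rfl)
  · rcases h' with h' | h' <;> simp at h'
  · rcases h' with h' | h' <;> simp at h'

lemma expMul_mem_of_slitStrip (hq : 0 < q0) (hw : w ∈ slitStrip) :
    (q0 : ℂ) * exp w ∈ Ω (1 * q0 ^ 2) := by
  have h0 : (q0 : ℂ) * exp w ≠ 0 :=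
    mul_ne_zero (by exact_mod_cast hq.ne') (exp_ne_zero _)
  have hy : w.im ∈ Icc 0 π := hw.1.2
  have hpos : 0 < Real.exp w.re + 1 * Real.exp (-w.re) := by positivity
  refine ⟨h0, fun hl => ?_, ?_⟩
  · by_cases hu : w.re = 0
    · have him := Λ_expMul_im (ε := 1) hq w
      rw [hl, zero_im] at him
      have hy0 : 0 < w.im := lt_of_le_of_ne hy.1 fun h => hw.2 (Or.inl (ext hu h.symm))
      have hy1 : w.im < π := lt_of_le_of_ne hy.2 fun h => hw.2 (Or.inr (ext
        (by simpa using hu) (by simpa using h)))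
      have := mul_pos (mul_pos hq (Real.sin_pos_of_pos_of_lt_pi hy0 hy1)) hpos
      linarith
    · have := abs_re_le_norm_Λ hq w
      rw [hl, norm_zero] at this
      linarith [mul_pos hq (abs_pos.2 hu)]
  · rw [Λ_expMul_im hq]
    have := Real.sin_nonneg_of_nonneg_of_le_pi hy.1 hy.2
    positivity

lemma log_le_of_mul_le {a x : ℝ} (ha : 0 < a) (hx : x ≠ 0) :
    |Real.log (a * |x|)| ≤ |Real.log a| + |Real.log x| := by
  rw [Real.log_mul ha.ne' (abs_ne_zero.2 hx), Real.log_abs]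
  exact abs_add_le _ _

/-- A bound for the real part of a logarithm in exponential coordinates. -/
lemma ZeroFreePair.exists_re_bound (h : ZeroFreePair κ β F G) (hq : 0 < q0) (R : ℝ) : ∃ C, ∀ w : ℂ,
    |w.re| ≤ R → (q0 : ℂ) * exp w ∈ Ω κ →
    exp (H w) = F (q0 * exp w) → ∀ m, 0 < m →
    m ≤ ‖Λ κ (q0 * exp w)‖ → |(H w).re| ≤ C + |Real.log m| := by
  have hpos : 0 < q0 * Real.exp R := by positivity
  have hpos' : 0 < q0⁻¹ * Real.exp R := by positivity
  obtain ⟨C, hC⟩ := h.exists_log_bound (R := q0 * Real.exp R + q0⁻¹ * Real.exp R + 1) (by linarith)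
  refine ⟨C, fun w hw hJ he m hm hml => ?_⟩
  obtain ⟨w1, w2⟩ := abs_le.1 hw
  have h1 : q0 * Real.exp w.re ≤ q0 * Real.exp R := by gcongr
  have h2 : (q0 * Real.exp w.re)⁻¹ ≤ q0⁻¹ * Real.exp R := by
    rw [mul_inv, ← Real.exp_neg]
    gcongr
    linarith
  have hmem : (q0 : ℂ) * exp w ∈ annulus (q0 * Real.exp R + q0⁻¹ * Real.exp R + 1) := by
    refine ⟨?_, ?_, hJ.1⟩ <;> rw [norm_expMul hq] <;> linarith
  have := hC _ ⟨hJ, hmem⟩ m hm hml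
  rwa [← he, norm_exp, Real.log_exp] at this

lemma ZeroFreePair.fst_neg_expMul (h : ZeroFreePair (1 * q0 ^ 2) β F G) (hq : 0 < q0)
    (hw : w ∈ slitStrip) : -((q0 : ℂ) * exp (-w)) ∈ Ω (1 * q0 ^ 2) ∧
    F (q0 * exp w) = β * G (q0 * exp (-w)) := by
  have hκ : (1 * q0 ^ 2 : ℝ) ≠ 0 := by positivity
  have h0 : (q0 : ℂ) ≠ 0 := by exact_mod_cast hq.ne'
  have e : (q0 : ℂ) * exp (-w) = ((1 * q0 ^ 2 : ℝ) : ℂ) / (q0 * exp w) := by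
    rw [exp_neg]; push_cast; field_simp
  have hm := expMul_mem_of_slitStrip hq hw
  have hm' : -((q0 : ℂ) * exp (-w)) ∈ Ω (1 * q0 ^ 2) := by
    have := hat_mem_Ω hκ (z := -(q0 * exp w)) (by rwa [neg_neg])
    rwa [div_neg, ← e] at this
  refine ⟨hm', ?_⟩
  rw [← h.hat _ hm', e, div_div_cancel₀ (by exact_mod_cast hκ)]

/-- The logarithm of `F` in the upper half-plane, in exponential coordinates. -/
structure IsStripLog (q0 : ℝ) (F G H : ℂ → ℂ) (L : ℂ) : Prop where
  continuousOn : ContinuousOn H slitStrip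
  exp_eq : ∀ w ∈ slitStrip, exp (H w) = F (q0 * exp w)
  exp_neg_eq : ∀ w ∈ slitStrip, exp (H w - L) = G (q0 * exp (-w))
  differentiableOn : DifferentiableOn ℂ H (univ ×ℂ Ioo 0 π)
  tendsto_atTop : Tendsto H (stripEnd atTop 0 π) (𝓝 0)
  tendsto_atBot : Tendsto H (stripEnd atBot 0 π) (𝓝 L)
  bound : ∀ R, ∃ C, ∀ w ∈ slitStrip, |w.re| ≤ R → w.re ≠ 0 → |(H w).re| ≤ C + |Real.log w.re|

/-- The lower edge of the strip is the positive half-line and the upper edge the negative one; the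
limit `L` at the left end is a logarithm of `F(0) = β`. -/
lemma ZeroFreePair.exists_isStripLog (h : ZeroFreePair (1 * q0 ^ 2) β F G) (hq : 0 < q0)
    (hβ : β ≠ 0) : ∃ H L, exp L = β ∧ IsStripLog q0 F G H L := by
  have hβ' : (β : ℂ) ≠ 0 := by exact_mod_cast hβ
  have hint : interior (univ ×ℂ Icc 0 π) = univ ×ℂ Ioo 0 π := by
    rw [interior_reProdIm, interior_univ, interior_Icc]
  have hmem := fun w hw => expMul_mem_of_slitStrip (w := w) hq hw
  have htop : Ioi 0 ×ℂ Icc 0 π ⊆ slitStrip := fun w hw =>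
    mem_slitStrip hw.2 (Or.inl (ne_of_gt hw.1))
  have hbot : Iio 0 ×ℂ Icc 0 π ⊆ slitStrip := fun w hw =>
    mem_slitStrip hw.2 (Or.inl (ne_of_lt hw.1))
  have hd : DifferentiableOn ℂ (fun w => F (q0 * exp w))
      (interior (univ ×ℂ Icc 0 π)) := by
    rw [hint]
    refine h.differentiableOn.comp (by fun_prop) fun w hw => ?_
    have hw2 : w.im ∈ Ioo 0 π := hw.2
    refine ⟨mul_ne_zero (by exact_mod_cast hq.ne') (exp_ne_zero _), ?_⟩
    rw [Λ_expMul_im hq]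
    have := Real.sin_pos_of_pos_of_lt_pi hw2.1 hw2.2
    positivity
  have hlim : Tendsto (fun w => F (q0 * exp w)) (stripEnd atTop 0 π) (𝓝 1) := by
    refine h.tendsto_fst.comp (tendsto_inf.2 ⟨tendsto_expMul_atTop hq _ _, tendsto_principal.2 ?_⟩)
    filter_upwards [mem_stripEnd (Ioi_mem_atTop (0 : ℝ))] with w hw using hmem w (htop hw)
  have hdisj : Disjoint {0, (π : ℂ) * I} (interior (univ ×ℂ Icc 0 π)) := by
    rw [hint, disjoint_left]
    rintro _ (rfl | rfl) hw
    · simpa using hw.2.1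
    · simpa using hw.2.2
  obtain ⟨H, h1, h2, h3, h4⟩ := exists_stripLog (S := univ ×ℂ Icc 0 π)
    (P := {0, (π : ℂ) * I}) (w0 := I) (y0 := 0) (y1 := π) Real.pi_pos.le
    ((convex_univ.is_linear_preimage reLm.isLinear).inter
      ((convex_Icc _ _).is_linear_preimage imLm.isLinear))
    (by rw [hint]; exact ⟨trivial, by simp; linarith [Real.pi_gt_three]⟩) hdisj htop
    (h.continuousOn.comp (by fun_prop) hmem) (fun w hw => h.ne_zero _ (hmem w hw)) hd hlim
  have hlim' : Tendsto (fun w => F (q0 * exp w)) (stripEnd atBot 0 π) (𝓝 β) := by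
    have hG : Tendsto (fun w => G (q0 * exp (-w))) (stripEnd atBot 0 π) (𝓝 1) := by
      refine h.tendsto_snd.comp (tendsto_inf.2 ⟨?_, tendsto_principal.2 ?_⟩)
      · rw [← Metric.cobounded_eq_cocompact, ← tendsto_norm_atTop_iff_cobounded]
        simp only [norm_expMul hq, neg_re]
        exact ((Real.tendsto_exp_atTop.comp (tendsto_neg_atBot_atTop.comp
          tendsto_comap)).const_mul_atTop hq).mono_left inf_le_left
      · filter_upwards [mem_stripEnd (Iio_mem_atBot (0 : ℝ))] with w hw
          using (h.fst_neg_expMul hq (hbot hw)).1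
    have := hG.const_mul (β : ℂ)
    rw [mul_one] at this
    refine this.congr' ?_
    filter_upwards [mem_stripEnd (Iio_mem_atBot (0 : ℝ))] with w hw
      using (h.fst_neg_expMul hq (hbot hw)).2.symm
  have := stripEnd_neBot (l := atBot) Real.pi_pos.le
  obtain ⟨L, hL, hLt⟩ := exists_tendsto_log (T := slitStrip) h1 h2 hβ' hlim'
    (stripEnd_atBot_preconnected hbot)
  replace h2 : ∀ w ∈ slitStrip, exp (H w) = F (q0 * exp w) := h2
  refine ⟨H, L, hL, h1, h2, fun w hw => ?_, hint ▸ h3, h4, hLt, fun R => ?_⟩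
  · rw [exp_sub, hL, h2 w hw, (h.fst_neg_expMul hq hw).2, mul_div_cancel_left₀ _ hβ']
  · obtain ⟨C, hC⟩ := h.exists_re_bound (H := H) hq R
    refine ⟨C + |Real.log q0|, fun w hw hR h0 => ?_⟩
    have := hC w hR (hmem w hw) (h2 w hw) (q0 * |w.re|) (mul_pos hq (abs_pos.2 h0))
      (abs_re_le_norm_Λ hq w)
    linarith [log_le_of_mul_le hq h0]

end

section

variable {σ δ q0 κ β ε : ℝ} {z w L : ℂ} {F G H ℓ : ℂ → ℂ}

lemma exp_zero_mul_I : exp ((0 : ℝ) * I) = (1 : ℝ) := by simp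

lemma exp_pi_mul_I' : exp (π * I) = (-1 : ℝ) := by
  rw [exp_pi_mul_I]; simp

lemma expK_neg_pi (x : ℝ) :
    expK q0 z (x + ((-π : ℝ) : ℂ) * I) = expK q0 z (x + π * I) := by
  refine expK_congr ?_
  rw [exp_add, exp_add]
  congr 1
  push_cast
  rw [neg_mul, exp_neg, exp_pi_mul_I]; norm_num

lemma IsStripLog.neg_continuousOn (h : IsStripLog q0 F G H L) :
    ContinuousOn (fun w => H (-w) - L) {w | -w ∈ slitStrip} :=
  (h.continuousOn.comp (f := fun w => -w) (by fun_prop) fun w hw => hw).sub continuousOn_const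

lemma line_mem_slitStrip {u y : ℝ} (hy : y ∈ Icc 0 π) (h : u ≠ 0) :
    (u + y * I : ℂ) ∈ slitStrip :=
  mem_slitStrip (by simpa using hy) (Or.inl (by simpa using h))

/-- The logarithm of `F G` on the two half-lines, in terms of the logarithm of `F`. -/
lemma IsStripLog.jump (h : IsStripLog q0 F G H L) {y : ℝ} (hy : y = 0 ∨ y = π) :
    ContinuousOn (fun u : ℝ => H (u + y * I) + (H (-u + y * I) - L)) {0}ᶜ ∧
    (∀ u : ℝ, u ≠ 0 → exp (H (u + y * I) + (H (-u + y * I) - L)) =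
      F (q0 * exp (u + y * I)) * G (q0 * exp (u + y * I))) ∧
    Tendsto (fun u : ℝ => H (u + y * I) + (H (-u + y * I) - L)) atTop (𝓝 0) ∧
    Tendsto (fun u : ℝ => H (u + y * I) + (H (-u + y * I) - L)) atBot (𝓝 0) := by
  have hyI : y ∈ Icc 0 π := by
    rcases hy with rfl | rfl
    exacts [⟨le_rfl, Real.pi_pos.le⟩, ⟨Real.pi_pos.le, le_rfl⟩]
  have hm' : ∀ u : ℝ, u ≠ 0 → (-u + y * I : ℂ) ∈ slitStrip := fun u hu => by
    have := line_mem_slitStrip hyI (neg_ne_zero.2 hu)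
    rwa [ofReal_neg] at this
  have ht' : ∀ {l : Filter ℝ} {l' : Filter ℝ} {c : ℂ}, Tendsto (fun u : ℝ => -u) l l' →
      Tendsto H (stripEnd l' 0 π) (𝓝 c) →
      Tendsto (fun u : ℝ => H (-u + y * I)) l (𝓝 c) := fun {l l' c} hl hH => by
    refine ((hH.comp (tendsto_line hyI)).comp hl).congr fun u => ?_
    simp [Function.comp]
  refine ⟨(h.continuousOn.comp (by fun_prop) fun u hu => line_mem_slitStrip hyI hu).add
    ((h.continuousOn.comp (by fun_prop) fun u hu => hm' u hu).sub continuousOn_const),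
    fun u hu => ?_, ?_, ?_⟩
  · rw [exp_add, h.exp_eq _ (line_mem_slitStrip hyI hu), h.exp_neg_eq _ (hm' u hu)]
    congr 3
    rcases hy with rfl | rfl
    · simp
    · rw [exp_neg, exp_add, exp_add, exp_neg, exp_pi_mul_I,
        mul_inv, inv_inv]
      norm_num
  · have := (h.tendsto_atTop.comp (tendsto_line (l := atTop) hyI)).add
      ((ht' tendsto_neg_atTop_atBot h.tendsto_atBot).sub_const L)
    simpa using this
  · have := (h.tendsto_atBot.comp (tendsto_line (l := atBot) hyI)).add
      ((ht' tendsto_neg_atBot_atTop h.tendsto_atTop).sub_const L)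
    simpa using this

open Classical in
/-- The Cauchy integral of the jump of the logarithm across the real line, evaluated by residues in
the upper and in the lower half-plane. -/
lemma IsStripLog.integral_jump (h : IsStripLog q0 F G H L) (hq : 0 < q0)
    (hz : z.im ≠ 0 ∨ z = 0) {r1 r2 : ℂ}
    (hr₁ : ∀ᶠ R : ℝ in atTop, IsResidue q0 z H (-R) R 0 π r1)
    (hr₂ : ∀ᶠ R : ℝ in atTop, IsResidue q0 z (fun w => H (-w) - L) (-R) R (-π) 0 r2) :
    (∀ R : ℝ, 0 < R → IsResidue q0 z H (-R) R 0 π r1 →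
      IsResidue q0 z (fun w => H (-w) - L) (-R) R (-π) 0 r2 →
      ∀ y : ℝ, y = 0 ∨ y = π →
      IntervalIntegrable (fun u : ℝ => H (u + y * I) + (H (-u + y * I) - L)) volume (-R) R) ∧
    (Integrable (fun u : ℝ => H (u + (0 : ℝ) * I) + (H (-u + (0 : ℝ) * I) - L)) →
      Integrable (fun u : ℝ => H (u + π * I) + (H (-u + π * I) - L)) →
    (∫ u : ℝ, expK q0 z (u + (0 : ℝ) * I) *
        (H (u + (0 : ℝ) * I) + (H (-u + (0 : ℝ) * I) - L))) -
      (∫ u : ℝ, expK q0 z (u + π * I) *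
        (H (u + π * I) + (H (-u + π * I) - L))) =
      r1 - r2 + 2 * π * I * (if z = 0 then L else 0)) := by
  have hpi := Real.pi_pos
  have hclm : ∀ R : ℝ, ∀ w ∈ (Icc (-R) R ×ℂ Icc 0 π) \
      {w | w.re = 0 ∧ (w.im = 0 ∨ w.im = π)}, w ∈ slitStrip := fun R w hw => by
    refine mem_slitStrip hw.1.2 (or_iff_not_imp_left.2 fun h0 => ?_)
    have h0' : w.re = 0 := not_not.1 h0
    exact ⟨lt_of_le_of_ne hw.1.2.1 fun he => hw.2 ⟨h0', Or.inl he.symm⟩,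
      lt_of_le_of_ne hw.1.2.2 fun he => hw.2 ⟨h0', Or.inr he⟩⟩
  -- the two boundary integrals over a large rectangle
  have key : ∀ R : ℝ, 0 < R → IsResidue q0 z H (-R) R 0 π r1 →
      IsResidue q0 z (fun w => H (-w) - L) (-R) R (-π) 0 r2 →
      (IntervalIntegrable (fun u : ℝ => H (u + (0 : ℝ) * I)) volume (-R) R ∧
        IntervalIntegrable (fun u : ℝ => H (u + π * I)) volume (-R) R ∧
        rectInt (fun w => expK q0 z w * H w) (-R) R 0 π = r1) ∧
      (IntervalIntegrable (fun u : ℝ => H (-(u + ((-π : ℝ) : ℂ) * I)) - L) volume (-R) R ∧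
        IntervalIntegrable (fun u : ℝ => H (-(u + ((0 : ℝ) : ℂ) * I)) - L) volume (-R) R ∧
        rectInt (fun w => expK q0 z w * (H (-w) - L)) (-R) R (-π) 0 = r2) := by
    intro R hR h1 h2
    obtain ⟨C, hC⟩ := h.bound R
    refine ⟨rectInt_kernel_horizontal (c := 0) (C := C) hq (by linarith) hR hpi (by linarith)
      (h.continuousOn.mono (hclm R)) (h.differentiableOn.mono fun w hw => ⟨trivial, hw.2⟩)
      (fun w hw h0 => ?_) h1, rectInt_kernel_horizontal (c := 0) (C := C + |L.re|) hq (by linarith) hR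
      (by linarith) (by linarith) (h.neg_continuousOn.mono fun w hw => hclm R _ ⟨⟨⟨?_, ?_⟩, ?_, ?_⟩, ?_⟩)
      ((h.differentiableOn.comp (by fun_prop) fun w hw => ⟨trivial, ?_, ?_⟩).sub
        (differentiableOn_const L)) (fun w hw h0 => ?_) h2⟩
    · rw [sub_zero]
      exact hC w (mem_slitStrip hw.2 (Or.inl h0)) (abs_le.2 hw.1) h0
    · exact neg_le_neg hw.1.1.2
    · simpa using neg_le_neg hw.1.1.1
    · simpa using neg_le_neg hw.1.2.2
    · simpa using neg_le_neg hw.1.2.1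
    · rintro ⟨e1, e2⟩
      refine hw.2 ⟨by simpa using e1, ?_⟩
      rcases e2 with e2 | e2
      · exact Or.inr (by simpa using e2)
      · exact Or.inl (by rw [neg_im] at e2; linarith)
    · simpa using hw.2.2
    · simpa using neg_lt_neg hw.2.1
    · have h3 := hC (-w) (mem_slitStrip ⟨by simpa using hw.2.2, by simpa using neg_le_neg hw.2.1⟩
        (Or.inl (by simpa using h0))) (by rw [neg_re, abs_neg]; exact abs_le.2 hw.1)
        (by simpa using h0)
      rw [neg_re, Real.log_neg_eq_log] at h3
      rw [sub_zero, sub_re]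
      linarith [abs_sub (H (-w)).re L.re]
  have hn0 : ∀ u : ℝ, H (-(u + ((0 : ℝ) : ℂ) * I)) = H (-u + ((0 : ℝ) : ℂ) * I) := fun u => by simp
  have hnp : ∀ u : ℝ, H (-(u + ((-π : ℝ) : ℂ) * I)) = H (-u + π * I) := fun u => by
    congr 1; push_cast; ring
  simp only [hn0, hnp] at key
  refine ⟨fun R hR h1 h2 y hy => ?_, fun ha hb => ?_⟩
  · obtain ⟨⟨i1, i2, -⟩, i3, i4, -⟩ := key R hR h1 h2
    rcases hy with rfl | rfl
    exacts [i1.add i4, i2.add i3]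
  -- the sides
  have hside : ∀ {g : ℂ → ℂ} {y0 y1 : ℝ} {l : Filter ℝ} {k c : ℂ}, y0 ≤ y1 →
      (∀ c : ℝ, ∀ᶠ x in l, x ≠ c) → Tendsto (expK q0 z) (stripEnd l y0 y1) (𝓝 k) →
      Tendsto g (stripEnd l y0 y1) (𝓝 c) →
      (∀ x y : ℝ, x ≠ 0 → y ∈ Icc y0 y1 → ContinuousWithinAt (fun y : ℝ => g (x + y * I))
        (Icc y0 y1) y) →
      Tendsto (fun x : ℝ => ∫ y in y0..y1, expK q0 z (x + y * I) * g (x + y * I)) l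
      (𝓝 ((y1 - y0 : ℝ) * (k * c))) := fun hy hl hk hg hc =>
    tendsto_kernel_side hq hy hl hk hg ((hl 0).mono fun x hx y hy => hc x y hx hy)
  have hneg : ∀ {l l' : Filter ℝ} {c : ℂ}, Tendsto (fun u : ℝ => -u) l l' →
      Tendsto H (stripEnd l' 0 π) (𝓝 c) →
      Tendsto (fun w => H (-w) - L) (stripEnd l (-π) 0) (𝓝 (c - L)) := fun {l l' c} hl hH => by
    refine (hH.comp (tendsto_inf.2 ⟨?_, tendsto_principal.2 ?_⟩)).sub_const L
    · rw [tendsto_comap_iff]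
      exact (hl.comp tendsto_comap).mono_left inf_le_left
    · have : {w : ℂ | w.im ∈ Icc (-π) 0} ∈ stripEnd l (-π) 0 :=
        inf_le_right (a := comap re l) (mem_principal_self _)
      filter_upwards [this] with w hw
      exact ⟨by simpa using hw.2, by simpa using neg_le_neg hw.1⟩
  have hcH : ∀ x y : ℝ, x ≠ 0 → y ∈ Icc 0 π →
      ContinuousWithinAt (fun y : ℝ => H (x + y * I)) (Icc 0 π) y := fun x y hx hy =>
    continuousOn_vertical h.continuousOn (fun y hy => line_mem_slitStrip hy hx) y hy
  have hcH' : ∀ x y : ℝ, x ≠ 0 → y ∈ Icc (-π) 0 →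
      ContinuousWithinAt (fun y : ℝ => H (-(x + y * I)) - L) (Icc (-π) 0) y :=
    fun x y hx hy => continuousOn_vertical h.neg_continuousOn (fun y hy => by
      have := line_mem_slitStrip (u := -x) (y := -y) ⟨by linarith [hy.2], by linarith [hy.1]⟩
        (neg_ne_zero.2 hx)
      change -(x + y * I : ℂ) ∈ slitStrip
      convert this using 1
      push_cast; ring) y hy
  have s1 := hside hpi.le eventually_ne_atTop (tendsto_expK_atTop (z := z) hq _ _)
    h.tendsto_atTop hcH
  have s2 := (hside hpi.le eventually_ne_atBot (tendsto_expK_atBot hq z _ _)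
    h.tendsto_atBot hcH).comp tendsto_neg_atTop_atBot
  have s3 := hside (by linarith) eventually_ne_atTop (tendsto_expK_atTop (z := z) hq _ _)
    (hneg tendsto_neg_atTop_atBot h.tendsto_atBot) hcH'
  have s4 := (hside (by linarith) eventually_ne_atBot (tendsto_expK_atBot hq z _ _)
    (hneg tendsto_neg_atBot_atTop h.tendsto_atTop) hcH').comp tendsto_neg_atTop_atBot
  -- the horizontal edges
  have e1 := intervalIntegral_tendsto_integral
    (integrable_expK_mul hq (Or.inl rfl) exp_zero_mul_I hz ha) tendsto_neg_atTop_atBot tendsto_id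
  have e2 := intervalIntegral_tendsto_integral
    (integrable_expK_mul hq (Or.inr rfl) exp_pi_mul_I' hz hb) tendsto_neg_atTop_atBot tendsto_id
  have etot := (((e1.sub e2).add ((s1.const_mul I).sub (s2.const_mul I))).sub
    ((s3.const_mul I).sub (s4.const_mul I)))
  have hconst : ∀ᶠ R : ℝ in atTop, r1 - r2 =
      (∫ u in -R..R, expK q0 z (u + (0 : ℝ) * I) *
        (H (u + (0 : ℝ) * I) + (H (-u + (0 : ℝ) * I) - L))) -
      (∫ u in -R..R, expK q0 z (u + π * I) *
        (H (u + π * I) + (H (-u + π * I) - L))) +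
      (I * (∫ y in (0 : ℝ)..π, expK q0 z (R + y * I) * H (R + y * I)) -
        I * ∫ y in (0 : ℝ)..π, expK q0 z ((-R : ℝ) + y * I) * H ((-R : ℝ) + y * I)) -
      (I * (∫ y in (-π)..0, expK q0 z (R + y * I) * (H (-(R + y * I)) - L)) -
        I * ∫ y in (-π)..0, expK q0 z ((-R : ℝ) + y * I) *
          (H (-((-R : ℝ) + y * I)) - L)) := by
    filter_upwards [hr₁, hr₂, eventually_gt_atTop 0] with R h1 h2 hR
    obtain ⟨⟨i1, i2, e1⟩, i3, i4, e2⟩ := key R hR h1 h2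
    have k0 := (continuous_expK_line hq (Or.inl rfl) exp_zero_mul_I hz).continuousOn (s := uIcc (-R) R)
    have kp := (continuous_expK_line hq (Or.inr rfl) exp_pi_mul_I' hz).continuousOn (s := uIcc (-R) R)
    simp only [mul_add]
    rw [intervalIntegral.integral_add (i1.continuousOn_mul k0) (i4.continuousOn_mul k0),
      intervalIntegral.integral_add (i2.continuousOn_mul kp) (i3.continuousOn_mul kp), ← e1, ← e2,
      rectInt, rectInt]
    simp only [hn0, hnp, expK_neg_pi]
    ring
  have hfin := tendsto_nhds_unique (etot.congr' (hconst.mono fun R hR => hR.symm)) tendsto_const_nhds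
  rw [← hfin]
  split_ifs <;> push_cast <;> ring

end

section

variable {σ δ q0 κ β ε : ℝ} {z w L : ℂ} {f F G H ℓ : ℂ → ℂ} {s y : ℝ}

lemma line_integral_of_eq (hq : 0 < q0) (hs : s = 1 ∨ s = -1) (hy : exp (y * I) = s)
    (hz : z.im ≠ 0 ∨ z = 0) {a : ℝ → ℂ} (ha : Integrable a)
    (hℓ : ∀ u : ℝ, u ≠ 0 → ℓ (q0 * exp (u + y * I)) = a u) {A B : Set ℝ}
    (hA : MeasurableSet A) (hB : ∀ x ∈ B, 0 < s * x) (hAB : ∀ u, s * (q0 * Real.exp u) ∈ B ↔ u ∈ A) :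
    IntegrableOn (fun x : ℝ => ℓ x / (x - z)) B ∧
    ∫ x in B, ℓ x / (x - z) = s * ∫ u in A, expK q0 z (u + y * I) * a u := by
  obtain ⟨h1, h2⟩ := line_integral hq hs hy hA hB hAB ℓ z
  have hae : (fun u : ℝ => expK q0 z (u + y * I) * ℓ (q0 * exp (u + y * I)))
      =ᵐ[volume] fun u : ℝ => expK q0 z (u + y * I) * a u := by
    filter_upwards [Measure.ae_ne volume (0 : ℝ)] with u hu
    rw [hℓ u hu]
  refine ⟨h1.2 (((integrable_expK_mul hq hs hy hz ha).congr hae.symm).integrableOn), ?_⟩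
  rw [h2, integral_congr_ae (ae_restrict_of_ae hae)]

/-- Integrability of a branch along the real line. -/
lemma integrable_real_line (hq : 0 < q0) (hz : z.im ≠ 0 ∨ z = 0) {a b : ℝ → ℂ} (ha : Integrable a)
    (hb : Integrable b) (hℓa : ∀ u : ℝ, u ≠ 0 → ℓ (q0 * exp (u + (0 : ℝ) * I)) = a u)
    (hℓb : ∀ u : ℝ, u ≠ 0 → ℓ (q0 * exp (u + π * I)) = b u) :
    Integrable (fun x : ℝ => ℓ x / (x - z)) ∧ ∫ x : ℝ, ℓ x / (x - z) =
      (∫ u : ℝ, expK q0 z (u + (0 : ℝ) * I) * a u) -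
        ∫ u : ℝ, expK q0 z (u + π * I) * b u := by
  have hpos : ∀ u : ℝ, 0 < q0 * Real.exp u := fun u => mul_pos hq (Real.exp_pos u)
  obtain ⟨i1, e1⟩ := line_integral_of_eq hq (Or.inl rfl) exp_zero_mul_I hz ha hℓa
    (A := univ) (B := Ioi 0) MeasurableSet.univ (fun x hx => by simpa using hx)
    (fun u => by simpa using hpos u)
  obtain ⟨i2, e2⟩ := line_integral_of_eq hq (Or.inr rfl) exp_pi_mul_I' hz hb hℓb
    (A := univ) (B := Iio 0) MeasurableSet.univ
    (fun x hx => by have : x < 0 := hx; linarith) (fun u => by simpa using hpos u)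
  rw [Measure.restrict_univ] at e1 e2
  have i2' : IntegrableOn (fun x : ℝ => ℓ x / (x - z)) (Iic 0) := by rwa [integrableOn_Iic_iff_integrableOn_Iio]
  constructor
  · have := i2'.union i1
    rwa [Iic_union_Ioi, integrableOn_univ] at this
  · rw [← intervalIntegral.integral_Iic_add_Ioi i2' i1, integral_Iic_eq_integral_Iio, e1, e2]
    push_cast; ring

lemma lineFun_exp (hq : 0 < q0) {a b : ℝ → ℂ}
    (ha : ∀ u : ℝ, u ≠ 0 → exp (a u) = f (q0 * exp (u + (0 : ℝ) * I)))
    (hb : ∀ u : ℝ, u ≠ 0 → exp (b u) = f (q0 * exp (u + π * I)))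
    {ζ : ℂ} (him : ζ.im = 0) (h0 : ζ ≠ 0) (h1 : ‖ζ‖ ≠ q0) :
    exp (lineFun q0 a b ζ) = f ζ := by
  have hu : Real.log (‖ζ‖ / q0) ≠ 0 := by
    refine Real.log_ne_zero_of_pos_of_ne_one (div_pos (norm_pos_iff.2 h0) hq) fun h => h1 ?_
    rwa [div_eq_one_iff_eq hq.ne'] at h
  rcases exists_line_of_real hq him h0 with ⟨h, e⟩ | ⟨h, e⟩
  · rw [lineFun, if_pos h, ha _ hu, ← e]
  · rw [lineFun, if_neg h.not_gt, hb _ hu, ← e]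

lemma norm_sq_of_real {ζ : ℂ} (him : ζ.im = 0) : ζ ^ 2 = ((‖ζ‖ ^ 2 : ℝ) : ℂ) := by
  have hζ : ζ = (ζ.re : ℂ) := ext (by simp) (by simp [him])
  rw [hζ, norm_real, Real.norm_eq_abs, sq_abs]
  push_cast; rfl

lemma IsResidue.zero (hq : 0 < q0) (g : ℂ → ℂ) (x0 x1 y0 y1 : ℝ) : IsResidue q0 0 g x0 x1 y0 y1 0 :=
  Or.inr ⟨fun _ _ => mul_ne_zero (by exact_mod_cast hq.ne') (exp_ne_zero _), rfl⟩

lemma cauchyS_eq {c : ℂ} (h : contourIntegral σ δ q0 (fun ζ => ℓ ζ / (ζ - z)) = 2 * π * I * c) :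
    cauchyS σ δ q0 ℓ z = c := by
  have : (2 * π * I : ℂ) ≠ 0 := by simp [Real.pi_ne_zero]
  rw [cauchyS, h]; field_simp

/-- What is shown about the branches of `log (F G)` on `Σ`: existence, and the factorisation of `F`
and `G` by the Cauchy integral. -/
def SolvesJumpProblem (σ δ q0 β : ℝ) (F G : ℂ → ℂ) : Prop :=
  (∃ ℓ, IsBranch σ δ q0 (fun ζ => F ζ * G ζ) ℓ) ∧
  ∀ ℓ, IsBranch σ δ q0 (fun ζ => F ζ * G ζ) ℓ →
    (∀ z ∈ Dplus σ δ q0 ∪ Dminus σ δ q0 ∪ {0}, ContourIntegrable σ δ q0 fun ζ => ℓ ζ / (ζ - z)) ∧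
    (∀ z ∈ Dplus σ δ q0, exp (cauchyS σ δ q0 ℓ z) = F z) ∧
    (∀ z ∈ Dminus σ δ q0, exp (-cauchyS σ δ q0 ℓ z) = G z) ∧
    exp (cauchyS σ δ q0 ℓ 0) = β

lemma eventually_mem_rect {p : ℂ} {y0 y1 : ℝ} (hp : p.im ∈ Ioo y0 y1) :
    ∀ᶠ R : ℝ in atTop, p ∈ Ioo (-R) R ×ℂ Ioo y0 y1 := by
  filter_upwards [eventually_gt_atTop |p.re|] with R hR
  exact ⟨abs_lt.1 hR, hp⟩

/-- The jump problem on the real line. -/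
theorem ZeroFreePair.solvesJumpProblem_line (h : ZeroFreePair (1 * q0 ^ 2) β F G) (hq : 0 < q0)
    (hβ : β ≠ 0) (hε : δ * σ = 1) : SolvesJumpProblem σ δ q0 β F G := by
  obtain ⟨H, L, hL, hH⟩ := h.exists_isStripLog hq hβ
  have hpi := Real.pi_pos
  obtain ⟨ac, ae, at1, at2⟩ := hH.jump (Or.inl rfl)
  obtain ⟨bc, be, bt1, bt2⟩ := hH.jump (Or.inr rfl)
  set a : ℝ → ℂ := fun u => H (u + (0 : ℝ) * I) + (H (-u + (0 : ℝ) * I) - L) with hadef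
  set b : ℝ → ℂ := fun u => H (u + π * I) + (H (-u + π * I) - L) with hbdef
  have hD : ∀ z : ℂ, (z ∈ Dplus σ δ q0 ↔ 0 < z.im) ∧ (z ∈ Dminus σ δ q0 ↔ z.im < 0) := fun z => by
    simp only [Dplus, Dminus, mem_ofPred_eq, hε]; norm_num
  have hloc := (hH.integral_jump (r1 := 0) (r2 := 0) hq (Or.inr rfl)
    (.of_forall fun R => IsResidue.zero hq _ _ _ _ _)
    (.of_forall fun R => IsResidue.zero hq _ _ _ _ _)).1
  have ia : Integrable a := h.integrable_log hβ hq (Or.inl rfl) rfl (s := 1) (Or.inl rfl)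
    (fun u hu => by rw [ae u hu, expMul_line exp_zero_mul_I]) at1 at2 fun R hR =>
      hloc R hR (IsResidue.zero hq _ _ _ _ _) (IsResidue.zero hq _ _ _ _ _) 0 (Or.inl rfl)
  have ib : Integrable b := h.integrable_log hβ hq (Or.inl rfl) rfl (s := -1) (Or.inr rfl)
    (fun u hu => by rw [be u hu, expMul_line exp_pi_mul_I']) bt1 bt2 fun R hR =>
      hloc R hR (IsResidue.zero hq _ _ _ _ _) (IsResidue.zero hq _ _ _ _ _) _ (Or.inr rfl)
  refine ⟨⟨lineFun q0 a b, ?_, ?_, ?_, ?_, fun h' => absurd h' (by rw [hε]; norm_num)⟩, fun ℓ hℓ => ?_⟩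
  all_goals try
    have hS : ∀ ζ ∈ Sig0 σ δ q0, ζ.im = 0 ∧ ζ ≠ 0 ∧ ‖ζ‖ ≠ q0 := fun ζ hζ => by
      obtain ⟨hζ1, hζ2⟩ : ζ.im = 0 ∧ ζ ≠ 0 := by
        rcases hζ.1 with h' | ⟨h', -⟩
        · exact h'
        · rw [hε] at h'; norm_num at h'
      refine ⟨hζ1, hζ2, fun hn => hζ.2 ?_⟩
      change ζ ^ 2 = _
      rw [norm_sq_of_real hζ1, hn, hε, one_mul]
  · intro ζ hζ
    obtain ⟨h1, h2, h3⟩ := hS ζ hζ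
    exact lineFun_exp hq (f := fun ζ => F ζ * G ζ) ae be h1 h2 h3
  · intro ζ hζ
    obtain ⟨h1, h2, h3⟩ := hS ζ hζ.1
    exact (continuousAt_lineFun hq ac bc (fun hr => h2 (ext hr h1)) h3).continuousWithinAt
  · exact tendsto_lineFun at1 bt1 ((tendsto_log_norm_infty hq).mono_left inf_le_left)
  · exact tendsto_lineFun at2 bt2 (tendsto_log_norm_zero hq (zero_notMem_Sig hq))
  · have hla := hℓ.eq_of_ray hq (Or.inl hε) (Or.inl rfl) exp_zero_mul_I ac ae at1 at2
    have hlb := hℓ.eq_of_ray hq (Or.inl hε) (Or.inr rfl) exp_pi_mul_I' bc be bt1 bt2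
    have hint := fun {z : ℂ} (hz : z.im ≠ 0 ∨ z = 0) => integrable_real_line hq hz ia ib hla hlb
    have hcont : ∀ {z r1 r2 : ℂ}, (z.im ≠ 0 ∨ z = 0) →
        (∀ᶠ R : ℝ in atTop, IsResidue q0 z H (-R) R 0 π r1) →
        (∀ᶠ R : ℝ in atTop, IsResidue q0 z (fun w => H (-w) - L) (-R) R (-π) 0 r2) →
        contourIntegral σ δ q0 (fun ζ => ℓ ζ / (ζ - z)) =
          r1 - r2 + 2 * π * I * (if z = 0 then L else 0) := fun {z r1 r2} hz h1 h2 => by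
      rw [contourIntegral, if_pos hε, (hint hz).2]
      convert (hH.integral_jump hq hz h1 h2).2 ia ib
    refine ⟨fun z hz => ⟨(hint ?_).1, fun h' => absurd h' (by rw [hε]; norm_num)⟩, fun z hz => ?_,
      fun z hz => ?_, ?_⟩
    · rcases hz with (hz | hz) | hz
      · exact Or.inl ((hD z).1.1 hz).ne'
      · exact Or.inl ((hD z).2.1 hz).ne
      · exact Or.inr hz
    · have him := (hD z).1.1 hz
      have hz0 : z ≠ 0 := by rintro rfl; simp at him
      obtain ⟨ez, -, hp, -⟩ := exists_log_coord hq hz0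
      set p := log (z / q0)
      have := hcont (r1 := 2 * π * I * H p) (r2 := 0) (Or.inl him.ne')
        ((eventually_mem_rect (hp him)).mono fun R hR => Or.inl ⟨p, hR, ez, rfl⟩)
        (.of_forall fun R => Or.inr ⟨fun w hw he => ?_, rfl⟩)
      · rw [if_neg hz0, sub_zero, mul_zero, add_zero] at this
        rw [cauchyS_eq this, hH.exp_eq _ (mem_slitStrip (Ioo_subset_Icc_self (hp him))
          (Or.inr (hp him))), ← ez]
      · have hw2 := hw.2
        rw [← he, expMul_im] at him
        exact him.not_ge (mul_nonpos_of_nonneg_of_nonpos (mul_pos hq (Real.exp_pos _)).le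
          (Real.sin_nonpos_of_nonpos_of_neg_pi_le hw2.2 hw2.1))
    · have him := (hD z).2.1 hz
      have hz0 : z ≠ 0 := by rintro rfl; simp at him
      obtain ⟨ez, -, -, hp⟩ := exists_log_coord hq hz0
      set p := log (z / q0)
      have hp' : (-p).im ∈ Ioo 0 π := by
        rw [neg_im]; constructor <;> linarith [(hp him).1, (hp him).2]
      have := hcont (r1 := 0) (r2 := 2 * π * I * (H (-p) - L)) (Or.inl him.ne)
        (.of_forall fun R => Or.inr ⟨fun w hw =>
          expMul_ne_of_strip hq hw.2 (Or.inl him), rfl⟩)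
        ((eventually_mem_rect (hp him)).mono fun R hR => Or.inl ⟨p, hR, ez, rfl⟩)
      rw [if_neg hz0, mul_zero, add_zero, zero_sub, ← mul_neg] at this
      rw [cauchyS_eq this, neg_neg, hH.exp_neg_eq _ (mem_slitStrip (Ioo_subset_Icc_self hp')
        (Or.inr hp')), neg_neg, ← ez]
    · have := hcont (z := 0) (r1 := 0) (r2 := 0) (Or.inr rfl)
        (.of_forall fun R => IsResidue.zero hq _ _ _ _ _)
        (.of_forall fun R => IsResidue.zero hq _ _ _ _ _)
      rw [if_pos rfl, sub_zero, zero_add] at this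
      rw [cauchyS_eq this, hL]

end

section

/-! ### The Riemann–Hilbert problem on the line and the circle -/

variable {σ δ q0 κ β ε : ℝ} {z w m : ℂ} {f F G H H' ℓ : ℂ → ℂ} {s y : ℝ}

/-- Exchanging the roles of the two functions, by `z ↦ -z`. -/
lemma ZeroFreePair.flip (h : ZeroFreePair κ β F G) (hκ : κ ≠ 0) (hβ : β ≠ 0) :
    ZeroFreePair κ β⁻¹ (fun z => G (-z)) fun z => F (-z) := by
  have hβ' : (β : ℂ) ≠ 0 := by exact_mod_cast hβ
  have hκ' : (κ : ℂ) ≠ 0 := by exact_mod_cast hκ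
  have hG : ∀ z ∈ Ω κ, κ / -z ∈ Ω κ ∧ G (-z) = F (κ / -z) / β := fun z hz => by
    have hz' : -(-z) ∈ Ω κ := by rwa [neg_neg]
    exact ⟨hat_mem_Ω hκ hz', by rw [h.hat _ hz', mul_div_cancel_left₀ _ hβ']⟩
  have hc : ContinuousOn (fun z : ℂ => (κ : ℂ) / -z) (Ω κ) :=
    continuousOn_const.div (by fun_prop) fun z hz => neg_ne_zero.2 hz.1
  refine ⟨⟨?_, ?_, ?_, ?_, fun z hz => ?_, fun z hz => ?_, fun R hR => ?_, ?_⟩, fun z hz => ?_,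
    fun b hb => ?_⟩
  · exact ((h.continuousOn.comp hc fun z hz => (hG z hz).1).div_const _).congr fun z hz => (hG z hz).2
  · have hl : ∀ z : ℂ, z ≠ 0 → Λ κ (κ / -z) = Λ κ z := fun z hz => by
      rw [Λ_hat hκ (neg_ne_zero.2 hz), Λ_neg, neg_neg]
    have hd : DifferentiableOn ℂ (fun z : ℂ => (κ : ℂ) / -z) (upperDomain κ) :=
      (differentiableOn_const _).div (by fun_prop) fun z hz => neg_ne_zero.2 hz.1
    refine ((h.differentiableOn.comp hd fun z hz =>
      ⟨div_ne_zero hκ' (neg_ne_zero.2 hz.1), ?_⟩).div_const β).congr fun z hz => (hG z (upperDomain_subset hz)).2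
    rw [hl z hz.1]; exact hz.2
  · exact h.tendsto_snd.comp (tendsto_inf.2 ⟨(Homeomorph.neg ℂ).isClosedEmbedding.tendsto_cocompact.mono_left
      inf_le_left, tendsto_principal.2 (eventually_inf_principal.2 (.of_forall fun z hz => by
        simpa using hz))⟩)
  · exact h.tendsto_fst.comp (tendsto_inf.2 ⟨(Homeomorph.neg ℂ).isClosedEmbedding.tendsto_cocompact.mono_left
      inf_le_left, tendsto_principal.2 (eventually_inf_principal.2 (.of_forall fun z hz => hz))⟩)
  · have h1 := (hG _ hz).2
    have h2 := h.hat (-(κ / z)) (by rw [neg_neg]; exact hat_mem_Ω hκ hz)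
    rw [div_neg, div_div_cancel₀ hκ'] at h2
    rw [h2, ofReal_inv, inv_mul_cancel_left₀ hβ']
  · have h1 := (hG _ (conj_mem_Ω hz)).2
    rw [h1, (hG z hz).2, map_div₀, conj_ofReal, ← h.map_conj _ (hG z hz).1]
    congr 2
    simp [div_neg]
  · have hκp := abs_pos.2 hκ
    have hκi := inv_pos.2 hκp
    have p1 := mul_nonneg hκp.le hR
    have p2 := mul_nonneg hκi.le hR
    obtain ⟨C, hC⟩ := h.bound (|κ| * R + |κ|⁻¹ * R) (by linarith)
    refine ⟨C / |β|, fun z hz => ?_⟩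
    have hn : ‖(κ : ℂ) / -z‖ = |κ| * ‖z‖⁻¹ := by
      rw [norm_div, norm_neg, norm_real, Real.norm_eq_abs, div_eq_mul_inv]
    have h1 := mul_lt_mul_of_pos_left hz.2.1 hκi
    have h2 := mul_lt_mul_of_pos_left hz.2.2.1 hκp
    have := hC (κ / -z) ⟨(hG z hz.1).1, by rw [hn]; linarith, by
      rw [hn, mul_inv, inv_inv]; linarith, (hG z hz.1).1.1⟩
    rw [Λ_hat hκ (neg_ne_zero.2 hz.1.1), Λ_neg, neg_neg] at this
    rw [(hG z hz.1).2, norm_div, norm_real, Real.norm_eq_abs, div_mul_eq_mul_div]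
    gcongr
  · obtain ⟨X, hX, hi⟩ := h.integrable
    refine ⟨X, hX, ?_⟩
    rw [← (Measure.measurePreserving_neg (volume : Measure ℝ)).setLIntegral_comp_preimage_emb
      (Homeomorph.neg ℝ).measurableEmbedding] at hi
    convert hi using 3
    · ext x; simp
    · simp [mul_comm]
  · have := h.ne_zero _ (hG z hz).1
    rw [(hG z hz).2]
    exact div_ne_zero this hβ'
  · have hb0 : b ≠ 0 := by rintro rfl; exact hκ' (by rw [← hb]; ring)
    obtain ⟨c, hc0, hev⟩ := h.branch (-b) (by rw [neg_sq, hb])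
    have ht : Tendsto (fun z : ℂ => (κ : ℂ) / -z) (𝓝[Ω κ] b) (𝓝[Ω κ] (-b)) := by
      refine tendsto_nhdsWithin_iff.2 ⟨?_, eventually_mem_nhdsWithin.mono fun z hz => (hG z hz).1⟩
      have hcont : ContinuousAt (fun z : ℂ => (κ : ℂ) / -z) b :=
        continuousAt_const.div (by fun_prop) (neg_ne_zero.2 hb0)
      have e : (κ : ℂ) / -b = -b := by rw [← hb]; field_simp
      have := hcont.tendsto
      rw [e] at this
      exact this.mono_left nhdsWithin_le_nhds
    refine ⟨c / |β|, by positivity, ?_⟩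
    filter_upwards [ht.eventually hev, self_mem_nhdsWithin] with z h1 h2
    rw [(hG z h2).2, norm_div, norm_real, Real.norm_eq_abs]
    gcongr

/-- The half-strip `Re w ≥ 0`, `0 ≤ Im w ≤ π` without the point `iπ/2`. -/
def slitHalfStrip : Set ℂ := (Ici 0 ×ℂ Icc 0 π) \ {((π / 2 : ℝ) : ℂ) * I}

lemma mem_slitHalfStrip (h0 : 0 ≤ w.re) (h : w.im ∈ Icc 0 π)
    (h' : 0 < w.re ∨ w.im ≠ π / 2) : w ∈ slitHalfStrip := by
  refine ⟨⟨h0, h⟩, ?_⟩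
  rintro rfl
  rcases h' with h' | h' <;> simp at h'

lemma line_mem_slitHalfStrip {u y : ℝ} (h0 : 0 ≤ u) (h : y ∈ Icc 0 π)
    (h' : 0 < u ∨ y ≠ π / 2) : (u + y * I : ℂ) ∈ slitHalfStrip :=
  mem_slitHalfStrip (by simpa using h0) (by simpa using h) (by simpa using h')

lemma expMul_mem_of_slitHalfStrip (hq : 0 < q0) (hw : w ∈ slitHalfStrip) :
    (q0 : ℂ) * exp w ∈ Ω (-1 * q0 ^ 2) ∧
      (0 < w.re → w.im ∈ Ioo 0 π →
        0 < (Λ (-1 * q0 ^ 2) (q0 * exp w)).im) := by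
  have h0 : (q0 : ℂ) * exp w ≠ 0 :=
    mul_ne_zero (by exact_mod_cast hq.ne') (exp_ne_zero _)
  have hy : w.im ∈ Icc 0 π := hw.1.2
  have hu : 0 ≤ w.re := hw.1.1
  have hpos : 0 < w.re → w.im ∈ Ioo 0 π →
      0 < (Λ (-1 * q0 ^ 2) (q0 * exp w)).im := fun hu hy => by
    rw [Λ_expMul_im hq]
    have h1 := Real.sin_pos_of_pos_of_lt_pi hy.1 hy.2
    have h2 : 0 < Real.exp w.re + -1 * Real.exp (-w.re) := by
      have := Real.exp_lt_exp.2 (show -w.re < w.re by linarith)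
      linarith
    positivity
  refine ⟨⟨h0, fun hl => ?_, ?_⟩, hpos⟩
  · by_cases hc : w.im = π / 2
    · have hu' : 0 < w.re := lt_of_le_of_ne hu fun he =>
        hw.2 (ext (by simpa using he.symm) (by simpa using hc))
      have := hpos hu' (by rw [hc]; constructor <;> linarith [Real.pi_pos])
      rw [hl] at this
      simp at this
    · have := abs_im_sub_le_norm_Λ hq hy
      rw [hl, norm_zero] at this
      have h3 := abs_pos.2 (sub_ne_zero.2 hc)
      have h4 : 0 < q0 * (2 / π * |w.im - π / 2|) := by
        have := Real.pi_pos
        positivity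
      linarith
  · rw [Λ_expMul_im hq]
    have h1 := Real.sin_nonneg_of_nonneg_of_le_pi hy.1 hy.2
    have h2 : 0 ≤ Real.exp w.re + -1 * Real.exp (-w.re) := by
      have := Real.exp_le_exp.2 (show -w.re ≤ w.re by linarith)
      linarith
    positivity

lemma reflect_mem (hw : w ∈ slitHalfStrip) :
    (π : ℂ) * I + conj w ∈ slitHalfStrip := by
  have h1 : 0 ≤ w.re := hw.1.1
  have h2 : 0 ≤ w.im ∧ w.im ≤ π := hw.1.2
  refine mem_slitHalfStrip (by simpa using h1) ?_ ?_
  · simp only [add_im, conj_im, im_ofReal_mul, I_im, mul_one]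
    exact ⟨by linarith, by linarith⟩
  · by_cases h : 0 < w.re
    · exact Or.inl (by simpa using h)
    · refine Or.inr fun he => hw.2 (ext ?_ ?_)
      · simpa using le_antisymm (not_lt.1 h) h1
      · simp only [add_im, conj_im, im_ofReal_mul, I_im, mul_one] at he ⊢
        linarith

/-- The logarithm of `F` in the part `|z| ≥ q0`, `Im z ≥ 0` of its domain, in exponential
coordinates. The part of the domain of `G` inside the circle is obtained from it by `w ↦ iπ - w`. -/
structure IsHalfStripLog (q0 β : ℝ) (F G H : ℂ → ℂ) : Prop where
  continuousOn : ContinuousOn H slitHalfStrip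
  exp_eq : ∀ w ∈ slitHalfStrip, exp (H w) = F (q0 * exp w)
  exp_hat_eq : ∀ w ∈ slitHalfStrip, exp (H w) = β * G (q0 * exp (π * I - w))
  differentiableOn : DifferentiableOn ℂ H (Ioi 0 ×ℂ Ioo 0 π)
  tendsto : Tendsto H (stripEnd atTop 0 π) (𝓝 0)
  symm : ∀ w ∈ slitHalfStrip, H (π * I + conj w) = conj (H w)
  bound : ∀ R, ∃ C, ∀ w ∈ slitHalfStrip, w.re ≤ R → w.im ≠ π / 2 →
    |(H w).re| ≤ C + |Real.log (w.im - π / 2)|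

lemma ZeroFreePair.exists_isHalfStripLog (h : ZeroFreePair (-1 * q0 ^ 2) β F G) (hq : 0 < q0) :
    ∃ H, IsHalfStripLog q0 β F G H := by
  have hpi := Real.pi_pos
  have hκ : (-1 * q0 ^ 2 : ℝ) ≠ 0 := by simp [hq.ne']
  have hint : interior (Ici 0 ×ℂ Icc 0 π) = Ioi 0 ×ℂ Ioo 0 π := by
    rw [interior_reProdIm, interior_Ici, interior_Icc]
  have hmem := fun w hw => (expMul_mem_of_slitHalfStrip (w := w) hq hw).1
  have htop : Ioi 0 ×ℂ Icc 0 π ⊆ slitHalfStrip := fun w hw =>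
    mem_slitHalfStrip (le_of_lt hw.1) hw.2 (Or.inl hw.1)
  have hd : DifferentiableOn ℂ (fun w => F (q0 * exp w))
      (interior (Ici 0 ×ℂ Icc 0 π)) := by
    rw [hint]
    refine h.differentiableOn.comp (by fun_prop) fun w hw => ?_
    have hm := htop ⟨hw.1, Ioo_subset_Icc_self hw.2⟩
    exact ⟨(hmem w hm).1, (expMul_mem_of_slitHalfStrip hq hm).2 hw.1 hw.2⟩
  have hlim : Tendsto (fun w => F (q0 * exp w)) (stripEnd atTop 0 π) (𝓝 1) := by
    refine h.tendsto_fst.comp (tendsto_inf.2 ⟨tendsto_expMul_atTop hq _ _, tendsto_principal.2 ?_⟩)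
    filter_upwards [mem_stripEnd (Ioi_mem_atTop (0 : ℝ))] with w hw using hmem w (htop hw)
  have hdisj : Disjoint {((π / 2 : ℝ) : ℂ) * I} (interior (Ici 0 ×ℂ Icc 0 π)) := by
    rw [hint, disjoint_left]
    rintro _ rfl hw
    simpa using hw.1
  have hconv : Convex ℝ (Ici 0 ×ℂ Icc 0 π) :=
    ((convex_Ici _).is_linear_preimage reLm.isLinear).inter
      ((convex_Icc _ _).is_linear_preimage imLm.isLinear)
  have hw0 : (1 + I : ℂ) ∈ interior (Ici 0 ×ℂ Icc 0 π) := by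
    rw [hint]; exact ⟨by simp, by simp; linarith [Real.pi_gt_three]⟩
  obtain ⟨H, h1, h2, h3, h4⟩ := exists_stripLog (S := Ici 0 ×ℂ Icc 0 π)
    (P := {((π / 2 : ℝ) : ℂ) * I}) (y0 := 0) (y1 := π) hpi.le hconv hw0 hdisj htop
    (h.continuousOn.comp (by fun_prop) hmem) (fun w hw => h.ne_zero _ (hmem w hw)) hd hlim
  replace h2 : ∀ w ∈ slitHalfStrip, exp (H w) = F (q0 * exp w) := h2
  refine ⟨H, h1, h2, fun w hw => ?_, hint ▸ h3, h4, fun w hw => ?_, fun R => ?_⟩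
  · have e : (q0 : ℂ) * exp (π * I - w) =
        ((-1 * q0 ^ 2 : ℝ) : ℂ) / (q0 * exp w) := by
      have h0 : (q0 : ℂ) ≠ 0 := by exact_mod_cast hq.ne'
      have := exp_ne_zero w
      rw [exp_sub, exp_pi_mul_I]
      push_cast
      field_simp
    have hm : -((q0 : ℂ) * exp (π * I - w)) ∈ Ω (-1 * q0 ^ 2) := by
      have := hat_mem_Ω hκ (z := -(q0 * exp w)) (by rw [neg_neg]; exact hmem w hw)
      rwa [div_neg, ← e] at this
    rw [h2 w hw, ← h.hat _ hm, e, div_div_cancel₀ (by exact_mod_cast hκ)]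
  · have hc : ContinuousOn (fun w => conj (H (π * I + conj w)))
        slitHalfStrip := continuous_conj.comp_continuousOn
      (ContinuousOn.comp (g := H) h1 (continuous_const.add continuous_conj).continuousOn
        fun w hw => reflect_mem hw)
    have := stripEnd_neBot (l := atTop) hpi.le
    have hpre : IsPreconnected slitHalfStrip :=
      (StarConvex.isPathConnected (starConvex_diff hconv hw0 hdisj)
        ⟨interior_subset hw0, disjoint_right.1 hdisj hw0⟩).isConnected.isPreconnected
    have hlim : Tendsto (fun w => conj (H (π * I + conj w)))
        (stripEnd atTop 0 π) (𝓝 0) := by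
      have ht : Tendsto (fun w : ℂ => π * I + conj w) (stripEnd atTop 0 π)
          (stripEnd atTop 0 π) := by
        refine tendsto_inf.2 ⟨tendsto_comap_iff.2 ?_, tendsto_principal.2 ?_⟩
        · have : (re ∘ fun w : ℂ => π * I + conj w) = re := by
            ext w; simp
          rw [this]
          exact tendsto_comap.mono_left inf_le_left
        · filter_upwards [mem_stripEnd (Ioi_mem_atTop (0 : ℝ))] with w hw
          exact (reflect_mem (htop hw)).1.2
      have := (continuous_conj.tendsto 0).comp (h4.comp ht)
      rwa [map_zero] at this
    have := eqOn_of_exp_eq (T := slitHalfStrip) hpre hc h1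
      (fun w hw => by
        rw [exp_conj, h2 _ (reflect_mem hw), h2 w hw, ← h.map_conj _ (hmem _ (reflect_mem hw))]
        congr 1
        rw [exp_add, exp_pi_mul_I, exp_conj]
        simp) (l := stripEnd atTop 0 π)
      (le_principal_iff.2 (mem_of_superset (mem_stripEnd (Ioi_mem_atTop (0 : ℝ))) htop))
      (by simpa using hlim.sub h4) hw
    rw [← this]; simp
  · obtain ⟨C, hC⟩ := h.exists_re_bound (H := H) hq |R|
    refine ⟨C + |Real.log (q0 * (2 / π))|, fun w hw hR h0 => ?_⟩
    have h0' := sub_ne_zero.2 h0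
    have := hC w (by rw [abs_of_nonneg hw.1.1]; exact hR.trans (le_abs_self R)) (hmem w hw) (h2 w hw)
      (q0 * (2 / π) * |w.im - π / 2|) (mul_pos (by positivity) (abs_pos.2 h0'))
      (by rw [mul_assoc]; exact abs_im_sub_le_norm_Λ hq hw.1.2)
    linarith [log_le_of_mul_le (a := q0 * (2 / π)) (by positivity) h0']

end

section

variable {σ δ q0 κ β ε : ℝ} {z w m : ℂ} {f F G H H' ℓ : ℂ → ℂ} {s y : ℝ}

/-- The function on `ℝ ∖ {0}` with the values `p u` at `u > 0` and `r u` at `-u < 0`. -/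
def fold (p r : ℝ → ℂ) (u : ℝ) : ℂ := if 0 < u then p u else r (-u)

lemma fold_pos {p r : ℝ → ℂ} {u : ℝ} (hu : 0 < u) : fold p r u = p u := if_pos hu

lemma fold_neg {p r : ℝ → ℂ} {u : ℝ} (hu : u < 0) : fold p r u = r (-u) := if_neg hu.not_gt

lemma fold_properties {p r : ℝ → ℂ} (hp : ContinuousOn p (Ici 0)) (hr : ContinuousOn r (Ici 0))
    (tp : Tendsto p atTop (𝓝 0)) (tr : Tendsto r atTop (𝓝 0)) :
    ContinuousOn (fold p r) {0}ᶜ ∧ Tendsto (fold p r) atTop (𝓝 0) ∧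
    Tendsto (fold p r) atBot (𝓝 0) ∧ ∀ R, 0 < R → IntervalIntegrable (fold p r) volume (-R) R := by
  have hr' : ContinuousOn (fun u => r (-u)) (Iic 0) :=
    hr.comp (by fun_prop) fun u hu => by simpa using hu
  refine ⟨fun u hu => ContinuousAt.continuousWithinAt ?_, tp.congr' ?_,
    (tr.comp tendsto_neg_atBot_atTop).congr' ?_, fun R hR => ?_⟩
  · rcases lt_or_gt_of_ne (show u ≠ 0 from hu) with h | h
    · refine (hr'.continuousAt (Iic_mem_nhds h)).congr ?_
      filter_upwards [Iio_mem_nhds h] with v hv using (fold_neg hv).symm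
    · refine (hp.continuousAt (Ici_mem_nhds h)).congr ?_
      filter_upwards [Ioi_mem_nhds h] with v hv using (fold_pos hv).symm
  · filter_upwards [eventually_gt_atTop 0] with u hu using (fold_pos hu).symm
  · filter_upwards [eventually_lt_atBot 0] with u hu using (fold_neg hu).symm
  · refine IntervalIntegrable.trans (b := 0) ?_ ?_
    · refine ((hr'.mono fun u hu => ?_).intervalIntegrable).congr_ae ?_
      · rw [uIcc_of_le (by linarith)] at hu; exact hu.2
      · filter_upwards [ae_restrict_mem measurableSet_uIoc, ae_restrict_of_ae (Measure.ae_ne volume (0 : ℝ))]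
          with u hu h0
        rw [uIoc_of_le (by linarith)] at hu
        exact (fold_neg (lt_of_le_of_ne hu.2 h0)).symm
    · refine ((hp.mono fun u hu => ?_).intervalIntegrable).congr fun u hu => ?_
      · rw [uIcc_of_le hR.le] at hu; exact hu.1
      · rw [uIoc_of_le hR.le] at hu; exact (fold_pos hu.1).symm

lemma tendsto_fold_integral {p r k : ℝ → ℂ} (hi : Integrable fun u => k u * fold p r u) :
    Tendsto (fun R : ℝ => ∫ u in (0 : ℝ)..R, k u * p u) atTop
      (𝓝 (∫ u in Ioi 0, k u * fold p r u)) ∧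
    Tendsto (fun R : ℝ => ∫ u in (0 : ℝ)..R, k (-u) * r u) atTop
      (𝓝 (∫ u in Iio 0, k u * fold p r u)) := by
  constructor
  · refine (intervalIntegral_tendsto_integral_Ioi 0 hi.integrableOn tendsto_id).congr' ?_
    filter_upwards [eventually_ge_atTop 0] with R hR
    refine intervalIntegral.integral_congr_ae (.of_forall fun u hu => ?_)
    replace hu : u ∈ uIoc 0 R := hu
    rw [uIoc_of_le hR] at hu
    rw [fold_pos hu.1]
  · rw [← integral_Iic_eq_integral_Iio]
    refine (intervalIntegral_tendsto_integral_Iic 0 hi.integrableOn tendsto_neg_atTop_atBot).congr' ?_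
    filter_upwards [eventually_ge_atTop 0] with R hR
    have := intervalIntegral.integral_comp_neg (a := 0) (b := R) (fun u => k u * fold p r u)
    rw [neg_zero] at this
    rw [← this]
    refine intervalIntegral.integral_congr_ae (.of_forall fun u hu => ?_)
    rw [uIoc_of_le hR] at hu
    rw [fold_neg (neg_lt_zero.2 hu.1), neg_neg]

/-- The boundary values that enter the two residue integrals over the half-strips to the right and
to the left of the imaginary axis. The first four terms come from the rays, the last from the arc. -/
def halfEdges (q0 : ℝ) (z : ℂ) (H : ℂ → ℂ) (m : ℂ) (R : ℝ) : ℂ :=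
  (∫ u in (0 : ℝ)..R, expK q0 z (u + (0 : ℝ) * I) * H (u + (0 : ℝ) * I)) -
  (∫ u in (0 : ℝ)..R, expK q0 z (u + π * I) * H (u + π * I)) -
  (∫ u in (0 : ℝ)..R, expK q0 z ((-u : ℝ) + (0 : ℝ) * I) * (H (u + π * I) - m)) +
  (∫ u in (0 : ℝ)..R, expK q0 z ((-u : ℝ) + π * I) * (H (u + (0 : ℝ) * I) - m)) -
  I * ∫ y in (0 : ℝ)..π, expK q0 z ((0 : ℝ) + y * I) *
    (H ((0 : ℝ) + y * I) + H ((0 : ℝ) + (π - y : ℝ) * I) - m)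

lemma IsHalfStripLog.residue_right (h : IsHalfStripLog q0 β F G H) (hq : 0 < q0) {R : ℝ} (hR : 0 < R)
    {r : ℂ} (hr : IsResidue q0 z H 0 R 0 π r) :
    IntervalIntegrable (fun y : ℝ => H ((0 : ℝ) + y * I)) volume 0 π ∧
      rectInt (fun w => expK q0 z w * H w) 0 R 0 π = r := by
  have hpi := Real.pi_pos
  obtain ⟨C, hC⟩ := h.bound R
  refine (rectInt_kernel_vertical (c := π / 2) (C := C) hq hR (by linarith)
    (by linarith) (by linarith) (h.continuousOn.mono fun w hw => ?_)
    (h.differentiableOn.mono fun w hw => ⟨hw.1.1, hw.2⟩) (fun w hw h0 => ?_) hr).imp_right And.right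
  · refine mem_slitHalfStrip hw.1.1.1 hw.1.2 (or_iff_not_imp_right.2 fun h0 => ?_)
    exact lt_of_le_of_ne hw.1.1.1 fun he => hw.2 ⟨not_not.1 h0, Or.inl he.symm⟩
  · exact hC w (mem_slitHalfStrip hw.1.1 hw.2 (Or.inr h0)) hw.1.2 h0

lemma IsHalfStripLog.residue_left (h : IsHalfStripLog q0 β F G H) (hq : 0 < q0) {R : ℝ} (hR : 0 < R)
    {r : ℂ} (hr : IsResidue q0 z (fun w => H (π * I - w) - m) (-R) 0 0 π r) :
    rectInt (fun w => expK q0 z w * (H (π * I - w) - m)) (-R) 0 0 π = r := by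
  have hpi := Real.pi_pos
  have hre : ∀ w : ℂ, (π * I - w).re = -w.re := fun w => by simp
  have him : ∀ w : ℂ, (π * I - w).im = π - w.im := fun w => by simp
  obtain ⟨C, hC⟩ := h.bound R
  refine (rectInt_kernel_vertical (c := π / 2) (C := C + |m.re|) hq (by linarith) (by linarith)
    (by linarith) (by linarith)
    ((h.continuousOn.comp (by fun_prop) fun w hw => ?_).sub continuousOn_const)
    ((h.differentiableOn.comp (by fun_prop) fun w hw => ?_).sub (differentiableOn_const m))
    (fun w hw h0 => ?_) hr).2.2
  · have h1 : w.re ≤ 0 := hw.1.1.2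
    refine mem_slitHalfStrip (by rw [hre]; linarith) ?_ (or_iff_not_imp_right.2 fun h0 => ?_)
    · rw [him]; exact ⟨by linarith [hw.1.2.2], by linarith [hw.1.2.1]⟩
    · rw [hre]
      rw [not_not, him] at h0
      have : w.re ≠ 0 := fun he => hw.2 ⟨by linarith, Or.inr he⟩
      linarith [lt_of_le_of_ne h1 this]
  · refine ⟨?_, ?_, ?_⟩
    · change 0 < (π * I - w).re; rw [hre]; linarith [show w.re < 0 from hw.1.2]
    · rw [him]; linarith [hw.2.2]
    · rw [him]; linarith [hw.2.1]
  · have h1 := hC (π * I - w) (mem_slitHalfStrip (by rw [hre]; linarith [hw.1.2])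
      (by rw [him]; exact ⟨by linarith [hw.2.2], by linarith [hw.2.1]⟩)
      (Or.inr (by rw [him]; exact fun he => h0 (by linarith)))) (by rw [hre]; linarith [hw.1.1])
      (by rw [him]; exact fun he => h0 (by linarith))
    rw [him, show π - w.im - π / 2 = -(w.im - π / 2) by ring,
      Real.log_neg_eq_log] at h1
    change |(H (π * I - w) - m).re| ≤ _
    rw [sub_re]
    linarith [abs_sub (H (π * I - w)).re m.re]

lemma IsHalfStripLog.continuousOn_ray (h : IsHalfStripLog q0 β F G H) {y : ℝ}
    (hy : y = 0 ∨ y = π) : ContinuousOn (fun u : ℝ => H (u + y * I)) (Ici 0) :=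
  h.continuousOn.comp (by fun_prop) fun u hu => by
    have := Real.pi_pos
    rcases hy with rfl | rfl
    · exact line_mem_slitHalfStrip hu ⟨le_rfl, this.le⟩ (Or.inr (by linarith))
    · exact line_mem_slitHalfStrip hu ⟨this.le, le_rfl⟩ (Or.inr (by linarith))

lemma IsHalfStripLog.intervalIntegrable_arc (h : IsHalfStripLog q0 β F G H) (hq : 0 < q0) :
    IntervalIntegrable (fun y : ℝ => H ((0 : ℝ) + y * I) + H ((0 : ℝ) + (π - y : ℝ) * I) - m)
      volume 0 π := by
  have h1 := (h.residue_right hq one_pos (IsResidue.zero hq H 0 1 0 π)).1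
  have h2 := (h1.comp_sub_left π).symm
  rw [sub_self, sub_zero] at h2
  exact (h1.add h2).sub intervalIntegrable_const

lemma continuous_expK_arc (hq : 0 < q0) (hz : ‖z‖ ≠ q0) :
    Continuous fun y : ℝ => expK q0 z ((0 : ℝ) + y * I) :=
  continuous_iff_continuousAt.2 fun y => ContinuousAt.comp (g := expK q0 z)
    (expK_ne fun he => hz (by rw [← he, norm_expMul hq]; simp)) (by fun_prop)

open Classical in
lemma IsHalfStripLog.tendsto_halfEdges (h : IsHalfStripLog q0 β F G H) (hq : 0 < q0)
    (hz : ‖z‖ ≠ q0) {r1 r2 : ℂ}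
    (hr₁ : ∀ᶠ R : ℝ in atTop, IsResidue q0 z H 0 R 0 π r1)
    (hr₂ : ∀ᶠ R : ℝ in atTop, IsResidue q0 z (fun w => H (π * I - w) - m) (-R) 0 0 π r2) :
    Tendsto (halfEdges q0 z H m) atTop
      (𝓝 (r1 - r2 + π * I * (if z = 0 then m else 0))) := by
  have hpi := Real.pi_pos
  have s1 := tendsto_kernel_side (g := H) hq hpi.le eventually_ne_atTop
    (tendsto_expK_atTop (z := z) hq _ _) h.tendsto
    ((eventually_gt_atTop 0).mono fun x hx => continuousOn_vertical h.continuousOn fun y hy =>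
      line_mem_slitHalfStrip hx.le hy (Or.inl hx))
  have ht : Tendsto (fun w => H (π * I - w) - m) (stripEnd atBot 0 π) (𝓝 (0 - m)) := by
    refine (h.tendsto.comp (tendsto_inf.2 ⟨tendsto_comap_iff.2 ?_, tendsto_principal.2 ?_⟩)).sub_const m
    · have : (re ∘ fun w : ℂ => π * I - w) = fun w => -w.re := by ext w; simp
      rw [this]
      exact (tendsto_neg_atBot_atTop.comp tendsto_comap).mono_left inf_le_left
    · filter_upwards [mem_stripEnd (Iio_mem_atBot (0 : ℝ))] with w hw
      have h1 : 0 ≤ w.im ∧ w.im ≤ π := hw.2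
      exact ⟨by simpa using h1.2, by simpa using h1.1⟩
  have s2 := (tendsto_kernel_side hq hpi.le eventually_ne_atBot
    (tendsto_expK_atBot hq z _ _) ht ((eventually_lt_atBot 0).mono fun x hx =>
      (ContinuousOn.comp (g := H) h.continuousOn (by fun_prop) fun y hy => by
        have := line_mem_slitHalfStrip (u := -x) (y := π - y) (by linarith)
          ⟨by linarith [hy.2], by linarith [hy.1]⟩ (Or.inl (by linarith))
        convert this using 1
        push_cast; ring).sub continuousOn_const)).comp tendsto_neg_atTop_atBot
  have hev : ∀ᶠ R : ℝ in atTop, r1 - r2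
      - I * (∫ y in (0 : ℝ)..π, expK q0 z (R + y * I) * H (R + y * I))
      - I * (∫ y in (0 : ℝ)..π, expK q0 z ((-R : ℝ) + y * I) *
        (H (π * I - ((-R : ℝ) + y * I)) - m)) = halfEdges q0 z H m R := by
    filter_upwards [hr₁, hr₂, eventually_gt_atTop 0] with R h1 h2 hR
    obtain ⟨i1, e1⟩ := h.residue_right hq hR h1
    have e2 := h.residue_left hq hR h2
    have i2 := (i1.comp_sub_left π).symm
    rw [sub_self, sub_zero] at i2
    have kc := (continuous_expK_arc hq hz).continuousOn (s := uIcc 0 π)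
    have hflip : ∀ g : ℝ → ℂ, ∫ u in -R..0, g u = ∫ u in (0 : ℝ)..R, g (-u) := fun g => by
      rw [intervalIntegral.integral_comp_neg, neg_zero]
    have a1 : ∀ u : ℝ, (π : ℂ) * I - ((-u : ℝ) + (0 : ℝ) * I) = u + π * I :=
      fun u => by push_cast; ring
    have a2 : ∀ u : ℝ, (π : ℂ) * I - ((-u : ℝ) + π * I) = u + (0 : ℝ) * I :=
      fun u => by push_cast; ring
    have a3 : ∀ y : ℝ, (π : ℂ) * I - ((0 : ℝ) + y * I) = (0 : ℝ) + (π - y : ℝ) * I :=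
      fun y => by push_cast; ring
    have e3 : ∫ y in (0 : ℝ)..π, expK q0 z ((0 : ℝ) + y * I) *
        (H ((0 : ℝ) + y * I) + H ((0 : ℝ) + (π - y : ℝ) * I) - m) =
        (∫ y in (0 : ℝ)..π, expK q0 z ((0 : ℝ) + y * I) * H ((0 : ℝ) + y * I)) +
        ∫ y in (0 : ℝ)..π, expK q0 z ((0 : ℝ) + y * I) *
          (H ((0 : ℝ) + (π - y : ℝ) * I) - m) := by
      rw [← intervalIntegral.integral_add (i1.continuousOn_mul kc)
        ((i2.sub intervalIntegrable_const).continuousOn_mul kc)]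
      congr 1; ext y; ring
    rw [rectInt] at e1 e2
    rw [hflip, hflip] at e2
    simp only [a1, a2, a3] at e2
    rw [halfEdges, e3, ← e1, ← e2]
    ring
  have := (((s1.const_mul I).const_sub (r1 - r2)).sub (s2.const_mul I)).congr' hev
  convert this using 2
  split_ifs <;> push_cast <;> ring

lemma expK_neg (z w : ℂ) : expK q0 (-z) w = expK q0 z (w + π * I) := by
  rw [expK, expK, exp_add, exp_pi_mul_I, ← neg_div_neg_eq]
  congr 1 <;> ring

/-- The logarithm of `F G` on the rays `s q0 e^u`, `u > 0`. -/
def rayLog (H H' : ℂ → ℂ) (y : ℝ) (u : ℝ) : ℂ :=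
  H (u + y * I) + H' (u + (π - y : ℝ) * I)

/-- The logarithm of `F G` on an open semicircle. -/
def arcLog (H : ℂ → ℂ) (m : ℂ) (y : ℝ) : ℂ :=
  H ((0 : ℝ) + y * I) + H ((0 : ℝ) + (π - y : ℝ) * I) - m

open Classical in
/-- The Cauchy integral over the line and the circle, evaluated by residues in the four domains. -/
lemma IsHalfStripLog.integral_jump (h : IsHalfStripLog q0 β F G H) {β' : ℝ} {F' G' : ℂ → ℂ}
    (h' : IsHalfStripLog q0 β' F' G' H') (hq : 0 < q0) (hz : z.im ≠ 0 ∨ z = 0) (hz' : ‖z‖ ≠ q0)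
    {r1 r2 r3 r4 : ℂ}
    (hr₁ : ∀ᶠ R : ℝ in atTop, IsResidue q0 z H 0 R 0 π r1)
    (hr₂ : ∀ᶠ R : ℝ in atTop, IsResidue q0 z (fun w => H (π * I - w) - m) (-R) 0 0 π r2)
    (hr₃ : ∀ᶠ R : ℝ in atTop, IsResidue q0 (-z) H' 0 R 0 π r3)
    (hr₄ : ∀ᶠ R : ℝ in atTop,
      IsResidue q0 (-z) (fun w => H' (π * I - w) - -m) (-R) 0 0 π r4)
    (ha : Integrable (fold (rayLog H H' 0) (rayLog H H' π)))
    (hb : Integrable (fold (rayLog H H' π) (rayLog H H' 0))) :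
    (∫ u in Ioi (0 : ℝ), expK q0 z (u + (0 : ℝ) * I) *
      fold (rayLog H H' 0) (rayLog H H' π) u) -
    (∫ u in Ioi (0 : ℝ), expK q0 z (u + π * I) *
      fold (rayLog H H' π) (rayLog H H' 0) u) -
    (∫ u in Iio (0 : ℝ), expK q0 z (u + (0 : ℝ) * I) *
      fold (rayLog H H' 0) (rayLog H H' π) u) +
    (∫ u in Iio (0 : ℝ), expK q0 z (u + π * I) *
      fold (rayLog H H' π) (rayLog H H' 0) u) -
    I * (∫ y in (0 : ℝ)..π, expK q0 z ((0 : ℝ) + y * I) * arcLog H m y) +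
    I * (∫ y in (0 : ℝ)..π, expK q0 (-z) ((0 : ℝ) + y * I) * arcLog H' (-m) y) =
    (r1 - r2) - (r3 - r4) + 2 * π * I * (if z = 0 then m else 0) := by
  have T := (h.tendsto_halfEdges hq hz' hr₁ hr₂).sub
    (h'.tendsto_halfEdges hq (by rwa [norm_neg]) hr₃ hr₄)
  obtain ⟨t1, t2⟩ := tendsto_fold_integral
    (integrable_expK_mul hq (Or.inl rfl) exp_zero_mul_I hz ha)
  obtain ⟨t3, t4⟩ := tendsto_fold_integral
    (integrable_expK_mul hq (Or.inr rfl) exp_pi_mul_I' hz hb)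
  have k0 : ∀ u : ℝ, expK q0 (-z) (u + (0 : ℝ) * I) = expK q0 z (u + π * I) :=
    fun u => by rw [expK_neg]; simp
  have k1 : ∀ u : ℝ, expK q0 (-z) (u + π * I) = expK q0 z (u + (0 : ℝ) * I) :=
    fun u => by
      rw [expK_neg]
      refine expK_congr ?_
      rw [exp_add, exp_add, exp_add, exp_pi_mul_I]
      simp
  have T' := ((((t1.sub t3).sub t2).add t4).sub_const
    (I * ∫ y in (0 : ℝ)..π, expK q0 z ((0 : ℝ) + y * I) * arcLog H m y)).add_const
    (I * ∫ y in (0 : ℝ)..π, expK q0 (-z) ((0 : ℝ) + y * I) * arcLog H' (-m) y)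
  have hev : ∀ᶠ R : ℝ in atTop, halfEdges q0 z H m R - halfEdges q0 (-z) H' (-m) R =
      (∫ u in (0 : ℝ)..R, expK q0 z (u + (0 : ℝ) * I) * rayLog H H' 0 u) -
      (∫ u in (0 : ℝ)..R, expK q0 z (u + π * I) * rayLog H H' π u) -
      (∫ u in (0 : ℝ)..R, expK q0 z ((-u : ℝ) + (0 : ℝ) * I) * rayLog H H' π u) +
      (∫ u in (0 : ℝ)..R, expK q0 z ((-u : ℝ) + π * I) * rayLog H H' 0 u) -
      I * (∫ y in (0 : ℝ)..π, expK q0 z ((0 : ℝ) + y * I) * arcLog H m y) +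
      I * (∫ y in (0 : ℝ)..π, expK q0 (-z) ((0 : ℝ) + y * I) * arcLog H' (-m) y) := by
    filter_upwards [eventually_ge_atTop 0] with R hR
    have hsub : uIcc 0 R ⊆ Ici 0 := by rw [uIcc_of_le hR]; exact fun u hu => hu.1
    have c1 := continuous_expK_line hq (Or.inl rfl) exp_zero_mul_I hz
    have c2 := continuous_expK_line hq (Or.inr rfl) exp_pi_mul_I' hz
    have c3 := c1.comp continuous_neg
    have c4 := c2.comp continuous_neg
    have ii : ∀ {k g : ℝ → ℂ}, Continuous k → ContinuousOn g (Ici 0) →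
        IntervalIntegrable (fun u => k u * g u) volume 0 R := fun hk hg =>
      (hk.continuousOn.mul (hg.mono hsub)).intervalIntegrable
    have g1 := h.continuousOn_ray (Or.inl rfl)
    have g2 := h.continuousOn_ray (Or.inr rfl)
    have g1' := h'.continuousOn_ray (Or.inl rfl)
    have g2' := h'.continuousOn_ray (Or.inr rfl)
    have hm : ContinuousOn (fun _ : ℝ => m) (Ici 0) := continuousOn_const
    have r0 : rayLog H H' 0 = fun u : ℝ => H (u + (0 : ℝ) * I) + H' (u + π * I) := by
      ext u; rw [rayLog, sub_zero]
    have rp : rayLog H H' π = fun u : ℝ => H (u + π * I) + H' (u + (0 : ℝ) * I) := by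
      ext u; rw [rayLog, sub_self]
    have x1 := intervalIntegral.integral_add (ii c1 g1) (ii c1 g2')
    have x2 := intervalIntegral.integral_add (ii c2 g2) (ii c2 g1')
    have x3 := intervalIntegral.integral_add (ii c3 (g2.sub hm)) (ii c3 (g1'.add hm))
    have x4 := intervalIntegral.integral_add (ii c4 (g1.sub hm)) (ii c4 (g2'.add hm))
    simp only [Function.comp, Pi.sub_apply, Pi.add_apply, ← mul_add, sub_add_add_cancel] at x1 x2 x3 x4
    rw [r0, rp, halfEdges, halfEdges]
    simp only [k0, k1, sub_neg_eq_add]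
    simp only [x1, x2, x3, x4, arcLog, sub_neg_eq_add]
    ring
  have := tendsto_nhds_unique (T'.congr' (hev.mono fun R hR => hR.symm)) T
  rw [this]
  simp only [neg_eq_zero]
  split_ifs <;> ring

end

section

variable {σ δ q0 κ β ε : ℝ} {z w m : ℂ} {f F G H H' ℓ : ℂ → ℂ} {s y : ℝ}

lemma residues_zero (hq : 0 < q0) (hz : z.im < 0 ∨ z = 0) (H : ℂ → ℂ) (m : ℂ) (R : ℝ) :
    IsResidue q0 z H 0 R 0 π 0 ∧
      IsResidue q0 z (fun w => H (π * I - w) - m) (-R) 0 0 π 0 :=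
  ⟨Or.inr ⟨fun _ hw => expMul_ne_of_strip hq hw.2 hz, rfl⟩,
    Or.inr ⟨fun _ hw => expMul_ne_of_strip hq hw.2 hz, rfl⟩⟩

/-- The residues of the Cauchy kernel times the logarithms, according to the side of the circle on
which `z` lies. -/
lemma IsHalfStripLog.exists_residues (h : IsHalfStripLog q0 β F G H) (hq : 0 < q0) (hβ : β ≠ 0)
    (hm : exp m = β) (him : 0 < z.im) (hz : ‖z‖ ≠ q0) : ∃ r1 r2 v : ℂ,
    (∀ᶠ R : ℝ in atTop, IsResidue q0 z H 0 R 0 π r1) ∧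
    (∀ᶠ R : ℝ in atTop, IsResidue q0 z (fun w => H (π * I - w) - m) (-R) 0 0 π r2) ∧
    r1 - r2 = 2 * π * I * v ∧ (q0 < ‖z‖ → exp v = F z) ∧
    (‖z‖ < q0 → exp (-v) = G z) := by
  have hz0 : z ≠ 0 := by rintro rfl; simp at him
  have hzp := norm_pos_iff.2 hz0
  obtain ⟨ez, hre, hp, -⟩ := exists_log_coord hq hz0
  set p := log (z / q0)
  replace hp := hp him
  rcases lt_or_gt_of_ne hz with hlt | hlt
  · have hneg : p.re < 0 := by
      rw [hre]; exact Real.log_neg (div_pos hzp hq) ((div_lt_one hq).2 hlt)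
    refine ⟨0, 2 * π * I * (H (π * I - p) - m), -(H (π * I - p) - m),
      Eventually.of_forall fun R => Or.inr ⟨fun w hw he => ?_, rfl⟩, ?_, by ring,
      fun h' => absurd h' hlt.not_gt, fun _ => ?_⟩
    · have h1 := Real.one_le_exp (show 0 ≤ w.re from hw.1.1)
      rw [← he, norm_expMul hq] at hlt
      nlinarith
    · filter_upwards [eventually_gt_atTop (-p.re)] with R hR
      exact Or.inl ⟨p, ⟨⟨by linarith, hneg⟩, hp⟩, ez, rfl⟩
    · rw [neg_neg, exp_sub, hm, h.exp_hat_eq _ (mem_slitHalfStrip ?_ ?_ (Or.inl ?_)),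
        sub_sub_cancel, ← ez, mul_div_cancel_left₀ _ (by exact_mod_cast hβ)]
      · simpa using hneg.le
      · simpa using ⟨hp.2.le, hp.1.le⟩
      · simpa using hneg
  · have hpos : 0 < p.re := by
      rw [hre]; exact Real.log_pos ((one_lt_div hq).2 hlt)
    refine ⟨2 * π * I * H p, 0, H p, ?_,
      Eventually.of_forall fun R => Or.inr ⟨fun w hw he => ?_, rfl⟩, sub_zero _, fun _ => ?_,
      fun h' => absurd h' hlt.not_gt⟩
    · filter_upwards [eventually_gt_atTop p.re] with R hR
      exact Or.inl ⟨p, ⟨⟨hpos, hR⟩, hp⟩, ez, rfl⟩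
    · have h1 := Real.exp_le_one_iff.2 (show w.re ≤ 0 from hw.1.2)
      rw [← he, norm_expMul hq] at hlt
      nlinarith
    · rw [h.exp_eq _ (mem_slitHalfStrip hpos.le (Ioo_subset_Icc_self hp) (Or.inl hpos)), ← ez]

lemma exp_pi_sub (y : ℝ) : exp ((π - y : ℝ) * I) = -(exp (y * I))⁻¹ := by
  rw [ofReal_sub, sub_mul, exp_sub, exp_pi_mul_I]
  ring

/-- On the rays the sum of the two logarithms is a logarithm of `F G`. -/
lemma IsHalfStripLog.fold_exp (h : IsHalfStripLog q0 β F G H)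
    (h' : IsHalfStripLog q0 β⁻¹ (fun z => G (-z)) (fun z => F (-z)) H')
    (hF : ScatteringPair (-1 * q0 ^ 2) β F G) (hq : 0 < q0) (hβ : β ≠ 0) (hs : s = 1 ∨ s = -1)
    (hy : y = 0 ∨ y = π) (hys : exp (y * I) = s) {u : ℝ} (hu : u ≠ 0) :
    exp (fold (rayLog H H' y) (rayLog H H' (π - y)) u) =
      F (q0 * exp (u + y * I)) * G (q0 * exp (u + y * I)) := by
  have hpi := Real.pi_pos
  have key : ∀ {y : ℝ}, y = 0 ∨ y = π → ∀ {u : ℝ}, 0 < u → exp (rayLog H H' y u) =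
      F (q0 * exp (u + y * I)) * G (q0 * exp (u + y * I)) := fun {y} hy {u} hu => by
    have hyI : y ∈ Icc 0 π := by
      rcases hy with rfl | rfl
      exacts [⟨le_rfl, hpi.le⟩, ⟨hpi.le, le_rfl⟩]
    rw [rayLog, exp_add, h.exp_eq _ (line_mem_slitHalfStrip hu.le hyI (Or.inl hu)),
      h'.exp_eq _ (line_mem_slitHalfStrip hu.le ⟨by linarith [hyI.2], by linarith [hyI.1]⟩ (Or.inl hu))]
    congr 2
    rw [exp_add, exp_pi_sub, exp_add]
    rcases hy with rfl | rfl
    · simp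
    · rw [exp_pi_mul_I]; norm_num
  rcases lt_or_gt_of_ne hu with h0 | h0
  · have e : (q0 : ℂ) * exp ((-u : ℝ) + (π - y : ℝ) * I) =
        ((-1 * q0 ^ 2 : ℝ) : ℂ) / (q0 * exp (u + y * I)) := by
      have h0 : (q0 : ℂ) ≠ 0 := by exact_mod_cast hq.ne'
      have h1 := exp_ne_zero u
      have h2 := exp_ne_zero (y * I)
      rw [exp_add, exp_pi_sub, exp_add, ofReal_neg, exp_neg]
      push_cast; field_simp
    have hx : s * (q0 * Real.exp u) ≠ 0 :=
      mul_ne_zero (by rcases hs with rfl | rfl <;> norm_num) (mul_pos hq (Real.exp_pos u)).ne'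
    obtain ⟨m1, m2⟩ := ofReal_mem (κ := -1 * q0 ^ 2) hx
      (by nlinarith [sq_nonneg (s * (q0 * Real.exp u)), sq_pos_of_pos hq])
    rw [← expMul_line hys] at m1 m2
    rw [fold_neg h0, key (by rcases hy with rfl | rfl <;> simp) (neg_pos.2 h0), e,
      hF.mul_hat (by simp [hq.ne']) hβ m1 m2]
  · rw [fold_pos h0, key hy h0]

/-- On a semicircle `F G` is positive up to the constant factor `β`. -/
lemma IsHalfStripLog.arcLog_spec (h : IsHalfStripLog q0 β F G H) (hβ : β ≠ 0) (hy : y ∈ Icc 0 π)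
    (hy' : y ≠ π / 2) :
    (exp m = β → exp (arcLog H m y) = F (q0 * exp ((0 : ℝ) + y * I)) *
      G (q0 * exp ((0 : ℝ) + y * I))) ∧ (arcLog H m y).im = -m.im ∧
    ∃ r : ℝ, 0 < r ∧ F (q0 * exp ((0 : ℝ) + y * I)) *
      G (q0 * exp ((0 : ℝ) + y * I)) * β = r := by
  have hβ' : (β : ℂ) ≠ 0 := by exact_mod_cast hβ
  have m1 := line_mem_slitHalfStrip (u := 0) le_rfl hy (Or.inr hy')
  have m2 := line_mem_slitHalfStrip (u := 0) (y := π - y) le_rfl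
    ⟨by linarith [hy.2], by linarith [hy.1]⟩ (Or.inr fun he => hy' (by linarith))
  have e1 := h.exp_eq _ m1
  have e2 := h.exp_hat_eq _ m2
  rw [show (π : ℂ) * I - ((0 : ℝ) + (π - y : ℝ) * I) = (0 : ℝ) + y * I by
    push_cast; ring] at e2
  have e3 := h.symm _ m1
  rw [show (π : ℂ) * I + conj ((0 : ℝ) + y * I) = (0 : ℝ) + (π - y : ℝ) * I by
    simp; ring] at e3
  refine ⟨fun hm => ?_, ?_, Real.exp (2 * (H ((0 : ℝ) + y * I)).re), Real.exp_pos _, ?_⟩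
  · rw [arcLog, exp_sub, exp_add, e1, e2, hm]; field_simp
  · rw [arcLog, e3]; simp
  · rw [mul_assoc, mul_comm (G _), ← e2, ← e1, e3, ← exp_add, add_conj]
    push_cast; rfl

lemma eq_of_exp_eq_of_im_eq {a b : ℂ} (h : exp a = exp b) (him : a.im = b.im) :
    a = b := by
  refine ext (Real.exp_injective ?_) him
  rw [← norm_exp, ← norm_exp, h]

lemma IsHalfStripLog.continuousAt_arcLog (h : IsHalfStripLog q0 β F G H) (hy : y ∈ Ioo 0 π)
    (hy' : y ≠ π / 2) : ContinuousAt (arcLog H m) y := by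
  have hc : ContinuousOn (fun y : ℝ => H ((0 : ℝ) + y * I)) (Icc 0 π \ {π / 2}) :=
    h.continuousOn.comp (by fun_prop) fun y hy => line_mem_slitHalfStrip le_rfl hy.1 (Or.inr hy.2)
  have hmem : ∀ {y : ℝ}, y ∈ Ioo 0 π → y ≠ π / 2 →
      Icc 0 π \ {π / 2} ∈ 𝓝 y := fun hy hy' =>
    inter_mem (Icc_mem_nhds hy.1 hy.2) (isOpen_compl_singleton.mem_nhds hy')
  exact ((hc.continuousAt (hmem hy hy')).add (ContinuousAt.comp (g := fun y : ℝ => H ((0 : ℝ) + y * I))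
    (hc.continuousAt (hmem ⟨by linarith [hy.2], by linarith [hy.1]⟩ fun he => hy' (by linarith)))
    (by fun_prop))).sub continuousAt_const

lemma expMul_arg {ζ : ℂ} (h : ‖ζ‖ = q0) :
    (q0 : ℂ) * exp ((0 : ℝ) + arg ζ * I) = ζ := by
  rw [ofReal_zero, zero_add, ← h, norm_mul_exp_arg_mul_I]

lemma arg_ne_of_notMem {ζ : ℂ} (h : ‖ζ‖ = q0) (hb : ζ ^ 2 ≠ ((-1 * q0 ^ 2 : ℝ) : ℂ)) :
    arg ζ ≠ π / 2 := fun ha => hb (by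
  rw [← expMul_arg h, ha]
  push_cast
  rw [zero_add, exp_pi_div_two_mul_I, mul_pow, I_sq]
  ring)

open Classical in
/-- A branch, assembled from the logarithms of `F` and `G`. -/
def circleBranch (q0 : ℝ) (H H' : ℂ → ℂ) (m : ℂ) (ζ : ℂ) : ℂ :=
  if ‖ζ‖ = q0 then
    if 0 < ζ.im then arcLog H m (arg ζ) else arcLog H' (-m) (arg (-ζ))
  else lineFun q0 (fold (rayLog H H' 0) (rayLog H H' π))
    (fold (rayLog H H' π) (rayLog H H' 0)) ζ

lemma IsHalfStripLog.rayLog_properties (h : IsHalfStripLog q0 β F G H) {β' : ℝ} {F' G' : ℂ → ℂ}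
    (h' : IsHalfStripLog q0 β' F' G' H') (hy : y = 0 ∨ y = π) :
    ContinuousOn (rayLog H H' y) (Ici 0) ∧ Tendsto (rayLog H H' y) atTop (𝓝 0) := by
  have hy' : π - y = 0 ∨ π - y = π := by rcases hy with rfl | rfl <;> simp
  have hm : ∀ {y : ℝ}, y = 0 ∨ y = π → y ∈ Icc 0 π := fun hy => by
    rcases hy with rfl | rfl
    exacts [⟨le_rfl, Real.pi_pos.le⟩, ⟨Real.pi_pos.le, le_rfl⟩]
  refine ⟨(h.continuousOn_ray hy).add (h'.continuousOn_ray hy'), ?_⟩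
  have := (h.tendsto.comp (tendsto_line (l := atTop) (hm hy))).add
    (h'.tendsto.comp (tendsto_line (l := atTop) (hm hy')))
  rw [add_zero] at this
  exact this

lemma IsHalfStripLog.isBranch (h : IsHalfStripLog q0 β F G H)
    (h' : IsHalfStripLog q0 β⁻¹ (fun z => G (-z)) (fun z => F (-z)) H')
    (hF : ScatteringPair (-1 * q0 ^ 2) β F G) (hq : 0 < q0) (hβ : β ≠ 0) (hm : exp m = β)
    (hε : δ * σ = -1) : IsBranch σ δ q0 (fun ζ => F ζ * G ζ) (circleBranch q0 H H' m) := by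
  have hm' : exp (-m) = (β⁻¹ : ℝ) := by rw [exp_neg, hm, ofReal_inv]
  have hβ' := inv_ne_zero hβ
  obtain ⟨c0, t0⟩ := h.rayLog_properties h' (Or.inl rfl)
  obtain ⟨cp, tp⟩ := h.rayLog_properties h' (Or.inr rfl)
  obtain ⟨ac, at1, at2, -⟩ := fold_properties c0 cp t0 tp
  obtain ⟨bc, bt1, bt2, -⟩ := fold_properties cp c0 tp t0
  have ae := fun (u : ℝ) (hu : u ≠ 0) =>
    h.fold_exp h' hF hq hβ (Or.inl rfl) (Or.inl rfl) exp_zero_mul_I hu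
  have be := fun (u : ℝ) (hu : u ≠ 0) =>
    h.fold_exp h' hF hq hβ (Or.inr rfl) (Or.inr rfl) exp_pi_mul_I' hu
  rw [sub_zero] at ae
  rw [sub_self] at be
  have hb : ∀ ζ ∈ Sig0 σ δ q0, ζ ^ 2 ≠ ((-1 * q0 ^ 2 : ℝ) : ℂ) := fun ζ hζ he =>
    hζ.2 (show ζ ^ 2 = _ by rw [he, hε])
  have hnp : ∀ {ζ : ℂ}, 0 < ζ.im → arg ζ ∈ Ioo 0 π := fun {ζ} h0 =>
    ⟨lt_of_le_of_ne (arg_nonneg_iff.2 h0.le) fun he =>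
      h0.ne' (arg_eq_zero_iff.1 he.symm).2, lt_of_le_of_ne (arg_le_pi ζ) fun he =>
      h0.ne' (arg_eq_pi_iff.1 he).2⟩
  have hne : ∀ ζ ∈ Sig σ δ q0, ζ.im ≠ 0 → ‖ζ‖ = q0 := fun ζ hζ h0 =>
    hζ.elim (fun h1 => absurd h1.1 h0) And.right
  refine ⟨fun ζ hζ => ?_, fun ζ hζ => ?_, ?_, ?_, fun _ => ⟨-m.im, fun ζ hζ hn => ⟨fun h0 => ?_, fun h0 => ?_⟩⟩⟩
  · by_cases hn : ‖ζ‖ = q0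
    · rw [circleBranch, if_pos hn]
      split_ifs with h0
      · have := (h.arcLog_spec (m := m) hβ (Ioo_subset_Icc_self (hnp h0))
          (arg_ne_of_notMem hn (hb ζ hζ))).1 hm
        rwa [expMul_arg hn] at this
      · have hn' : ‖-ζ‖ = q0 := by rwa [norm_neg]
        have := (h'.arcLog_spec (m := -m) (y := arg (-ζ)) hβ'
          ⟨arg_nonneg_iff.2 (by simpa using h0), arg_le_pi _⟩
          (arg_ne_of_notMem hn' (by rw [neg_sq]; exact hb ζ hζ))).1 hm'
        rw [expMul_arg hn', neg_neg] at this
        rw [this, mul_comm]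
    · have him : ζ.im = 0 := by_contra fun h0 => hn (hne ζ hζ.1 h0)
      rw [circleBranch, if_neg hn]
      exact lineFun_exp hq (f := fun ζ => F ζ * G ζ) ae be him
        (fun h0 => zero_notMem_Sig hq (h0 ▸ hζ.1)) hn
  · rcases lt_trichotomy ζ.im 0 with h0 | h0 | h0
    · have hn := hne ζ hζ.1.1 h0.ne
      have hn' : ‖-ζ‖ = q0 := by rwa [norm_neg]
      have hp : 0 < (-ζ).im := by simpa using h0
      have hcont := (ContinuousAt.comp (f := fun ζ => arg (-ζ)) (h'.continuousAt_arcLog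
        (m := -m) (hnp hp) (arg_ne_of_notMem hn' (by rw [neg_sq]; exact hb ζ hζ.1)))
        (ContinuousAt.comp (continuousAt_arg (Or.inr hp.ne'))
          continuousAt_neg)).continuousWithinAt (s := Sig0 σ δ q0 \ {(q0 : ℂ), -(q0 : ℂ)})
      refine hcont.congr_of_eventuallyEq_of_mem ?_ hζ
      filter_upwards [self_mem_nhdsWithin, mem_nhdsWithin_of_mem_nhds
        ((isOpen_lt continuous_im continuous_const).mem_nhds h0)] with w hw hw0
      rw [circleBranch, if_pos (hne w hw.1.1 (ne_of_lt hw0)), if_neg (not_lt.2 (le_of_lt hw0))]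
      rfl
    · have hn : ‖ζ‖ ≠ q0 := fun hn => hζ.2 (by
        have := norm_sq_of_real h0
        rw [hn, ofReal_pow] at this
        exact sq_eq_sq_iff_eq_or_eq_neg.1 this)
      refine ((continuousAt_lineFun hq ac bc (fun hr => zero_notMem_Sig hq
        ((ext hr h0 : ζ = 0) ▸ hζ.1.1)) hn).congr ?_).continuousWithinAt
      filter_upwards [(isOpen_ne_fun continuous_norm continuous_const).mem_nhds hn] with w hw
      rw [circleBranch, if_neg hw]
    · have hn := hne ζ hζ.1.1 h0.ne'
      have hcont := (ContinuousAt.comp (f := arg) (h.continuousAt_arcLog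
        (m := m) (hnp h0) (arg_ne_of_notMem hn (hb ζ hζ.1)))
        (continuousAt_arg (Or.inr h0.ne'))).continuousWithinAt
        (s := Sig0 σ δ q0 \ {(q0 : ℂ), -(q0 : ℂ)})
      refine hcont.congr_of_eventuallyEq_of_mem ?_ hζ
      filter_upwards [self_mem_nhdsWithin, mem_nhdsWithin_of_mem_nhds
        ((isOpen_lt continuous_const continuous_im).mem_nhds h0)] with w hw hw0
      rw [circleBranch, if_pos (hne w hw.1.1 (ne_of_gt hw0)), if_pos hw0]
      rfl
  · refine (tendsto_lineFun at1 bt1 ((tendsto_log_norm_infty hq).mono_left inf_le_left)).congr' ?_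
    filter_upwards [inf_le_left (a := cocompact ℂ) ((tendsto_norm_cocompact_atTop (E := ℂ)).eventually
      (eventually_gt_atTop q0))] with ζ hζ
    rw [circleBranch, if_neg (ne_of_gt hζ)]
  · refine (tendsto_lineFun at2 bt2 (tendsto_log_norm_zero hq (zero_notMem_Sig hq))).congr' ?_
    filter_upwards [mem_nhdsWithin_of_mem_nhds ((isOpen_lt (continuous_norm (E := ℂ))
      continuous_const).mem_nhds (by simpa using hq : ‖(0 : ℂ)‖ < q0))] with ζ hζ
    rw [circleBranch, if_neg (ne_of_lt hζ)]
  · rw [circleBranch, if_pos hn, if_pos h0]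
    exact (h.arcLog_spec hβ (Ioo_subset_Icc_self (hnp h0)) (arg_ne_of_notMem hn (hb ζ hζ))).2.1
  · rw [circleBranch, if_pos hn, if_neg h0.not_gt]
    exact (h'.arcLog_spec hβ' (Ioo_subset_Icc_self (hnp (by simpa using h0))) (arg_ne_of_notMem
      ((norm_neg ζ).trans hn) (by rw [neg_sq]; exact hb ζ hζ))).2.1

end

section

variable {σ δ q0 κ β ε : ℝ} {z w m : ℂ} {f F G H H' ℓ : ℂ → ℂ} {s y : ℝ}

lemma circlePt_eq (q0 y : ℝ) : circlePt q0 y = q0 * exp ((0 : ℝ) + y * I) := by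
  rw [circlePt, ofReal_zero, zero_add, mul_comm I]

lemma circlePt_sub_pi (q0 y : ℝ) :
    circlePt q0 (y - π) = -(q0 * exp ((0 : ℝ) + y * I)) := by
  rw [circlePt, ofReal_zero, zero_add, ofReal_sub, mul_sub, exp_sub,
    mul_comm I, mul_comm I, exp_pi_mul_I]
  ring

lemma norm_expMul_arc (hq : 0 < q0) (y : ℝ) : ‖(q0 : ℂ) * exp ((0 : ℝ) + y * I)‖ = q0 := by
  rw [norm_expMul hq]; simp

/-- The integral over `|x| > q0` and over `(-q0, q0)`, in exponential coordinates. -/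
lemma integral_outer_sub_inner (hq : 0 < q0) (hz : z.im ≠ 0 ∨ z = 0) {a b : ℝ → ℂ} (ha : Integrable a)
    (hb : Integrable b) (hℓa : ∀ u : ℝ, u ≠ 0 → ℓ (q0 * exp (u + (0 : ℝ) * I)) = a u)
    (hℓb : ∀ u : ℝ, u ≠ 0 → ℓ (q0 * exp (u + π * I)) = b u) :
    (∫ x in {x : ℝ | q0 < |x|}, ℓ x / (x - z)) - (∫ x in Ioo (-q0) q0, ℓ x / (x - z)) =
    (∫ u in Ioi (0 : ℝ), expK q0 z (u + (0 : ℝ) * I) * a u) -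
    (∫ u in Ioi (0 : ℝ), expK q0 z (u + π * I) * b u) -
    (∫ u in Iio (0 : ℝ), expK q0 z (u + (0 : ℝ) * I) * a u) +
    ∫ u in Iio (0 : ℝ), expK q0 z (u + π * I) * b u := by
  have g1 : ∀ u : ℝ, q0 < q0 * Real.exp u ↔ 0 < u := fun u => by
    rw [lt_mul_iff_one_lt_right hq, Real.one_lt_exp_iff]
  have g2 : ∀ u : ℝ, q0 * Real.exp u < q0 ↔ u < 0 := fun u => by
    rw [mul_lt_iff_lt_one_right hq, Real.exp_lt_one_iff]
  have g3 : ∀ u : ℝ, 0 < q0 * Real.exp u := fun u => mul_pos hq (Real.exp_pos u)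
  obtain ⟨i1, e1⟩ := line_integral_of_eq hq (Or.inl rfl) exp_zero_mul_I hz ha hℓa
    (A := Ioi 0) (B := Ioi q0) measurableSet_Ioi
    (fun x hx => by rw [one_mul]; exact hq.trans hx) (fun u => by simpa using g1 u)
  obtain ⟨i2, e2⟩ := line_integral_of_eq hq (Or.inr rfl) exp_pi_mul_I' hz hb hℓb
    (A := Ioi 0) (B := Iio (-q0)) measurableSet_Ioi
    (fun x hx => by have : x < -q0 := hx; linarith) (fun u => by simpa using g1 u)
  obtain ⟨i3, e3⟩ := line_integral_of_eq hq (Or.inl rfl) exp_zero_mul_I hz ha hℓa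
    (A := Iio 0) (B := Ioo 0 q0) measurableSet_Iio
    (fun x hx => by rw [one_mul]; exact hx.1) (fun u => by simpa [g3 u] using g2 u)
  obtain ⟨i4, e4⟩ := line_integral_of_eq hq (Or.inr rfl) exp_pi_mul_I' hz hb hℓb
    (A := Iio 0) (B := Ioo (-q0) 0) measurableSet_Iio
    (fun x hx => by linarith [hx.2]) (fun u => by simpa [g3 u] using g2 u)
  have s1 : {x : ℝ | q0 < |x|} = Ioi q0 ∪ Iio (-q0) := by
    ext x
    change q0 < |x| ↔ q0 < x ∨ x < -q0
    rw [lt_abs, lt_neg]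
  have s2 : Ioo (-q0) q0 = Ioc (-q0) 0 ∪ Ioo 0 q0 :=
    (Ioc_union_Ioo_eq_Ioo (by linarith) hq).symm
  have hae := Ioo_ae_eq_Ioc (μ := (volume : Measure ℝ)) (a := -q0) (b := 0)
  rw [s1, s2, setIntegral_union (disjoint_left.2 fun x h1 h2 => by
      have h1' : q0 < x := h1
      have h2' : x < -q0 := h2
      linarith) measurableSet_Iio i1 i2,
    setIntegral_union (disjoint_left.2 fun x h1 h2 => h1.2.not_gt h2.1) measurableSet_Ioo
      ((integrableOn_congr_set_ae hae.symm).2 i4) i3, setIntegral_congr_set hae.symm, e1, e2, e3, e4]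
  push_cast; ring

lemma ae_ne_pi_div_two : ∀ᵐ y : ℝ, y ≠ π / 2 := Measure.ae_ne volume _

/-- The integral over an open semicircle `s q0 e^{iy}`, `0 < y < π`, in terms of the angle. -/
lemma integral_arc (hq : 0 < q0) {c : ℝ → ℂ} (hc : IntervalIntegrable c volume 0 π)
    (hz : ‖z‖ ≠ q0) :
    ((∀ y ∈ Ioo 0 π, y ≠ π / 2 → ℓ (q0 * exp ((0 : ℝ) + y * I)) = c y) →
      IntegrableOn (fun φ : ℝ => ℓ (circlePt q0 φ) / (circlePt q0 φ - z)) (Ioo 0 π) ∧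
      ∫ φ in Ioo 0 π, ℓ (circlePt q0 φ) / (circlePt q0 φ - z) * (I * circlePt q0 φ) =
        I * ∫ y in (0 : ℝ)..π, expK q0 z ((0 : ℝ) + y * I) * c y) ∧
    ((∀ y ∈ Ioo 0 π, y ≠ π / 2 → ℓ (-(q0 * exp ((0 : ℝ) + y * I))) = c y) →
      IntegrableOn (fun φ : ℝ => ℓ (circlePt q0 φ) / (circlePt q0 φ - z)) (Ioo (-π) 0) ∧
      ∫ φ in Ioo (-π) 0, ℓ (circlePt q0 φ) / (circlePt q0 φ - z) * (I * circlePt q0 φ) =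
        I * ∫ y in (0 : ℝ)..π, expK q0 (-z) ((0 : ℝ) + y * I) * c y) := by
  have hpi := Real.pi_pos
  have hae : ∀ {g h : ℝ → ℂ}, (∀ y ∈ Ioo 0 π, y ≠ π / 2 → g y = h y) →
      g =ᵐ[volume.restrict (uIoc 0 π)] h := fun {g h} hgh => by
    rw [uIoc_of_le hpi.le, ← Measure.restrict_congr_set Ioo_ae_eq_Ioc]
    filter_upwards [ae_restrict_mem measurableSet_Ioo, ae_restrict_of_ae ae_ne_pi_div_two]
      with y h1 h2 using hgh y h1 h2
  have hne : ∀ {z : ℂ}, ‖z‖ ≠ q0 → ∀ y : ℝ, (q0 : ℂ) * exp ((0 : ℝ) + y * I) - z ≠ 0 :=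
    fun hz y => sub_ne_zero.2 fun he => hz (by rw [← he, norm_expMul_arc hq])
  have hi : ∀ {z : ℂ}, ‖z‖ ≠ q0 → IntervalIntegrable
      (fun y : ℝ => ((q0 : ℂ) * exp ((0 : ℝ) + y * I) - z)⁻¹ * c y) volume 0 π :=
    fun hz => hc.continuousOn_mul
      (Continuous.inv₀ (by fun_prop) (hne hz)).continuousOn
  have hn' : ‖-z‖ ≠ q0 := by rwa [norm_neg]
  constructor <;> intro hℓ
  · constructor
    · rw [← intervalIntegrable_iff_integrableOn_Ioo_of_le hpi.le]
      refine (hi hz).congr_ae (hae fun y h1 h2 => ?_)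
      rw [circlePt_eq, hℓ y h1 h2]; ring
    · rw [← integral_Ioc_eq_integral_Ioo, ← intervalIntegral.integral_of_le hpi.le,
        ← intervalIntegral.integral_const_mul]
      refine intervalIntegral.integral_congr_ae_restrict (hae fun y h1 h2 => ?_)
      rw [circlePt_eq, hℓ y h1 h2, expK]; ring
  · constructor
    · rw [← intervalIntegrable_iff_integrableOn_Ioo_of_le (by linarith)]
      have h1 : IntervalIntegrable (fun y : ℝ => ℓ (circlePt q0 (y - π)) /
          (circlePt q0 (y - π) - z)) volume 0 π := by
        refine (hi hn').neg.congr_ae (hae fun y h1 h2 => ?_)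
        have := hne hn' y
        rw [circlePt_sub_pi, hℓ y h1 h2, Pi.neg_apply, ← neg_mul, ← inv_neg]
        ring
      have := h1.comp_add_right π
      simp only [add_sub_cancel_right] at this
      rwa [zero_sub, sub_self] at this
    · have hs := intervalIntegral.integral_comp_sub_right (a := 0) (b := π) (fun φ : ℝ =>
        ℓ (circlePt q0 φ) / (circlePt q0 φ - z) * (I * circlePt q0 φ)) π
      rw [zero_sub, sub_self] at hs
      rw [← integral_Ioc_eq_integral_Ioo, ← intervalIntegral.integral_of_le (by linarith), ← hs,
        ← intervalIntegral.integral_const_mul]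
      refine intervalIntegral.integral_congr_ae_restrict (hae fun y h1 h2 => ?_)
      have := hne hn' y
      rw [circlePt_sub_pi, hℓ y h1 h2, expK,
        show -((q0 : ℂ) * exp ((0 : ℝ) + y * I)) - z =
          -((q0 : ℂ) * exp ((0 : ℝ) + y * I) - -z) by ring]
      field_simp

/-- The jump problem on the line and the circle. -/
theorem ZeroFreePair.solvesJumpProblem_circle (hF : ZeroFreePair (-1 * q0 ^ 2) β F G) (hq : 0 < q0)
    (hβ : β ≠ 0) (hε : δ * σ = -1) : SolvesJumpProblem σ δ q0 β F G := by
  have hpi := Real.pi_pos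
  have hβ' := inv_ne_zero hβ
  have hβc : (β : ℂ) ≠ 0 := by exact_mod_cast hβ
  obtain ⟨H, h⟩ := hF.exists_isHalfStripLog hq
  obtain ⟨H', h'⟩ := (hF.flip (by simp [hq.ne']) hβ).exists_isHalfStripLog hq
  refine ⟨⟨_, h.isBranch h' hF.toScatteringPair hq hβ (m := log β) (exp_log hβc) hε⟩,
    fun ℓ hℓ => ?_⟩
  -- the branch on the rays
  obtain ⟨c0, t0⟩ := h.rayLog_properties h' (Or.inl rfl)
  obtain ⟨cp, tp⟩ := h.rayLog_properties h' (Or.inr rfl)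
  obtain ⟨ac, at1, at2, ai⟩ := fold_properties c0 cp t0 tp
  obtain ⟨bc, bt1, bt2, bi⟩ := fold_properties cp c0 tp t0
  have ae := fun (u : ℝ) (hu : u ≠ 0) =>
    h.fold_exp h' hF.toScatteringPair hq hβ (Or.inl rfl) (Or.inl rfl) exp_zero_mul_I hu
  have be := fun (u : ℝ) (hu : u ≠ 0) =>
    h.fold_exp h' hF.toScatteringPair hq hβ (Or.inr rfl) (Or.inr rfl) exp_pi_mul_I' hu
  rw [sub_zero] at ae
  rw [sub_self] at be
  have hla := hℓ.eq_of_ray hq (Or.inr hε) (Or.inl rfl) exp_zero_mul_I ac ae at1 at2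
  have hlb := hℓ.eq_of_ray hq (Or.inr hε) (Or.inr rfl) exp_pi_mul_I' bc be bt1 bt2
  have ia := hF.integrable_log hβ hq (Or.inr rfl) rfl (s := 1) (Or.inl rfl)
    (fun u hu => by rw [ae u hu, expMul_line exp_zero_mul_I]) at1 at2 ai
  have ib := hF.integrable_log hβ hq (Or.inr rfl) rfl (s := -1) (Or.inr rfl)
    (fun u hu => by rw [be u hu, expMul_line exp_pi_mul_I']) bt1 bt2 bi
  -- the branch on the arcs
  have hmem : ∀ y ∈ Ioo 0 π, y ≠ π / 2 → ∀ ζ : ℂ,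
      ζ = q0 * exp ((0 : ℝ) + y * I) ∨ ζ = -(q0 * exp ((0 : ℝ) + y * I)) →
      ζ ∈ Sig0 σ δ q0 ∧ ‖ζ‖ = q0 := fun y hy hy' ζ hζ => by
    have hn : ‖ζ‖ = q0 := by
      rcases hζ with rfl | rfl
      · exact norm_expMul_arc hq y
      · rw [norm_neg, norm_expMul_arc hq]
    refine ⟨⟨Or.inr ⟨hε, hn⟩, fun hb => ?_⟩, hn⟩
    have hb' : ζ ^ 2 = ((δ * σ * q0 ^ 2 : ℝ) : ℂ) := hb
    have hJ := (expMul_mem_of_slitHalfStrip hq (line_mem_slitHalfStrip (u := 0) le_rfl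
      (Ioo_subset_Icc_self hy) (Or.inr hy'))).1
    refine hJ.2.1 (lam_eq_zero_of_sq (by simp [hq.ne']) ?_).2
    rw [← hε, ← hb']
    rcases hζ with rfl | rfl
    · rfl
    · rw [neg_sq]
  have him : ∀ y ∈ Ioo 0 π, 0 < ((q0 : ℂ) * exp ((0 : ℝ) + y * I)).im :=
    fun y hy => by
    rw [expMul_im]
    have := Real.sin_pos_of_pos_of_lt_pi hy.1 hy.2
    simpa using mul_pos hq this
  obtain ⟨c, hc⟩ := hℓ.circle hε
  -- the constant of the upper semicircle determines the sign of `β`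
  obtain ⟨m, hm, hmi⟩ : ∃ m : ℂ, exp m = β ∧ m.im = -c := by
    have hy : π / 4 ∈ Ioo 0 π := ⟨by linarith, by linarith⟩
    have hy' : π / 4 ≠ π / 2 := by linarith
    obtain ⟨hS, hn⟩ := hmem _ hy hy' _ (Or.inl rfl)
    obtain ⟨r, hr, e⟩ := (h.arcLog_spec (m := 0) hβ (Ioo_subset_Icc_self hy) hy').2.2
    rw [← hℓ.exp_eq _ hS] at e
    have hci := (hc _ hS hn).1 (him _ hy)
    set L := ℓ (q0 * exp ((0 : ℝ) + (π / 4 : ℝ) * I))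
    refine ⟨Real.log r - L, ?_, by rw [sub_im, ofReal_im, hci, zero_sub]⟩
    rw [exp_sub, ← ofReal_exp, Real.exp_log hr, ← e,
      mul_div_cancel_left₀ _ (exp_ne_zero _)]
  have hm' : exp (-m) = (β⁻¹ : ℝ) := by rw [exp_neg, hm, ofReal_inv]
  have hup : ∀ y ∈ Ioo 0 π, y ≠ π / 2 →
      ℓ (q0 * exp ((0 : ℝ) + y * I)) = arcLog H m y := fun y hy hy' => by
    obtain ⟨hS, hn⟩ := hmem y hy hy' _ (Or.inl rfl)
    obtain ⟨e1, e2, -⟩ := h.arcLog_spec (m := m) hβ (Ioo_subset_Icc_self hy) hy'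
    refine eq_of_exp_eq_of_im_eq (by rw [e1 hm, hℓ.exp_eq _ hS]) ?_
    rw [e2, hmi, neg_neg, (hc _ hS hn).1 (him y hy)]
  have hlow : ∀ y ∈ Ioo 0 π, y ≠ π / 2 →
      ℓ (-(q0 * exp ((0 : ℝ) + y * I))) = arcLog H' (-m) y := fun y hy hy' => by
    obtain ⟨hS, hn⟩ := hmem y hy hy' _ (Or.inr rfl)
    obtain ⟨e1, e2, -⟩ := h'.arcLog_spec (m := -m) hβ' (Ioo_subset_Icc_self hy) hy'
    refine eq_of_exp_eq_of_im_eq (by rw [e1 hm', hℓ.exp_eq _ hS, mul_comm]) ?_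
    rw [e2, neg_im, hmi, neg_neg, (hc _ hS hn).2 (by simpa using him y hy)]
  have arcU : IntervalIntegrable (arcLog H m) volume 0 π := h.intervalIntegrable_arc hq
  have arcL : IntervalIntegrable (arcLog H' (-m)) volume 0 π := h'.intervalIntegrable_arc hq
  have hcont : ∀ {z r1 r2 r3 r4 c : ℂ}, (z.im ≠ 0 ∨ z = 0) → ‖z‖ ≠ q0 →
      (∀ᶠ R : ℝ in atTop, IsResidue q0 z H 0 R 0 π r1) →
      (∀ᶠ R : ℝ in atTop, IsResidue q0 z (fun w => H (π * I - w) - m) (-R) 0 0 π r2) →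
      (∀ᶠ R : ℝ in atTop, IsResidue q0 (-z) H' 0 R 0 π r3) →
      (∀ᶠ R : ℝ in atTop,
        IsResidue q0 (-z) (fun w => H' (π * I - w) - -m) (-R) 0 0 π r4) →
      (r1 - r2) - (r3 - r4) = 2 * π * I * c →
      cauchyS σ δ q0 ℓ z = c + open Classical in if z = 0 then m else 0 :=
    fun {z r1 r2 r3 r4 c} hz hz' h1 h2 h3 h4 hr => by
    refine cauchyS_eq ?_
    rw [mul_add, ← hr, contourIntegral, if_neg (by rw [hε]; norm_num),
      integral_outer_sub_inner hq hz ia ib hla hlb, ((integral_arc hq arcU hz').1 hup).2,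
      ((integral_arc hq arcL hz').2 hlow).2, ← h.integral_jump h' hq hz hz' h1 h2 h3 h4 ia ib]
  have hD : ∀ z : ℂ, (z ∈ Dplus σ δ q0 ↔ 0 < (‖z‖ - q0) * z.im) ∧
      (z ∈ Dminus σ δ q0 ↔ (‖z‖ - q0) * z.im < 0) := fun z => by
    simp only [Dplus, Dminus, mem_ofPred_eq, hε]; norm_num
  have hupper : ∀ z : ℂ, 0 < z.im → ‖z‖ ≠ q0 → (q0 < ‖z‖ → exp (cauchyS σ δ q0 ℓ z) = F z) ∧
      (‖z‖ < q0 → exp (-cauchyS σ δ q0 ℓ z) = G z) := fun z hz hn => by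
    obtain ⟨r1, r2, v, k1, k2, k3, k4, k5⟩ := h.exists_residues hq hβ hm hz hn
    have k := fun R => residues_zero (z := -z) hq (Or.inl (by simpa using hz)) H' (-m) R
    have := hcont (c := v) (Or.inl hz.ne') hn k1 k2 (.of_forall fun R => (k R).1)
      (.of_forall fun R => (k R).2) (by rw [k3]; ring)
    rw [if_neg (by rintro rfl; simp at hz), add_zero] at this
    rw [this]
    exact ⟨k4, k5⟩
  have hlower : ∀ z : ℂ, z.im < 0 → ‖z‖ ≠ q0 → (q0 < ‖z‖ → exp (-cauchyS σ δ q0 ℓ z) = G z) ∧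
      (‖z‖ < q0 → exp (cauchyS σ δ q0 ℓ z) = F z) := fun z hz hn => by
    obtain ⟨r1, r2, v, k1, k2, k3, k4, k5⟩ := h'.exists_residues (z := -z) hq hβ' hm'
      (by simpa using hz) (by rwa [norm_neg])
    have k := fun R => residues_zero (z := z) hq (Or.inl hz) H m R
    have := hcont (c := -v) (Or.inl hz.ne) hn (.of_forall fun R => (k R).1)
      (.of_forall fun R => (k R).2) k1 k2 (by rw [k3]; ring)
    rw [if_neg (by rintro rfl; simp at hz), add_zero] at this
    rw [norm_neg, neg_neg] at k4 k5
    rw [this, neg_neg]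
    exact ⟨k4, k5⟩
  refine ⟨fun z hz => ?_, fun z hz => ?_, fun z hz => ?_, ?_⟩
  · have hz' : (z.im ≠ 0 ∨ z = 0) ∧ ‖z‖ ≠ q0 := by
      rcases hz with hz | rfl
      · have h0 : (‖z‖ - q0) * z.im ≠ 0 := by
          rcases hz with hz | hz
          exacts [((hD z).1.1 hz).ne', ((hD z).2.1 hz).ne]
        exact ⟨Or.inl (right_ne_zero_of_mul h0), sub_ne_zero.1 (left_ne_zero_of_mul h0)⟩
      · exact ⟨Or.inr rfl, by rw [norm_zero]; exact hq.ne⟩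
    refine ⟨(integrable_real_line hq hz'.1 ia ib hla hlb).1, fun _ => ?_⟩
    have h1 := ((integral_arc (ℓ := ℓ) hq arcU hz'.2).1 hup).1
    have h2 := ((integral_arc (ℓ := ℓ) hq arcL hz'.2).2 hlow).1
    have := ((integrableOn_congr_set_ae Ioo_ae_eq_Ioc).1 h2).union h1
    rwa [Ioc_union_Ioo_eq_Ioo (by linarith) hpi] at this
  · rcases mul_pos_iff.1 ((hD z).1.1 hz) with ⟨h1, h2⟩ | ⟨h1, h2⟩
    · exact (hupper z h2 (sub_pos.1 h1).ne').1 (sub_pos.1 h1)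
    · exact (hlower z h2 (sub_neg.1 h1).ne).2 (sub_neg.1 h1)
  · rcases mul_neg_iff.1 ((hD z).2.1 hz) with ⟨h1, h2⟩ | ⟨h1, h2⟩
    · exact (hlower z h2 (sub_pos.1 h1).ne').1 (sub_pos.1 h1)
    · exact (hupper z h2 (sub_neg.1 h1).ne).2 (sub_neg.1 h1)
  · have k := fun R => residues_zero (z := 0) hq (Or.inr rfl) H m R
    have k' := fun R => residues_zero (z := -0) hq (Or.inr neg_zero) H' (-m) R
    have := hcont (z := 0) (c := 0) (Or.inr rfl) (by rw [norm_zero]; exact hq.ne)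
      (.of_forall fun R => (k R).1) (.of_forall fun R => (k R).2)
      (.of_forall fun R => (k' R).1) (.of_forall fun R => (k' R).2) (by simp)
    rw [if_pos rfl, zero_add] at this
    rw [this, hm]

end

section

/-! ### The scattering problem of the nonlocal equation -/

variable {σ δ q0 qm t κ β : ℝ} {q : ℝ → ℝ → ℝ} {z : ℂ} {F G ℓ : ℂ → ℂ} {N1 N2 : ℕ} {zs : Fin N1 → ℂ}
  {ws : Fin N2 → ℝ}

lemma Λ_im_eq (hz : z ≠ 0) :
    ∃ r : ℝ, 0 < r ∧ (Λ (1 * q0 ^ 2) z).im * r = z.im * (‖z‖ ^ 2 + q0 ^ 2) ∧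
      (Λ (-1 * q0 ^ 2) z).im * r = z.im * (‖z‖ ^ 2 - q0 ^ 2) := by
  have h := norm_pos_iff.2 hz
  refine ⟨2 * ‖z‖ ^ 2, by positivity, ?_, ?_⟩ <;> rw [Λ_im] <;> field_simp
  ring

lemma sign_iff_of_mul_eq {a b r s : ℝ} (hr : 0 < r) (hs : 0 < s) (h : a * r = b * s) :
    (0 < a ↔ 0 < b) ∧ (a < 0 ↔ b < 0) ∧ (a = 0 ↔ b = 0) := by
  have h1 := congrArg SignType.sign h
  rw [sign_mul, sign_mul, sign_pos hr, sign_pos hs, mul_one, mul_one] at h1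
  exact ⟨by rw [← sign_eq_one_iff, h1, sign_eq_one_iff],
    by rw [← sign_eq_neg_one_iff, h1, sign_eq_neg_one_iff],
    by rw [← sign_eq_zero_iff, h1, sign_eq_zero_iff]⟩

lemma mem_domains_iff (hε : δ * σ = 1 ∨ δ * σ = -1) (hq : 0 < q0) :
    (z ∈ Dplus σ δ q0 ↔ z ∈ upperDomain (δ * σ * q0 ^ 2)) ∧
    (z ∈ Dminus σ δ q0 ↔ z ≠ 0 ∧ (Λ (δ * σ * q0 ^ 2) z).im < 0) ∧
    (z ∈ Sig0 σ δ q0 ↔ z ≠ 0 ∧ Λ (δ * σ * q0 ^ 2) z ≠ 0 ∧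
      (Λ (δ * σ * q0 ^ 2) z).im = 0) := by
  have hq2 : 0 < q0 ^ 2 := by positivity
  by_cases hz : z = 0
  · subst hz
    refine ⟨?_, ?_, ?_⟩
    · simp [Dplus, upperDomain]
    · simp [Dminus]
    · simp [Sig0, zero_notMem_Sig hq]
  have hbr : z ∈ branchPoints σ δ q0 ↔ Λ (δ * σ * q0 ^ 2) z = 0 := by
    rw [Λ, div_eq_zero_iff, sub_eq_zero, eq_div_iff hz, ← sq]
    simp [branchPoints]
  obtain ⟨r, hr, e1, e2⟩ := Λ_im_eq (q0 := q0) hz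
  have hzp := norm_pos_iff.2 hz
  have hs : 0 < ‖z‖ ^ 2 + q0 ^ 2 := by positivity
  rw [Sig0, Set.mem_sdiff, hbr, upperDomain, mem_ofPred_eq]
  rcases hε with h | h <;> rw [h]
  · obtain ⟨p1, p2, p3⟩ := sign_iff_of_mul_eq hr hs e1
    rw [p1, p2, p3]
    simp only [Dplus, Dminus, Sig, mem_ofPred_eq, h]
    norm_num
    tauto
  · obtain ⟨p1, p2, p3⟩ := sign_iff_of_mul_eq (b := (‖z‖ - q0) * z.im) hr
      (show 0 < ‖z‖ + q0 by positivity) (e2.trans (by ring))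
    rw [p1, p2, p3, mul_eq_zero, sub_eq_zero, or_comm]
    simp only [Dplus, Dminus, Sig, mem_ofPred_eq, h]
    norm_num
    tauto

lemma ZeroFreePair.solvesJumpProblem (h : ZeroFreePair (δ * σ * q0 ^ 2) β F G) (hq : 0 < q0)
    (hβ : β ≠ 0) (hε : δ * σ = 1 ∨ δ * σ = -1) : SolvesJumpProblem σ δ q0 β F G := by
  rcases hε with hε | hε
  · rw [hε] at h; exact h.solvesJumpProblem_line hq hβ hε
  · rw [hε] at h; exact h.solvesJumpProblem_circle hq hβ hε

/-- The permutation of the discrete spectrum induced by `z ↦ -z^*`. -/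
def etaSwap (N1 N2 : ℕ) : Fin N1 ⊕ Fin N1 ⊕ Fin N2 ≃ Fin N1 ⊕ Fin N1 ⊕ Fin N2 where
  toFun := Sum.elim (Sum.inr ∘ Sum.inl) (Sum.elim Sum.inl (Sum.inr ∘ Sum.inr))
  invFun := Sum.elim (Sum.inr ∘ Sum.inl) (Sum.elim Sum.inl (Sum.inr ∘ Sum.inr))
  left_inv := by rintro (n | n | n) <;> rfl
  right_inv := by rintro (n | n | n) <;> rfl

lemma eta_etaSwap (n : Fin N1 ⊕ Fin N1 ⊕ Fin N2) :
    eta zs ws (etaSwap N1 N2 n) = -conj (eta zs ws n) := by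
  rcases n with n | n | n <;> simp [eta, etaSwap]

lemma prod_eta_sq_div (hε : δ * σ = 1 ∨ δ * σ = -1) :
    ((((∏ n, ‖zs n‖ ^ 4 / q0 ^ 4) * ∏ m, -(δ * σ) * (ws m ^ 2 / q0 ^ 2) : ℝ)) : ℂ) =
      ∏ n, eta zs ws n ^ 2 / ((δ * σ * q0 ^ 2 : ℝ) : ℂ) := by
  have h1 : ∀ n, ((‖zs n‖ ^ 4 / q0 ^ 4 : ℝ) : ℂ) = eta zs ws (Sum.inl n) ^ 2 /
      ((δ * σ * q0 ^ 2 : ℝ) : ℂ) * (eta zs ws (Sum.inr (Sum.inl n)) ^ 2 /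
      ((δ * σ * q0 ^ 2 : ℝ) : ℂ)) := fun n => by
    have e1 : eta zs ws (Sum.inl n) = zs n := rfl
    have e2 : eta zs ws (Sum.inr (Sum.inl n)) = -conj (zs n) := rfl
    have e3 : ‖zs n‖ ^ 4 / q0 ^ 4 = (‖zs n‖ ^ 2) ^ 2 / (δ * σ * q0 ^ 2 * (δ * σ * q0 ^ 2)) := by
      rcases hε with h | h <;> rw [h] <;> ring
    rw [e1, e2, e3, div_mul_div_comm, neg_sq, ← mul_pow, mul_conj', ofReal_div,
      ofReal_mul, ofReal_pow, ofReal_pow]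
  have h2 : ∀ m, ((-(δ * σ) * (ws m ^ 2 / q0 ^ 2) : ℝ) : ℂ) =
      eta zs ws (Sum.inr (Sum.inr m)) ^ 2 / ((δ * σ * q0 ^ 2 : ℝ) : ℂ) := fun m => by
    have e1 : eta zs ws (Sum.inr (Sum.inr m)) = I * (ws m : ℂ) := rfl
    have e3 : -(δ * σ) * (ws m ^ 2 / q0 ^ 2) = -ws m ^ 2 / (δ * σ * q0 ^ 2) := by
      rcases hε with h | h <;> rw [h] <;> ring
    rw [e1, e3, mul_pow, I_sq, ofReal_div, ofReal_neg, ofReal_pow,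
      neg_one_mul]
  rw [Fintype.prod_sum_type, Fintype.prod_sum_type, ← mul_assoc, ← Finset.prod_mul_distrib,
    ofReal_mul, ofReal_prod, ofReal_prod]
  simp only [h1, h2]

/-- The derivative at a simple zero that has been split off. -/
lemma hasDerivAt_of_eventuallyEq {ι : Type*} [Fintype ι] [DecidableEq ι] {f E : ℂ → ℂ} {η ξ : ι → ℂ}
    (j : ι) (hE : ContinuousAt E (η j)) (hξ : ∀ n, η j ≠ ξ n)
    (hf : ∀ᶠ z in 𝓝 (η j), f z = E z * ∏ n, (z - η n) / (z - ξ n)) :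
    HasDerivAt f ((∏ n ∈ Finset.univ.erase j, (η j - η n)) / (∏ n, (η j - ξ n)) * E (η j)) (η j) := by
  have h1 : ContinuousAt (fun z => ∏ n ∈ Finset.univ.erase j, (z - η n)) (η j) := by fun_prop
  have h2 : ContinuousAt (fun z => ∏ n, (z - ξ n)) (η j) := by fun_prop
  have hg := (h1.div h2 (Finset.prod_ne_zero_iff.2 fun n _ => sub_ne_zero.2 (hξ n))).mul hE
  have hf' : ∀ᶠ z in 𝓝 (η j), f z = (z - η j) *
      ((∏ n ∈ Finset.univ.erase j, (z - η n)) / (∏ n, (z - ξ n)) * E z) := by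
    filter_upwards [hf] with z hz
    rw [hz, Finset.prod_div_distrib, ← Finset.mul_prod_erase _ _ (Finset.mem_univ j)]
    ring
  rw [hasDerivAt_iff_tendsto_slope]
  refine (hg.tendsto.mono_left nhdsWithin_le_nhds).congr' ?_
  filter_upwards [nhdsWithin_le_nhds hf', self_mem_nhdsWithin] with z hz hz'
  rw [slope_def_field, hz, hf'.self_of_nhds, sub_self, zero_mul, sub_zero,
    mul_div_cancel_left₀ _ (sub_ne_zero.2 hz')]
  rfl

/-- The discrete spectrum is invariant under `z ↦ -z^*`, and all of its points are simple zeros. -/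
lemma discreteSpectrum (hε : δ * σ = 1 ∨ δ * σ = -1) (hq : 0 < q0)
    (sp : ScatteringPair (δ * σ * q0 ^ 2) β (s11 σ δ q0 qm q t) G)
    (hZ : IsSimpleDiscreteSpectrum σ δ q0 qm q t zs ws) :
    Function.Injective (eta zs ws) ∧
    (∀ n, eta zs ws n ∈ upperDomain (δ * σ * q0 ^ 2) ∧
      s11 σ δ q0 qm q t (eta zs ws n) = 0 ∧ deriv (s11 σ δ q0 qm q t) (eta zs ws n) ≠ 0) ∧
    ∀ z ∈ Dplus σ δ q0, s11 σ δ q0 qm q t z = 0 → ∃ n, z = eta zs ws n := by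
  have hD := fun z => (mem_domains_iff (z := z) hε hq).1
  have hJ : ∀ z ∈ Dplus σ δ q0, z ∈ Ω (δ * σ * q0 ^ 2) := fun z hz =>
    upperDomain_subset ((hD z).1 hz)
  have hconj : ∀ z ∈ Dplus σ δ q0, -conj z ∈ Dplus σ δ q0 := fun z hz => by
    obtain ⟨h1, h2⟩ := (hD z).1 hz
    exact (hD _).2 ⟨by simpa using h1, by rw [Λ_conj]; simpa using h2⟩
  have hzs : ∀ n, zs n ∈ Dplus σ δ q0 ∧ 0 < (zs n).re ∧ s11 σ δ q0 qm q t (zs n) = 0 := fun n => by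
    have : zs n ∈ range zs := ⟨n, rfl⟩
    rwa [hZ.zs_range] at this
  have hws : ∀ n, I * (ws n : ℂ) ∈ Dplus σ δ q0 ∧ (I * (ws n : ℂ)).re = 0 ∧
      s11 σ δ q0 qm q t (I * (ws n : ℂ)) = 0 := fun n => by
    have : I * (ws n : ℂ) ∈ range fun m => I * (ws m : ℂ) := ⟨n, rfl⟩
    rwa [hZ.ws_range] at this
  have hsym : ∀ z ∈ Dplus σ δ q0, s11 σ δ q0 qm q t z = 0 →
      s11 σ δ q0 qm q t (-conj z) = 0 := fun z hz h0 => by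
    rw [sp.map_conj z (hJ z hz), h0, map_zero]
  refine ⟨?_, ?_, fun z hz h0 => ?_⟩
  · have hre : ∀ n, (-conj (zs n)).re < 0 := fun n => by simpa using (hzs n).2.1
    rintro (n | n | n) (k | k | k) h <;> simp only [eta, Sum.elim_inl, Sum.elim_inr] at h
    · rw [hZ.zs_injective h]
    · linarith [congrArg re h, (hzs n).2.1, hre k]
    · linarith [congrArg re h, (hzs n).2.1, (hws k).2.1]
    · linarith [congrArg re h, (hzs k).2.1, hre n]
    · rw [hZ.zs_injective ((starRingEnd ℂ).injective (neg_injective h))]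
    · linarith [congrArg re h, hre n, (hws k).2.1]
    · linarith [congrArg re h, (hzs k).2.1, (hws n).2.1]
    · linarith [congrArg re h, hre k, (hws n).2.1]
    · have h' := mul_left_cancel₀ I_ne_zero h
      rw [hZ.ws_injective (show ws n = ws k by exact_mod_cast h')]
  · rintro (n | n | n) <;> simp only [eta, Sum.elim_inl, Sum.elim_inr]
    · exact ⟨(hD _).1 (hzs n).1, (hzs n).2.2, hZ.zs_simple n⟩
    · refine ⟨(hD _).1 (hconj _ (hzs n).1), hsym _ (hzs n).1 (hzs n).2.2, fun h0 => hZ.zs_simple n ?_⟩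
      -- `s₁₁` agrees near `z_n` with `z ↦ conj (s₁₁ (-conj z))`
      have he : s11 σ δ q0 qm q t =ᶠ[𝓝 (zs n)] fun z =>
          conj ((fun w => s11 σ δ q0 qm q t (-w)) (conj z)) := by
        filter_upwards [isOpen_upperDomain.mem_nhds ((hD _).1 (hzs n).1)] with z hz
        rw [sp.map_conj z (hJ z ((hD z).2 hz)), conj_conj]
      have hd := congrFun (deriv_conj_conj (f := fun w => s11 σ δ q0 qm q t (-w))) (zs n)
      simp only [Function.comp_apply, deriv_comp_neg, h0, neg_zero, map_zero] at hd
      exact he.deriv_eq.trans hd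
    · exact ⟨(hD _).1 (hws n).1, (hws n).2.2, hZ.ws_simple n⟩
  · rcases lt_trichotomy z.re 0 with hr | hr | hr
    · have : -conj z ∈ range zs := by
        rw [hZ.zs_range]
        exact ⟨hconj z hz, by simpa using hr, hsym z hz h0⟩
      obtain ⟨n, hn⟩ := this
      exact ⟨Sum.inr (Sum.inl n), by simp [eta, hn]⟩
    · have : z ∈ range fun m => I * (ws m : ℂ) := by rw [hZ.ws_range]; exact ⟨hz, hr, h0⟩
      obtain ⟨n, hn⟩ := this
      exact ⟨Sum.inr (Sum.inr n), hn.symm⟩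
    · have : z ∈ range zs := by rw [hZ.zs_range]; exact ⟨hz, hr, h0⟩
      obtain ⟨n, hn⟩ := this
      exact ⟨Sum.inl n, hn.symm⟩

end

end

end NonlocalMKdV

open NonlocalMKdV

theorem mainTheorem4
    (σ δ q₀ qm : ℝ) (hσ : σ = 1 ∨ σ = -1) (hδ : δ = 1 ∨ δ = -1)
    (q : ℝ → ℝ → ℝ)
    (hsol : NonlocalMKdV.IsSolution σ q)
    (hbc : NonlocalMKdV.HasNZBC δ q₀ qm q)
    (t : ℝ)
    (hns : NonlocalMKdV.NoSpectralSingularities σ δ q₀ qm q t)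
    (N₁ N₂ : ℕ) (zs : Fin N₁ → ℂ) (ws : Fin N₂ → ℝ)
    (hZ : NonlocalMKdV.IsSimpleDiscreteSpectrum σ δ q₀ qm q t zs ws) :
    (∃ ℓ : ℂ → ℂ, NonlocalMKdV.IsLogBranch σ δ q₀ qm q t ℓ) ∧
    ∀ ℓ : ℂ → ℂ, NonlocalMKdV.IsLogBranch σ δ q₀ qm q t ℓ →
      -- all the integrals below converge absolutely
      (∀ z ∈ NonlocalMKdV.Dplus σ δ q₀ ∪ NonlocalMKdV.Dminus σ δ q₀ ∪ {0},
        NonlocalMKdV.ContourIntegrable σ δ q₀ (fun ζ => ℓ ζ / (ζ - z))) ∧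
      -- trace formulae
      (∀ z ∈ NonlocalMKdV.Dplus σ δ q₀,
        NonlocalMKdV.s11 σ δ q₀ qm q t z =
          Complex.exp (NonlocalMKdV.cauchyS σ δ q₀ ℓ z) *
            ∏ n, (z - NonlocalMKdV.eta zs ws n) / (z - NonlocalMKdV.etaHat σ δ q₀ zs ws n)) ∧
      (∀ z ∈ NonlocalMKdV.Dminus σ δ q₀,
        NonlocalMKdV.s22 σ δ q₀ qm q t z =
          Complex.exp (-NonlocalMKdV.cauchyS σ δ q₀ ℓ z) *
            ∏ n, (z - NonlocalMKdV.etaHat σ δ q₀ zs ws n) / (z - NonlocalMKdV.eta zs ws n)) ∧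
      -- theta condition
      (((∏ n, ‖zs n‖ ^ 4 / q₀ ^ 4) * ∏ m, -(δ * σ) * (ws m ^ 2 / q₀ ^ 2) : ℝ) : ℂ) *
          Complex.exp (1 / (2 * Real.pi * Complex.I) *
            NonlocalMKdV.contourIntegral σ δ q₀ (fun ζ => ℓ ζ / ζ)) = (δ : ℂ) ∧
      -- derivatives at the discrete spectrum
      (∀ j, HasDerivAt (NonlocalMKdV.s11 σ δ q₀ qm q t)
        ((∏ m ∈ Finset.univ.erase j,
            (NonlocalMKdV.eta zs ws j - NonlocalMKdV.eta zs ws m)) /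
          (∏ m, (NonlocalMKdV.eta zs ws j - NonlocalMKdV.etaHat σ δ q₀ zs ws m)) *
          Complex.exp (NonlocalMKdV.cauchyS σ δ q₀ ℓ (NonlocalMKdV.eta zs ws j)))
        (NonlocalMKdV.eta zs ws j)) ∧
      (∀ j, HasDerivAt (NonlocalMKdV.s22 σ δ q₀ qm q t)
        ((∏ m ∈ Finset.univ.erase j,
            (NonlocalMKdV.etaHat σ δ q₀ zs ws j - NonlocalMKdV.etaHat σ δ q₀ zs ws m)) /
          (∏ m, (NonlocalMKdV.etaHat σ δ q₀ zs ws j - NonlocalMKdV.eta zs ws m)) *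
          Complex.exp (-NonlocalMKdV.cauchyS σ δ q₀ ℓ (NonlocalMKdV.etaHat σ δ q₀ zs ws j)))
        (NonlocalMKdV.etaHat σ δ q₀ zs ws j)) := by
  have hε : δ * σ = 1 ∨ δ * σ = -1 := by
    rcases hσ with rfl | rfl <;> rcases hδ with rfl | rfl <;> norm_num
  have hδ2 : δ * δ = 1 := by rcases hδ with rfl | rfl <;> norm_num
  have hδ0 : δ ≠ 0 := left_ne_zero_of_mul (hδ2.symm ▸ one_ne_zero)
  have hq := hbc.pos
  set κ : ℝ := δ * σ * q₀ ^ 2 with hκd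
  have hκ : κ ≠ 0 := by rcases hε with h | h <;> simp [hκd, h, hq.ne']
  have hdom := fun z => mem_domains_iff (z := z) hε hq
  simp only [← hκd] at hdom
  have h := linePotential hσ hδ hsol hbc t
  have sp := scatteringPair hσ hδ hq hbc.abs_eq h
  obtain ⟨hinj, heta, hall⟩ := discreteSpectrum hε hq sp hZ
  have hη := fun n => (heta n).1
  have hJ : Ω κ ⊆ Dplus σ δ q₀ ∪ Sig0 σ δ q₀ := fun z hz => by
    rcases hz.2.2.lt_or_eq with hl | hl
    · exact Or.inl ((hdom z).1.2 ⟨hz.1, hl⟩)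
    · exact Or.inr ((hdom z).2.2.2 ⟨hz.1, hz.2.1, hl.symm⟩)
  have hB := prod_eta_sq_div (zs := zs) (ws := ws) hε (q0 := q₀)
  set B : ℝ := (∏ n, ‖zs n‖ ^ 4 / q₀ ^ 4) * ∏ m, -(δ * σ) * (ws m ^ 2 / q₀ ^ 2) with hBd
  have hB0 : B ≠ 0 := fun h0 => by
    rw [h0, Complex.ofReal_zero, eq_comm, Finset.prod_eq_zero_iff] at hB
    obtain ⟨n, -, hn⟩ := hB
    exact div_ne_zero (pow_ne_zero 2 (hη n).1) (Complex.ofReal_ne_zero.2 hκ) hn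
  obtain ⟨zf, hfac, hfac'⟩ := sp.zeroFreePair hκ hδ2 hinj (etaSwap N₁ N₂) eta_etaSwap hη
    (fun n => (heta n).2.1) (fun z hz h0 => (hJ hz).elim (fun h1 => hall z h1 h0)
      fun h1 => absurd h0 (hns.s11_ne z h1)) (fun n => (heta n).2.2)
    (fun b hb => by
      obtain ⟨c, hc, h1⟩ := hns.s11_branch b hb
      exact ⟨c, hc, h1.filter_mono (nhdsWithin_mono _ hJ)⟩) hB
  have hβ : δ / B ≠ 0 := div_ne_zero hδ0 hB0
  set F := zeroFreePart κ (eta zs ws) (s11 σ δ q₀ qm q t)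
  set G : ℂ → ℂ := fun z => F (κ / z) / ((δ / B : ℝ) : ℂ) with hG
  have hD : ∀ {z}, z ∈ Dplus σ δ q₀ → z ∈ Ω κ := fun {z} hz => by
    obtain ⟨h1, h2⟩ := (hdom z).1.1 hz
    exact ⟨h1, fun h0 => by simp [h0] at h2, h2.le⟩
  have hD' : ∀ {z}, z ∈ Dminus σ δ q₀ → -z ∈ Ω κ := fun {z} hz => by
    obtain ⟨h1, h2⟩ := (hdom z).2.1.1 hz
    exact ⟨neg_ne_zero.2 h1, by rw [Λ_neg]; exact fun h0 => by simp [neg_eq_zero.1 h0] at h2,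
      by rw [Λ_neg]; simpa using h2.le⟩
  have hprod : ∀ ζ ∈ Sig0 σ δ q₀, F ζ * G ζ =
      1 + s12 σ δ q₀ qm q t ζ * s21 σ δ q₀ qm q t ζ := fun ζ hζ => by
    obtain ⟨h1, h2, h3⟩ := (hdom ζ).2.2.1 hζ
    have hz : ζ ∈ Ω κ := ⟨h1, h2, h3.ge⟩
    have hz' := neg_mem_of_im_eq_zero hz h3
    rw [one_add_s12_mul_s21 hδ h hz hz', hfac ζ hz, hfac' ζ hz']
    linear_combination (-(F ζ * G ζ)) * blaschke_mul_inv hκ hη h3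
  have hbranch : ∀ ℓ, IsBranch σ δ q₀ (fun ζ => F ζ * G ζ) ℓ ↔ IsLogBranch σ δ q₀ qm q t ℓ :=
    fun ℓ => ⟨fun h => ⟨fun ζ hζ => (h.exp_eq ζ hζ).trans (hprod ζ hζ), h.continuousOn,
      h.tendsto_infty, h.tendsto_zero, h.circle⟩, fun h => ⟨fun ζ hζ => (h.exp_eq ζ hζ).trans
        (hprod ζ hζ).symm, h.continuousOn, h.tendsto_infty, h.tendsto_zero, h.circle⟩⟩
  obtain ⟨⟨ℓ₀, hℓ₀⟩, hsolve⟩ := zf.solvesJumpProblem hq hβ hε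
  refine ⟨⟨ℓ₀, (hbranch ℓ₀).1 hℓ₀⟩, fun ℓ hℓ => ?_⟩
  obtain ⟨hint, hp, hm, h0⟩ := hsolve ℓ ((hbranch ℓ).2 hℓ)
  have hhat : ∀ n, etaHat σ δ q₀ zs ws n ∈ Dminus σ δ q₀ := fun n =>
    (hdom _).2.1.2 ⟨div_ne_zero (Complex.ofReal_ne_zero.2 hκ) (hη n).1, by
      rw [etaHat, Λ_hat hκ (hη n).1]; simpa using (hη n).2⟩
  have hdis : ∀ n m, eta zs ws n ≠ etaHat σ δ q₀ zs ws m := fun n m h1 => by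
    have h2 := ((hdom _).2.1.1 (hhat m)).2
    rw [← h1] at h2
    exact lt_asymm h2 (hη n).2
  have hFc : ∀ z ∈ upperDomain κ, ContinuousAt F z := fun z hz =>
    (zf.differentiableOn.differentiableAt (isOpen_upperDomain.mem_nhds hz)).continuousAt
  refine ⟨hint, fun z hz => ?_, fun z hz => ?_, ?_, fun j => ?_, fun j => ?_⟩
  · rw [hp z hz]; exact hfac z (hD hz)
  · rw [hm z hz]; exact hfac' z (hD' hz)
  · simp only [cauchyS, sub_zero] at h0
    rw [h0, ← Complex.ofReal_mul, mul_div_cancel₀ _ hB0]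
  · rw [hp _ ((hdom _).1.2 (hη j))]
    refine hasDerivAt_of_eventuallyEq (ξ := etaHat σ δ q₀ zs ws) j (hFc _ (hη j)) (hdis j) ?_
    filter_upwards [isOpen_upperDomain.mem_nhds (hη j)] with z hz
    exact hfac z (hD ((hdom z).1.2 hz))
  · rw [hm _ (hhat j)]
    have hj := (hdom _).2.1.1 (hhat j)
    refine hasDerivAt_of_eventuallyEq (η := etaHat σ δ q₀ zs ws) (ξ := eta zs ws) j ?_
      (fun n => (hdis n j).symm) ?_
    · refine ContinuousAt.div_const (ContinuousAt.comp (g := F) (hFc _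
        ⟨div_ne_zero (Complex.ofReal_ne_zero.2 hκ) hj.1, ?_⟩)
        (continuousAt_const.div continuousAt_id hj.1)) _
      rw [Λ_hat hκ hj.1]; simpa using hj.2
    · have hop : IsOpen {z : ℂ | -z ≠ 0 ∧ 0 < (Λ κ (-z)).im} :=
        isOpen_upperDomain.preimage continuous_neg
      filter_upwards [hop.mem_nhds (by simpa [Λ_neg] using hj)] with z hz
      exact hfac' z ⟨hz.1, fun h0 => by simp [h0] at hz, hz.2.le⟩
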